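/- Let $M$ be a complete oriented Riemannian manifold of dimension $n$ (smooth, without boundary, second countable). Let $p>1$ and $p'=p/(p-1)$. Exterior derivatives are taken in the sense of distributions: for a $k$-form $\omega$ and a $(k+1)$-form $\eta$, $d\omega=\eta$ means $\int_M\omega\wedge d\varphi=(-1)^{k+1}\int_M\eta\wedge\varphi$ for all smooth compactly supported $(n-k-1)$-forms $\varphi$. Let $\Omega^{k,p}(M)$ be the space of $L^p$ $k$-forms $\omega$ such that $d\omega$ is $L^p$ (with $\Omega^{-1,p}(M)=0$), and consider $d:\Omega^{k-1,p}(M)\to\Omega^{k,p}(M)$ and $d:\Omega^{k,p}(M)\to\Omega^{k+1,p}(M)$. Put $$H^{k,p}(M)=\ker d/\operatorname{im} d,\qquad R^{k,p}(M)=\ker d/\overline{\operatorname{im} d},\qquad T^{k,p}(M)=\overline{\operatorname{im} d}/\operatorname{im} d$$ (the $L^p$ cohomology, the reduced $L^p$ cohomology and the torsion in degree $k$), the closures being taken in the space of $L^p$ $k$-forms. (1) Let $0\le k\le n$ and let $\omega$ be a closed $L^p$ $k$-form on $M$. - The class of $\omega$ in $R^{k,p}(M)$ is nonzero if and only if there is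 a closed $L^{p'}$ $(n-k)$-form $\psi$ with $\int_M\omega\wedge\psi\neq 0$. - The class of $\omega$ in $H^{k,p}(M)$ is nonzero if and only if there is a sequence $(\psi_j)$ in $\Omega^{n-k,p'}(M)$ such that $\int_M\omega\wedge\psi_j\ge 1$ for all $j$ and $\|d\psi_j\|_{L^{p'}}\to 0$. (2) For $0\le k\le n$: $R^{k,p}(M)=0$ if and only if $R^{n-k,p'}(M)=0$. (3) For $0\le k\le n+1$: $T^{k,p}(M)=0$ if and only if $T^{n-k+1,p'}(M)=0$. -/

import Mathlib

open Bundle MeasureTheory Filter Module Set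
open scoped Manifold ContDiff Topology ENNReal

noncomputable section

namespace LpDeRham

/-! ### Alternating forms on a Euclidean vector space -/

section Pointwise

set_option linter.unusedSectionVars false

/-- The exterior product `α ∧ β` of alternating forms:
`(α ∧ β)(v) = ∑ sign σ • α (v_σ(1), …, v_σ(k)) * β (v_σ(k+1), …, v_σ(k+l))`,
the sum being over `(k, l)`-shuffles `σ`. -/
def wedge {V : Type*} [AddCommGroup V] [Module ℝ V] {k l : ℕ}
    (α : V [⋀^Fin k]→ₗ[ℝ] ℝ) (β : V [⋀^Fin l]→ₗ[ℝ] ℝ) : V [⋀^Fin (k + l)]→ₗ[ℝ] ℝ :=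
  ((LinearMap.mul' ℝ ℝ).compAlternatingMap (α.domCoprod β)).domDomCongr finSumFinEquiv

lemma wedge_add_left {V : Type*} [AddCommGroup V] [Module ℝ V] {k l : ℕ}
    (α α' : V [⋀^Fin k]→ₗ[ℝ] ℝ) (β : V [⋀^Fin l]→ₗ[ℝ] ℝ) :
    wedge (α + α') β = wedge α β + wedge α' β := by
  simp only [wedge, ← AlternatingMap.domCoprod'_apply, TensorProduct.add_tmul, map_add]
  ext v
  simp

lemma wedge_smul_left {V : Type*} [AddCommGroup V] [Module ℝ V] {k l : ℕ}
    (c : ℝ) (α : V [⋀^Fin k]→ₗ[ℝ] ℝ) (β : V [⋀^Fin l]→ₗ[ℝ] ℝ) :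
    wedge (c • α) β = c • wedge α β := by
  simp only [wedge, ← AlternatingMap.domCoprod'_apply, ← TensorProduct.smul_tmul', map_smul]
  ext v
  simp

variable {n : ℕ} {V : Type*} [NormedAddCommGroup V] [InnerProductSpace ℝ V]
  [Fact (finrank ℝ V = n)]

/-- Some orthonormal basis of an `n`-dimensional Euclidean space. -/
def onb (n : ℕ) (V : Type*) [NormedAddCommGroup V] [InnerProductSpace ℝ V]
    [FiniteDimensional ℝ V] [Fact (finrank ℝ V = n)] : OrthonormalBasis (Fin n) ℝ V :=
  (stdOrthonormalBasis ℝ V).reindex (finCongr Fact.out)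

variable [FiniteDimensional ℝ V]

/-- The norm on `k`-forms induced by the inner product of `V`: for an orthonormal basis `b`,
`|α|² = (1 / k!) ∑ α (b i₁, …, b iₖ) ^ 2`, the sum being over all `k`-tuples of indices
(equivalently, `|α|²` is the sum over increasing `k`-tuples); the value is independent of `b`. -/
def formNorm (n : ℕ) {V : Type*} [NormedAddCommGroup V] [InnerProductSpace ℝ V]
    [FiniteDimensional ℝ V] [Fact (finrank ℝ V = n)] {k : ℕ} (α : V [⋀^Fin k]→L[ℝ] ℝ) : ℝ :=
  √((k.factorial : ℝ)⁻¹ * ∑ f : Fin k → Fin n, (α fun i => onb n V (f i)) ^ 2)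

lemma formNorm_eq {k : ℕ} (α : V [⋀^Fin k]→L[ℝ] ℝ) :
    formNorm n α = √((k.factorial : ℝ)⁻¹) *
      ‖WithLp.toLp 2 (fun f : Fin k → Fin n => α fun i => onb n V (f i))‖ := by
  rw [formNorm, Real.sqrt_mul (by positivity), EuclideanSpace.norm_eq]
  simp

lemma formNorm_nonneg {k : ℕ} (α : V [⋀^Fin k]→L[ℝ] ℝ) : 0 ≤ formNorm n α := Real.sqrt_nonneg _

@[simp] lemma formNorm_zero {k : ℕ} : formNorm n (0 : V [⋀^Fin k]→L[ℝ] ℝ) = 0 := by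
  simp [formNorm]

lemma formNorm_add_le {k : ℕ} (α β : V [⋀^Fin k]→L[ℝ] ℝ) :
    formNorm n (α + β) ≤ formNorm n α + formNorm n β := by
  simp only [formNorm_eq, ← mul_add]
  refine mul_le_mul_of_nonneg_left (le_trans (le_of_eq ?_) (norm_add_le _ _)) (by positivity)
  congr 1

lemma formNorm_smul {k : ℕ} (c : ℝ) (α : V [⋀^Fin k]→L[ℝ] ℝ) :
    formNorm n (c • α) = |c| * formNorm n α := by
  simp only [formNorm_eq]
  rw [mul_left_comm, ← Real.norm_eq_abs, ← norm_smul]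
  congr 2

/-- Expression of the norm of a form through its components in an arbitrary basis `s`. -/
lemma sum_sq_onb {k : ℕ} (b : OrthonormalBasis (Fin n) ℝ V) (s : Basis (Fin n) ℝ V)
    (α : V [⋀^Fin k]→L[ℝ] ℝ) :
    ∑ f : Fin k → Fin n, (α fun i => b (f i)) ^ 2 =
      ∑ I : Fin k → Fin n, ∑ J : Fin k → Fin n,
        (∏ m, (Matrix.of fun i j => inner ℝ (s i) (s j))⁻¹ (I m) (J m)) *
          ((α fun m => s (I m)) * α fun m => s (J m)) := by
  set G : Matrix (Fin n) (Fin n) ℝ := Matrix.of fun i j => inner ℝ (s i) (s j) with hG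
  set P := s.toMatrix b with hP
  set Q := b.toBasis.toMatrix s with hQ
  have hPQ : P * Q = 1 := by
    have := s.toMatrix_mul_toMatrix_flip b.toBasis
    rwa [OrthonormalBasis.coe_toBasis] at this
  have hQP : Q * P = 1 := by
    have := b.toBasis.toMatrix_mul_toMatrix_flip s
    rwa [OrthonormalBasis.coe_toBasis] at this
  have hGQ : G = Q.transpose * Q := by
    ext i j
    simp only [hG, Matrix.of_apply, Matrix.mul_apply, Matrix.transpose_apply, hQ,
      Basis.toMatrix_apply, OrthonormalBasis.coe_toBasis_repr_apply,
      OrthonormalBasis.repr_apply_apply]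
    rw [← OrthonormalBasis.sum_inner_mul_inner b]
    exact Finset.sum_congr rfl fun a _ => by rw [real_inner_comm]
  have hinv : G⁻¹ = P * P.transpose := by
    refine Matrix.inv_eq_left_inv ?_
    rw [hGQ, Matrix.mul_assoc, ← Matrix.mul_assoc P.transpose, ← Matrix.transpose_mul, hQP,
      Matrix.transpose_one, Matrix.one_mul, hPQ]
  have hexp : ∀ f : Fin k → Fin n, (α fun i => b (f i)) =
      ∑ I : Fin k → Fin n, (∏ m, P (I m) (f m)) * α fun m => s (I m) := by
    intro f
    have h1 : (fun i => b (f i)) = fun m => ∑ j : Fin n, P j (f m) • s j := by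
      funext m
      rw [hP]
      exact (s.sum_toMatrix_smul_self (v := b) (f m)).symm
    rw [h1]
    have h2 := α.toMultilinearMap.map_sum (fun m (j : Fin n) => P j (f m) • s j)
    refine h2.trans (Finset.sum_congr rfl fun I _ => ?_)
    exact α.toMultilinearMap.map_smul_univ (fun m => P (I m) (f m)) (fun m => s (I m))
  simp only [hexp, sq, Finset.sum_mul_sum]
  rw [Finset.sum_comm]
  refine Finset.sum_congr rfl fun I _ => ?_
  rw [Finset.sum_comm]
  refine Finset.sum_congr rfl fun J _ => ?_
  rw [hinv]
  simp only [Matrix.mul_apply, Matrix.transpose_apply]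
  rw [Finset.prod_univ_sum, Finset.sum_mul, Fintype.piFinset_univ]
  refine Finset.sum_congr rfl fun f _ => ?_
  rw [Finset.prod_mul_distrib]
  ring

/-- The number `f` such that the `n`-form `α` is `f` times the volume form of the oriented
`n`-dimensional Euclidean space `(V, o)`. -/
def volCoeff (o : Orientation ℝ V (Fin n)) (α : V [⋀^Fin n]→ₗ[ℝ] ℝ) : ℝ :=
  o.volumeForm (onb n V) * α (onb n V)

lemma volCoeff_smul_volumeForm (o : Orientation ℝ V (Fin n)) (α : V [⋀^Fin n]→ₗ[ℝ] ℝ) :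
    α = volCoeff o α • o.volumeForm := by
  have h : o.volumeForm (onb n V) * o.volumeForm (onb n V) = 1 := by
    rw [← abs_mul_abs_self, o.abs_volumeForm_apply_of_orthonormal (onb n V)]
    norm_num
  have h1 := AlternatingMap.eq_smul_basis_det (onb n V).toBasis α
  have h2 := AlternatingMap.eq_smul_basis_det (onb n V).toBasis o.volumeForm
  simp only [OrthonormalBasis.coe_toBasis] at h1 h2
  rw [volCoeff, h2, smul_smul, ← h2, mul_right_comm, h, one_mul]
  exact h1

lemma volCoeff_add (o : Orientation ℝ V (Fin n)) (α β : V [⋀^Fin n]→ₗ[ℝ] ℝ) :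
    volCoeff o (α + β) = volCoeff o α + volCoeff o β := by
  simp [volCoeff, mul_add]

lemma volCoeff_smul (o : Orientation ℝ V (Fin n)) (c : ℝ) (α : V [⋀^Fin n]→ₗ[ℝ] ℝ) :
    volCoeff o (c • α) = c * volCoeff o α := by
  simp [volCoeff, mul_left_comm]

end Pointwise

/-! ### Riemannian manifolds -/

section Manifold

set_option linter.unusedSectionVars false

variable {n : ℕ} {M : Type*} [EMetricSpace M] [ChartedSpace (EuclideanSpace ℝ (Fin n)) M]

/-- Differential `k`-forms on `M`, with no regularity assumption. -/
def DiffForm (n : ℕ) (M : Type*) [EMetricSpace M] [ChartedSpace (EuclideanSpace ℝ (Fin n)) M]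
    (k : ℕ) : Type _ :=
  (x : M) → TangentSpace (𝓡 n) x [⋀^Fin k]→L[ℝ] ℝ

instance (k : ℕ) : AddCommGroup (DiffForm n M k) :=
  inferInstanceAs (AddCommGroup ((x : M) → TangentSpace (𝓡 n) x [⋀^Fin k]→L[ℝ] ℝ))

instance (k : ℕ) : Module ℝ (DiffForm n M k) :=
  inferInstanceAs (Module ℝ ((x : M) → TangentSpace (𝓡 n) x [⋀^Fin k]→L[ℝ] ℝ))

@[simp] lemma DiffForm.zero_apply {k : ℕ} (x : M) : (0 : DiffForm n M k) x = 0 := rfl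

@[simp] lemma DiffForm.add_apply {k : ℕ} (θ θ' : DiffForm n M k) (x : M) :
    (θ + θ') x = θ x + θ' x := rfl

@[simp] lemma DiffForm.smul_apply {k : ℕ} (c : ℝ) (θ : DiffForm n M k) (x : M) :
    (c • θ) x = c • θ x := rfl

instance (x : M) : FiniteDimensional ℝ (TangentSpace (𝓡 n) x) :=
  inferInstanceAs (FiniteDimensional ℝ (EuclideanSpace ℝ (Fin n)))

instance (x : M) : Fact (finrank ℝ (TangentSpace (𝓡 n) x) = n) :=
  ⟨(finrank_euclideanSpace_fin : finrank ℝ (EuclideanSpace ℝ (Fin n)) = n)⟩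

variable [IsManifold (𝓡 n) ∞ M]

variable (n) in
/-- The linear map `ℝⁿ → T_x M` sending the standard basis to the coordinate vector fields at `x`
of the chart around `x₀` (for `x` in the domain of this chart). -/
def coordL (x₀ x : M) : EuclideanSpace ℝ (Fin n) →L[ℝ] TangentSpace (𝓡 n) x :=
  (trivializationAt (EuclideanSpace ℝ (Fin n)) (TangentSpace (𝓡 n)) x₀).symmL ℝ x

/-- The expression of a form in the coordinates of the chart around `x₀`, as a function
of the point of `M`. -/
def localRep {k : ℕ} (x₀ : M) (θ : DiffForm n M k) (x : M) :
    EuclideanSpace ℝ (Fin n) [⋀^Fin k]→L[ℝ] ℝ :=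
  (θ x).compContinuousLinearMap (coordL n x₀ x)

/-- The expression of a form in the chart around `x₀`, as a form on an open subset of `ℝⁿ`. -/
def chartRep {k : ℕ} (x₀ : M) (θ : DiffForm n M k) (y : EuclideanSpace ℝ (Fin n)) :
    EuclideanSpace ℝ (Fin n) [⋀^Fin k]→L[ℝ] ℝ :=
  localRep x₀ θ ((extChartAt (𝓡 n) x₀).symm y)

/-- Smooth forms with compact support. -/
def IsTestForm {k : ℕ} (φ : DiffForm n M k) : Prop :=
  (∀ x₀ : M, ContDiffOn ℝ ∞ (chartRep x₀ φ) (extChartAt (𝓡 n) x₀).target) ∧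
    IsCompact (closure {x | φ x ≠ 0})

/-- The exterior derivative of a smooth form, computed at `x` in the chart around `x`. -/
def extD {k : ℕ} (φ : DiffForm n M k) : DiffForm n M (k + 1) := fun x =>
  (extDeriv (chartRep x φ) (extChartAt (𝓡 n) x x)).compContinuousLinearMap
    ((trivializationAt (EuclideanSpace ℝ (Fin n)) (TangentSpace (𝓡 n)) x).continuousLinearMapAt ℝ x)

/-- An orientation of the manifold `M`: the orientation of `T_x M` depends continuously on `x`,
i.e. it is locally constant when it is read in a chart. -/
def IsContinuousOrientation (o : (x : M) → Orientation ℝ (TangentSpace (𝓡 n) x) (Fin n)) : Prop :=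
  ∀ x₀ : M, ∃ o₀ : Orientation ℝ (EuclideanSpace ℝ (Fin n)) (Fin n), ∀ᶠ x in 𝓝 x₀,
    ∀ hx : x ∈ (trivializationAt (EuclideanSpace ℝ (Fin n)) (TangentSpace (𝓡 n)) x₀).baseSet,
      Orientation.map (Fin n) ((trivializationAt (EuclideanSpace ℝ (Fin n))
        (TangentSpace (𝓡 n)) x₀).continuousLinearEquivAt ℝ x hx).toLinearEquiv (o x) = o₀

variable [RiemannianBundle (fun x : M => TangentSpace (𝓡 n) x)]

variable (n) in
/-- The Gram matrix `g_ij` of the metric at `x` in the chart around `x₀`. -/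
def gram (x₀ x : M) : Matrix (Fin n) (Fin n) ℝ := Matrix.of fun i j =>
  inner ℝ (coordL n x₀ x (EuclideanSpace.single i 1)) (coordL n x₀ x (EuclideanSpace.single j 1))

variable [MeasurableSpace M]

variable (n) in
/-- The measure `√(det g_ij) dy` on the domain of the chart around `x₀`. -/
def chartVolume (x₀ : M) : Measure M :=
  ((volume.restrict (extChartAt (𝓡 n) x₀).target).withDensity fun y =>
    ENNReal.ofReal √(gram n x₀ ((extChartAt (𝓡 n) x₀).symm y)).det).map
      (extChartAt (𝓡 n) x₀).symm

variable (n M) in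
/-- The Riemannian volume. The measures `chartVolume n x₀` agree on the intersections of the
domains of the charts, so that their supremum is the measure obtained by gluing them. -/
def riemannianVolume : Measure M := ⨆ x₀ : M, chartVolume n x₀

/-- `∫_M θ ∧ ψ` is the integral of this function (where `θ ∧ ψ` is this function times the
volume form) against the Riemannian volume. -/
def pairing (o : (x : M) → Orientation ℝ (TangentSpace (𝓡 n) x) (Fin n)) {k l : ℕ}
    (h : k + l = n) (θ : DiffForm n M k) (ψ : DiffForm n M l) (x : M) : ℝ :=
  volCoeff (o x) ((wedge (θ x).toAlternatingMap (ψ x).toAlternatingMap).domDomCongr (finCongr h))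

lemma pairing_add_left (o : (x : M) → Orientation ℝ (TangentSpace (𝓡 n) x) (Fin n)) {k l : ℕ}
    (h : k + l = n) (θ θ' : DiffForm n M k) (ψ : DiffForm n M l) :
    pairing o h (θ + θ') ψ = pairing o h θ ψ + pairing o h θ' ψ := by
  funext x
  have : (wedge ((θ + θ') x).toAlternatingMap (ψ x).toAlternatingMap).domDomCongr (finCongr h) =
      (wedge (θ x).toAlternatingMap (ψ x).toAlternatingMap).domDomCongr (finCongr h) +
      (wedge (θ' x).toAlternatingMap (ψ x).toAlternatingMap).domDomCongr (finCongr h) := by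
    rw [← AlternatingMap.domDomCongr_add, ← wedge_add_left]
    rfl
  rw [Pi.add_apply, pairing, this, volCoeff_add]
  rfl

lemma pairing_smul_left (o : (x : M) → Orientation ℝ (TangentSpace (𝓡 n) x) (Fin n)) {k l : ℕ}
    (h : k + l = n) (c : ℝ) (θ : DiffForm n M k) (ψ : DiffForm n M l) :
    pairing o h (c • θ) ψ = c • pairing o h θ ψ := by
  funext x
  have : (wedge ((c • θ) x).toAlternatingMap (ψ x).toAlternatingMap).domDomCongr (finCongr h) =
      c • (wedge (θ x).toAlternatingMap (ψ x).toAlternatingMap).domDomCongr (finCongr h) := by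
    rw [← AlternatingMap.domDomCongr_smul, ← wedge_smul_left]
    rfl
  rw [Pi.smul_apply, pairing, this, volCoeff_smul]
  rfl

/-- `∫_M θ ∧ ψ`. -/
def wedgeIntegral (o : (x : M) → Orientation ℝ (TangentSpace (𝓡 n) x) (Fin n)) {k l : ℕ}
    (h : k + l = n) (θ : DiffForm n M k) (ψ : DiffForm n M l) : ℝ :=
  ∫ x, pairing o h θ ψ x ∂(riemannianVolume n M)

/-- `η = dθ` in the sense of distributions:
`∫_M θ ∧ dφ = (-1)^(k+1) ∫_M η ∧ φ` for all smooth compactly supported forms `φ` of degree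
`n - k - 1` (and both integrals make sense, which is automatic if `θ` and `η` are `L^p` forms).
If `k ≥ n` there is nothing to require, since all `(k+1)`-forms vanish. -/
def IsWeakExtD (o : (x : M) → Orientation ℝ (TangentSpace (𝓡 n) x) (Fin n)) {k : ℕ}
    (θ : DiffForm n M k) (η : DiffForm n M (k + 1)) : Prop :=
  ∀ (l : ℕ) (h : k + 1 + l = n) (φ : DiffForm n M l), IsTestForm φ →
    Integrable (pairing o (by omega) θ (extD φ)) (riemannianVolume n M) ∧
    Integrable (pairing o h η φ) (riemannianVolume n M) ∧
    wedgeIntegral o (by omega) θ (extD φ) = (-1) ^ (k + 1) * wedgeIntegral o h η φ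

lemma IsWeakExtD.zero (o : (x : M) → Orientation ℝ (TangentSpace (𝓡 n) x) (Fin n)) {k : ℕ} :
    IsWeakExtD o (0 : DiffForm n M k) 0 := by
  intro l h φ _
  have h1 : ∀ {k l : ℕ} (h : k + l = n) (ψ : DiffForm n M l),
      pairing o h (0 : DiffForm n M k) ψ = 0 := fun h ψ => by
    simpa using pairing_smul_left o h 0 0 ψ
  simp only [wedgeIntegral, h1]
  simp

lemma IsWeakExtD.add {o : (x : M) → Orientation ℝ (TangentSpace (𝓡 n) x) (Fin n)} {k : ℕ}
    {θ θ' : DiffForm n M k} {η η' : DiffForm n M (k + 1)}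
    (h₁ : IsWeakExtD o θ η) (h₂ : IsWeakExtD o θ' η') : IsWeakExtD o (θ + θ') (η + η') := by
  intro l h φ hφ
  obtain ⟨a, b, c⟩ := h₁ l h φ hφ
  obtain ⟨a', b', c'⟩ := h₂ l h φ hφ
  simp only [wedgeIntegral, pairing_add_left] at *
  refine ⟨a.add a', b.add b', ?_⟩
  simp only [Pi.add_apply]
  rw [integral_add a a', integral_add b b', c, c', mul_add]

lemma IsWeakExtD.smul {o : (x : M) → Orientation ℝ (TangentSpace (𝓡 n) x) (Fin n)} {k : ℕ}
    {θ : DiffForm n M k} {η : DiffForm n M (k + 1)} (r : ℝ)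
    (h₁ : IsWeakExtD o θ η) : IsWeakExtD o (r • θ) (r • η) := by
  intro l h φ hφ
  obtain ⟨a, b, c⟩ := h₁ l h φ hφ
  simp only [wedgeIntegral, pairing_smul_left] at *
  refine ⟨a.smul r, b.smul r, ?_⟩
  simp only [Pi.smul_apply]
  rw [integral_smul, integral_smul, c, smul_eq_mul, smul_eq_mul]
  ring

/-! ### Measurability of the norm of a form -/

section Measurability

variable [IsContMDiffRiemannianBundle (𝓡 n) ∞ (EuclideanSpace ℝ (Fin n))
    (fun x : M => TangentSpace (𝓡 n) x)]

lemma continuousOn_gram (x₀ : M) (i j : Fin n) :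
    ContinuousOn (fun x => gram n x₀ x i j) (chartAt (EuclideanSpace ℝ (Fin n)) x₀).source := by
  have hb := TangentBundle.trivializationAt_baseSet (I := 𝓡 n) x₀
  have hf : ∀ v : EuclideanSpace ℝ (Fin n), ContinuousOn (fun x => (TotalSpace.mk' (EuclideanSpace ℝ (Fin n)) x
      (coordL n x₀ x v) : TotalSpace (EuclideanSpace ℝ (Fin n)) (TangentSpace (𝓡 n) (M := M))))
      (chartAt (EuclideanSpace ℝ (Fin n)) x₀).source := by
    intro v
    rw [← hb]
    set e := trivializationAt (EuclideanSpace ℝ (Fin n)) (TangentSpace (𝓡 n)) x₀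
    have h1 : ContinuousOn (fun x => e.toOpenPartialHomeomorph.symm (x, v)) e.baseSet :=
      e.toOpenPartialHomeomorph.continuousOn_symm.comp (by fun_prop)
        fun x hx => by simpa [e.target_eq] using hx
    refine h1.congr fun x hx => ?_
    exact (congrArg (TotalSpace.mk' (EuclideanSpace ℝ (Fin n)) x)
      (Trivialization.symmL_apply e hx v)).trans (e.mk_symm hx v)
  obtain ⟨g, hg, hg'⟩ := IsContMDiffRiemannianBundle.exists_contMDiff (IB := 𝓡 n) (n := ∞)
    (F := EuclideanSpace ℝ (Fin n)) (E := fun x : M => TangentSpace (𝓡 n) x)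
  have : IsContinuousRiemannianBundle (EuclideanSpace ℝ (Fin n))
    (fun x : M => TangentSpace (𝓡 n) x) := ⟨g, hg.continuous, hg'⟩
  exact ContinuousOn.inner_bundle (hf _) (hf _)

lemma formNorm_eq_gram {k : ℕ} (θ : DiffForm n M k) {x₀ x : M}
    (hx : x ∈ (chartAt (EuclideanSpace ℝ (Fin n)) x₀).source) :
    formNorm n (θ x) = √((k.factorial : ℝ)⁻¹ *
      ∑ I : Fin k → Fin n, ∑ J : Fin k → Fin n, (∏ m, (gram n x₀ x)⁻¹ (I m) (J m)) *
        ((localRep x₀ θ x fun m => EuclideanSpace.single (I m) 1) *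
          localRep x₀ θ x fun m => EuclideanSpace.single (J m) 1)) := by
  have hb := TangentBundle.trivializationAt_baseSet (I := 𝓡 n) x₀
  rw [← hb] at hx
  let e := (trivializationAt (EuclideanSpace ℝ (Fin n)) (TangentSpace (𝓡 n)) x₀)
  let s : Basis (Fin n) ℝ (TangentSpace (𝓡 n) x) :=
    (EuclideanSpace.basisFun (Fin n) ℝ).toBasis.map
      (e.continuousLinearEquivAt ℝ x hx).symm.toLinearEquiv
  have hs : ∀ i, s i = coordL n x₀ x (EuclideanSpace.single i 1) := by
    intro i
    have h1 : s i = e.symm x (EuclideanSpace.single i 1) := by simp [s]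
    rw [h1]
    exact (Trivialization.symmL_apply e hx _).symm
  rw [formNorm, sum_sq_onb (onb n _) s (θ x)]
  simp only [hs]
  rfl

variable [BorelSpace M] [SecondCountableTopology M]

lemma aemeasurable_formNorm {k : ℕ} {θ : DiffForm n M k} {μ : Measure M}
    (hθ : ∀ x₀ : M, AEStronglyMeasurable (localRep x₀ θ)
      (μ.restrict (chartAt (EuclideanSpace ℝ (Fin n)) x₀).source)) :
    AEMeasurable (fun x => formNorm n (θ x)) μ := by
  obtain ⟨t, ht, hU⟩ := TopologicalSpace.countable_cover_nhds
    (fun x : M => (chartAt (EuclideanSpace ℝ (Fin n)) x).open_source.mem_nhds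
      (mem_chart_source _ x))
  have := ht.to_subtype
  rw [← Measure.restrict_univ (μ := μ), ← hU, biUnion_eq_iUnion, aemeasurable_iUnion_iff]
  rintro ⟨x₀, -⟩
  set S := (chartAt (EuclideanSpace ℝ (Fin n)) x₀).source
  have hS : MeasurableSet S := (chartAt (EuclideanSpace ℝ (Fin n)) x₀).open_source.measurableSet
  have hcomp : ∀ v : Fin k → EuclideanSpace ℝ (Fin n),
      AEMeasurable (fun x => localRep x₀ θ x v) (μ.restrict S) := fun v =>
    ((continuous_eval_const v).comp_aestronglyMeasurable (hθ x₀)).aemeasurable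
  have hg : ∀ i j, AEMeasurable (fun x => gram n x₀ x i j) (μ.restrict S) := fun i j =>
    (continuousOn_gram x₀ i j).aemeasurable hS
  have hG : AEMeasurable (fun x i j => gram n x₀ x i j) (μ.restrict S) :=
    aemeasurable_pi_iff.2 fun i => aemeasurable_pi_iff.2 fun j => hg i j
  have hinv : ∀ i j, AEMeasurable (fun x => (gram n x₀ x)⁻¹ i j) (μ.restrict S) := by
    intro i j
    have : ∀ x, (gram n x₀ x)⁻¹ i j = (gram n x₀ x).det⁻¹ * (gram n x₀ x).adjugate i j := by
      intro x
      simp [Matrix.inv_def, Ring.inverse_eq_inv']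
    simp only [this]
    refine AEMeasurable.mul (AEMeasurable.inv ?_) ?_
    · have : Continuous fun A : Fin n → Fin n → ℝ => (Matrix.of A).det :=
        Continuous.matrix_det continuous_id
      exact this.measurable.comp_aemeasurable hG
    · have : Continuous fun A : Fin n → Fin n → ℝ => (Matrix.of A).adjugate i j :=
        (Continuous.matrix_adjugate continuous_id).matrix_elem i j
      exact this.measurable.comp_aemeasurable hG
  refine AEMeasurable.congr (f := fun x => √((k.factorial : ℝ)⁻¹ *
      ∑ I : Fin k → Fin n, ∑ J : Fin k → Fin n, (∏ m, (gram n x₀ x)⁻¹ (I m) (J m)) *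
        ((localRep x₀ θ x fun m => EuclideanSpace.single (I m) 1) *
          localRep x₀ θ x fun m => EuclideanSpace.single (J m) 1))) ?_ ?_
  · refine (AEMeasurable.const_mul (Finset.aemeasurable_fun_sum _ fun I _ =>
      Finset.aemeasurable_fun_sum _ fun J _ => ?_) _).sqrt
    exact (Finset.aemeasurable_fun_prod _ fun m _ => hinv _ _).mul ((hcomp _).mul (hcomp _))
  · filter_upwards [ae_restrict_mem hS] with x hx
    exact (formNorm_eq_gram θ hx).symm

end Measurability

/-! ### `L^p` cohomology -/

section Cohomology

/-- The `L^p` norm of a form. -/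
def lpNorm {k : ℕ} (θ : DiffForm n M k) (p : ℝ≥0∞) : ℝ≥0∞ :=
  eLpNorm (fun x => formNorm n (θ x)) p (riemannianVolume n M)

/-- A form is measurable if its components in charts are (almost everywhere) measurable. -/
def IsMeasurableForm {k : ℕ} (θ : DiffForm n M k) : Prop :=
  ∀ x₀ : M, AEStronglyMeasurable (localRep x₀ θ)
    ((riemannianVolume n M).restrict (chartAt (EuclideanSpace ℝ (Fin n)) x₀).source)

lemma lpNorm_smul {k : ℕ} (c : ℝ) (θ : DiffForm n M k) (p : ℝ≥0∞) :
    lpNorm (c • θ) p = ‖c‖ₑ * lpNorm θ p := by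
  have : (fun x => formNorm n ((c • θ) x)) = |c| • fun x => formNorm n (θ x) := by
    funext x
    exact formNorm_smul c (θ x)
  rw [lpNorm, this, eLpNorm_const_smul, lpNorm, Real.enorm_abs]

lemma IsMeasurableForm.add {k : ℕ} {θ θ' : DiffForm n M k} (h : IsMeasurableForm θ)
    (h' : IsMeasurableForm θ') : IsMeasurableForm (θ + θ') := fun x₀ => (h x₀).add (h' x₀)

lemma IsMeasurableForm.smul {k : ℕ} {θ : DiffForm n M k} (c : ℝ) (h : IsMeasurableForm θ) :
    IsMeasurableForm (c • θ) := fun x₀ => (h x₀).const_smul c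

lemma IsMeasurableForm.zero {k : ℕ} : IsMeasurableForm (0 : DiffForm n M k) := fun _ =>
  aestronglyMeasurable_const (b := (0 : EuclideanSpace ℝ (Fin n) [⋀^Fin k]→L[ℝ] ℝ))

lemma lpNorm_zero {k : ℕ} (p : ℝ≥0∞) : lpNorm (0 : DiffForm n M k) p = 0 := by
  simp [lpNorm]

variable [IsContMDiffRiemannianBundle (𝓡 n) ∞ (EuclideanSpace ℝ (Fin n))
    (fun x : M => TangentSpace (𝓡 n) x)] [BorelSpace M] [SecondCountableTopology M]

lemma lpNorm_add_le {k : ℕ} {θ θ' : DiffForm n M k} (h : IsMeasurableForm θ)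
    (h' : IsMeasurableForm θ') (p : ℝ≥0∞) :
    lpNorm (θ + θ') p ≤ ENNReal.LpAddConst p * (lpNorm θ p + lpNorm θ' p) := by
  have hm : AEStronglyMeasurable (fun x => formNorm n (θ x)) (riemannianVolume n M) :=
    (aemeasurable_formNorm h).aestronglyMeasurable
  have hm' : AEStronglyMeasurable (fun x => formNorm n (θ' x)) (riemannianVolume n M) :=
    (aemeasurable_formNorm h').aestronglyMeasurable
  refine (eLpNorm_mono_real (g := (fun x => formNorm n (θ x)) + fun x => formNorm n (θ' x))
    fun x => ?_).trans (eLpNorm_add_le' hm hm' p)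
  rw [Real.norm_of_nonneg (formNorm_nonneg _)]
  exact formNorm_add_le (θ x) (θ' x)

variable (n M) in
/-- The space `L^p Ω^k(M)` of `L^p` forms of degree `k`. Forms which agree almost everywhere are
not identified here: they are identified in the cohomology groups below. -/
def lpForms (k : ℕ) (p : ℝ≥0∞) : Submodule ℝ (DiffForm n M k) where
  carrier := {θ | IsMeasurableForm θ ∧ lpNorm θ p < ⊤}
  add_mem' h h' := ⟨h.1.add h'.1, (lpNorm_add_le h.1 h'.1 p).trans_lt
    (ENNReal.mul_lt_top (ENNReal.LpAddConst_lt_top p) (ENNReal.add_lt_top.2 ⟨h.2, h'.2⟩))⟩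
  zero_mem' := ⟨.zero, by simp [lpNorm_zero]⟩
  smul_mem' c θ h := ⟨h.1.smul c, by
    rw [lpNorm_smul]
    exact ENNReal.mul_lt_top enorm_lt_top h.2⟩

variable (o : (x : M) → Orientation ℝ (TangentSpace (𝓡 n) x) (Fin n))

/-- The kernel of `d` on `L^p` forms of degree `k`. -/
def closedForms (k : ℕ) (p : ℝ≥0∞) : Submodule ℝ (DiffForm n M k) where
  carrier := {θ | θ ∈ lpForms n M k p ∧ IsWeakExtD o θ 0}
  add_mem' h h' := ⟨add_mem h.1 h'.1, by simpa using h.2.add h'.2⟩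
  zero_mem' := ⟨zero_mem _, .zero o⟩
  smul_mem' c θ h := ⟨Submodule.smul_mem _ c h.1, by simpa using h.2.smul c⟩

/-- The image of `d : Ω^{k-1,p}(M) → L^p Ω^k(M)`, where `Ω^{k-1,p}(M)` is the space of `L^p`
forms of degree `k - 1` whose exterior derivative is `L^p`; in degree `0`, this image is `0`, so
that it consists of the functions which vanish almost everywhere. -/
def exactForms : (k : ℕ) → (p : ℝ≥0∞) → Submodule ℝ (DiffForm n M k)
  | 0, p =>
    { carrier := {θ | θ ∈ lpForms n M 0 p ∧ ∀ᵐ x ∂(riemannianVolume n M), θ x = 0}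
      add_mem' := fun h h' => ⟨add_mem h.1 h'.1, by
        filter_upwards [h.2, h'.2] with x hx hx'
        rw [DiffForm.add_apply, hx, hx', add_zero]⟩
      zero_mem' := ⟨zero_mem _, by simp⟩
      smul_mem' := fun c θ h => ⟨Submodule.smul_mem _ c h.1, by
        filter_upwards [h.2] with x hx
        rw [DiffForm.smul_apply, hx, smul_zero]⟩ }
  | k + 1, p =>
    { carrier := {η | η ∈ lpForms n M (k + 1) p ∧ ∃ β ∈ lpForms n M k p, IsWeakExtD o β η}
      add_mem' := fun ⟨h, β, hβ, hd⟩ ⟨h', β', hβ', hd'⟩ =>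
        ⟨add_mem h h', β + β', add_mem hβ hβ', hd.add hd'⟩
      zero_mem' := ⟨zero_mem _, 0, zero_mem _, .zero o⟩
      smul_mem' := fun c _ ⟨h, β, hβ, hd⟩ =>
        ⟨Submodule.smul_mem _ c h, c • β, Submodule.smul_mem _ c hβ, hd.smul c⟩ }

lemma exactForms_le_lpForms (k : ℕ) (p : ℝ≥0∞) : exactForms o k p ≤ lpForms n M k p := by
  cases k
  · exact fun _ h => h.1
  · exact fun _ h => h.1

/-- The closure of the image of `d` in `L^p Ω^k(M)`. -/
def exactClosure (k : ℕ) (p : ℝ≥0∞) : Submodule ℝ (DiffForm n M k) where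
  carrier := {θ | θ ∈ lpForms n M k p ∧ ∃ η : ℕ → DiffForm n M k, (∀ j, η j ∈ exactForms o k p) ∧
    Tendsto (fun j => lpNorm (η j - θ) p) atTop (𝓝 0)}
  add_mem' := by
    rintro θ θ' ⟨h, η, hη, ht⟩ ⟨h', η', hη', ht'⟩
    refine ⟨add_mem h h', η + η', fun j => add_mem (hη j) (hη' j), ?_⟩
    have hlim : Tendsto (fun j => ENNReal.LpAddConst p * (lpNorm (η j - θ) p + lpNorm (η' j - θ') p))
        atTop (𝓝 0) := by
      have := ENNReal.Tendsto.const_mul (a := ENNReal.LpAddConst p) (ht.add ht')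
        (Or.inr (ENNReal.LpAddConst_lt_top p).ne)
      simpa using this
    refine tendsto_of_tendsto_of_tendsto_of_le_of_le tendsto_const_nhds hlim
      (fun _ => zero_le) fun j => ?_
    have hj := (sub_mem (exactForms_le_lpForms o k p (hη j)) h).1
    have hj' := (sub_mem (exactForms_le_lpForms o k p (hη' j)) h').1
    have : (η + η') j - (θ + θ') = (η j - θ) + (η' j - θ') := by
      rw [Pi.add_apply]; abel
    simpa only [this] using lpNorm_add_le hj hj' p
  zero_mem' := ⟨zero_mem _, 0, fun _ => zero_mem _, by simp [lpNorm_zero]⟩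
  smul_mem' := by
    rintro c θ ⟨h, η, hη, ht⟩
    refine ⟨Submodule.smul_mem _ c h, c • η, fun j => Submodule.smul_mem _ c (hη j), ?_⟩
    have hlim := ENNReal.Tendsto.const_mul (a := ‖c‖ₑ) ht (Or.inr enorm_ne_top)
    rw [mul_zero] at hlim
    refine hlim.congr fun j => ?_
    rw [Pi.smul_apply, ← smul_sub, lpNorm_smul]

/-- The `L^p` cohomology `H^{k,p}(M) = ker d / im d`. -/
abbrev LpCohomology (k : ℕ) (p : ℝ≥0∞) : Type _ :=
  closedForms o k p ⧸ (exactForms o k p).submoduleOf (closedForms o k p)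

/-- The reduced `L^p` cohomology `R^{k,p}(M)`: the quotient of `ker d` by the closure of `im d`. -/
abbrev ReducedLpCohomology (k : ℕ) (p : ℝ≥0∞) : Type _ :=
  closedForms o k p ⧸ (exactClosure o k p).submoduleOf (closedForms o k p)

/-- The torsion `T^{k,p}(M)` of the `L^p` cohomology: the quotient of the closure of `im d`
by `im d`. -/
abbrev LpTorsion (k : ℕ) (p : ℝ≥0∞) : Type _ :=
  exactClosure o k p ⧸ (exactForms o k p).submoduleOf (exactClosure o k p)

/-- The class in `H^{k,p}(M)` of a closed `L^p` form. -/
def cohomologyClass {k : ℕ} {p : ℝ≥0∞} (θ : closedForms o k p) : LpCohomology o k p :=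
  Submodule.Quotient.mk θ

/-- The class in `R^{k,p}(M)` of a closed `L^p` form. -/
def reducedClass {k : ℕ} {p : ℝ≥0∞} (θ : closedForms o k p) : ReducedLpCohomology o k p :=
  Submodule.Quotient.mk θ

end Cohomology

end Manifold

end LpDeRham

end

/-! Write `q` for the exponent conjugate to `p`. Everything follows from two facts about the pairing
`∫ θ ∧ ψ` of `L^p` and `L^q` forms.

The first is Stokes' formula `∫ θ ∧ dψ = (-1)^(k+1) ∫ dθ ∧ ψ` when `θ, dθ` are `L^p` and `ψ, dψ` are
`L^q` (`IsWeakExtD.wedgeIntegral_eq`). Completeness enters only here: by Hopf–Rinow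
(`isCompact_edist_le`) closed balls are compact, so there are compactly supported cutoffs `f_j → 1`
whose Lipschitz constants tend to `0`, and cutting off by `f_j` costs at most a constant times
`Lip(f_j) ∫ |θ| |ψ|`. The estimate is proved in small chart balls, by mollifying the forms and the
Lipschitz cutoff (`abs_integral_lipschitz_cutoff_le`), and is summed over a partition of unity
`ρ_i`; the terms with `dρ_i` cancel because `∑ dρ_i = 0` (`abs_integral_lipschitz_le`).

The second is duality: a functional that is bounded by the `L^p` norm of a form is the pairing with
an `L^q` form (`exists_wedgeIntegral_eq`). A measurable, almost orthonormal frame turns forms into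
vector valued functions. There the representing function is `|u|^(p-2) u`, up to a factor, where `u`
has minimal norm in the closure of the affine hyperplane on which the functional is `1`; it exists
by the uniform convexity of `L^p`.

By Stokes, closed `L^q` forms annihilate exact `L^p` forms; conversely an `L^q` form orthogonal to
the exact forms is closed. So the closure of the exact forms is the annihilator of the closed `L^q`
forms (`not_mem_exactClosure_iff`). This gives the criterion for reduced cohomology, and the
resulting condition for its vanishing, that closed forms pair to zero with closed forms, is
symmetric in the two degrees and exponents.

A form `ξ` is exact as soon as `|∫ β ∧ ξ| ≤ C ‖dβ‖` for all `β`: then `dβ ↦ ∫ β ∧ ξ` is a bounded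
functional, and the form that represents it is, up to sign, a primitive of `ξ`
(`mem_exactForms_of_abs_wedgeIntegral_le`). Negating the bound for each `C` yields the sequences of
the second criterion.

For the torsion, suppose that the exact `L^p` forms are closed, hence form a Banach space, and let
`ξ` be a limit of exact forms `dψ_j` in `L^q`. The functionals `dβ ↦ ∫ dβ ∧ ψ_j = ± ∫ β ∧ dψ_j`
converge pointwise, so they are uniformly bounded by Banach–Steinhaus. In the limit this is the
bound above, and `ξ` is exact (`exists_abs_wedgeIntegral_le`). -/

noncomputable section

namespace LpDeRham

open scoped NNReal

universe u

/-! ### Algebra of the exterior product -/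

section WedgeAlgebra

variable {V W : Type*} [AddCommGroup V] [Module ℝ V] [AddCommGroup W] [Module ℝ W]

/-- The value of `α ∧ β` on a family of `n = k + l` vectors. -/
def wedgeEval {k l n : ℕ} (h : k + l = n) (α : V [⋀^Fin k]→ₗ[ℝ] ℝ) (β : V [⋀^Fin l]→ₗ[ℝ] ℝ)
    (v : Fin n → V) : ℝ :=
  ((wedge α β).domDomCongr (finCongr h)) v

/-- Alternatizing the tensor product counts every shuffle `k! l!` times. Unlike the sum over
shuffles, the sum over the whole symmetric group can be reindexed by any permutation, and the
identities below rely on this. -/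
lemma wedgeEval_eq_sum {k l n : ℕ} (h : k + l = n) (α : V [⋀^Fin k]→ₗ[ℝ] ℝ)
    (β : V [⋀^Fin l]→ₗ[ℝ] ℝ) (v : Fin n → V) :
    wedgeEval h α β v = ((k.factorial : ℝ) * l.factorial)⁻¹ * ∑ σ : Equiv.Perm (Fin n),
      ((Equiv.Perm.sign σ : ℤ) : ℝ) * (α (fun i : Fin k => v (σ ⟨i, by omega⟩)) *
        β (fun j : Fin l => v (σ ⟨k + j, by omega⟩))) := by
  subst h
  have key := congrArg (fun m => LinearMap.mul' ℝ ℝ (m (v ∘ finSumFinEquiv)))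
    (MultilinearMap.domCoprod_alternization_eq α β)
  simp only [MultilinearMap.alternatization_apply, AlternatingMap.smul_apply, map_sum, map_nsmul,
    Fintype.card_fin] at key
  have hL : wedgeEval rfl α β v = LinearMap.mul' ℝ ℝ (α.domCoprod β (v ∘ finSumFinEquiv)) := by
    simp only [wedgeEval, wedge, AlternatingMap.domDomCongr_apply,
      LinearMap.compAlternatingMap_apply]
    congr 1
  have hpos : ((k.factorial : ℝ) * l.factorial) ≠ 0 := by positivity
  rw [hL, eq_inv_mul_iff_mul_eq₀ hpos]
  rw [nsmul_eq_mul] at key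
  push_cast at key
  rw [← key]
  refine Fintype.sum_equiv (Equiv.permCongr finSumFinEquiv) _ _ fun σ => ?_
  rw [Equiv.Perm.sign_permCongr, MultilinearMap.domDomCongr_apply, MultilinearMap.domCoprod_apply]
  rw [Units.smul_def, map_zsmul, LinearMap.mul'_apply, zsmul_eq_mul]
  congr 2
  · refine congrArg α (funext fun i => ?_)
    simp only [Function.comp_apply, Equiv.permCongr_apply]
    congr 3
    rw [eq_comm, Equiv.symm_apply_eq, finSumFinEquiv_apply_left]
    rfl
  · refine congrArg β (funext fun i => ?_)
    simp only [Function.comp_apply, Equiv.permCongr_apply]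
    congr 3
    rw [eq_comm, Equiv.symm_apply_eq, finSumFinEquiv_apply_right]
    rfl

lemma wedgeEval_comp {k l n : ℕ} (h : k + l = n) (α : V [⋀^Fin k]→ₗ[ℝ] ℝ)
    (β : V [⋀^Fin l]→ₗ[ℝ] ℝ) (L : W →ₗ[ℝ] V) (v : Fin n → W) :
    wedgeEval h (α.compLinearMap L) (β.compLinearMap L) v = wedgeEval h α β (L ∘ v) := by
  simp only [wedgeEval_eq_sum]
  rfl

lemma wedgeEval_add_right {k l n : ℕ} (h : k + l = n) (α : V [⋀^Fin k]→ₗ[ℝ] ℝ)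
    (β β' : V [⋀^Fin l]→ₗ[ℝ] ℝ) (v : Fin n → V) :
    wedgeEval h α (β + β') v = wedgeEval h α β v + wedgeEval h α β' v := by
  simp only [wedgeEval_eq_sum, AlternatingMap.add_apply, mul_add, Finset.sum_add_distrib]

lemma wedgeEval_smul_right {k l n : ℕ} (h : k + l = n) (c : ℝ) (α : V [⋀^Fin k]→ₗ[ℝ] ℝ)
    (β : V [⋀^Fin l]→ₗ[ℝ] ℝ) (v : Fin n → V) :
    wedgeEval h α (c • β) v = c * wedgeEval h α β v := by
  simp only [wedgeEval_eq_sum, AlternatingMap.smul_apply, smul_eq_mul, Finset.mul_sum]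
  exact Finset.sum_congr rfl fun σ _ => by ring

lemma wedgeEval_add_left {k l n : ℕ} (h : k + l = n) (α α' : V [⋀^Fin k]→ₗ[ℝ] ℝ)
    (β : V [⋀^Fin l]→ₗ[ℝ] ℝ) (v : Fin n → V) :
    wedgeEval h (α + α') β v = wedgeEval h α β v + wedgeEval h α' β v := by
  simp only [wedgeEval_eq_sum, AlternatingMap.add_apply, add_mul, mul_add, Finset.sum_add_distrib]

lemma wedgeEval_smul_left {k l n : ℕ} (h : k + l = n) (c : ℝ) (α : V [⋀^Fin k]→ₗ[ℝ] ℝ)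
    (β : V [⋀^Fin l]→ₗ[ℝ] ℝ) (v : Fin n → V) :
    wedgeEval h (c • α) β v = c * wedgeEval h α β v := by
  simp only [wedgeEval_eq_sum, AlternatingMap.smul_apply, smul_eq_mul, Finset.mul_sum]
  exact Finset.sum_congr rfl fun σ _ => by ring

/-- Reindexes by right translation with the cycle that sends `a` to `0`, whose sign is `(-1)^a`. -/
lemma sum_sign_mul_cycleRange {m : ℕ} (a : Fin (m + 1)) (F G : Equiv.Perm (Fin (m + 1)) → ℝ)
    (hFG : ∀ σ, F (σ * a.cycleRange) = G σ) :
    ∑ σ, ((Equiv.Perm.sign σ : ℤ) : ℝ) * F σ =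
      (-1) ^ (a : ℕ) * ∑ σ, ((Equiv.Perm.sign σ : ℤ) : ℝ) * G σ := by
  rw [Finset.mul_sum]
  symm
  refine Fintype.sum_equiv (Equiv.mulRight a.cycleRange) _ _ fun σ => ?_
  rw [Equiv.coe_mulRight, hFG, Equiv.Perm.sign_mul, Fin.sign_cycleRange]
  push_cast
  ring

/-- The exterior product with the alternatization of a linear map valued in forms, as a sum over
all permutations. -/
lemma wedgeEval_alternatizeUncurryFin_left {k l n : ℕ} (h : k + 1 + l = n)
    (T : V →ₗ[ℝ] V [⋀^Fin k]→ₗ[ℝ] ℝ) (β : V [⋀^Fin l]→ₗ[ℝ] ℝ) (v : Fin n → V) :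
    wedgeEval h (AlternatingMap.alternatizeUncurryFin T) β v =
      ((k.factorial : ℝ) * l.factorial)⁻¹ * ∑ σ : Equiv.Perm (Fin n),
      ((Equiv.Perm.sign σ : ℤ) : ℝ) * (T (v (σ ⟨0, by omega⟩))
        (fun i : Fin k => v (σ ⟨i + 1, by omega⟩)) *
        β (fun j : Fin l => v (σ ⟨k + 1 + j, by omega⟩))) := by
  obtain ⟨m, rfl⟩ : ∃ m, n = m + 1 := ⟨k + l, by omega⟩
  rw [wedgeEval_eq_sum]
  simp only [AlternatingMap.alternatizeUncurryFin_apply, Finset.sum_mul,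
    Finset.mul_sum (Finset.univ : Finset (Fin (k + 1)))]
  rw [Finset.sum_comm]
  -- Reindexed by the cycle that moves `i` to `0`, the `i`-th term of the alternatization no longer
  -- depends on `i`, since the sign of the cycle cancels `(-1)^i`. The `k + 1` equal terms turn `(k
  -- + 1)!` into `k!`.
  have hi : ∀ i : Fin (k + 1), ∑ σ : Equiv.Perm (Fin (m + 1)), ((Equiv.Perm.sign σ : ℤ) : ℝ) *
        ((-1) ^ (i : ℕ) • T (v (σ ⟨i, by omega⟩))
          (i.removeNth fun i : Fin (k + 1) => v (σ ⟨i, by omega⟩)) *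
        β (fun j : Fin l => v (σ ⟨k + 1 + j, by omega⟩))) =
      ∑ σ : Equiv.Perm (Fin (m + 1)), ((Equiv.Perm.sign σ : ℤ) : ℝ) * (T (v (σ ⟨0, by omega⟩))
        (fun i : Fin k => v (σ ⟨i + 1, by omega⟩)) *
        β (fun j : Fin l => v (σ ⟨k + 1 + j, by omega⟩))) := by
    intro i
    have h0 : Fin.cycleRange (⟨i, by omega⟩ : Fin (m + 1)) ⟨i, by omega⟩ = ⟨0, by omega⟩ :=
      Fin.cycleRange_self _
    have h1 : ∀ j : Fin k, Fin.cycleRange (⟨i, by omega⟩ : Fin (m + 1))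
        ⟨(i.succAbove j : Fin (k + 1)), by omega⟩ = ⟨j + 1, by omega⟩ := by
      intro j
      have := Fin.cycleRange_succAbove (⟨i, by omega⟩ : Fin (m + 1)) ⟨j, by omega⟩
      rw [Fin.succ_mk] at this
      rw [← this]
      congr 1
      simp only [Fin.ext_iff, Fin.succAbove, Fin.lt_def, Fin.castSucc_mk, Fin.val_castSucc]
      split_ifs <;> rfl
    have h2 : ∀ j : Fin l, Fin.cycleRange (⟨i, by omega⟩ : Fin (m + 1)) ⟨k + 1 + j, by omega⟩ =
        ⟨k + 1 + j, by omega⟩ := fun j =>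
      Fin.cycleRange_of_gt (by simp only [Fin.lt_def]; omega)
    rw [sum_sign_mul_cycleRange ⟨i, by omega⟩ _ (fun σ => (-1) ^ (i : ℕ) *
      (T (v (σ ⟨0, by omega⟩)) (fun i : Fin k => v (σ ⟨i + 1, by omega⟩)) *
        β (fun j : Fin l => v (σ ⟨k + 1 + j, by omega⟩))))]
    · rw [Finset.mul_sum]
      refine Finset.sum_congr rfl fun σ _ => ?_
      have h3 : ((-1 : ℝ) ^ (i : ℕ)) * (-1) ^ (i : ℕ) = 1 := by
        rw [← mul_pow]; norm_num
      linear_combination (((Equiv.Perm.sign σ : ℤ) : ℝ) * (T (v (σ ⟨0, by omega⟩))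
        (fun i : Fin k => v (σ ⟨i + 1, by omega⟩)) *
        β (fun j : Fin l => v (σ ⟨k + 1 + j, by omega⟩)))) * h3
    · intro σ
      simp only [Equiv.Perm.mul_apply, h0, h2]
      rw [zsmul_eq_mul, mul_assoc]
      push_cast
      congr 3
      funext j
      simp only [Fin.removeNth_apply, h1]
  rw [Finset.sum_congr rfl fun i _ => hi i, Finset.sum_const, Finset.card_univ, Fintype.card_fin,
    nsmul_eq_mul, Nat.factorial_succ]
  have : ((k : ℝ) + 1) ≠ 0 := by positivity
  push_cast
  field_simp

/-- As for the left factor, but the distinguished vector sits at position `k + i` and has to cross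
the `k` arguments of `α`. The cycle has sign `(-1)^(k + i)`, which leaves `(-1)^k`. -/
lemma wedgeEval_alternatizeUncurryFin_right {k l n : ℕ} (h : k + (l + 1) = n)
    (α : V [⋀^Fin k]→ₗ[ℝ] ℝ) (T : V →ₗ[ℝ] V [⋀^Fin l]→ₗ[ℝ] ℝ) (v : Fin n → V) :
    wedgeEval h α (AlternatingMap.alternatizeUncurryFin T) v =
      (-1) ^ k * (((k.factorial : ℝ) * l.factorial)⁻¹ * ∑ σ : Equiv.Perm (Fin n),
      ((Equiv.Perm.sign σ : ℤ) : ℝ) * (α (fun i : Fin k => v (σ ⟨i + 1, by omega⟩)) *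
        T (v (σ ⟨0, by omega⟩)) (fun j : Fin l => v (σ ⟨k + 1 + j, by omega⟩)))) := by
  obtain ⟨m, rfl⟩ : ∃ m, n = m + 1 := ⟨k + l, by omega⟩
  rw [wedgeEval_eq_sum]
  simp only [AlternatingMap.alternatizeUncurryFin_apply,
    Finset.mul_sum (Finset.univ : Finset (Fin (l + 1)))]
  rw [Finset.sum_comm]
  have hi : ∀ i : Fin (l + 1), ∑ σ : Equiv.Perm (Fin (m + 1)), ((Equiv.Perm.sign σ : ℤ) : ℝ) *
        (α (fun i : Fin k => v (σ ⟨i, by omega⟩)) * ((-1) ^ (i : ℕ) • T (v (σ ⟨k + i, by omega⟩))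
          (i.removeNth fun i : Fin (l + 1) => v (σ ⟨k + i, by omega⟩)))) =
      (-1) ^ k * ∑ σ : Equiv.Perm (Fin (m + 1)),
        ((Equiv.Perm.sign σ : ℤ) : ℝ) * (α (fun i : Fin k => v (σ ⟨i + 1, by omega⟩)) *
        T (v (σ ⟨0, by omega⟩)) (fun j : Fin l => v (σ ⟨k + 1 + j, by omega⟩))) := by
    intro i
    have h0 : Fin.cycleRange (⟨k + i, by omega⟩ : Fin (m + 1)) ⟨k + i, by omega⟩ =
      ⟨0, by omega⟩ := Fin.cycleRange_self _
    have h1 : ∀ j : Fin l, Fin.cycleRange (⟨k + i, by omega⟩ : Fin (m + 1))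
        ⟨k + (i.succAbove j : Fin (l + 1)), by omega⟩ = ⟨k + 1 + j, by omega⟩ := by
      intro j
      have := Fin.cycleRange_succAbove (⟨k + i, by omega⟩ : Fin (m + 1)) ⟨k + j, by omega⟩
      rw [Fin.succ_mk] at this
      rw [show (⟨k + 1 + j, by omega⟩ : Fin (m + 1)) = ⟨k + j + 1, by omega⟩ by
        simp only [Fin.ext_iff]; omega, ← this]
      congr 1
      simp only [Fin.ext_iff, Fin.succAbove, Fin.lt_def, Fin.castSucc_mk, Fin.val_castSucc]
      split_ifs <;> simp only [Fin.val_castSucc, Fin.val_succ] <;> omega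
    have h2 : ∀ j : Fin k, Fin.cycleRange (⟨k + i, by omega⟩ : Fin (m + 1)) ⟨j, by omega⟩ =
        ⟨j + 1, by omega⟩ := fun j => by
      rw [Fin.cycleRange_of_lt (by simp only [Fin.lt_def]; omega)]
      simp only [Fin.ext_iff]
      rw [Fin.val_add_one_of_lt (by simp only [Fin.lt_def, Fin.val_last]; omega)]
    rw [sum_sign_mul_cycleRange ⟨k + i, by omega⟩ _ (fun σ => (-1) ^ (i : ℕ) *
      (α (fun i : Fin k => v (σ ⟨i + 1, by omega⟩)) *
        T (v (σ ⟨0, by omega⟩)) (fun j : Fin l => v (σ ⟨k + 1 + j, by omega⟩))))]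
    · rw [Finset.mul_sum, Finset.mul_sum]
      refine Finset.sum_congr rfl fun σ _ => ?_
      have h3 : ((-1 : ℝ) ^ (i : ℕ)) * (-1) ^ (i : ℕ) = 1 := by
        rw [← mul_pow]; norm_num
      rw [pow_add]
      linear_combination ((-1) ^ k * ((Equiv.Perm.sign σ : ℤ) : ℝ) *
        (α (fun i : Fin k => v (σ ⟨i + 1, by omega⟩)) *
        T (v (σ ⟨0, by omega⟩)) (fun j : Fin l => v (σ ⟨k + 1 + j, by omega⟩)))) * h3
    · intro σ
      simp only [Equiv.Perm.mul_apply, h0, h2]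
      rw [zsmul_eq_mul, mul_left_comm]
      push_cast
      congr 3
      funext j
      simp only [Fin.removeNth_apply, h1]
  rw [Finset.sum_congr rfl fun i _ => hi i, Finset.sum_const, Finset.card_univ, Fintype.card_fin,
    nsmul_eq_mul, Nat.factorial_succ]
  have : ((l : ℝ) + 1) ≠ 0 := by positivity
  push_cast
  field_simp

/-- Moving a covector across the exterior product. -/
lemma wedgeEval_smulRight_alternatizeUncurryFin {k l n : ℕ} (h : k + 1 + l = n)
    (h' : k + (l + 1) = n) (lam : V →ₗ[ℝ] ℝ) (α : V [⋀^Fin k]→ₗ[ℝ] ℝ) (β : V [⋀^Fin l]→ₗ[ℝ] ℝ)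
    (v : Fin n → V) :
    wedgeEval h' α (AlternatingMap.alternatizeUncurryFin (lam.smulRight β)) v =
      (-1) ^ k * wedgeEval h (AlternatingMap.alternatizeUncurryFin (lam.smulRight α)) β v := by
  rw [wedgeEval_alternatizeUncurryFin_left, wedgeEval_alternatizeUncurryFin_right]
  congr 2
  refine Finset.sum_congr rfl fun σ _ => ?_
  simp only [LinearMap.smulRight_apply, AlternatingMap.smul_apply, smul_eq_mul]
  ring

/-- The exterior product is commutative up to sign. -/
lemma exists_wedgeEval_comm {k l n : ℕ} (h : k + l = n) (h' : l + k = n) :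
    ∃ ε : ℝ, ε * ε = 1 ∧ ∀ (V : Type u) [AddCommGroup V] [Module ℝ V] (α : V [⋀^Fin k]→ₗ[ℝ] ℝ)
      (β : V [⋀^Fin l]→ₗ[ℝ] ℝ) (v : Fin n → V),
      wedgeEval h' β α v = ε * wedgeEval h α β v := by
  -- The permutation that exchanges the two blocks of arguments; `ε` is its sign. It depends only on
  -- the degrees, so one `ε` serves all tangent spaces.
  set c : Equiv.Perm (Fin n) :=
    (finCongr h.symm).trans (finAddFlip.trans (finCongr h')) with hc
  have h1 : ∀ i : Fin k, c ⟨i, by omega⟩ = ⟨l + i, by omega⟩ := fun i => by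
    have : (Fin.cast h.symm ⟨i, by omega⟩ : Fin (k + l)) = Fin.castAdd l i := rfl
    simp only [hc, Equiv.trans_apply, finCongr_apply, this, finAddFlip_apply_castAdd]
    rfl
  have h2 : ∀ j : Fin l, c ⟨k + j, by omega⟩ = ⟨j, by omega⟩ := fun i => by
    have : (Fin.cast h.symm ⟨k + i, by omega⟩ : Fin (k + l)) = Fin.natAdd k i := rfl
    simp only [hc, Equiv.trans_apply, finCongr_apply, this, finAddFlip_apply_natAdd]
    rfl
  refine ⟨((Equiv.Perm.sign c : ℤ) : ℝ), ?_, fun V _ _ α β v => ?_⟩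
  · rw [← Int.cast_mul, ← Units.val_mul, Int.units_mul_self]; norm_num
  · rw [wedgeEval_eq_sum, wedgeEval_eq_sum, mul_left_comm, Finset.mul_sum _ _ ((Equiv.Perm.sign c : ℤ) : ℝ), mul_comm (k.factorial : ℝ)]
    congr 1
    refine Fintype.sum_equiv (Equiv.mulRight c) _ _ fun σ => ?_
    simp only [Equiv.coe_mulRight, Equiv.Perm.mul_apply, h1, h2, Equiv.Perm.sign_mul]
    have h3 : ((Equiv.Perm.sign c : ℤ) : ℝ) * ((Equiv.Perm.sign c : ℤ) : ℝ) = 1 := by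
      rw [← Int.cast_mul, ← Units.val_mul, Int.units_mul_self]; norm_num
    push_cast
    linear_combination (-((Equiv.Perm.sign σ : ℤ) : ℝ) *
      (β (fun i : Fin l => v (σ ⟨i, by omega⟩)) * α (fun j => v (σ ⟨l + j, by omega⟩)))) * h3

/-- The exterior product is nondegenerate. -/
lemma eq_zero_of_wedgeEval_eq_zero {n : ℕ} (b : Basis (Fin n) ℝ V) {l : ℕ} :
    ∀ {k : ℕ} (h : k + l = n) (α : V [⋀^Fin k]→ₗ[ℝ] ℝ),
      (∀ β : V [⋀^Fin l]→ₗ[ℝ] ℝ, wedgeEval h α β b = 0) → α = 0 := by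
  induction l with
  | zero =>
    intro k h α hα
    obtain rfl : k = n := by omega
    -- In top degree the pairing with the constant `1` is a nonzero multiple of `α b`, which
    -- determines `α`.
    have h1 := hα (AlternatingMap.constOfIsEmpty ℝ V (Fin 0) 1)
    rw [wedgeEval_eq_sum] at h1
    have h2 : ∀ σ : Equiv.Perm (Fin k), ((Equiv.Perm.sign σ : ℤ) : ℝ) *
        (α (fun i : Fin k => b (σ ⟨i, by omega⟩)) *
        (AlternatingMap.constOfIsEmpty ℝ V (Fin 0) (1 : ℝ))
          (fun j : Fin 0 => b (σ ⟨k + j, by omega⟩))) = α b := by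
      intro σ
      have := α.map_perm b σ
      simp only [AlternatingMap.constOfIsEmpty_apply, Function.const_apply, mul_one]
      change _ * α (fun i => b (σ i)) = _
      change α (fun i => b (σ i)) = _ at this
      rw [this, Units.smul_def, zsmul_eq_mul, ← mul_assoc, ← Int.cast_mul, ← Units.val_mul,
        Int.units_mul_self]
      simp
    rw [Finset.sum_congr rfl fun σ _ => h2 σ, Finset.sum_const, Finset.card_univ,
      nsmul_eq_mul] at h1
    have h3 : α b = 0 := by
      have h4 : (Fintype.card (Equiv.Perm (Fin k)) : ℝ) ≠ 0 := by
        exact_mod_cast Fintype.card_ne_zero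
      have h5 : ((k.factorial : ℝ) * (Nat.factorial 0 : ℕ))⁻¹ ≠ 0 := by positivity
      exact (mul_eq_zero.1 ((mul_eq_zero.1 h1).resolve_left h5)).resolve_left h4
    rw [AlternatingMap.eq_smul_basis_det b α, h3, zero_smul]
  | succ l ih =>
    intro k h α hα
    -- Moving the covector from the second factor to the first shows that `λ ∧ α` pairs to zero with
    -- every form of degree `l`, so the induction hypothesis applies to it.
    have h1 : ∀ lam : V →ₗ[ℝ] ℝ, AlternatingMap.alternatizeUncurryFin (lam.smulRight α) = 0 := by
      intro lam
      refine ih (by omega : k + 1 + l = n) _ fun β => ?_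
      have := wedgeEval_smulRight_alternatizeUncurryFin (by omega : k + 1 + l = n) h lam α β b
      rw [hα] at this
      have h2 : ((-1 : ℝ)) ^ k ≠ 0 := by simp
      simpa [h2] using this.symm
    refine Basis.ext_alternating b fun I hI => ?_
    -- Here `k < n`, so some index `i₀` is missing from `I`. On `(b i₀, b I)` only the first term of
    -- the wedge of the coordinate `i₀` with `α` survives, and it is `α (b I)`.
    obtain ⟨i₀, hi₀⟩ : ∃ i₀, i₀ ∉ Set.range I := by
      by_contra! hcon
      have := Fintype.card_le_of_surjective I hcon
      simp at this
      omega
    have h2 := congrArg (fun γ => γ (Fin.cons (b i₀) (fun i => b (I i)))) (h1 (b.coord i₀))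
    simp only [AlternatingMap.alternatizeUncurryFin_apply, AlternatingMap.zero_apply] at h2
    rw [Fin.sum_univ_succ, Finset.sum_eq_zero] at h2
    · simpa using h2
    · intro i _
      have : I i ≠ i₀ := fun h => hi₀ ⟨i, h⟩
      simp [this]

end WedgeAlgebra

lemma minSmoothness_two_le_infty : minSmoothness ℝ 2 ≤ (∞ : WithTop ℕ∞) := by
  simp only [minSmoothness_of_isRCLikeNormedField]
  exact WithTop.coe_le_coe.2 le_top

/-! ### Smoothness of form-valued functions -/

section FormValued

variable {n k : ℕ}

/-- The components of an alternating form on the standard basis determine it. -/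
lemma injective_formComponents : Function.Injective
    (fun (α : EuclideanSpace ℝ (Fin n) [⋀^Fin k]→L[ℝ] ℝ) (I : Fin k → Fin n) =>
      α fun i => EuclideanSpace.single (I i) 1) := by
  intro α β h
  refine ContinuousAlternatingMap.toAlternatingMap_injective
    (Basis.ext_alternating (EuclideanSpace.basisFun (Fin n) ℝ).toBasis fun I _ => ?_)
  simpa using congrFun h I

variable (n k) in
/-- The components of an alternating form on the standard basis. -/
def formComponents : (EuclideanSpace ℝ (Fin n) [⋀^Fin k]→L[ℝ] ℝ) →ₗ[ℝ]
    ((Fin k → Fin n) → ℝ) where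
  toFun α I := α fun i => EuclideanSpace.single (I i) 1
  map_add' _ _ := rfl
  map_smul' _ _ := rfl

instance : FiniteDimensional ℝ (EuclideanSpace ℝ (Fin n) [⋀^Fin k]→L[ℝ] ℝ) :=
  FiniteDimensional.of_injective (formComponents n k) injective_formComponents

variable (n k) in
lemma exists_formComponents_leftInverse :
    ∃ g : ((Fin k → Fin n) → ℝ) →L[ℝ] (EuclideanSpace ℝ (Fin n) [⋀^Fin k]→L[ℝ] ℝ),
      ∀ α, g (formComponents n k α) = α := by
  obtain ⟨g, hg⟩ := (formComponents n k).exists_leftInverse_of_injective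
    (LinearMap.ker_eq_bot.2 injective_formComponents)
  exact ⟨LinearMap.toContinuousLinearMap g, fun α => LinearMap.congr_fun hg α⟩

/-- The value of a form in terms of its components. -/
lemma form_apply_eq_sum (α : EuclideanSpace ℝ (Fin n) [⋀^Fin k]→L[ℝ] ℝ)
    (v : Fin k → EuclideanSpace ℝ (Fin n)) :
    α v = ∑ I : Fin k → Fin n, (∏ i, v i (I i)) * α fun i => EuclideanSpace.single (I i) 1 := by
  have h1 : v = fun i => ∑ j : Fin n, v i j • EuclideanSpace.single j (1 : ℝ) := by
    funext i
    have := (EuclideanSpace.basisFun (Fin n) ℝ).sum_repr (v i)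
    simpa using this.symm
  conv_lhs => rw [h1]
  have h2 := α.toMultilinearMap.map_sum
    (fun i (j : Fin n) => v i j • EuclideanSpace.single (𝕜 := ℝ) j (1 : ℝ))
  refine h2.trans (Finset.sum_congr rfl fun I _ => ?_)
  exact α.toMultilinearMap.map_smul_univ (fun i => v i (I i))
    (fun i => EuclideanSpace.single (I i) 1)

variable {F : Type*} [NormedAddCommGroup F] [NormedSpace ℝ F]

/-- A linear left inverse of the component map recovers the form, so smoothness can be checked on
real valued functions. -/
lemma contDiffAt_of_components {f : F → EuclideanSpace ℝ (Fin n) [⋀^Fin k]→L[ℝ] ℝ} {y : F}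
    (h : ∀ I : Fin k → Fin n, ContDiffAt ℝ ∞ (fun z => f z fun i => EuclideanSpace.single (I i) 1) y) :
    ContDiffAt ℝ ∞ f y := by
  obtain ⟨g, hg⟩ := exists_formComponents_leftInverse n k
  have h1 : f = fun z => g (formComponents n k (f z)) := funext fun z => (hg _).symm
  rw [h1]
  exact g.contDiff.contDiffAt.comp y (contDiffAt_pi.2 h)

lemma contDiffAt_form_apply {f : F → EuclideanSpace ℝ (Fin n) [⋀^Fin k]→L[ℝ] ℝ} {y : F}
    (hf : ContDiffAt ℝ ∞ f y) (v : Fin k → EuclideanSpace ℝ (Fin n)) :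
    ContDiffAt ℝ ∞ (fun z => f z v) y :=
  (ContinuousAlternatingMap.apply ℝ (EuclideanSpace ℝ (Fin n)) ℝ v).contDiff.contDiffAt.comp y hf

/-- The components of a pullback are polynomials in the components of the form and the entries of
the map. -/
lemma contDiffAt_compContinuousLinearMap
    {f : F → EuclideanSpace ℝ (Fin n) [⋀^Fin k]→L[ℝ] ℝ}
    {L : F → EuclideanSpace ℝ (Fin n) →L[ℝ] EuclideanSpace ℝ (Fin n)} {y : F}
    (hf : ContDiffAt ℝ ∞ f y) (hL : ContDiffAt ℝ ∞ L y) :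
    ContDiffAt ℝ ∞ (fun z => (f z).compContinuousLinearMap (L z)) y := by
  refine contDiffAt_of_components fun I => ?_
  simp only [ContinuousAlternatingMap.compContinuousLinearMap_apply]
  have h1 : ∀ z, (f z) (⇑(L z) ∘ fun i => EuclideanSpace.single (I i) 1) =
      ∑ J : Fin k → Fin n, (∏ i, (L z (EuclideanSpace.single (I i) 1)) (J i)) *
        f z fun i => EuclideanSpace.single (J i) 1 := fun z => form_apply_eq_sum _ _
  simp only [h1]
  refine ContDiffAt.sum fun J _ => ContDiffAt.mul (contDiffAt_prod fun i _ => ?_)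
    (contDiffAt_form_apply hf _)
  exact contDiffAt_euclidean.1 (hL.clm_apply contDiffAt_const) _

end FormValued

/-! ### Forms in charts and change of coordinates -/

section Charts

set_option linter.unusedSectionVars false

variable {n : ℕ} {M : Type*} [EMetricSpace M] [ChartedSpace (EuclideanSpace ℝ (Fin n)) M]
  [IsManifold (𝓡 n) ∞ M]

variable (n) in
/-- The inverse of `coordL`. -/
def coordInv (x₀ x : M) : TangentSpace (𝓡 n) x →L[ℝ] EuclideanSpace ℝ (Fin n) :=
  (trivializationAt (EuclideanSpace ℝ (Fin n)) (TangentSpace (𝓡 n)) x₀).continuousLinearMapAt ℝ x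

lemma coordL_coordInv {x₀ x : M} (hx : x ∈ (extChartAt (𝓡 n) x₀).source)
    (v : TangentSpace (𝓡 n) x) : coordL n x₀ x (coordInv n x₀ x v) = v :=
  Trivialization.symmL_continuousLinearMapAt _
    (by simpa [TangentBundle.trivializationAt_baseSet] using hx) v

lemma coordInv_coordL {x₀ x : M} (hx : x ∈ (extChartAt (𝓡 n) x₀).source)
    (v : EuclideanSpace ℝ (Fin n)) : coordInv n x₀ x (coordL n x₀ x v) = v :=
  Trivialization.continuousLinearMapAt_symmL _
    (by simpa [TangentBundle.trivializationAt_baseSet] using hx) v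

/-- Links the trivializations of the tangent bundle, through which forms are read in charts, to the
derivative of the transition map, to which the chain rule and the change of variables formula apply.
-/
lemma coordInv_coordL_eq_tangentCoordChange {x₀ x₁ x : M}
    (hx₀ : x ∈ (extChartAt (𝓡 n) x₀).source) (hx₁ : x ∈ (extChartAt (𝓡 n) x₁).source)
    (v : EuclideanSpace ℝ (Fin n)) :
    coordInv n x₀ x (coordL n x₁ x v) = tangentCoordChange (𝓡 n) x₁ x₀ x v := by
  rw [extChartAt_source] at hx₀ hx₁
  rw [coordInv, coordL, TangentBundle.continuousLinearMapAt_trivializationAt_eq_core hx₀,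
    TangentBundle.symmL_trivializationAt_eq_core hx₁]
  exact tangentCoordChange_comp (I := 𝓡 n)
    ⟨⟨by simpa using hx₁, by simp⟩, by simpa using hx₀⟩

lemma coordL_tangentCoordChange {x₀ x₁ x : M}
    (hx₀ : x ∈ (extChartAt (𝓡 n) x₀).source) (hx₁ : x ∈ (extChartAt (𝓡 n) x₁).source)
    (v : EuclideanSpace ℝ (Fin n)) :
    coordL n x₀ x (tangentCoordChange (𝓡 n) x₁ x₀ x v) = coordL n x₁ x v := by
  rw [← coordInv_coordL_eq_tangentCoordChange hx₀ hx₁, coordL_coordInv hx₀]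

lemma hasFDerivAt_tangentCoordChange {x₀ x₁ x : M}
    (hx₀ : x ∈ (extChartAt (𝓡 n) x₀).source) (hx₁ : x ∈ (extChartAt (𝓡 n) x₁).source) :
    HasFDerivAt (extChartAt (𝓡 n) x₀ ∘ (extChartAt (𝓡 n) x₁).symm)
      (tangentCoordChange (𝓡 n) x₁ x₀ x) (extChartAt (𝓡 n) x₁ x) := by
  have := hasFDerivWithinAt_tangentCoordChange (I := 𝓡 n) (x := x₁) (y := x₀) (z := x) ⟨hx₁, hx₀⟩
  rwa [ModelWithCorners.range_eq_univ, hasFDerivWithinAt_univ] at this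

lemma localRep_change {k : ℕ} (θ : DiffForm n M k) {x₀ x₁ x : M}
    (hx₀ : x ∈ (extChartAt (𝓡 n) x₀).source) (hx₁ : x ∈ (extChartAt (𝓡 n) x₁).source) :
    localRep x₁ θ x =
      (localRep x₀ θ x).compContinuousLinearMap (tangentCoordChange (𝓡 n) x₁ x₀ x) := by
  ext v
  simp only [localRep, ContinuousAlternatingMap.compContinuousLinearMap_apply]
  congr 1
  funext i
  exact (coordL_tangentCoordChange hx₀ hx₁ _).symm

lemma chartRep_extChartAt {k : ℕ} (θ : DiffForm n M k) {x₀ x : M}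
    (hx : x ∈ (extChartAt (𝓡 n) x₀).source) :
    chartRep x₀ θ (extChartAt (𝓡 n) x₀ x) = localRep x₀ θ x := by
  rw [chartRep, (extChartAt (𝓡 n) x₀).left_inv hx]

lemma eventually_symm_mem_source {x₀ x₁ x : M}
    (hx₀ : x ∈ (extChartAt (𝓡 n) x₀).source) (hx₁ : x ∈ (extChartAt (𝓡 n) x₁).source) :
    ∀ᶠ y in 𝓝 (extChartAt (𝓡 n) x₁ x), y ∈ (extChartAt (𝓡 n) x₁).target ∧
      (extChartAt (𝓡 n) x₁).symm y ∈ (extChartAt (𝓡 n) x₀).source := by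
  refine Filter.Eventually.and
    ((isOpen_extChartAt_target x₁).mem_nhds ((extChartAt (𝓡 n) x₁).map_source hx₁)) ?_
  refine (continuousAt_extChartAt_symm' hx₁).eventually ?_
  rw [(extChartAt (𝓡 n) x₁).left_inv hx₁]
  exact (isOpen_extChartAt_source x₀).mem_nhds hx₀

/-- Chart expressions of a form are related by pullback along the transition map. -/
lemma chartRep_eventuallyEq_pullback {k : ℕ} (θ : DiffForm n M k) {x₀ x₁ x : M}
    (hx₀ : x ∈ (extChartAt (𝓡 n) x₀).source) (hx₁ : x ∈ (extChartAt (𝓡 n) x₁).source) :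
    chartRep x₁ θ =ᶠ[𝓝 (extChartAt (𝓡 n) x₁ x)] fun y =>
      (chartRep x₀ θ ((extChartAt (𝓡 n) x₀ ∘ (extChartAt (𝓡 n) x₁).symm) y)).compContinuousLinearMap
        (fderiv ℝ (extChartAt (𝓡 n) x₀ ∘ (extChartAt (𝓡 n) x₁).symm) y) := by
  filter_upwards [eventually_symm_mem_source hx₀ hx₁] with y hy
  have h1 := (extChartAt (𝓡 n) x₁).map_target hy.1
  have h2 := (hasFDerivAt_tangentCoordChange hy.2 h1).fderiv
  rw [(extChartAt (𝓡 n) x₁).right_inv hy.1] at h2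
  rw [h2, Function.comp_apply, chartRep_extChartAt θ hy.2]
  exact localRep_change θ hy.2 h1

lemma contDiffAt_transition {x₀ x₁ x : M}
    (hx₀ : x ∈ (extChartAt (𝓡 n) x₀).source) (hx₁ : x ∈ (extChartAt (𝓡 n) x₁).source) :
    ContDiffAt ℝ ∞ (extChartAt (𝓡 n) x₀ ∘ (extChartAt (𝓡 n) x₁).symm) (extChartAt (𝓡 n) x₁ x) := by
  have := contDiffWithinAt_ext_coord_change (I := 𝓡 n) (n := ∞) x₀ x₁
    (y := extChartAt (𝓡 n) x₁ x) ((by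
      rw [PartialEquiv.trans_source]
      exact ⟨(extChartAt (𝓡 n) x₁).map_source hx₁, by
        rwa [mem_preimage, (extChartAt (𝓡 n) x₁).left_inv hx₁]⟩))
  rwa [ModelWithCorners.range_eq_univ, contDiffWithinAt_univ] at this

/-- The exterior derivative can be computed in any chart. -/
lemma localRep_extD {k : ℕ} (θ : DiffForm n M k) {x₀ x : M}
    (hx₀ : x ∈ (extChartAt (𝓡 n) x₀).source)
    (hθ : DifferentiableAt ℝ (chartRep x₀ θ) (extChartAt (𝓡 n) x₀ x)) :
    localRep x₀ (extD θ) x = extDeriv (chartRep x₀ θ) (extChartAt (𝓡 n) x₀ x) := by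
  have hx : x ∈ (extChartAt (𝓡 n) x).source := mem_extChartAt_source x
  have hτ : (extChartAt (𝓡 n) x₀ ∘ (extChartAt (𝓡 n) x).symm) (extChartAt (𝓡 n) x x) =
      extChartAt (𝓡 n) x₀ x := by
    rw [Function.comp_apply, (extChartAt (𝓡 n) x).left_inv hx]
  -- `extD` uses the chart around the point itself. The two chart expressions differ by the pullback
  -- under the transition map, and `d` commutes with pullbacks.
  have h1 := (chartRep_eventuallyEq_pullback θ hx₀ hx).extDeriv_eq
  rw [extDeriv_pullback (by rwa [hτ]) (contDiffAt_transition hx₀ hx)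
    minSmoothness_two_le_infty, hτ,
    (hasFDerivAt_tangentCoordChange hx₀ hx).fderiv] at h1
  ext v
  have h2 : extD θ x = (extDeriv (chartRep x θ) (extChartAt (𝓡 n) x x)).compContinuousLinearMap
    (coordInv n x x) := rfl
  simp only [localRep, h2, h1, ContinuousAlternatingMap.compContinuousLinearMap_apply]
  congr 1
  funext i
  change tangentCoordChange (𝓡 n) x x₀ x (coordInv n x x (coordL n x₀ x (v i))) = v i
  rw [← coordInv_coordL_eq_tangentCoordChange hx₀ hx, coordL_coordInv hx, coordInv_coordL hx₀]

variable (n) in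
/-- The form on `M` supported in the domain of the chart around `x₀` whose expression in
this chart is `f`. -/
def ofChart {k : ℕ} (x₀ : M) (f : EuclideanSpace ℝ (Fin n) → EuclideanSpace ℝ (Fin n) [⋀^Fin k]→L[ℝ] ℝ) :
    DiffForm n M k :=
  open Classical in fun x => if x ∈ (extChartAt (𝓡 n) x₀).source then
    (f (extChartAt (𝓡 n) x₀ x)).compContinuousLinearMap (coordInv n x₀ x) else 0

lemma localRep_ofChart {k : ℕ} {x₀ x : M} (hx : x ∈ (extChartAt (𝓡 n) x₀).source)
    (f : EuclideanSpace ℝ (Fin n) → EuclideanSpace ℝ (Fin n) [⋀^Fin k]→L[ℝ] ℝ) :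
    localRep x₀ (ofChart n x₀ f) x = f (extChartAt (𝓡 n) x₀ x) := by
  ext v
  simp only [localRep, ofChart, if_pos hx, ContinuousAlternatingMap.compContinuousLinearMap_apply]
  congr 1
  funext i
  exact coordInv_coordL hx _

lemma chartRep_ofChart {k : ℕ} {x₀ : M} {y : EuclideanSpace ℝ (Fin n)}
    (hy : y ∈ (extChartAt (𝓡 n) x₀).target)
    (f : EuclideanSpace ℝ (Fin n) → EuclideanSpace ℝ (Fin n) [⋀^Fin k]→L[ℝ] ℝ) :
    chartRep x₀ (ofChart n x₀ f) y = f y := by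
  rw [chartRep, localRep_ofChart ((extChartAt (𝓡 n) x₀).map_target hy),
    (extChartAt (𝓡 n) x₀).right_inv hy]

lemma ofChart_apply_ne_zero {k : ℕ} {x₀ x : M}
    {f : EuclideanSpace ℝ (Fin n) → EuclideanSpace ℝ (Fin n) [⋀^Fin k]→L[ℝ] ℝ}
    (hx : ofChart n x₀ f x ≠ 0) :
    x ∈ (extChartAt (𝓡 n) x₀).source ∧ f (extChartAt (𝓡 n) x₀ x) ≠ 0 := by
  by_contra hcon
  refine hx ?_
  rw [ofChart]
  split_ifs with h
  · have : f (extChartAt (𝓡 n) x₀ x) = 0 := by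
      by_contra h'
      exact hcon ⟨h, h'⟩
    rw [this]
    rfl
  · rfl

/-- A smooth form with compact support in the domain of a chart is a test form. -/
lemma isTestForm_ofChart {k : ℕ} {x₀ : M}
    {f : EuclideanSpace ℝ (Fin n) → EuclideanSpace ℝ (Fin n) [⋀^Fin k]→L[ℝ] ℝ}
    (hf : ContDiff ℝ ∞ f) {K : Set (EuclideanSpace ℝ (Fin n))} (hK : IsCompact K)
    (hKt : K ⊆ (extChartAt (𝓡 n) x₀).target) (hfK : ∀ y ∉ K, f y = 0) :
    IsTestForm (ofChart n x₀ f) := by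
  have hK' : IsCompact ((extChartAt (𝓡 n) x₀).symm '' K) :=
    hK.image_of_continuousOn ((continuousOn_extChartAt_symm x₀).mono hKt)
  have hsupp : {x | ofChart n x₀ f x ≠ 0} ⊆ (extChartAt (𝓡 n) x₀).symm '' K := by
    intro x hx
    obtain ⟨h1, h2⟩ := ofChart_apply_ne_zero hx
    exact ⟨extChartAt (𝓡 n) x₀ x, by by_contra h; exact h2 (hfK _ h),
      (extChartAt (𝓡 n) x₀).left_inv h1⟩
  refine ⟨fun x₁ y hy => ContDiffAt.contDiffWithinAt ?_,
    hK'.of_isClosed_subset isClosed_closure (closure_minimal hsupp hK'.isClosed)⟩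
  have hx₁ := (extChartAt (𝓡 n) x₁).map_target hy
  have hy' := (extChartAt (𝓡 n) x₁).right_inv hy
  -- Inside the domain of the first chart the expression is a pullback by a smooth transition map.
  -- Outside, the point has a neighbourhood that misses the compact set carrying the form.
  by_cases hx₀ : (extChartAt (𝓡 n) x₁).symm y ∈ (extChartAt (𝓡 n) x₀).source
  · have h1 := chartRep_eventuallyEq_pullback (ofChart n x₀ f) hx₀ hx₁
    have h2 := contDiffAt_transition hx₀ hx₁
    have h3 := eventually_symm_mem_source hx₀ hx₁
    rw [hy'] at h1 h2 h3
    have h4 : chartRep x₁ (ofChart n x₀ f) =ᶠ[𝓝 y] fun y =>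
        (f ((extChartAt (𝓡 n) x₀ ∘ (extChartAt (𝓡 n) x₁).symm) y)).compContinuousLinearMap
        (fderiv ℝ (extChartAt (𝓡 n) x₀ ∘ (extChartAt (𝓡 n) x₁).symm) y) := by
      filter_upwards [h1, h3] with z hz hz'
      rw [hz, chartRep_ofChart]
      exact (extChartAt (𝓡 n) x₀).map_source hz'.2
    refine ContDiffAt.congr_of_eventuallyEq ?_ h4
    have h5 : ContDiffAt ℝ ∞ (fderiv ℝ (extChartAt (𝓡 n) x₀ ∘ (extChartAt (𝓡 n) x₁).symm)) y :=
      h2.fderiv_right (by simp)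
    exact contDiffAt_compContinuousLinearMap (hf.contDiffAt.comp y h2) h5
  · have h1 : (extChartAt (𝓡 n) x₁).symm y ∈ ((extChartAt (𝓡 n) x₀).symm '' K)ᶜ := by
      rintro ⟨z, hz, hz'⟩
      exact hx₀ (hz' ▸ (extChartAt (𝓡 n) x₀).map_target (hKt hz))
    have h2 : ∀ᶠ z in 𝓝 y, (extChartAt (𝓡 n) x₁).symm z ∈ ((extChartAt (𝓡 n) x₀).symm '' K)ᶜ :=
      (continuousAt_extChartAt_symm'' hy).eventually (hK'.isClosed.isOpen_compl.mem_nhds h1)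
    refine (contDiffAt_const (c := 0)).congr_of_eventuallyEq ?_
    filter_upwards [h2] with z hz
    have : ofChart n x₀ f ((extChartAt (𝓡 n) x₁).symm z) = 0 := by
      by_contra h
      exact hz (hsupp h)
    rw [chartRep, localRep, this]
    rfl

end Charts

/-! ### The volume form in coordinates -/

section VolumeFactor

set_option linter.unusedSectionVars false

/-- With `Q` the matrix of `s` in an orthonormal basis, the Gram matrix is `QᵀQ` and the volume form
takes the value `± det Q`. -/
lemma volumeForm_apply_sq {n : ℕ} {V : Type*} [NormedAddCommGroup V] [InnerProductSpace ℝ V]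
    [FiniteDimensional ℝ V] [Fact (finrank ℝ V = n)] (o : Orientation ℝ V (Fin n))
    (s : Fin n → V) :
    o.volumeForm s ^ 2 = (Matrix.of fun i j => inner ℝ (s i) (s j)).det := by
  set b := onb n V
  set Q := b.toBasis.toMatrix s with hQ
  have hGQ : (Matrix.of fun i j => (inner ℝ (s i) (s j) : ℝ)) = Q.transpose * Q := by
    ext i j
    simp only [Matrix.of_apply, Matrix.mul_apply, Matrix.transpose_apply, hQ,
      Basis.toMatrix_apply, OrthonormalBasis.coe_toBasis_repr_apply,
      OrthonormalBasis.repr_apply_apply]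
    rw [← OrthonormalBasis.sum_inner_mul_inner b]
    exact Finset.sum_congr rfl fun a _ => by rw [real_inner_comm]
  have h : o.volumeForm b * o.volumeForm b = 1 := by
    rw [← abs_mul_abs_self, o.abs_volumeForm_apply_of_orthonormal b]
    norm_num
  have h2 := AlternatingMap.eq_smul_basis_det b.toBasis o.volumeForm
  rw [OrthonormalBasis.coe_toBasis] at h2
  rw [hGQ, Matrix.det_mul, Matrix.det_transpose, h2, AlternatingMap.smul_apply, Basis.det_apply,
    smul_eq_mul]
  linear_combination (Q.det ^ 2) * h

variable {n : ℕ} {M : Type*} [EMetricSpace M] [ChartedSpace (EuclideanSpace ℝ (Fin n)) M]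
  [IsManifold (𝓡 n) ∞ M]

variable (n) in
/-- The frame of coordinate vector fields of the chart around `x₀`. -/
def coordFrame (x₀ x : M) (i : Fin n) : TangentSpace (𝓡 n) x :=
  coordL n x₀ x (EuclideanSpace.single i 1)

/-- The coordinate vector fields form a basis of each tangent space. -/
def coordBasis {x₀ x : M} (hx : x ∈ (extChartAt (𝓡 n) x₀).source) :
    Basis (Fin n) ℝ (TangentSpace (𝓡 n) x) :=
  (EuclideanSpace.basisFun (Fin n) ℝ).toBasis.map
    ((trivializationAt (EuclideanSpace ℝ (Fin n)) (TangentSpace (𝓡 n)) x₀).continuousLinearEquivAt ℝ x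
      (by simpa [TangentBundle.trivializationAt_baseSet] using hx)).symm.toLinearEquiv

lemma coe_coordBasis {x₀ x : M} (hx : x ∈ (extChartAt (𝓡 n) x₀).source) :
    ⇑(coordBasis hx) = coordFrame n x₀ x := by
  funext i
  have hb : x ∈ (trivializationAt (EuclideanSpace ℝ (Fin n)) (TangentSpace (𝓡 n)) x₀).baseSet := by
    simpa [TangentBundle.trivializationAt_baseSet] using hx
  have h1 : coordBasis hx i = (trivializationAt (EuclideanSpace ℝ (Fin n)) (TangentSpace (𝓡 n)) x₀).symm x
      (EuclideanSpace.single i 1) := by simp [coordBasis]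
  rw [h1]
  exact (Trivialization.symmL_apply _ hb _).symm

/-- The coefficient of the exterior product of two forms on `ℝⁿ` with respect to the standard
volume form. -/
def formWedge {k l : ℕ} (h : k + l = n) (α : EuclideanSpace ℝ (Fin n) [⋀^Fin k]→L[ℝ] ℝ)
    (β : EuclideanSpace ℝ (Fin n) [⋀^Fin l]→L[ℝ] ℝ) : ℝ :=
  wedgeEval h α.toAlternatingMap β.toAlternatingMap fun i => EuclideanSpace.single i 1

variable [RiemannianBundle (fun x : M => TangentSpace (𝓡 n) x)]

/-- The value of the Riemannian volume form on the coordinate frame. -/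
def volFactor (o : (x : M) → Orientation ℝ (TangentSpace (𝓡 n) x) (Fin n)) (x₀ x : M) : ℝ :=
  (o x).volumeForm (coordFrame n x₀ x)

lemma volFactor_sq (o : (x : M) → Orientation ℝ (TangentSpace (𝓡 n) x) (Fin n)) (x₀ x : M) :
    volFactor o x₀ x ^ 2 = (gram n x₀ x).det :=
  volumeForm_apply_sq _ _

/-- A top-degree form that vanishes on a basis is zero, whereas the volume form is `± 1` on
orthonormal bases. -/
lemma volFactor_ne_zero (o : (x : M) → Orientation ℝ (TangentSpace (𝓡 n) x) (Fin n)) {x₀ x : M}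
    (hx : x ∈ (extChartAt (𝓡 n) x₀).source) : volFactor o x₀ x ≠ 0 := by
  intro h
  have h1 : (o x).volumeForm = 0 := by
    have := AlternatingMap.eq_smul_basis_det (coordBasis hx) (o x).volumeForm
    rw [this, coe_coordBasis]
    change volFactor o x₀ x • _ = 0
    rw [h, zero_smul]
  have h2 := (o x).abs_volumeForm_apply_of_orthonormal (onb n _)
  rw [h1] at h2
  simp at h2

lemma det_gram_pos {x₀ x : M} (hx : x ∈ (extChartAt (𝓡 n) x₀).source) :
    0 < (gram n x₀ x).det := by
  -- Any pointwise choice of orientations will do, since only the square of the volume factor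
  -- matters.
  rw [← volFactor_sq (fun x => (onb n (TangentSpace (𝓡 n) x)).toBasis.orientation)]
  exact sq_pos_of_ne_zero (volFactor_ne_zero _ hx)

lemma abs_volFactor (o : (x : M) → Orientation ℝ (TangentSpace (𝓡 n) x) (Fin n)) (x₀ x : M) :
    |volFactor o x₀ x| = √(gram n x₀ x).det := by
  rw [← volFactor_sq o, Real.sqrt_sq_eq_abs]

/-- The pairing of forms in coordinates. -/
lemma pairing_mul_volFactor (o : (x : M) → Orientation ℝ (TangentSpace (𝓡 n) x) (Fin n))
    {k l : ℕ} (h : k + l = n) (θ : DiffForm n M k) (ψ : DiffForm n M l) (x₀ x : M) :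
    pairing o h θ ψ x * volFactor o x₀ x = formWedge h (localRep x₀ θ x) (localRep x₀ ψ x) := by
  have h1 := volCoeff_smul_volumeForm (o x)
    ((wedge (θ x).toAlternatingMap (ψ x).toAlternatingMap).domDomCongr (finCongr h))
  have h2 := congrArg (fun γ => γ (coordFrame n x₀ x)) h1
  refine h2.symm.trans ?_
  exact (wedgeEval_comp h (θ x).toAlternatingMap (ψ x).toAlternatingMap
    (coordL n x₀ x).toLinearMap _).symm

/-- The two coordinate frames differ by the derivative of the transition map, and a top-degree form
scales by its determinant. Up to sign this is the transformation rule of `√(det g)` that makes the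
chart measures compatible. -/
lemma volFactor_change (o : (x : M) → Orientation ℝ (TangentSpace (𝓡 n) x) (Fin n)) {x₀ x₁ x : M}
    (hx₀ : x ∈ (extChartAt (𝓡 n) x₀).source) (hx₁ : x ∈ (extChartAt (𝓡 n) x₁).source) :
    volFactor o x₁ x = (tangentCoordChange (𝓡 n) x₁ x₀ x).det * volFactor o x₀ x := by
  have h1 := AlternatingMap.eq_smul_basis_det (EuclideanSpace.basisFun (Fin n) ℝ).toBasis
    ((o x).volumeForm.compLinearMap (coordL n x₀ x).toLinearMap)
  have h2 := congrArg (fun γ => γ ((tangentCoordChange (𝓡 n) x₁ x₀ x).toLinearMap ∘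
    (EuclideanSpace.basisFun (Fin n) ℝ).toBasis)) h1
  simp only [AlternatingMap.smul_apply, Basis.det_comp, Basis.det_self, mul_one, smul_eq_mul] at h2
  rw [mul_comm]
  convert h2 using 1
  · simp only [AlternatingMap.compLinearMap_apply, volFactor]
    congr 1
    funext i
    simp only [coordFrame, Function.comp_apply]
    refine (coordL_tangentCoordChange hx₀ hx₁ _).symm.trans ?_
    simp
  · congr 1
    simp only [AlternatingMap.compLinearMap_apply, volFactor]
    congr 1
    funext i
    simp [coordFrame]

lemma sqrt_det_gram_change {x₀ x₁ x : M}
    (hx₀ : x ∈ (extChartAt (𝓡 n) x₀).source) (hx₁ : x ∈ (extChartAt (𝓡 n) x₁).source) :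
    √(gram n x₁ x).det = |(tangentCoordChange (𝓡 n) x₁ x₀ x).det| * √(gram n x₀ x).det := by
  set o := fun x : M => (onb n (TangentSpace (𝓡 n) x)).toBasis.orientation
  rw [← abs_volFactor o, ← abs_volFactor o, volFactor_change o hx₀ hx₁, abs_mul]

/-- The dimension has to be positive: in dimension `0` the empty basis has only the positive
orientation and cannot be adjusted to `o x`. -/
lemma volFactor_pos_iff (hn : 0 < n) (o : (x : M) → Orientation ℝ (TangentSpace (𝓡 n) x) (Fin n))
    {x₀ x : M} (hx : x ∈ (extChartAt (𝓡 n) x₀).source) :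
    0 < volFactor o x₀ x ↔ (coordBasis hx).orientation = o x := by
  have : Nonempty (Fin n) := ⟨⟨0, hn⟩⟩
  set b := (onb n (TangentSpace (𝓡 n) x)).adjustToOrientation (o x)
  have hb : b.toBasis.orientation = o x := OrthonormalBasis.orientation_adjustToOrientation _ _
  rw [volFactor, (o x).volumeForm_robust b hb, ← coe_coordBasis hx,
    ← Basis.orientation_eq_iff_det_pos, hb, eq_comm]

/-- A continuous orientation has a constant sign with respect to the coordinates near a point. -/
lemma exists_sign_volFactor {o : (x : M) → Orientation ℝ (TangentSpace (𝓡 n) x) (Fin n)}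
    (ho : IsContinuousOrientation o) (x₀ : M) :
    ∃ s : ℝ, s * s = 1 ∧ ∀ᶠ x in 𝓝 x₀, volFactor o x₀ x = s * √(gram n x₀ x).det := by
  have habs : ∀ x, volFactor o x₀ x = √(gram n x₀ x).det ∨ volFactor o x₀ x = -√(gram n x₀ x).det :=
    fun x => eq_or_eq_neg_of_abs_eq (abs_volFactor o x₀ x)
  have hsrc : ∀ᶠ x in 𝓝 x₀, x ∈ (extChartAt (𝓡 n) x₀).source := extChartAt_source_mem_nhds x₀
  -- In dimension `0` a chart domain is a single point, so the sign is read off at `x₀`.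
  rcases Nat.eq_zero_or_pos n with rfl | hn
  · have hloc : ∀ᶠ x in 𝓝 x₀, x = x₀ := by
      filter_upwards [hsrc] with x hx
      exact (extChartAt (𝓡 0) x₀).injOn hx (mem_extChartAt_source x₀) (Subsingleton.elim _ _)
    rcases habs x₀ with h | h
    · exact ⟨1, by norm_num, hloc.mono fun x hx => by rw [hx, h, one_mul]⟩
    · exact ⟨-1, by norm_num, hloc.mono fun x hx => by rw [hx, h, neg_one_mul]⟩
  · obtain ⟨o₀, ho₀⟩ := ho x₀
    by_cases hpos : (EuclideanSpace.basisFun (Fin n) ℝ).toBasis.orientation = o₀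
    · refine ⟨1, by norm_num, ?_⟩
      filter_upwards [ho₀, hsrc] with x hx hxs
      have hb : x ∈ (trivializationAt (EuclideanSpace ℝ (Fin n)) (TangentSpace (𝓡 n)) x₀).baseSet := by
        simpa [TangentBundle.trivializationAt_baseSet] using hxs
      have h1 : 0 < volFactor o x₀ x := by
        rw [volFactor_pos_iff hn o hxs, coordBasis, Basis.orientation_map, hpos, ← hx hb]
        exact (Orientation.map _ _).symm_apply_apply _
      rw [one_mul, ← abs_volFactor o, abs_of_pos h1]
    · refine ⟨-1, by norm_num, ?_⟩
      filter_upwards [ho₀, hsrc] with x hx hxs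
      have hb : x ∈ (trivializationAt (EuclideanSpace ℝ (Fin n)) (TangentSpace (𝓡 n)) x₀).baseSet := by
        simpa [TangentBundle.trivializationAt_baseSet] using hxs
      have h1 : ¬ 0 < volFactor o x₀ x := by
        rw [volFactor_pos_iff hn o hxs, coordBasis, Basis.orientation_map]
        intro h
        refine hpos ?_
        rw [← hx hb, ← h]
        exact ((Orientation.map _ _).apply_symm_apply _).symm
      rw [← abs_volFactor o, abs_of_nonpos (not_lt.1 h1)]
      ring

end VolumeFactor

/-! ### The Riemannian measure -/

section RiemannianMeasure

set_option linter.unusedSectionVars false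

variable {n : ℕ} {M : Type*} [EMetricSpace M] [ChartedSpace (EuclideanSpace ℝ (Fin n)) M]
  [IsManifold (𝓡 n) ∞ M] [RiemannianBundle (fun x : M => TangentSpace (𝓡 n) x)]
  [IsContMDiffRiemannianBundle (𝓡 n) ∞ (EuclideanSpace ℝ (Fin n))
    (fun x : M => TangentSpace (𝓡 n) x)]
  [MeasurableSpace M] [BorelSpace M]

lemma continuousOn_sqrt_det_gram (x₀ : M) :
    ContinuousOn (fun x => √(gram n x₀ x).det) (extChartAt (𝓡 n) x₀).source := by
  rw [extChartAt_source]
  have h1 : ContinuousOn (fun x => gram n x₀ x) (chartAt (EuclideanSpace ℝ (Fin n)) x₀).source :=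
    continuousOn_pi.2 fun i => continuousOn_pi.2 fun j => continuousOn_gram x₀ i j
  exact (Continuous.matrix_det continuous_id).comp_continuousOn h1 |>.sqrt

lemma continuousOn_sqrt_det_gram_symm (x₀ : M) :
    ContinuousOn (fun y => √(gram n x₀ ((extChartAt (𝓡 n) x₀).symm y)).det)
      (extChartAt (𝓡 n) x₀).target :=
  (continuousOn_sqrt_det_gram x₀).comp (continuousOn_extChartAt_symm x₀)
    fun _ hy => (extChartAt (𝓡 n) x₀).map_target hy

lemma measurableSet_target (x₀ : M) : MeasurableSet (extChartAt (𝓡 n) x₀).target :=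
  (isOpen_extChartAt_target x₀).measurableSet

lemma measurableSet_source (x₀ : M) : MeasurableSet (extChartAt (𝓡 n) x₀).source :=
  (isOpen_extChartAt_source x₀).measurableSet

lemma aemeasurable_chart_symm (x₀ : M) :
    AEMeasurable (extChartAt (𝓡 n) x₀).symm (volume.restrict (extChartAt (𝓡 n) x₀).target) :=
  (continuousOn_extChartAt_symm x₀).aemeasurable (measurableSet_target x₀)

lemma aemeasurable_chart_density (x₀ : M) :
    AEMeasurable (fun y => ENNReal.ofReal √(gram n x₀ ((extChartAt (𝓡 n) x₀).symm y)).det)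
      (volume.restrict (extChartAt (𝓡 n) x₀).target) :=
  ((continuousOn_sqrt_det_gram_symm x₀).aemeasurable (measurableSet_target x₀)).ennreal_ofReal

lemma lintegral_chartVolume (x₀ : M) {F : M → ℝ≥0∞} (hF : Measurable F) :
    ∫⁻ x, F x ∂(chartVolume n x₀) = ∫⁻ y in (extChartAt (𝓡 n) x₀).target,
      ENNReal.ofReal √(gram n x₀ ((extChartAt (𝓡 n) x₀).symm y)).det *
        F ((extChartAt (𝓡 n) x₀).symm y) := by
  have h1 := aemeasurable_chart_symm (n := n) x₀
  rw [chartVolume, lintegral_map' hF.aemeasurable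
    (h1.mono_ac (withDensity_absolutelyContinuous _ _))]
  exact lintegral_withDensity_eq_lintegral_mul₀ (aemeasurable_chart_density x₀)
    (hF.comp_aemeasurable h1)

lemma chartVolume_apply (x₀ : M) {S : Set M} (hS : MeasurableSet S) :
    chartVolume n x₀ S = ∫⁻ y in (extChartAt (𝓡 n) x₀).target,
      ((extChartAt (𝓡 n) x₀).symm ⁻¹' S).indicator
        (fun y => ENNReal.ofReal √(gram n x₀ ((extChartAt (𝓡 n) x₀).symm y)).det) y := by
  rw [← lintegral_indicator_one hS, lintegral_chartVolume x₀ (measurable_one.indicator hS)]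
  refine lintegral_congr fun y => ?_
  by_cases hy : (extChartAt (𝓡 n) x₀).symm y ∈ S
  · rw [indicator_of_mem hy, indicator_of_mem (by exact hy)]; simp
  · rw [indicator_of_notMem hy, indicator_of_notMem (by exact hy)]; simp

lemma chartVolume_compl_source (x₀ : M) :
    chartVolume n x₀ (extChartAt (𝓡 n) x₀).sourceᶜ = 0 := by
  rw [chartVolume_apply x₀ (measurableSet_source x₀).compl]
  refine (setLIntegral_congr_fun (measurableSet_target x₀) fun y hy => ?_).trans lintegral_zero
  refine indicator_of_notMem ?_ _
  rw [mem_preimage, mem_compl_iff, not_not]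
  exact (extChartAt (𝓡 n) x₀).map_target hy

/-- The measures `chartVolume` agree on the intersections of the chart domains. -/
lemma chartVolume_eq_of_subset {x₀ x₁ : M} {S : Set M} (hS : MeasurableSet S)
    (h₀ : S ⊆ (extChartAt (𝓡 n) x₀).source) (h₁ : S ⊆ (extChartAt (𝓡 n) x₁).source) :
    chartVolume n x₀ S = chartVolume n x₁ S := by
  have hmeas : ∀ x : M, MeasurableSet ((extChartAt (𝓡 n) x).target ∩
      (extChartAt (𝓡 n) x).symm ⁻¹' S) := by
    intro x
    have h : Measurable ((extChartAt (𝓡 n) x).target.domRestrict (extChartAt (𝓡 n) x).symm) :=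
      (continuousOn_iff_continuous_domRestrict.1 (continuousOn_extChartAt_symm x)).measurable
    have h' := (measurableSet_target x).subtype_image (h hS)
    convert h' using 1
    ext y
    constructor
    · rintro ⟨hy, hyS⟩
      exact ⟨⟨y, hy⟩, hyS, rfl⟩
    · rintro ⟨⟨z, hz⟩, hzS, rfl⟩
      exact ⟨hz, hzS⟩
  have happ : ∀ x : M, chartVolume n x S = ∫⁻ y in ((extChartAt (𝓡 n) x).target ∩
      (extChartAt (𝓡 n) x).symm ⁻¹' S),
        ENNReal.ofReal √(gram n x ((extChartAt (𝓡 n) x).symm y)).det := by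
    intro x
    rw [chartVolume_apply x hS, ← lintegral_indicator (measurableSet_target x),
      ← lintegral_indicator (hmeas x)]
    refine lintegral_congr fun y => ?_
    simp only [indicator, mem_inter_iff, mem_preimage]
    split_ifs <;> simp_all
  -- The two coordinate images of `S` correspond under the transition map, and its Jacobian is the
  -- ratio of the two densities `√(det g)`.
  set A := (extChartAt (𝓡 n) x₁).target ∩ (extChartAt (𝓡 n) x₁).symm ⁻¹' S
  have himage : (extChartAt (𝓡 n) x₀).target ∩ (extChartAt (𝓡 n) x₀).symm ⁻¹' S =
      (extChartAt (𝓡 n) x₀ ∘ (extChartAt (𝓡 n) x₁).symm) '' A := by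
    ext y
    constructor
    · rintro ⟨hy, hyS⟩
      refine ⟨extChartAt (𝓡 n) x₁ ((extChartAt (𝓡 n) x₀).symm y),
        ⟨(extChartAt (𝓡 n) x₁).map_source (h₁ hyS), ?_⟩, ?_⟩
      · rwa [mem_preimage, (extChartAt (𝓡 n) x₁).left_inv (h₁ hyS)]
      · rw [Function.comp_apply, (extChartAt (𝓡 n) x₁).left_inv (h₁ hyS),
          (extChartAt (𝓡 n) x₀).right_inv hy]
    · rintro ⟨z, ⟨hz, hzS⟩, rfl⟩
      refine ⟨(extChartAt (𝓡 n) x₀).map_source (h₀ hzS), ?_⟩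
      rwa [mem_preimage, Function.comp_apply, (extChartAt (𝓡 n) x₀).left_inv (h₀ hzS)]
  have hinj : InjOn (extChartAt (𝓡 n) x₀ ∘ (extChartAt (𝓡 n) x₁).symm) A := by
    rintro y ⟨hy, hyS⟩ z ⟨hz, hzS⟩ hyz
    exact (extChartAt (𝓡 n) x₁).symm.injOn hy hz
      ((extChartAt (𝓡 n) x₀).injOn (h₀ hyS) (h₀ hzS) hyz)
  have hderiv : ∀ y ∈ A, HasFDerivWithinAt (extChartAt (𝓡 n) x₀ ∘ (extChartAt (𝓡 n) x₁).symm)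
      (tangentCoordChange (𝓡 n) x₁ x₀ ((extChartAt (𝓡 n) x₁).symm y)) A y := by
    rintro y ⟨hy, hyS⟩
    have := hasFDerivAt_tangentCoordChange (h₀ hyS) (h₁ hyS)
    rw [(extChartAt (𝓡 n) x₁).right_inv hy] at this
    exact this.hasFDerivWithinAt
  rw [happ, happ, himage, lintegral_image_eq_lintegral_abs_det_fderiv_mul volume (hmeas x₁) hderiv hinj]
  refine setLIntegral_congr_fun (hmeas x₁) fun y hy => ?_
  rw [sqrt_det_gram_change (h₀ hy.2) (h₁ hy.2), ENNReal.ofReal_mul (abs_nonneg _),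
    Function.comp_apply, (extChartAt (𝓡 n) x₀).left_inv (h₀ hy.2)]

lemma chartVolume_restrict_eq {x₀ x₁ : M} {S : Set M} (hS : MeasurableSet S)
    (h₀ : S ⊆ (extChartAt (𝓡 n) x₀).source) (h₁ : S ⊆ (extChartAt (𝓡 n) x₁).source) :
    (chartVolume n x₀).restrict S = (chartVolume n x₁).restrict S := by
  ext T hT
  rw [Measure.restrict_apply hT, Measure.restrict_apply hT]
  exact chartVolume_eq_of_subset (hT.inter hS) (inter_subset_right.trans h₀)
    (inter_subset_right.trans h₁)

lemma chartVolume_restrict_source (x₀ : M) :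
    (chartVolume n x₀).restrict (extChartAt (𝓡 n) x₀).source = chartVolume n x₀ :=
  Measure.restrict_eq_self_of_ae_mem (by
    rw [ae_iff]
    exact chartVolume_compl_source x₀)

variable [SecondCountableTopology M]

variable (n M) in
lemma exists_seq_chart_cover [Nonempty M] :
    ∃ c : ℕ → M, ⋃ i, (extChartAt (𝓡 n) (c i)).source = univ := by
  obtain ⟨t, ht, hU⟩ := TopologicalSpace.countable_cover_nhds
    (fun x : M => extChartAt_source_mem_nhds (I := 𝓡 n) x)
  have hne : t.Nonempty := by
    by_contra h
    rw [not_nonempty_iff_eq_empty.1 h] at hU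
    simp only [mem_empty_iff_false, iUnion_of_empty, iUnion_empty] at hU
    exact (Set.empty_ne_univ (α := M)) hU
  obtain ⟨c, rfl⟩ := ht.exists_eq_range hne
  exact ⟨c, by rw [← hU, biUnion_range]⟩

/-- The Riemannian volume is given by the density `√(det g_ij)` in each chart. -/
lemma riemannianVolume_restrict_source (x₀ : M) :
    (riemannianVolume n M).restrict (extChartAt (𝓡 n) x₀).source = chartVolume n x₀ := by
  have : Nonempty M := ⟨x₀⟩
  obtain ⟨c, hc⟩ := exists_seq_chart_cover n M
  -- The chart measures are glued along a countable partition subordinate to chart domains. By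
  -- compatibility the glued measure `μ` restricts to each chart measure; so it dominates their
  -- supremum, and on a chart domain the two agree.
  set P : ℕ → Set M := disjointed fun i => (extChartAt (𝓡 n) (c i)).source with hP
  have hPm : ∀ i, MeasurableSet (P i) := MeasurableSet.disjointed fun i => measurableSet_source (c i)
  have hPs : ∀ i, P i ⊆ (extChartAt (𝓡 n) (c i)).source := fun i => disjointed_subset _ i
  have hPd : Pairwise (Function.onFun Disjoint P) := disjoint_disjointed _
  have hPu : ⋃ i, P i = univ := by rw [hP, iUnion_disjointed, hc]
  set μ : Measure M := Measure.sum fun i => (chartVolume n (c i)).restrict (P i) with hμ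
  have hμr : ∀ x : M, μ.restrict (extChartAt (𝓡 n) x).source = chartVolume n x := by
    intro x
    rw [hμ, Measure.restrict_sum _ (measurableSet_source x)]
    have h1 : ∀ i, ((chartVolume n (c i)).restrict (P i)).restrict (extChartAt (𝓡 n) x).source =
        (chartVolume n x).restrict (P i) := by
      intro i
      rw [Measure.restrict_restrict (measurableSet_source x),
        chartVolume_restrict_eq ((measurableSet_source x).inter (hPm i))
        (inter_subset_right.trans (hPs i)) (inter_subset_left : _ ⊆ (extChartAt (𝓡 n) x).source),
        inter_comm, ← Measure.restrict_restrict (hPm i), chartVolume_restrict_source]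
    simp only [h1]
    rw [← Measure.restrict_iUnion hPd hPm, hPu, Measure.restrict_univ]
  have hle : riemannianVolume n M ≤ μ := iSup_le fun x => by
    rw [← hμr x]
    exact Measure.restrict_le_self
  refine le_antisymm ((Measure.restrict_mono le_rfl hle).trans (hμr x₀).le) ?_
  rw [← chartVolume_restrict_source x₀]
  exact Measure.restrict_mono le_rfl (le_iSup (fun x : M => chartVolume n x) x₀)

/-- Compact subsets of a chart domain have finite volume. -/
lemma riemannianVolume_lt_top_of_subset_source {x₀ : M} {K : Set M} (hK : IsCompact K)
    (hKs : K ⊆ (extChartAt (𝓡 n) x₀).source) : riemannianVolume n M K < ⊤ := by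
  have h1 : riemannianVolume n M K = chartVolume n x₀ K := by
    rw [← riemannianVolume_restrict_source x₀, Measure.restrict_apply hK.measurableSet,
      inter_eq_left.2 hKs]
  obtain ⟨C, hC⟩ := (hK.image_of_continuousOn ((continuousOn_sqrt_det_gram x₀).mono hKs)).bddAbove
  have hK' : IsCompact (extChartAt (𝓡 n) x₀ '' K) :=
    hK.image_of_continuousOn ((continuousOn_extChartAt x₀).mono hKs)
  rw [h1, chartVolume_apply x₀ hK.measurableSet]
  calc ∫⁻ y in (extChartAt (𝓡 n) x₀).target, ((extChartAt (𝓡 n) x₀).symm ⁻¹' K).indicator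
        (fun y => ENNReal.ofReal √(gram n x₀ ((extChartAt (𝓡 n) x₀).symm y)).det) y
      ≤ ∫⁻ y in (extChartAt (𝓡 n) x₀).target, (extChartAt (𝓡 n) x₀ '' K).indicator
        (fun _ => ENNReal.ofReal C) y := by
        refine setLIntegral_mono' (measurableSet_target x₀) fun y hy => ?_
        by_cases hyK : (extChartAt (𝓡 n) x₀).symm y ∈ K
        · have hyK' : y ∈ extChartAt (𝓡 n) x₀ '' K := ⟨_, hyK, (extChartAt (𝓡 n) x₀).right_inv hy⟩
          rw [indicator_of_mem (by exact hyK), indicator_of_mem hyK']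
          exact ENNReal.ofReal_le_ofReal (hC ⟨_, hyK, rfl⟩)
        · rw [indicator_of_notMem (by exact hyK)]
          exact zero_le
    _ ≤ ∫⁻ y, (extChartAt (𝓡 n) x₀ '' K).indicator (fun _ => ENNReal.ofReal C) y :=
        setLIntegral_le_lintegral _ _
    _ < ⊤ := by
        rw [lintegral_indicator_const hK'.measurableSet]
        exact ENNReal.mul_lt_top ENNReal.ofReal_lt_top hK'.measure_lt_top

instance : IsFiniteMeasureOnCompacts (riemannianVolume n M) := by
  have : LocallyCompactSpace M := ChartedSpace.locallyCompactSpace (EuclideanSpace ℝ (Fin n)) M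
  have : IsLocallyFiniteMeasure (riemannianVolume n M) := by
    refine ⟨fun x => ?_⟩
    obtain ⟨K, hK, hxK, hKs⟩ := exists_compact_subset (isOpen_extChartAt_source (I := 𝓡 n) x)
      (mem_extChartAt_source x)
    exact ⟨K, mem_interior_iff_mem_nhds.1 hxK, riemannianVolume_lt_top_of_subset_source hK hKs⟩
  infer_instance

end RiemannianMeasure

/-! ### The Hopf–Rinow theorem -/

section HopfRinow

open Manifold
open scoped NNReal

/-- A Riemannian manifold is a length space. -/
lemma exists_edist_eq_of_edist_lt_add (n : ℕ) {M : Type*} [EMetricSpace M]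
    [ChartedSpace (EuclideanSpace ℝ (Fin n)) M] [RiemannianBundle (fun x : M => TangentSpace (𝓡 n) x)]
    [IsRiemannianManifold (𝓡 n) M] {x y : M} {s t : ℝ≥0∞} (hs : s ≠ ⊤)
    (hsxy : s ≤ edist x y) (hst : edist x y < s + t) : ∃ z, edist x z = s ∧ edist z y < t := by
  have hR : ∀ x y : M, edist x y = riemannianEDist (𝓡 n) x y := IsRiemannianManifold.out
  rw [hR] at hst
  -- Along a curve of length less than `s + t` the distance to `x` takes the value `s`. The first
  -- part of the curve has length at least `s`, so the rest has length less than `t`.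
  obtain ⟨γ, hγ0, hγ1, hγ, hlen⟩ := exists_lt_of_riemannianEDist_lt hst
  have hcont : ContinuousOn (fun u => edist x (γ u)) (Icc 0 1) :=
    (continuous_const.edist continuous_id).comp_continuousOn hγ.continuousOn
  obtain ⟨u, hu, hus⟩ := intermediate_value_Icc zero_le_one hcont
    (show s ∈ Icc _ _ by simp only [hγ0, hγ1, edist_self]; exact ⟨zero_le, hsxy⟩)
  refine ⟨γ u, hus, ?_⟩
  have h1 : edist x (γ u) ≤ pathELength (𝓡 n) γ 0 u := by
    rw [hR]
    exact riemannianEDist_le_pathELength (hγ.mono (Icc_subset_Icc_right hu.2)) hγ0 rfl hu.1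
  have h2 : edist (γ u) y ≤ pathELength (𝓡 n) γ u 1 := by
    rw [hR]
    exact riemannianEDist_le_pathELength (hγ.mono (Icc_subset_Icc_left hu.1)) rfl hγ1 hu.2
  have h3 := pathELength_add (I := 𝓡 n) (γ := γ) hu.1 hu.2
  refine h2.trans_lt ?_
  have h4 : s + pathELength (𝓡 n) γ u 1 < s + t := by
    refine lt_of_le_of_lt ?_ hlen
    rw [← h3, ← hus]
    gcongr
  exact (ENNReal.add_lt_add_iff_left hs).1 h4

/-- The compact ball has a compact neighbourhood, which contains some `δ`-thickening of it. By the
length property, a point at distance at most `r + δ / 2` from `x` lies within `δ` of the ball;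
halving `δ` makes the inequality strict. -/
lemma exists_isCompact_edist_le_add (n : ℕ) {M : Type*} [EMetricSpace M]
    [ChartedSpace (EuclideanSpace ℝ (Fin n)) M] [RiemannianBundle (fun x : M => TangentSpace (𝓡 n) x)]
    [IsRiemannianManifold (𝓡 n) M] (x : M) {r : ℝ≥0} (hr : IsCompact {y | edist x y ≤ r}) :
    ∃ δ : ℝ≥0, 0 < δ ∧ IsCompact {y | edist x y ≤ (r + δ : ℝ≥0)} := by
  have : LocallyCompactSpace M := ChartedSpace.locallyCompactSpace (EuclideanSpace ℝ (Fin n)) M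
  obtain ⟨K, hK, hrK⟩ := exists_compact_superset hr
  obtain ⟨δ, hδ, hδK⟩ := hr.exists_thickening_subset_open isOpen_interior hrK
  refine ⟨δ.toNNReal / 2, by positivity, hK.of_isClosed_subset
    (isClosed_le (continuous_const.edist continuous_id) continuous_const) fun y hy => ?_⟩
  refine interior_subset (hδK ?_)
  rw [Metric.mem_thickening_iff_infEDist_lt]
  by_cases hxy : edist x y ≤ r
  · refine (Metric.infEDist_zero_of_mem (by exact hxy)).trans_lt ?_
    simpa using hδ
  · obtain ⟨z, hz, hzy⟩ := exists_edist_eq_of_edist_lt_add n (t := ENNReal.ofReal δ)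
      ENNReal.coe_ne_top (not_le.1 hxy).le (by
        refine lt_of_le_of_lt hy ?_
        rw [ENNReal.ofReal, ← ENNReal.coe_add, ENNReal.coe_lt_coe]
        have : 0 < δ.toNNReal := by simpa using hδ
        gcongr
        exact NNReal.half_lt_self this.ne')
    refine lt_of_le_of_lt (Metric.infEDist_le_edist_of_mem (y := z) hz.le) ?_
    rwa [edist_comm]

/-- A closed ball is complete, so total boundedness suffices. In a length space the ball of radius
`R` lies within `ε / 2` of the slightly smaller ball of radius `R - e'`, which is compact and so has
a finite `ε / 2`-net. -/
lemma isCompact_edist_le_of_forall_lt (n : ℕ) {M : Type*} [EMetricSpace M]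
    [ChartedSpace (EuclideanSpace ℝ (Fin n)) M] [RiemannianBundle (fun x : M => TangentSpace (𝓡 n) x)]
    [IsRiemannianManifold (𝓡 n) M] [CompleteSpace M] (x : M) {R : ℝ≥0} (hR : 0 < R)
    (h : ∀ r < R, IsCompact {y | edist x y ≤ (r : ℝ≥0)}) : IsCompact {y | edist x y ≤ R} := by
  refine isCompact_iff_totallyBounded_isComplete.2 ⟨?_,
    (isClosed_le (continuous_const.edist continuous_id) continuous_const).isComplete⟩
  refine EMetric.totallyBounded_iff.2 fun ε hε => ?_
  obtain ⟨e, he, heε⟩ : ∃ e : ℝ≥0, 0 < e ∧ (e : ℝ≥0∞) < ε / 2 := by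
    obtain ⟨e, he1, he2⟩ := ENNReal.lt_iff_exists_nnreal_btwn.1 (ENNReal.half_pos hε.ne')
    exact ⟨e, by simpa using he1, he2⟩
  set e' := min e R / 2 with he'
  have he'pos : 0 < e' := by positivity
  have he'e : e' < e := (NNReal.half_lt_self (by positivity)).trans_le (min_le_left _ _)
  have he'R : e' ≤ R := (NNReal.half_le_self _).trans (min_le_right _ _)
  have hlt : R - e' < R := tsub_lt_self hR he'pos
  obtain ⟨t, ht, htc⟩ := EMetric.totallyBounded_iff.1 (h _ hlt).totallyBounded (ε / 2)
    (ENNReal.half_pos hε.ne')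
  refine ⟨t, ht, fun y hy => ?_⟩
  have hzy : ∃ z, edist x z ≤ (R - e' : ℝ≥0) ∧ edist y z < ε / 2 := by
    by_cases hxy : edist x y ≤ (R - e' : ℝ≥0)
    · exact ⟨y, hxy, by rw [edist_self]; exact ENNReal.half_pos hε.ne'⟩
    · obtain ⟨z, hz, hzy⟩ := exists_edist_eq_of_edist_lt_add n (t := e)
        ENNReal.coe_ne_top (not_le.1 hxy).le (by
          refine lt_of_le_of_lt hy ?_
          rw [← ENNReal.coe_add, ENNReal.coe_lt_coe]
          calc R = R - e' + e' := (tsub_add_cancel_of_le he'R).symm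
            _ < R - e' + e := by gcongr)
      exact ⟨z, hz.le, by rw [edist_comm]; exact hzy.trans heε⟩
  obtain ⟨z, hz, hyz⟩ := hzy
  obtain ⟨w, hw, hzw⟩ := mem_iUnion₂.1 (htc hz)
  refine mem_iUnion₂.2 ⟨w, hw, ?_⟩
  calc edist y w ≤ edist y z + edist z w := edist_triangle _ _ _
    _ < ε / 2 + ε / 2 := ENNReal.add_lt_add hyz hzw
    _ = ε := ENNReal.add_halves ε

/-- Hopf–Rinow: in a complete Riemannian manifold, closed balls are compact. -/
theorem isCompact_edist_le (n : ℕ) {M : Type*} [EMetricSpace M]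
    [ChartedSpace (EuclideanSpace ℝ (Fin n)) M] [RiemannianBundle (fun x : M => TangentSpace (𝓡 n) x)]
    [IsRiemannianManifold (𝓡 n) M] [CompleteSpace M] (x : M) (r : ℝ≥0) : IsCompact {y | edist x y ≤ r} := by
  set S : Set ℝ≥0 := {r | IsCompact {y | edist x y ≤ (r : ℝ≥0)}} with hS
  have hdown : ∀ r ∈ S, ∀ r' ≤ r, r' ∈ S := fun r hr r' hr' =>
    IsCompact.of_isClosed_subset hr (isClosed_le (continuous_const.edist continuous_id)
      continuous_const) fun y (hy : edist x y ≤ _) => hy.trans (by exact_mod_cast hr')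
  have h0 : (0 : ℝ≥0) ∈ S := by
    have : {y | edist x y ≤ ((0 : ℝ≥0) : ℝ≥0∞)} = {x} := by
      ext y
      simp [eq_comm]
    rw [hS, mem_ofPred_eq, this]
    exact isCompact_singleton
  by_contra hr
  -- If one radius fails, the radii of compact balls are bounded. Their supremum is again such a
  -- radius and can still be enlarged, a contradiction.
  have hb : BddAbove S := ⟨r, fun r' hr' => by
    by_contra hlt
    exact hr (hdown r' hr' r (not_le.1 hlt).le)⟩
  have hR : sSup S ∈ S := by
    rcases eq_or_lt_of_le (zero_le (a := sSup S)) with h | h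
    · rw [← h]; exact h0
    · refine isCompact_edist_le_of_forall_lt n x h fun r' hr' => ?_
      obtain ⟨r'', hr'', hlt⟩ := exists_lt_of_lt_csSup ⟨0, h0⟩ hr'
      exact hdown r'' hr'' r' hlt.le
  obtain ⟨δ, hδ, hδS⟩ := exists_isCompact_edist_le_add n x hR
  exact absurd (le_csSup hb hδS) (not_le.2 (lt_add_of_pos_right _ hδ))

end HopfRinow

/-! ### Comparison of the metric with a constant metric -/

section LocalGeometry

set_option linter.unusedSectionVars false

variable {n : ℕ} {M : Type*} [EMetricSpace M] [ChartedSpace (EuclideanSpace ℝ (Fin n)) M]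
  [IsManifold (𝓡 n) ∞ M] [RiemannianBundle (fun x : M => TangentSpace (𝓡 n) x)]
  [IsContMDiffRiemannianBundle (𝓡 n) ∞ (EuclideanSpace ℝ (Fin n))
    (fun x : M => TangentSpace (𝓡 n) x)]

variable (n M) in
lemma isContinuousRiemannianBundle_tangentSpace :
    IsContinuousRiemannianBundle (EuclideanSpace ℝ (Fin n)) (fun x : M => TangentSpace (𝓡 n) x) := by
  obtain ⟨g, hg, hg'⟩ := IsContMDiffRiemannianBundle.exists_contMDiff (IB := 𝓡 n) (n := ∞)
    (F := EuclideanSpace ℝ (Fin n)) (E := fun x : M => TangentSpace (𝓡 n) x)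
  exact ⟨g, hg.continuous, hg'⟩

/-- Near a point, the metric read in the chart is almost constant. -/
lemma eventually_norm_coordL_le (x₀ : M) : ∀ᶠ x in 𝓝 x₀, x ∈ (extChartAt (𝓡 n) x₀).source ∧
    ∀ v : EuclideanSpace ℝ (Fin n), ‖coordL n x₀ x v‖ ≤ 2 * ‖coordL n x₀ x₀ v‖ ∧
      ‖coordL n x₀ x₀ v‖ ≤ 2 * ‖coordL n x₀ x v‖ := by
  have := isContinuousRiemannianBundle_tangentSpace n M
  filter_upwards [eventually_norm_symmL_trivializationAt_self_comp_lt (EuclideanSpace ℝ (Fin n))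
    (fun x : M => TangentSpace (𝓡 n) x) x₀ one_lt_two,
    eventually_norm_symmL_trivializationAt_comp_self_lt (EuclideanSpace ℝ (Fin n))
    (fun x : M => TangentSpace (𝓡 n) x) x₀ one_lt_two,
    extChartAt_source_mem_nhds (I := 𝓡 n) x₀] with x h1 h2 hx
  refine ⟨hx, fun v => ⟨?_, ?_⟩⟩
  · have h3 := ContinuousLinearMap.le_of_opNorm_le _ h2.le (coordL n x₀ x₀ v)
    rw [ContinuousLinearMap.comp_apply] at h3
    change ‖coordL n x₀ x (coordInv n x₀ x₀ (coordL n x₀ x₀ v))‖ ≤ _ at h3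
    rwa [coordInv_coordL (mem_extChartAt_source x₀)] at h3
  · have h3 := ContinuousLinearMap.le_of_opNorm_le _ h1.le (coordL n x₀ x v)
    rw [ContinuousLinearMap.comp_apply] at h3
    change ‖coordL n x₀ x₀ (coordInv n x₀ x (coordL n x₀ x v))‖ ≤ _ at h3
    rwa [coordInv_coordL hx] at h3

variable (n) in
lemma exists_ball_norm_coordL_le (x₀ : M) : ∃ r > 0,
    ∀ y ∈ Metric.ball (extChartAt (𝓡 n) x₀ x₀) r, y ∈ (extChartAt (𝓡 n) x₀).target ∧
    ∀ v : EuclideanSpace ℝ (Fin n),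
      ‖coordL n x₀ ((extChartAt (𝓡 n) x₀).symm y) v‖ ≤ 2 * ‖coordL n x₀ x₀ v‖ ∧
      ‖coordL n x₀ x₀ v‖ ≤ 2 * ‖coordL n x₀ ((extChartAt (𝓡 n) x₀).symm y) v‖ := by
  have h1 : Tendsto (extChartAt (𝓡 n) x₀).symm (𝓝 (extChartAt (𝓡 n) x₀ x₀)) (𝓝 x₀) := by
    have := continuousAt_extChartAt_symm (I := 𝓡 n) x₀
    rwa [ContinuousAt, extChartAt_to_inv] at this
  have h2 : ∀ᶠ y in 𝓝 (extChartAt (𝓡 n) x₀ x₀), y ∈ (extChartAt (𝓡 n) x₀).target :=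
    extChartAt_target_mem_nhds x₀
  obtain ⟨r, hr, h⟩ := Metric.eventually_nhds_iff_ball.1
    ((h1.eventually (eventually_norm_coordL_le (n := n) x₀)).and h2)
  exact ⟨r, hr, fun y hy => ⟨(h y hy).2, (h y hy).1.2⟩⟩


/-- The Riemannian distance is controlled by the constant metric near a point. -/
lemma edist_extChartAt_symm_le [IsRiemannianManifold (𝓡 n) M] {x₀ : M} {r : ℝ}
    (hr : ∀ y ∈ Metric.ball (extChartAt (𝓡 n) x₀ x₀) r, y ∈ (extChartAt (𝓡 n) x₀).target ∧
    ∀ v : EuclideanSpace ℝ (Fin n),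
      ‖coordL n x₀ ((extChartAt (𝓡 n) x₀).symm y) v‖ ≤ 2 * ‖coordL n x₀ x₀ v‖ ∧
      ‖coordL n x₀ x₀ v‖ ≤ 2 * ‖coordL n x₀ ((extChartAt (𝓡 n) x₀).symm y) v‖)
    {y z : EuclideanSpace ℝ (Fin n)} (hy : y ∈ Metric.ball (extChartAt (𝓡 n) x₀ x₀) r)
    (hz : z ∈ Metric.ball (extChartAt (𝓡 n) x₀ x₀) r) :
    edist ((extChartAt (𝓡 n) x₀).symm y) ((extChartAt (𝓡 n) x₀).symm z) ≤
      ENNReal.ofReal (2 * ‖coordL n x₀ x₀ (z - y)‖) := by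
  rw [IsRiemannianManifold.out (I := 𝓡 n) ((extChartAt (𝓡 n) x₀).symm y)
    ((extChartAt (𝓡 n) x₀).symm z)]
  -- The distance is at most the length of the image of the segment from `y` to `z`. On the ball its
  -- speed is at most twice the length of `z - y` measured at the centre.
  let η : ℝ → EuclideanSpace ℝ (Fin n) := fun t => y + t • (z - y)
  have hη : ∀ t ∈ Icc (0 : ℝ) 1, η t ∈ Metric.ball (extChartAt (𝓡 n) x₀ x₀) r := by
    intro t ht
    refine (convex_ball _ _).segment_subset hy hz ?_
    rw [segment_eq_image']
    exact ⟨t, ht, rfl⟩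
  have hηd : ∀ t, HasDerivAt η (z - y) t := fun t => by
    have h := ((hasDerivAt_id t).smul_const (z - y)).const_add y
    rw [one_smul] at h
    exact h
  have hηs : ContMDiff 𝓘(ℝ, ℝ) 𝓘(ℝ, EuclideanSpace ℝ (Fin n)) 1 η := by
    rw [contMDiff_iff_contDiff]
    fun_prop
  have hηt : Icc (0 : ℝ) 1 ⊆ η ⁻¹' (extChartAt (𝓡 n) x₀).target := fun t ht => (hr _ (hη t ht)).1
  have h1 : Manifold.riemannianEDist (𝓡 n) ((extChartAt (𝓡 n) x₀).symm y)
      ((extChartAt (𝓡 n) x₀).symm z) ≤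
      Manifold.pathELength (𝓡 n) ((extChartAt (𝓡 n) x₀).symm ∘ η) 0 1 := by
    refine Manifold.riemannianEDist_le_pathELength ?_ (by simp [η]) (by simp [η]) zero_le_one
    exact (contMDiffOn_extChartAt_symm (n := 1) x₀).comp hηs.contMDiffOn hηt
  refine h1.trans ?_
  rw [Manifold.pathELength_eq_lintegral_mfderivWithin_Icc]
  have h2 : ∀ t ∈ Icc (0 : ℝ) 1, ‖mfderivWithin 𝓘(ℝ, ℝ) (𝓡 n) ((extChartAt (𝓡 n) x₀).symm ∘ η)
      (Icc 0 1) t (1 : ℝ)‖ₑ ≤ ENNReal.ofReal (2 * ‖coordL n x₀ x₀ (z - y)‖) := by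
    intro t ht
    have h3 : mfderivWithin 𝓘(ℝ, ℝ) (𝓡 n) ((extChartAt (𝓡 n) x₀).symm ∘ η) (Icc 0 1) t =
        (mfderivWithin 𝓘(ℝ, EuclideanSpace ℝ (Fin n)) (𝓡 n) (extChartAt (𝓡 n) x₀).symm
          (range (𝓡 n)) (η t)) ∘L
        (mfderivWithin 𝓘(ℝ, ℝ) 𝓘(ℝ, EuclideanSpace ℝ (Fin n)) η (Icc 0 1) t) := by
      apply mfderivWithin_comp
      · exact mdifferentiableWithinAt_extChartAt_symm (hηt ht)
      · exact hηs.contMDiffOn.mdifferentiableOn one_ne_zero t ht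
      · exact hηt.trans (preimage_mono (extChartAt_target_subset_range x₀))
      · rw [uniqueMDiffWithinAt_iff_uniqueDiffWithinAt]
        exact uniqueDiffOn_Icc zero_lt_one t ht
    have h4 : mfderivWithin 𝓘(ℝ, ℝ) 𝓘(ℝ, EuclideanSpace ℝ (Fin n)) η (Icc 0 1) t (1 : ℝ) = z - y := by
      rw [mfderivWithin_eq_fderivWithin]
      have := (hηd t).hasFDerivAt.hasFDerivWithinAt.fderivWithin
        (uniqueDiffOn_Icc zero_lt_one t ht)
      rw [this]
      exact one_smul ℝ (z - y)
    have h5 := (hr _ (hη t ht)).2 (z - y)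
    -- Coordinate vector fields are the columns of the derivative of the inverse chart.
    have h6 : coordL n x₀ ((extChartAt (𝓡 n) x₀).symm (η t)) =
        mfderivWithin 𝓘(ℝ, EuclideanSpace ℝ (Fin n)) (𝓡 n) (extChartAt (𝓡 n) x₀).symm
          (range (𝓡 n)) (η t) := by
      have hsrc : (extChartAt (𝓡 n) x₀).symm (η t) ∈
          (chartAt (EuclideanSpace ℝ (Fin n)) x₀).source := by
        rw [← extChartAt_source (𝓡 n)]
        exact (extChartAt (𝓡 n) x₀).map_target (hηt ht)
      have := TangentBundle.symmL_trivializationAt (I := 𝓡 n) (x₀ := x₀) hsrc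
      rw [(extChartAt (𝓡 n) x₀).right_inv (hηt ht)] at this
      exact this
    have h7 : mfderivWithin 𝓘(ℝ, ℝ) (𝓡 n) ((extChartAt (𝓡 n) x₀).symm ∘ η) (Icc 0 1) t (1 : ℝ) =
        coordL n x₀ ((extChartAt (𝓡 n) x₀).symm (η t)) (z - y) := by
      rw [h6]
      exact (DFunLike.congr_fun h3 (1 : ℝ)).trans (congrArg (mfderivWithin
        𝓘(ℝ, EuclideanSpace ℝ (Fin n)) (𝓡 n) (extChartAt (𝓡 n) x₀).symm (range (𝓡 n)) (η t)) h4)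
    rw [h7, ← ofReal_norm]
    exact ENNReal.ofReal_le_ofReal h5.1
  refine (setLIntegral_mono' measurableSet_Icc h2).trans ?_
  simp

end LocalGeometry

/-! ### Pointwise inequalities for norms of forms -/

section PointwiseBounds

variable {n : ℕ} {V : Type*} [NormedAddCommGroup V] [InnerProductSpace ℝ V]
  [Fact (finrank ℝ V = n)] [FiniteDimensional ℝ V]

/-- A constant in comparisons of norms on `k`-forms in dimension `n`. -/
def formConst (n k : ℕ) : ℝ := √(k.factorial : ℝ) * (n : ℝ) ^ k

lemma formConst_nonneg (n k : ℕ) : 0 ≤ formConst n k := by unfold formConst; positivity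

lemma abs_apply_onb_le {k : ℕ} (α : V [⋀^Fin k]→L[ℝ] ℝ) (f : Fin k → Fin n) :
    |α fun i => onb n V (f i)| ≤ √(k.factorial : ℝ) * formNorm n α := by
  rw [formNorm, ← Real.sqrt_mul (by positivity), ← mul_assoc, mul_inv_cancel₀ (by positivity),
    one_mul]
  refine Real.abs_le_sqrt ?_
  exact Finset.single_le_sum (f := fun f : Fin k → Fin n => (α fun i => onb n V (f i)) ^ 2)
    (fun _ _ => sq_nonneg _) (Finset.mem_univ f)

/-- Expanding in an orthonormal basis gives `n ^ k` terms, each with a coefficient of size at most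
`√(k!)` times the norm. The constant is crude; only its independence of the point is used. -/
lemma abs_form_apply_le {k : ℕ} (α : V [⋀^Fin k]→L[ℝ] ℝ) (v : Fin k → V) :
    |α v| ≤ formConst n k * formNorm n α * ∏ i, ‖v i‖ := by
  have h1 : v = fun m => ∑ j : Fin n, inner ℝ (onb n V j) (v m) • onb n V j := by
    funext m
    exact ((onb n V).sum_repr' (v m)).symm
  have h2 := α.toMultilinearMap.map_sum
    (fun m (j : Fin n) => inner ℝ (onb n V j) (v m) • onb n V j)
  have h3 : α v = ∑ f : Fin k → Fin n, (∏ m, inner ℝ (onb n V (f m)) (v m)) *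
      α fun m => onb n V (f m) := by
    conv_lhs => rw [h1]
    refine h2.trans (Finset.sum_congr rfl fun f _ => ?_)
    exact α.toMultilinearMap.map_smul_univ (fun m => inner ℝ (onb n V (f m)) (v m))
      (fun m => onb n V (f m))
  rw [h3]
  refine (Finset.abs_sum_le_sum_abs _ _).trans ((Finset.sum_le_card_nsmul _ _
    ((√(k.factorial : ℝ) * formNorm n α) * ∏ i, ‖v i‖) fun f _ => ?_).trans (le_of_eq ?_))
  · rw [abs_mul, mul_comm, Finset.abs_prod]
    refine mul_le_mul (abs_apply_onb_le α f) (Finset.prod_le_prod (fun _ _ => abs_nonneg _)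
      fun i _ => ?_) (by positivity) (mul_nonneg (by positivity) (formNorm_nonneg _))
    refine (abs_real_inner_le_norm _ _).trans (le_of_eq ?_)
    rw [(onb n V).norm_eq_one, one_mul]
  · simp [formConst]
    ring

lemma formNorm_le {k : ℕ} (α : V [⋀^Fin k]→L[ℝ] ℝ) {c : ℝ} (hc : 0 ≤ c)
    (h : ∀ v : Fin k → V, (∀ i, ‖v i‖ ≤ 1) → |α v| ≤ c) : formNorm n α ≤ (n : ℝ) ^ k * c := by
  rw [formNorm]
  refine Real.sqrt_le_iff.2 ⟨by positivity, ?_⟩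
  have h1 : ∑ f : Fin k → Fin n, (α fun i => onb n V (f i)) ^ 2 ≤ (n : ℝ) ^ k * c ^ 2 := by
    refine (Finset.sum_le_card_nsmul _ _ (c ^ 2) fun f _ => ?_).trans (le_of_eq ?_)
    · rw [← sq_abs]
      exact pow_le_pow_left₀ (abs_nonneg _) (h _ fun i => ((onb n V).norm_eq_one _).le) 2
    · simp
  -- `n ^ k` is a natural number, hence at most its square, even when it is `0`.
  have h2 : (n : ℝ) ^ k ≤ ((n : ℝ) ^ k) ^ 2 := by
    rw [sq]
    rcases Nat.eq_zero_or_pos (n ^ k) with h0 | h0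
    · have : (n : ℝ) ^ k = 0 := by exact_mod_cast h0
      simp [this]
    · have : (1 : ℝ) ≤ (n : ℝ) ^ k := by exact_mod_cast h0
      nlinarith
  calc (k.factorial : ℝ)⁻¹ * ∑ f : Fin k → Fin n, (α fun i => onb n V (f i)) ^ 2
      ≤ 1 * ((n : ℝ) ^ k * c ^ 2) := by
        refine mul_le_mul (inv_le_one_of_one_le₀ ?_) h1
          (Finset.sum_nonneg fun _ _ => sq_nonneg _) zero_le_one
        exact_mod_cast Nat.one_le_iff_ne_zero.2 k.factorial_ne_zero
    _ ≤ ((n : ℝ) ^ k * c) ^ 2 := by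
        rw [one_mul, mul_pow]
        exact mul_le_mul_of_nonneg_right h2 (sq_nonneg c)

/-- The constant in the bound `|α ∧ β| ≤ C |α| |β|`. -/
def wedgeConst (n k l : ℕ) : ℝ :=
  ((k.factorial : ℝ) * l.factorial)⁻¹ * (n.factorial * (formConst n k * formConst n l))

lemma wedgeConst_nonneg (n k l : ℕ) : 0 ≤ wedgeConst n k l := by
  have := formConst_nonneg n k
  have := formConst_nonneg n l
  unfold wedgeConst
  positivity

lemma abs_wedgeEval_le {k l : ℕ} (h : k + l = n) (α : V [⋀^Fin k]→L[ℝ] ℝ)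
    (β : V [⋀^Fin l]→L[ℝ] ℝ) {v : Fin n → V} (hv : ∀ i, ‖v i‖ ≤ 1) :
    |wedgeEval h α.toAlternatingMap β.toAlternatingMap v| ≤
      wedgeConst n k l * (formNorm n α * formNorm n β) := by
  have hα := formNorm_nonneg (n := n) α
  have hβ := formNorm_nonneg (n := n) β
  have hk := formConst_nonneg n k
  have hl := formConst_nonneg n l
  have key : ∀ {m : ℕ} (γ : V [⋀^Fin m]→L[ℝ] ℝ) (w : Fin m → V), (∀ i, ‖w i‖ ≤ 1) →
      |γ w| ≤ formConst n m * formNorm n γ := by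
    intro m γ w hw
    refine (abs_form_apply_le γ w).trans (mul_le_of_le_one_right
      (mul_nonneg (formConst_nonneg n m) (formNorm_nonneg _)) ?_)
    exact Finset.prod_le_one (fun _ _ => norm_nonneg _) fun i _ => hw i
  rw [wedgeEval_eq_sum, abs_mul, abs_of_nonneg (by positivity), wedgeConst, mul_assoc]
  refine mul_le_mul_of_nonneg_left ?_ (by positivity)
  refine (Finset.abs_sum_le_sum_abs _ _).trans ((Finset.sum_le_card_nsmul _ _
    ((formConst n k * formConst n l) * (formNorm n α * formNorm n β)) fun σ _ => ?_).trans
      (le_of_eq ?_))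
  · rw [abs_mul, abs_mul]
    have h1 : |((Equiv.Perm.sign σ : ℤ) : ℝ)| = 1 := by
      rcases Int.units_eq_one_or (Equiv.Perm.sign σ) with h | h <;> simp [h]
    rw [h1, one_mul]
    refine (mul_le_mul (key α _ fun i => hv _) (key β _ fun i => hv _) (abs_nonneg _)
      (by positivity)).trans (le_of_eq (by ring))
  · rw [Finset.card_univ, Fintype.card_perm, Fintype.card_fin, nsmul_eq_mul]
    ring

/-- The exterior product of a covector and an alternating form. -/
def covWedge {E : Type*} [NormedAddCommGroup E] [NormedSpace ℝ E] {l : ℕ} (lam : E →L[ℝ] ℝ)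
    (β : E [⋀^Fin l]→L[ℝ] ℝ) : E [⋀^Fin (l + 1)]→L[ℝ] ℝ :=
  ContinuousAlternatingMap.alternatizeUncurryFin (lam.smulRight β)

lemma covWedge_apply {E : Type*} [NormedAddCommGroup E] [NormedSpace ℝ E] {l : ℕ}
    (lam : E →L[ℝ] ℝ) (β : E [⋀^Fin l]→L[ℝ] ℝ) (v : Fin (l + 1) → E) :
    covWedge lam β v = ∑ i : Fin (l + 1), (-1 : ℝ) ^ (i : ℕ) * (lam (v i) * β (i.removeNth v)) := by
  rw [covWedge, ContinuousAlternatingMap.alternatizeUncurryFin_apply]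
  refine Finset.sum_congr rfl fun i _ => ?_
  simp

lemma covWedge_comp {E F : Type*} [NormedAddCommGroup E] [NormedSpace ℝ E] [NormedAddCommGroup F]
    [NormedSpace ℝ F] {l : ℕ} (lam : E →L[ℝ] ℝ) (β : E [⋀^Fin l]→L[ℝ] ℝ) (T : F →L[ℝ] E) :
    (covWedge lam β).compContinuousLinearMap T =
      covWedge (lam.comp T) (β.compContinuousLinearMap T) := by
  ext v
  simp only [ContinuousAlternatingMap.compContinuousLinearMap_apply, covWedge_apply]
  rfl

lemma formNorm_covWedge_le {l : ℕ} (lam : V →L[ℝ] ℝ) (β : V [⋀^Fin l]→L[ℝ] ℝ) :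
    formNorm n (covWedge lam β) ≤
      (n : ℝ) ^ (l + 1) * ((l + 1) * formConst n l) * (‖lam‖ * formNorm n β) := by
  have hβ := formNorm_nonneg (n := n) β
  have hl := formConst_nonneg n l
  rw [mul_assoc]
  refine formNorm_le _ (by positivity) fun v hv => ?_
  rw [covWedge_apply]
  refine (Finset.abs_sum_le_sum_abs _ _).trans ((Finset.sum_le_card_nsmul _ _
    (‖lam‖ * (formConst n l * formNorm n β)) fun i _ => ?_).trans (le_of_eq ?_))
  · rw [abs_mul, abs_pow, abs_neg, abs_one, one_pow, one_mul, abs_mul]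
    refine mul_le_mul ?_ ?_ (abs_nonneg _) (norm_nonneg _)
    · exact (lam.le_opNorm _).trans (mul_le_of_le_one_right (norm_nonneg _) (hv i))
    · refine (abs_form_apply_le β _).trans (mul_le_of_le_one_right (by positivity) ?_)
      exact Finset.prod_le_one (fun _ _ => norm_nonneg _) fun j _ => hv _
  · simp
    ring

/-- A linear map which expands lengths at most by the factor `C` does not increase the norm of
forms much. -/
lemma norm_compContinuousLinearMap_le {k : ℕ} {E : Type*} [NormedAddCommGroup E] [NormedSpace ℝ E]
    (T : E →L[ℝ] V) {C : ℝ} (hC : 0 ≤ C)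
    (hT : ∀ v, ‖T v‖ ≤ C * ‖v‖) (α : V [⋀^Fin k]→L[ℝ] ℝ) :
    ‖α.compContinuousLinearMap T‖ ≤ formConst n k * C ^ k * formNorm n α := by
  have hα := formNorm_nonneg (n := n) α
  have hk := formConst_nonneg n k
  refine ContinuousAlternatingMap.opNorm_le_bound _
    (mul_nonneg (mul_nonneg hk (pow_nonneg hC k)) hα)
    fun v => ?_
  rw [ContinuousAlternatingMap.compContinuousLinearMap_apply, Real.norm_eq_abs]
  refine (abs_form_apply_le (n := n) α _).trans ?_
  have : ∏ i, ‖(T ∘ v) i‖ ≤ C ^ k * ∏ i, ‖v i‖ := by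
    refine (Finset.prod_le_prod (fun _ _ => norm_nonneg _) fun i _ => hT (v i)).trans (le_of_eq ?_)
    rw [Finset.prod_mul_distrib]
    simp
  refine (mul_le_mul_of_nonneg_left this (by positivity)).trans (le_of_eq ?_)
  ring

/-- The section `S` lifts unit vectors to vectors of length at most `C`, on which the pulled back
form takes the same values. -/
lemma formNorm_le_norm_compContinuousLinearMap {k : ℕ} {E : Type*} [NormedAddCommGroup E]
    [NormedSpace ℝ E] (T : E →L[ℝ] V) (S : V → E) (hTS : ∀ v, T (S v) = v) {C : ℝ} (hC : 0 ≤ C)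
    (hS : ∀ v, ‖S v‖ ≤ C * ‖v‖) (α : V [⋀^Fin k]→L[ℝ] ℝ) :
    formNorm n α ≤ (n : ℝ) ^ k * C ^ k * ‖α.compContinuousLinearMap T‖ := by
  rw [mul_assoc]
  refine formNorm_le α (by positivity) fun v hv => ?_
  have h1 : α v = α.compContinuousLinearMap T fun i => S (v i) := by
    rw [ContinuousAlternatingMap.compContinuousLinearMap_apply]
    congr 1
    funext i
    exact (hTS (v i)).symm
  rw [h1, ← Real.norm_eq_abs, mul_comm]
  refine (ContinuousAlternatingMap.le_opNorm _ _).trans (mul_le_mul_of_nonneg_left ?_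
    (norm_nonneg _))
  refine (Finset.prod_le_prod (fun _ _ => norm_nonneg _) fun i _ => (hS (v i)).trans
    (mul_le_of_le_one_right hC (hv i))).trans (le_of_eq (by simp))

end PointwiseBounds

/-! ### The pointwise bound of the pairing -/

section PairingBound

set_option linter.unusedSectionVars false

variable {n : ℕ} {M : Type*} [EMetricSpace M] [ChartedSpace (EuclideanSpace ℝ (Fin n)) M]
  [IsManifold (𝓡 n) ∞ M] [RiemannianBundle (fun x : M => TangentSpace (𝓡 n) x)]

/-- On an orthonormal basis the volume form is `± 1`, so there the pairing is, up to sign, a value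
of the wedge product on unit vectors. -/
lemma abs_pairing_le (o : (x : M) → Orientation ℝ (TangentSpace (𝓡 n) x) (Fin n)) {k l : ℕ}
    (h : k + l = n) (θ : DiffForm n M k) (ψ : DiffForm n M l) (x : M) :
    |pairing o h θ ψ x| ≤ wedgeConst n k l * (formNorm n (θ x) * formNorm n (ψ x)) := by
  have h1 : pairing o h θ ψ x = (o x).volumeForm (onb n (TangentSpace (𝓡 n) x)) *
      wedgeEval h (θ x).toAlternatingMap (ψ x).toAlternatingMap
        (onb n (TangentSpace (𝓡 n) x)) := rfl
  rw [h1, abs_mul, (o x).abs_volumeForm_apply_of_orthonormal, one_mul]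
  exact abs_wedgeEval_le h _ _ fun i => ((onb n (TangentSpace (𝓡 n) x)).norm_eq_one i).le

end PairingBound

/-! ### The wedge pairing as a continuous bilinear map -/

section FormWedge

variable {n : ℕ}

/-- The norm of `formWedge`. -/
lemma norm_formWedge_le {k l : ℕ} (h : k + l = n) (α : EuclideanSpace ℝ (Fin n) [⋀^Fin k]→L[ℝ] ℝ)
    (β : EuclideanSpace ℝ (Fin n) [⋀^Fin l]→L[ℝ] ℝ) : ‖formWedge h α β‖ ≤
      ((k.factorial : ℝ) * l.factorial)⁻¹ * n.factorial * ‖α‖ * ‖β‖ := by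
  have key : ∀ {m : ℕ} (γ : EuclideanSpace ℝ (Fin n) [⋀^Fin m]→L[ℝ] ℝ) (f : Fin m → Fin n),
      |γ fun i => EuclideanSpace.single (f i) 1| ≤ ‖γ‖ := fun γ f => by
    refine (γ.le_opNorm _).trans (le_of_eq ?_)
    simp
  rw [formWedge, wedgeEval_eq_sum, Real.norm_eq_abs, abs_mul, abs_of_nonneg (by positivity),
    mul_assoc, mul_assoc]
  refine mul_le_mul_of_nonneg_left ?_ (by positivity)
  refine (Finset.abs_sum_le_sum_abs _ _).trans ((Finset.sum_le_card_nsmul _ _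
    (‖α‖ * ‖β‖) fun σ _ => ?_).trans (le_of_eq ?_))
  · rw [abs_mul, abs_mul]
    have h1 : |((Equiv.Perm.sign σ : ℤ) : ℝ)| = 1 := by
      rcases Int.units_eq_one_or (Equiv.Perm.sign σ) with h | h <;> simp [h]
    rw [h1, one_mul]
    exact mul_le_mul (key α _) (key β _) (abs_nonneg _) (norm_nonneg _)
  · rw [Finset.card_univ, Fintype.card_perm, Fintype.card_fin, nsmul_eq_mul]

/-- `formWedge` as a continuous bilinear map. -/
def formWedgeL {k l : ℕ} (h : k + l = n) :
    (EuclideanSpace ℝ (Fin n) [⋀^Fin k]→L[ℝ] ℝ) →L[ℝ]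
      (EuclideanSpace ℝ (Fin n) [⋀^Fin l]→L[ℝ] ℝ) →L[ℝ] ℝ :=
  LinearMap.mkContinuous₂
    (LinearMap.mk₂ ℝ (formWedge h)
      (fun α α' _ => wedgeEval_add_left h α.toAlternatingMap α'.toAlternatingMap _ _)
      (fun c α _ => wedgeEval_smul_left h c α.toAlternatingMap _ _)
      (fun _ β β' => wedgeEval_add_right h _ β.toAlternatingMap β'.toAlternatingMap _)
      (fun c _ β => wedgeEval_smul_right h c _ β.toAlternatingMap _))
    (((k.factorial : ℝ) * l.factorial)⁻¹ * n.factorial) (norm_formWedge_le h)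

lemma formWedgeL_apply {k l : ℕ} (h : k + l = n) (α : EuclideanSpace ℝ (Fin n) [⋀^Fin k]→L[ℝ] ℝ)
    (β : EuclideanSpace ℝ (Fin n) [⋀^Fin l]→L[ℝ] ℝ) : formWedgeL h α β = formWedge h α β := rfl

end FormWedge

/-! ### Chart balls with controlled geometry; integrability -/

section GoodBalls

set_option linter.unusedSectionVars false

variable {n : ℕ} {M : Type*} [EMetricSpace M] [ChartedSpace (EuclideanSpace ℝ (Fin n)) M]
  [IsManifold (𝓡 n) ∞ M] [RiemannianBundle (fun x : M => TangentSpace (𝓡 n) x)]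

/-- A ball in the chart around `x₀` on which the metric is controlled and on which the
orientation is that of the chart, up to a constant sign. -/
structure GoodBall (o : (x : M) → Orientation ℝ (TangentSpace (𝓡 n) x) (Fin n)) (x₀ : M) where
  /-- the radius -/
  radius : ℝ
  radius_pos : 0 < radius
  /-- the orientation of the chart -/
  sign : ℝ
  sign_mul_sign : sign * sign = 1
  /-- a bound for the distortion -/
  const : ℝ
  const_pos : 0 < const
  mem_target : ∀ y ∈ Metric.ball (extChartAt (𝓡 n) x₀ x₀) radius, y ∈ (extChartAt (𝓡 n) x₀).target
  coordL_le_center : ∀ y ∈ Metric.ball (extChartAt (𝓡 n) x₀ x₀) radius,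
    ∀ v : EuclideanSpace ℝ (Fin n),
      ‖coordL n x₀ ((extChartAt (𝓡 n) x₀).symm y) v‖ ≤ 2 * ‖coordL n x₀ x₀ v‖ ∧
      ‖coordL n x₀ x₀ v‖ ≤ 2 * ‖coordL n x₀ ((extChartAt (𝓡 n) x₀).symm y) v‖
  coordL_le : ∀ y ∈ Metric.ball (extChartAt (𝓡 n) x₀ x₀) radius,
    ∀ v : EuclideanSpace ℝ (Fin n), ‖coordL n x₀ ((extChartAt (𝓡 n) x₀).symm y) v‖ ≤ const * ‖v‖
  volFactor_eq : ∀ y ∈ Metric.ball (extChartAt (𝓡 n) x₀ x₀) radius,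
    volFactor o x₀ ((extChartAt (𝓡 n) x₀).symm y) =
      sign * √(gram n x₀ ((extChartAt (𝓡 n) x₀).symm y)).det
  one_le_density : ∀ y ∈ Metric.ball (extChartAt (𝓡 n) x₀ x₀) radius,
    1 ≤ const * √(gram n x₀ ((extChartAt (𝓡 n) x₀).symm y)).det

variable [IsContMDiffRiemannianBundle (𝓡 n) ∞ (EuclideanSpace ℝ (Fin n))
    (fun x : M => TangentSpace (𝓡 n) x)] [MeasurableSpace M] [BorelSpace M]

lemma nonempty_goodBall {o : (x : M) → Orientation ℝ (TangentSpace (𝓡 n) x) (Fin n)}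
    (ho : IsContinuousOrientation o) (x₀ : M) : Nonempty (GoodBall o x₀) := by
  obtain ⟨r, hr, h⟩ := exists_ball_norm_coordL_le n x₀
  obtain ⟨s, hs, hs'⟩ := exists_sign_volFactor ho x₀
  have h1 : Tendsto (extChartAt (𝓡 n) x₀).symm (𝓝 (extChartAt (𝓡 n) x₀ x₀)) (𝓝 x₀) := by
    have := continuousAt_extChartAt_symm (I := 𝓡 n) x₀
    rwa [ContinuousAt, extChartAt_to_inv] at this
  have h2 : ContinuousAt (fun y => √(gram n x₀ ((extChartAt (𝓡 n) x₀).symm y)).det)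
      (extChartAt (𝓡 n) x₀ x₀) :=
    (continuousOn_sqrt_det_gram_symm x₀).continuousAt (extChartAt_target_mem_nhds x₀)
  have h3 : 0 < √(gram n x₀ ((extChartAt (𝓡 n) x₀).symm (extChartAt (𝓡 n) x₀ x₀))).det := by
    rw [extChartAt_to_inv]
    exact Real.sqrt_pos.2 (det_gram_pos (mem_extChartAt_source x₀))
  set a := √(gram n x₀ ((extChartAt (𝓡 n) x₀).symm (extChartAt (𝓡 n) x₀ x₀))).det with ha
  have h4 : ∀ᶠ y in 𝓝 (extChartAt (𝓡 n) x₀ x₀),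
      a / 2 < √(gram n x₀ ((extChartAt (𝓡 n) x₀).symm y)).det :=
    h2.eventually (lt_mem_nhds (half_lt_self h3))
  obtain ⟨r', hr', h'⟩ := Metric.eventually_nhds_iff_ball.1 ((h1.eventually hs').and h4)
  -- The first entry of the maximum bounds the metric on the ball through its value at the centre.
  -- The second serves the density, which exceeds half of its value `a` at the centre.
  refine ⟨⟨min r r', lt_min hr hr', s, hs, max (2 * ‖coordL n x₀ x₀‖) (2 / a),
    lt_max_of_lt_right (by positivity), fun y hy => (h y ?_).1, fun y hy => (h y ?_).2,
    fun y hy v => ?_, fun y hy => (h' y ?_).1, fun y hy => ?_⟩⟩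
  · exact Metric.ball_subset_ball (min_le_left _ _) hy
  · exact Metric.ball_subset_ball (min_le_left _ _) hy
  · refine ((h y (Metric.ball_subset_ball (min_le_left _ _) hy)).2 v).1.trans ?_
    calc 2 * ‖coordL n x₀ x₀ v‖ ≤ 2 * (‖coordL n x₀ x₀‖ * ‖v‖) :=
          mul_le_mul_of_nonneg_left ((coordL n x₀ x₀).le_opNorm v) zero_le_two
      _ = (2 * ‖coordL n x₀ x₀‖) * ‖v‖ := by ring
      _ ≤ _ := mul_le_mul_of_nonneg_right (le_max_left _ _) (norm_nonneg v)
  · exact Metric.ball_subset_ball (min_le_right _ _) hy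
  · have h5 := (h' y (Metric.ball_subset_ball (min_le_right _ _) hy)).2
    calc (1 : ℝ) = 2 / a * (a / 2) := by field_simp
      _ ≤ _ := mul_le_mul (le_max_right _ _) h5.le (by positivity)
        (le_max_of_le_right (by positivity))

namespace GoodBall

variable {o : (x : M) → Orientation ℝ (TangentSpace (𝓡 n) x) (Fin n)} {x₀ : M}
  (B : GoodBall o x₀)

/-- The image of a good ball in `ℝⁿ`. -/
def ball : Set (EuclideanSpace ℝ (Fin n)) :=
  Metric.ball (extChartAt (𝓡 n) x₀ x₀) B.radius

/-- A good ball as an open subset of `M`. -/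
def dom : Set M := (extChartAt (𝓡 n) x₀).source ∩ extChartAt (𝓡 n) x₀ ⁻¹' B.ball

lemma isOpen_ball : IsOpen B.ball := Metric.isOpen_ball

lemma measurableSet_ball : MeasurableSet B.ball := Metric.isOpen_ball.measurableSet

lemma isOpen_dom : IsOpen B.dom :=
  (continuousOn_extChartAt x₀).isOpen_inter_preimage (isOpen_extChartAt_source x₀) B.isOpen_ball

lemma mem_dom : x₀ ∈ B.dom :=
  ⟨mem_extChartAt_source x₀, Metric.mem_ball_self B.radius_pos⟩

lemma ball_subset_target : B.ball ⊆ (extChartAt (𝓡 n) x₀).target := B.mem_target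

lemma symm_mem_dom {y : EuclideanSpace ℝ (Fin n)} (hy : y ∈ B.ball) :
    (extChartAt (𝓡 n) x₀).symm y ∈ B.dom :=
  ⟨(extChartAt (𝓡 n) x₀).map_target (B.mem_target y hy), by
    rw [mem_preimage, (extChartAt (𝓡 n) x₀).right_inv (B.mem_target y hy)]
    exact hy⟩

lemma symm_mem_dom_iff {y : EuclideanSpace ℝ (Fin n)} (hy : y ∈ (extChartAt (𝓡 n) x₀).target) :
    (extChartAt (𝓡 n) x₀).symm y ∈ B.dom ↔ y ∈ B.ball := by
  refine ⟨fun h => ?_, B.symm_mem_dom⟩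
  have := h.2
  rwa [mem_preimage, (extChartAt (𝓡 n) x₀).right_inv hy] at this

lemma formWedge_chartRep {k l : ℕ} (h : k + l = n) (θ : DiffForm n M k) (ψ : DiffForm n M l)
    {y : EuclideanSpace ℝ (Fin n)} (hy : y ∈ B.ball) :
    formWedge h (chartRep x₀ θ y) (chartRep x₀ ψ y) =
      B.sign * (√(gram n x₀ ((extChartAt (𝓡 n) x₀).symm y)).det *
        pairing o h θ ψ ((extChartAt (𝓡 n) x₀).symm y)) := by
  rw [chartRep, chartRep, ← pairing_mul_volFactor o, B.volFactor_eq y hy]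
  ring

/-- The density of the Riemannian volume in a good ball. -/
def ballMeasure : Measure (EuclideanSpace ℝ (Fin n)) :=
  (volume.restrict B.ball).withDensity fun y =>
    ENNReal.ofReal √(gram n x₀ ((extChartAt (𝓡 n) x₀).symm y)).det

lemma aemeasurable_density : AEMeasurable (fun y =>
    ENNReal.ofReal √(gram n x₀ ((extChartAt (𝓡 n) x₀).symm y)).det) (volume.restrict B.ball) :=
  (aemeasurable_chart_density x₀).mono_measure
    (Measure.restrict_mono B.ball_subset_target le_rfl)

lemma aemeasurable_symm : AEMeasurable (extChartAt (𝓡 n) x₀).symm (volume.restrict B.ball) :=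
  (aemeasurable_chart_symm x₀).mono_measure (Measure.restrict_mono B.ball_subset_target le_rfl)

lemma aemeasurable_symm' : AEMeasurable (extChartAt (𝓡 n) x₀).symm B.ballMeasure :=
  B.aemeasurable_symm.mono_ac (withDensity_absolutelyContinuous _ _)

/-- The density is bounded below on a good ball. Hence `L^p` bounds for the Riemannian volume pass
to Lebesgue measure in the chart, where mollification takes place. -/
lemma volume_le_ballMeasure :
    volume.restrict B.ball ≤ ENNReal.ofReal B.const • B.ballMeasure := by
  rw [ballMeasure, ← withDensity_smul' _ _ ENNReal.ofReal_ne_top]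
  conv_lhs => rw [← withDensity_one (μ := volume.restrict B.ball)]
  refine withDensity_mono ?_
  filter_upwards [ae_restrict_mem B.measurableSet_ball] with y hy
  rw [Pi.one_apply, Pi.smul_apply, smul_eq_mul, ← ENNReal.ofReal_mul B.const_pos.le,
    ENNReal.one_le_ofReal]
  exact B.one_le_density y hy

lemma volume_absolutelyContinuous : volume.restrict B.ball ≪ B.ballMeasure :=
  (Measure.absolutelyContinuous_of_le_smul B.volume_le_ballMeasure)

variable [SecondCountableTopology M]

lemma restrict_dom : (riemannianVolume n M).restrict B.dom =
    B.ballMeasure.map (extChartAt (𝓡 n) x₀).symm := by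
  have h1 : (riemannianVolume n M).restrict B.dom = (chartVolume n x₀).restrict B.dom := by
    rw [← riemannianVolume_restrict_source, Measure.restrict_restrict B.isOpen_dom.measurableSet,
      inter_eq_left.2 (show B.dom ⊆ _ from inter_subset_left)]
  rw [h1, chartVolume, Measure.restrict_map_of_aemeasurable
    ((aemeasurable_chart_symm x₀).mono_ac (withDensity_absolutelyContinuous _ _))
    B.isOpen_dom.measurableSet]
  congr 1
  have h2 : ((extChartAt (𝓡 n) x₀).symm ⁻¹' B.dom : Set (EuclideanSpace ℝ (Fin n)))
      =ᵐ[(volume.restrict (extChartAt (𝓡 n) x₀).target).withDensity fun y =>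
        ENNReal.ofReal √(gram n x₀ ((extChartAt (𝓡 n) x₀).symm y)).det] B.ball := by
    refine (withDensity_absolutelyContinuous _ _).ae_le ?_
    filter_upwards [ae_restrict_mem (measurableSet_target x₀)] with y hy
    exact propext (B.symm_mem_dom_iff hy)
  rw [Measure.restrict_congr_set h2, restrict_withDensity B.measurableSet_ball,
    Measure.restrict_restrict B.measurableSet_ball, inter_eq_left.2 B.ball_subset_target]
  rfl

lemma aestronglyMeasurable_comp_symm {E : Type*} [TopologicalSpace E] {F : M → E}
    (hF : AEStronglyMeasurable F ((riemannianVolume n M).restrict B.dom)) :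
    AEStronglyMeasurable (fun y => F ((extChartAt (𝓡 n) x₀).symm y)) (volume.restrict B.ball) := by
  rw [restrict_dom] at hF
  exact (hF.comp_aemeasurable B.aemeasurable_symm').mono_ac B.volume_absolutelyContinuous

lemma memLp_comp_symm {E : Type*} [NormedAddCommGroup E] {F : M → E} {p : ℝ≥0∞}
    (hF : MemLp F p ((riemannianVolume n M).restrict B.dom)) :
    MemLp (fun y => F ((extChartAt (𝓡 n) x₀).symm y)) p (volume.restrict B.ball) := by
  have h1 := hF.1
  rw [restrict_dom] at hF h1
  rw [memLp_map_measure_iff h1 B.aemeasurable_symm'] at hF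
  exact hF.of_measure_le_smul ENNReal.ofReal_ne_top B.volume_le_ballMeasure

lemma setIntegral_dom {F : M → ℝ}
    (hF : AEStronglyMeasurable F ((riemannianVolume n M).restrict B.dom)) :
    ∫ x in B.dom, F x ∂(riemannianVolume n M) =
      ∫ y in B.ball, √(gram n x₀ ((extChartAt (𝓡 n) x₀).symm y)).det *
        F ((extChartAt (𝓡 n) x₀).symm y) := by
  rw [restrict_dom] at hF ⊢
  rw [integral_map B.aemeasurable_symm' hF, ballMeasure,
    integral_withDensity_eq_integral_toReal_smul₀ B.aemeasurable_density
      (Eventually.of_forall fun _ => ENNReal.ofReal_lt_top)]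
  refine integral_congr_ae (Eventually.of_forall fun y => ?_)
  simp only [smul_eq_mul]
  rw [ENNReal.toReal_ofReal (Real.sqrt_nonneg _)]

/-- The integral of an exterior product over a good ball. -/
lemma setIntegral_pairing {k l : ℕ} (h : k + l = n) {θ : DiffForm n M k} {ψ : DiffForm n M l}
    (hθψ : AEStronglyMeasurable (pairing o h θ ψ) ((riemannianVolume n M).restrict B.dom)) :
    ∫ x in B.dom, pairing o h θ ψ x ∂(riemannianVolume n M) =
      B.sign * ∫ y in B.ball, formWedge h (chartRep x₀ θ y) (chartRep x₀ ψ y) := by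
  rw [B.setIntegral_dom hθψ, ← integral_const_mul]
  refine setIntegral_congr_fun B.measurableSet_ball fun y hy => ?_
  rw [B.formWedge_chartRep h θ ψ hy, ← mul_assoc, B.sign_mul_sign, one_mul]

lemma aestronglyMeasurable_localRep {k : ℕ} {θ : DiffForm n M k} (hθ : IsMeasurableForm θ) :
    AEStronglyMeasurable (localRep x₀ θ) ((riemannianVolume n M).restrict B.dom) := by
  refine (hθ x₀).mono_measure (Measure.restrict_mono ?_ le_rfl)
  rw [← extChartAt_source (𝓡 n)]
  exact inter_subset_left

/-- The pairing is defined through unrelated orthonormal bases of the tangent spaces, so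
measurability is not visible from its definition. In the chart it is the wedge of the components
divided by `± √(det g)`, with a constant sign on the ball. -/
lemma aestronglyMeasurable_pairing_dom {k l : ℕ} (h : k + l = n) {θ : DiffForm n M k}
    {ψ : DiffForm n M l} (hθ : IsMeasurableForm θ) (hψ : IsMeasurableForm ψ) :
    AEStronglyMeasurable (pairing o h θ ψ) ((riemannianVolume n M).restrict B.dom) := by
  have h1 := (formWedgeL h).aestronglyMeasurable_comp₂ (B.aestronglyMeasurable_localRep hθ)
    (B.aestronglyMeasurable_localRep hψ)
  have h2 : AEStronglyMeasurable (fun x => √(gram n x₀ x).det)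
      ((riemannianVolume n M).restrict B.dom) :=
    ((continuousOn_sqrt_det_gram x₀).mono inter_subset_left).aestronglyMeasurable
      B.isOpen_dom.measurableSet
  refine ((h1.mul (h2.aemeasurable.inv.aestronglyMeasurable)).const_mul B.sign).congr ?_
  filter_upwards [ae_restrict_mem B.isOpen_dom.measurableSet] with x hx
  have h3 : volFactor o x₀ x = B.sign * √(gram n x₀ x).det := by
    have := B.volFactor_eq _ hx.2
    rwa [(extChartAt (𝓡 n) x₀).left_inv hx.1] at this
  have h4 : √(gram n x₀ x).det ≠ 0 := (Real.sqrt_pos.2 (det_gram_pos hx.1)).ne'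
  simp only [Pi.mul_apply, Pi.inv_apply, formWedgeL_apply]
  rw [← pairing_mul_volFactor o, h3]
  have := B.sign_mul_sign
  field_simp
  linear_combination (pairing o h θ ψ x) * this

lemma aestronglyMeasurable_chartRep {k : ℕ} {θ : DiffForm n M k} (hθ : IsMeasurableForm θ) :
    AEStronglyMeasurable (chartRep x₀ θ) (volume.restrict B.ball) :=
  B.aestronglyMeasurable_comp_symm (B.aestronglyMeasurable_localRep hθ)

lemma memLp_chartRep {k : ℕ} {θ : DiffForm n M k} {p : ℝ≥0∞} (hθ : θ ∈ lpForms n M k p) :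
    MemLp (chartRep x₀ θ) p (volume.restrict B.ball) := by
  have h1 : MemLp (fun x => formNorm n (θ x)) p ((riemannianVolume n M).restrict B.dom) :=
    MemLp.restrict _ ⟨(aemeasurable_formNorm hθ.1).aestronglyMeasurable, hθ.2⟩
  refine (B.memLp_comp_symm h1).of_le_mul (c := formConst n k * B.const ^ k)
    (B.aestronglyMeasurable_chartRep hθ.1) ?_
  filter_upwards [ae_restrict_mem B.measurableSet_ball] with y hy
  rw [Real.norm_of_nonneg (formNorm_nonneg _)]
  exact norm_compContinuousLinearMap_le (n := n) _ B.const_pos.le (B.coordL_le y hy) _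

end GoodBall

variable [SecondCountableTopology M]
variable {o : (x : M) → Orientation ℝ (TangentSpace (𝓡 n) x) (Fin n)}

lemma exists_seq_goodBall [Nonempty M] (ho : IsContinuousOrientation o) :
    ∃ (c : ℕ → M) (B : ∀ i, GoodBall o (c i)), ⋃ i, (B i).dom = univ := by
  obtain ⟨t, ht, hU⟩ := TopologicalSpace.countable_cover_nhds
    (fun x : M => ((nonempty_goodBall ho x).some.isOpen_dom.mem_nhds
      (nonempty_goodBall ho x).some.mem_dom))
  have hne : t.Nonempty := by
    by_contra h
    rw [not_nonempty_iff_eq_empty] at h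
    subst h
    rw [biUnion_empty] at hU
    exact empty_ne_univ hU
  obtain ⟨c, rfl⟩ := ht.exists_eq_range hne
  exact ⟨c, fun i => (nonempty_goodBall ho (c i)).some, by rw [← hU, biUnion_range]⟩

lemma aestronglyMeasurable_of_goodBall (ho : IsContinuousOrientation o) {E : Type*}
    [TopologicalSpace E] [TopologicalSpace.PseudoMetrizableSpace E] {F : M → E}
    (h : ∀ (x₀ : M) (B : GoodBall o x₀),
      AEStronglyMeasurable F ((riemannianVolume n M).restrict B.dom)) :
    AEStronglyMeasurable F (riemannianVolume n M) := by
  rcases isEmpty_or_nonempty M with hM | hM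
  · have : riemannianVolume n M = 0 := Measure.eq_zero_of_isEmpty _
    rw [this]
    exact aestronglyMeasurable_zero_measure F
  · obtain ⟨c, B, hB⟩ := exists_seq_goodBall ho
    rw [← Measure.restrict_univ (μ := riemannianVolume n M), ← hB, aestronglyMeasurable_iUnion_iff]
    exact fun i => h _ (B i)

lemma aestronglyMeasurable_pairing (ho : IsContinuousOrientation o) {k l : ℕ} (h : k + l = n)
    {θ : DiffForm n M k} {ψ : DiffForm n M l} (hθ : IsMeasurableForm θ) (hψ : IsMeasurableForm ψ) :
    AEStronglyMeasurable (pairing o h θ ψ) (riemannianVolume n M) :=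
  aestronglyMeasurable_of_goodBall ho fun _ B => B.aestronglyMeasurable_pairing_dom h hθ hψ

lemma memLp_formNorm {k : ℕ} {p : ℝ≥0∞} {θ : DiffForm n M k} (hθ : θ ∈ lpForms n M k p) :
    MemLp (fun x => formNorm n (θ x)) p (riemannianVolume n M) :=
  ⟨(aemeasurable_formNorm hθ.1).aestronglyMeasurable, hθ.2⟩

/-- Hölder's inequality. -/
lemma integrable_formNorm_mul {k l : ℕ} {p q : ℝ} (hpq : p.HolderConjugate q)
    {θ : DiffForm n M k} {ψ : DiffForm n M l} (hθ : θ ∈ lpForms n M k (ENNReal.ofReal p))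
    (hψ : ψ ∈ lpForms n M l (ENNReal.ofReal q)) :
    Integrable (fun x => formNorm n (θ x) * formNorm n (ψ x)) (riemannianVolume n M) := by
  have : (ENNReal.ofReal p).HolderConjugate (ENNReal.ofReal q) := hpq.ennrealOfReal
  exact (memLp_formNorm hθ).integrable_mul (memLp_formNorm hψ)

lemma integrable_pairing (ho : IsContinuousOrientation o) {k l : ℕ} (h : k + l = n) {p q : ℝ}
    (hpq : p.HolderConjugate q)
    {θ : DiffForm n M k} {ψ : DiffForm n M l} (hθ : θ ∈ lpForms n M k (ENNReal.ofReal p))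
    (hψ : ψ ∈ lpForms n M l (ENNReal.ofReal q)) :
    Integrable (pairing o h θ ψ) (riemannianVolume n M) :=
  ((integrable_formNorm_mul hpq hθ hψ).const_mul (wedgeConst n k l)).mono'
    (aestronglyMeasurable_pairing ho h hθ.1 hψ.1)
    (Eventually.of_forall fun x => abs_pairing_le o h θ ψ x)

end GoodBalls

/-! ### Smooth forms on Euclidean space and Stokes' formula -/

section EuclideanForms

variable {n : ℕ}

/-- An alternating map on `ℝⁿ` is continuous. -/
def toContinuousForm {l : ℕ} (β : EuclideanSpace ℝ (Fin n) [⋀^Fin l]→ₗ[ℝ] ℝ) :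
    EuclideanSpace ℝ (Fin n) [⋀^Fin l]→L[ℝ] ℝ :=
  { β with
    cont := by
      have h : ∀ v : Fin l → EuclideanSpace ℝ (Fin n), β v =
          ∑ I : Fin l → Fin n, (∏ i, v i (I i)) * β fun i => EuclideanSpace.single (I i) 1 := by
        intro v
        have h1 : v = fun m => ∑ j : Fin n, (v m j) • EuclideanSpace.single j (1 : ℝ) := by
          funext m
          refine ((EuclideanSpace.basisFun (Fin n) ℝ).sum_repr (v m)).symm.trans
            (Finset.sum_congr rfl fun j _ => ?_)
          rw [EuclideanSpace.basisFun_apply, EuclideanSpace.basisFun_repr]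
        conv_lhs => rw [h1]
        refine (β.toMultilinearMap.map_sum
          (fun m (j : Fin n) => v m j • EuclideanSpace.single j (1 : ℝ))).trans
            (Finset.sum_congr rfl fun I _ => ?_)
        exact β.toMultilinearMap.map_smul_univ (fun m => v m (I m))
          (fun m => EuclideanSpace.single (I m) 1)
      change Continuous fun v : Fin l → EuclideanSpace ℝ (Fin n) => β v
      rw [funext h]
      fun_prop }

lemma eq_zero_of_formWedge_eq_zero {k l : ℕ} (h : k + l = n)
    {α : EuclideanSpace ℝ (Fin n) [⋀^Fin k]→L[ℝ] ℝ}
    (hα : ∀ β : EuclideanSpace ℝ (Fin n) [⋀^Fin l]→L[ℝ] ℝ, formWedge h α β = 0) : α = 0 := by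
  have h1 := eq_zero_of_wedgeEval_eq_zero (EuclideanSpace.basisFun (Fin n) ℝ).toBasis h
    α.toAlternatingMap fun β => ?_
  · ext v
    exact congrArg (fun γ => γ v) h1
  · have := hα (toContinuousForm β)
    rw [formWedge] at this
    rw [← this]
    congr 1
    funext i
    rw [OrthonormalBasis.coe_toBasis, EuclideanSpace.basisFun_apply]

lemma formWedge_covWedge {k l : ℕ} (h : k + 1 + l = n) (h' : k + (l + 1) = n)
    (lam : EuclideanSpace ℝ (Fin n) →L[ℝ] ℝ) (α : EuclideanSpace ℝ (Fin n) [⋀^Fin k]→L[ℝ] ℝ)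
    (β : EuclideanSpace ℝ (Fin n) [⋀^Fin l]→L[ℝ] ℝ) :
    formWedge h' α (covWedge lam β) = (-1) ^ k * formWedge h (covWedge lam α) β := by
  have := wedgeEval_smulRight_alternatizeUncurryFin h h' lam.toLinearMap α.toAlternatingMap
    β.toAlternatingMap (fun i => EuclideanSpace.single i 1)
  rw [formWedge, formWedge, covWedge, covWedge,
    ContinuousAlternatingMap.toAlternatingMap_alternatizeUncurryFin,
    ContinuousAlternatingMap.toAlternatingMap_alternatizeUncurryFin]
  exact this

lemma extDeriv_smul_fun {l : ℕ} {g : EuclideanSpace ℝ (Fin n) → ℝ}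
    {b : EuclideanSpace ℝ (Fin n) → EuclideanSpace ℝ (Fin n) [⋀^Fin l]→L[ℝ] ℝ}
    {y : EuclideanSpace ℝ (Fin n)} (hg : DifferentiableAt ℝ g y) (hb : DifferentiableAt ℝ b y) :
    extDeriv (fun y => g y • b y) y = covWedge (fderiv ℝ g y) (b y) + g y • extDeriv b y := by
  have h1 := congrArg ContinuousAlternatingMap.alternatizeUncurryFin (fderiv_fun_smul hg hb)
  rw [add_comm (g y • _)] at h1
  refine h1.trans ?_
  exact (map_add (ContinuousAlternatingMap.alternatizeUncurryFinCLM ℝ _ ℝ) _ _).trans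
    (congrArg₂ _ rfl (map_smul (ContinuousAlternatingMap.alternatizeUncurryFinCLM ℝ _ ℝ) _ _))

/-- Stokes' theorem for smooth forms on `ℝⁿ`, one of which has compact support. -/
lemma integral_formWedge_extDeriv {k l : ℕ} (h : k + 1 + l = n) (h' : k + (l + 1) = n)
    {a : EuclideanSpace ℝ (Fin n) → EuclideanSpace ℝ (Fin n) [⋀^Fin k]→L[ℝ] ℝ}
    {b : EuclideanSpace ℝ (Fin n) → EuclideanSpace ℝ (Fin n) [⋀^Fin l]→L[ℝ] ℝ}
    (ha : ContDiff ℝ 1 a) (hb : ContDiff ℝ 1 b) (hbc : HasCompactSupport b) :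
    ∫ y, formWedge h' (a y) (extDeriv b y) =
      (-1) ^ (k + 1) * ∫ y, formWedge h (extDeriv a y) (b y) := by
  set e : Fin n → EuclideanSpace ℝ (Fin n) := fun i => EuclideanSpace.single i 1
  -- Both sides are sums over permutations `σ` of a component of `a` times a component of `b`, one
  -- of them differentiated along `d σ`. The components are the same on both sides, so scalar
  -- integration by parts applies to each `σ`. It contributes one sign, and placing the derivative
  -- in front contributes `(-1)^k`.
  let A : Equiv.Perm (Fin n) → EuclideanSpace ℝ (Fin n) → ℝ :=
    fun σ y => a y fun i : Fin k => e (σ ⟨i + 1, by omega⟩)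
  let B : Equiv.Perm (Fin n) → EuclideanSpace ℝ (Fin n) → ℝ :=
    fun σ y => b y fun i : Fin l => e (σ ⟨k + 1 + i, by omega⟩)
  let d : Equiv.Perm (Fin n) → EuclideanSpace ℝ (Fin n) := fun σ => e (σ ⟨0, by omega⟩)
  have hA : ∀ σ, ContDiff ℝ 1 (A σ) := fun σ =>
    (ContinuousAlternatingMap.apply ℝ (EuclideanSpace ℝ (Fin n)) ℝ
      (fun i : Fin k => e (σ ⟨i + 1, by omega⟩))).contDiff.comp ha
  have hB : ∀ σ, ContDiff ℝ 1 (B σ) := fun σ =>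
    (ContinuousAlternatingMap.apply ℝ (EuclideanSpace ℝ (Fin n)) ℝ
      (fun i : Fin l => e (σ ⟨k + 1 + i, by omega⟩))).contDiff.comp hb
  have hBc : ∀ σ, HasCompactSupport (B σ) := fun σ =>
    hbc.comp_left (g := fun β : EuclideanSpace ℝ (Fin n) [⋀^Fin l]→L[ℝ] ℝ =>
      β fun i : Fin l => e (σ ⟨k + 1 + i, by omega⟩)) rfl
  have hA' : ∀ σ y v, fderiv ℝ (A σ) y v = (fderiv ℝ a y v) fun i : Fin k => e (σ ⟨i + 1, by omega⟩) := by
    intro σ y v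
    have := ((ContinuousAlternatingMap.apply ℝ (EuclideanSpace ℝ (Fin n)) ℝ
      (fun i : Fin k => e (σ ⟨i + 1, by omega⟩)) : _ →L[ℝ] ℝ).hasFDerivAt.comp y
      (ha.differentiable one_ne_zero y).hasFDerivAt).fderiv
    exact congrArg (fun L => L v) this
  have hB' : ∀ σ y v, fderiv ℝ (B σ) y v =
      (fderiv ℝ b y v) fun i : Fin l => e (σ ⟨k + 1 + i, by omega⟩) := by
    intro σ y v
    have := ((ContinuousAlternatingMap.apply ℝ (EuclideanSpace ℝ (Fin n)) ℝ
      (fun i : Fin l => e (σ ⟨k + 1 + i, by omega⟩)) : _ →L[ℝ] ℝ).hasFDerivAt.comp y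
      (hb.differentiable one_ne_zero y).hasFDerivAt).fderiv
    exact congrArg (fun L => L v) this
  have h1 : ∀ y, formWedge h (extDeriv a y) (b y) = ((k.factorial : ℝ) * l.factorial)⁻¹ *
      ∑ σ : Equiv.Perm (Fin n), ((Equiv.Perm.sign σ : ℤ) : ℝ) * (fderiv ℝ (A σ) y (d σ) * B σ y) := by
    intro y
    simp only [hA']
    rw [formWedge, extDeriv, ContinuousAlternatingMap.toAlternatingMap_alternatizeUncurryFin,
      wedgeEval_alternatizeUncurryFin_left]
    rfl
  have h2 : ∀ y, formWedge h' (a y) (extDeriv b y) = (-1) ^ k * (((k.factorial : ℝ) * l.factorial)⁻¹ *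
      ∑ σ : Equiv.Perm (Fin n), ((Equiv.Perm.sign σ : ℤ) : ℝ) * (A σ y * fderiv ℝ (B σ) y (d σ))) := by
    intro y
    simp only [hB']
    rw [formWedge, extDeriv, ContinuousAlternatingMap.toAlternatingMap_alternatizeUncurryFin,
      wedgeEval_alternatizeUncurryFin_right]
    rfl
  have hc1 : ∀ σ, Continuous fun y => fderiv ℝ (A σ) y (d σ) := fun σ =>
    ((hA σ).continuous_fderiv one_ne_zero).clm_apply continuous_const
  have hc2 : ∀ σ, Continuous fun y => fderiv ℝ (B σ) y (d σ) := fun σ =>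
    ((hB σ).continuous_fderiv one_ne_zero).clm_apply continuous_const
  have hi1 : ∀ σ, Integrable (fun y => fderiv ℝ (A σ) y (d σ) * B σ y) := fun σ =>
    ((hc1 σ).mul (hB σ).continuous).integrable_of_hasCompactSupport ((hBc σ).mul_left)
  have hi2 : ∀ σ, Integrable (fun y => A σ y * fderiv ℝ (B σ) y (d σ)) := fun σ =>
    ((hA σ).continuous.mul (hc2 σ)).integrable_of_hasCompactSupport
      (((hBc σ).fderiv_apply ℝ (d σ)).mul_left)
  have hi3 : ∀ σ, Integrable (fun y => A σ y * B σ y) := fun σ =>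
    ((hA σ).continuous.mul (hB σ).continuous).integrable_of_hasCompactSupport ((hBc σ).mul_left)
  simp only [h1, h2]
  rw [integral_const_mul, integral_const_mul, integral_const_mul,
    integral_finsetSum _ fun σ _ => (hi1 σ).const_mul _,
    integral_finsetSum _ fun σ _ => (hi2 σ).const_mul _, pow_succ, mul_assoc, mul_left_comm (-1 : ℝ)]
  congr 2
  rw [Finset.mul_sum]
  refine Finset.sum_congr rfl fun σ _ => ?_
  rw [integral_const_mul, integral_const_mul,
    integral_mul_fderiv_eq_neg_fderiv_mul_of_integrable (hi1 σ) (hi2 σ) (hi3 σ)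
      (fun x _ => (hA σ).differentiable one_ne_zero x) (fun x _ => (hB σ).differentiable one_ne_zero x)]
  ring

end EuclideanForms

/-! ### Mollification in Lebesgue spaces -/

section Mollification

variable {E : Type*} [NormedAddCommGroup E] [NormedSpace ℝ E] [FiniteDimensional ℝ E]
  [MeasurableSpace E] [BorelSpace E] {G : Type*} [NormedAddCommGroup G] [NormedSpace ℝ G]
  {μ : Measure E} [μ.IsAddHaarMeasure]

/-- Averaging does not increase `L^q` norms. -/
lemma eLpNorm_convolution_le (ρ : ContDiffBump (0 : E)) {u : E → G}
    (hu : AEStronglyMeasurable u μ) {q : ℝ≥0∞} (hq : 1 ≤ q) (hq' : q ≠ ⊤) :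
    eLpNorm (convolution (ρ.normed μ) u (ContinuousLinearMap.lsmul ℝ ℝ) μ) q μ ≤ eLpNorm u q μ := by
  -- A strongly measurable representative makes all translates, and the function of two variables in
  -- the double integral, measurable.
  wlog hu' : StronglyMeasurable u generalizing u
  · rw [convolution_congr _ (ae_eq_refl _) hu.ae_eq_mk, eLpNorm_congr_ae hu.ae_eq_mk]
    exact this hu.stronglyMeasurable_mk.aestronglyMeasurable hu.stronglyMeasurable_mk
  have hq0 : q ≠ 0 := (zero_lt_one.trans_le hq).ne'
  have hqr : 0 < q.toReal := ENNReal.toReal_pos hq0 hq'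
  -- The mollifier is the density of a probability measure, for which the `L^1` norm is at most the
  -- `L^q` norm. Tonelli's theorem and translation invariance then give the estimate.
  set ν : Measure E := μ.withDensity fun t => ENNReal.ofReal (ρ.normed μ t) with hν
  have hρm : Measurable fun t => ENNReal.ofReal (ρ.normed μ t) :=
    ENNReal.measurable_ofReal.comp ρ.continuous_normed.measurable
  have hν1 : IsProbabilityMeasure ν := by
    refine ⟨?_⟩
    rw [hν, withDensity_apply _ MeasurableSet.univ, Measure.restrict_univ,
      ← ofReal_integral_eq_lintegral_ofReal ρ.integrable_normed
      (Eventually.of_forall ρ.nonneg_normed), ρ.integral_normed, ENNReal.ofReal_one]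
  have hsub : ∀ x, StronglyMeasurable fun t => u (x - t) := fun x =>
    hu'.comp_measurable (measurable_const.sub measurable_id)
  have key : ∀ x, ‖convolution (ρ.normed μ) u (ContinuousLinearMap.lsmul ℝ ℝ) μ x‖ₑ ^ q.toReal ≤
      ∫⁻ t, ‖u (x - t)‖ₑ ^ q.toReal ∂ν := by
    intro x
    have h1 : ‖convolution (ρ.normed μ) u (ContinuousLinearMap.lsmul ℝ ℝ) μ x‖ₑ ≤
        eLpNorm (fun t => u (x - t)) 1 ν := by
      rw [eLpNorm_one_eq_lintegral_enorm, hν, lintegral_withDensity_eq_lintegral_mul _ hρm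
        (hsub x).enorm, convolution_def]
      refine (enorm_integral_le_lintegral_enorm _).trans (lintegral_mono fun t => ?_)
      rw [ContinuousLinearMap.lsmul_apply, enorm_smul, Pi.mul_apply, ← ofReal_norm (ρ.normed μ t),
        Real.norm_of_nonneg (ρ.nonneg_normed t)]
    have h2 := h1.trans (eLpNorm_le_eLpNorm_of_exponent_le hq (hsub x).aestronglyMeasurable)
    rw [eLpNorm_eq_lintegral_rpow_enorm_toReal hq0 hq'] at h2
    refine (ENNReal.rpow_le_rpow h2 hqr.le).trans (le_of_eq ?_)
    rw [← ENNReal.rpow_mul, one_div, inv_mul_cancel₀ hqr.ne', ENNReal.rpow_one]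
  rw [eLpNorm_eq_lintegral_rpow_enorm_toReal hq0 hq', eLpNorm_eq_lintegral_rpow_enorm_toReal hq0 hq']
  refine ENNReal.rpow_le_rpow ((lintegral_mono key).trans (le_of_eq ?_)) (by positivity)
  rw [lintegral_lintegral_swap]
  · simp only [lintegral_sub_right_eq_self (fun x => ‖u x‖ₑ ^ q.toReal)]
    rw [lintegral_const, measure_univ, mul_one]
  · have : Measurable fun z : E × E => ‖u (z.1 - z.2)‖ₑ ^ q.toReal :=
      ((hu'.comp_measurable (measurable_fst.sub measurable_snd)).enorm).pow_const _
    exact this.aemeasurable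

/-- Mollifications converge in `L^q`. -/
lemma exists_eLpNorm_convolution_sub_le [CompleteSpace G] {u : E → G} {q : ℝ≥0∞} (hq : 1 ≤ q) (hq' : q ≠ ⊤)
    (hu : MemLp u q μ) {ε : ℝ≥0∞} (hε : ε ≠ 0) :
    ∃ δ > 0, ∀ ρ : ContDiffBump (0 : E), ρ.rOut < δ →
      eLpNorm (convolution (ρ.normed μ) u (ContinuousLinearMap.lsmul ℝ ℝ) μ - u) q μ ≤ ε := by
  have : ProperSpace E := FiniteDimensional.proper ℝ E
  have hε3 : ε / 3 ≠ 0 := ENNReal.div_ne_zero.2 ⟨hε, by norm_num⟩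
  -- There are three errors of size `ε / 3`: the mollification of `u - g`, the difference `u - g`
  -- itself, and the mollification error of the continuous compactly supported `g`, which is
  -- uniformly small and lives on a compact set.
  obtain ⟨g, hgc, hug, hg, hgq⟩ := hu.exists_hasCompactSupport_eLpNorm_sub_le hq' hε3
  set K := Metric.cthickening 1 (tsupport g)
  have hK : IsCompact K := hgc.isCompact.cthickening
  have hKm : μ K ^ (1 / q.toReal) ≠ ⊤ :=
    ENNReal.rpow_ne_top_of_nonneg (by positivity) hK.measure_lt_top.ne
  obtain ⟨η, hη, hη'⟩ : ∃ η : ℝ, 0 < η ∧ ENNReal.ofReal η * μ K ^ (1 / q.toReal) ≤ ε / 3 := by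
    have h1 : Tendsto (fun η : ℝ => ENNReal.ofReal η * μ K ^ (1 / q.toReal)) (𝓝[>] 0) (𝓝 0) := by
      have h2 : Tendsto (fun η : ℝ => ENNReal.ofReal η) (𝓝[>] 0) (𝓝 0) := by
        have := (ENNReal.continuous_ofReal.tendsto 0).mono_left (nhdsWithin_le_nhds (s := Ioi 0))
        rwa [ENNReal.ofReal_zero] at this
      have := ENNReal.Tendsto.mul_const h2 (Or.inr hKm)
      rwa [zero_mul] at this
    obtain ⟨η, h3, h4⟩ := ((h1.eventually (gt_mem_nhds (pos_iff_ne_zero.2 hε3))).and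
      self_mem_nhdsWithin).exists
    exact ⟨η, h4, h3.le⟩
  have hunif := hgc.uniformContinuous_of_continuous hg
  obtain ⟨δ, hδ, hδ'⟩ := Metric.uniformContinuous_iff.1 hunif η hη
  -- The bound `1` on the radius keeps the mollification of `g` supported in the fixed compact set
  -- `K`.
  refine ⟨min δ 1, lt_min hδ one_pos, fun ρ hρ => ?_⟩
  have hρc : HasCompactSupport (ρ.normed μ) := ρ.hasCompactSupport_normed
  have hcu := hρc.convolutionExists_left (ContinuousLinearMap.lsmul ℝ ℝ : ℝ →L[ℝ] G →L[ℝ] G)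
    ρ.continuous_normed (hu.locallyIntegrable hq)
  have hcg := hρc.convolutionExists_left (ContinuousLinearMap.lsmul ℝ ℝ : ℝ →L[ℝ] G →L[ℝ] G)
    ρ.continuous_normed (hgq.locallyIntegrable hq)
  have hcug := hρc.convolutionExists_left (ContinuousLinearMap.lsmul ℝ ℝ : ℝ →L[ℝ] G →L[ℝ] G)
    ρ.continuous_normed ((hu.sub hgq).locallyIntegrable hq)
  have hcont : ∀ {v : E → G}, MemLp v q μ →
      Continuous (convolution (ρ.normed μ) v (ContinuousLinearMap.lsmul ℝ ℝ) μ) := fun hv =>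
    hρc.continuous_convolution_left _ ρ.continuous_normed (hv.locallyIntegrable hq)
  have hsplit : convolution (ρ.normed μ) u (ContinuousLinearMap.lsmul ℝ ℝ) μ - u =
      convolution (ρ.normed μ) (u - g) (ContinuousLinearMap.lsmul ℝ ℝ) μ +
      (convolution (ρ.normed μ) g (ContinuousLinearMap.lsmul ℝ ℝ) μ - g) - (u - g) := by
    funext x
    have := (hcug x).distrib_add (hcg x)
    rw [sub_add_cancel] at this
    simp only [Pi.sub_apply, Pi.add_apply, this]
    abel
  have h1 := eLpNorm_convolution_le ρ (hu.sub hgq).1 hq hq'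
  have h2 : eLpNorm (convolution (ρ.normed μ) g (ContinuousLinearMap.lsmul ℝ ℝ) μ - g) q μ ≤ ε / 3 := by
    refine (eLpNorm_sub_le_of_dist_bdd μ hq' hK.measurableSet hη.le (fun x => ?_) ?_ ?_).trans hη'
    · refine ContDiffBump.dist_normed_convolution_le hg.aestronglyMeasurable fun y hy => ?_
      exact (hδ' ((Metric.mem_ball.1 hy).trans (hρ.trans_le (min_le_left _ _)))).le
    · refine (support_convolution_subset_swap _).trans ?_
      rintro _ ⟨y, hy, z, hz, rfl⟩
      refine Metric.mem_cthickening_of_dist_le _ y _ _ (subset_tsupport g hy) ?_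
      rw [ρ.support_normed_eq, mem_ball_zero_iff] at hz
      rw [dist_eq_norm, add_sub_cancel_left]
      exact (hz.trans (hρ.trans_le (min_le_right _ _))).le
    · exact (subset_tsupport g).trans (Metric.self_subset_cthickening _)
  rw [hsplit]
  have hm1 := (hcont (hu.sub hgq)).aestronglyMeasurable (μ := μ)
  have hm2 := ((hcont hgq).sub hg).aestronglyMeasurable (μ := μ)
  calc _ ≤ eLpNorm (convolution (ρ.normed μ) (u - g) (ContinuousLinearMap.lsmul ℝ ℝ) μ +
      (convolution (ρ.normed μ) g (ContinuousLinearMap.lsmul ℝ ℝ) μ - g)) q μ +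
        eLpNorm (u - g) q μ := eLpNorm_sub_le (hm1.add hm2) (hu.sub hgq).1 hq
    _ ≤ (eLpNorm (convolution (ρ.normed μ) (u - g) (ContinuousLinearMap.lsmul ℝ ℝ) μ) q μ +
        eLpNorm (convolution (ρ.normed μ) g (ContinuousLinearMap.lsmul ℝ ℝ) μ - g) q μ) +
        eLpNorm (u - g) q μ := by
        gcongr
        exact eLpNorm_add_le hm1 hm2 hq
    _ ≤ (ε / 3 + ε / 3) + ε / 3 := by
        gcongr
        exact h1.trans hug
    _ = ε := ENNReal.add_thirds ε

end Mollification

/-! ### Derivatives of convolutions -/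

section ConvolutionDerivative

lemma hasCompactSupport_comp_sub_left {E : Type*} [NormedAddCommGroup E] {ρ : E → ℝ} (hρc : HasCompactSupport ρ) (x : E) :
    HasCompactSupport fun s => ρ (x - s) :=
  hρc.comp_homeomorph (Homeomorph.subLeft x)

variable {E : Type*} [NormedAddCommGroup E] [NormedSpace ℝ E] [MeasurableSpace E] [BorelSpace E]
  {G : Type*} [NormedAddCommGroup G] [NormedSpace ℝ G] {μ : Measure E}
  [μ.IsAddLeftInvariant] [μ.IsNegInvariant]

lemma integrable_fderiv_smulRight {ρ : E → ℝ} (hρ : ContDiff ℝ 1 ρ) (hρc : HasCompactSupport ρ)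
    {c : E → G} (hc : LocallyIntegrable c μ) (x : E) :
    Integrable (fun t => (fderiv ℝ ρ t).smulRight (c (x - t))) μ := by
  have h := (hρc.fderiv ℝ).convolutionExists_left (ContinuousLinearMap.precompL E
    (ContinuousLinearMap.lsmul ℝ ℝ : ℝ →L[ℝ] G →L[ℝ] G)) (hρ.continuous_fderiv one_ne_zero) hc x
  refine Integrable.congr h (Eventually.of_forall fun t => ?_)
  ext v
  rfl

lemma hasFDerivAt_convolution_smul [SFinite μ] {ρ : E → ℝ} (hρ : ContDiff ℝ 1 ρ) (hρc : HasCompactSupport ρ)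
    {c : E → G} (hc : LocallyIntegrable c μ) (x : E) :
    HasFDerivAt (convolution ρ c (ContinuousLinearMap.lsmul ℝ ℝ) μ)
      (∫ t, (fderiv ℝ ρ t).smulRight (c (x - t)) ∂μ) x := by
  have h := hρc.hasFDerivAt_convolution_left (ContinuousLinearMap.lsmul ℝ ℝ) hρ hc x
  refine h.congr_fderiv (integral_congr_ae (Eventually.of_forall fun t => ?_))
  ext v
  rfl

/-- The derivative falls on the mollifier, so `c` only has to be locally integrable. -/
lemma apply_fderiv_convolution [SFinite μ] {ρ : E → ℝ} (hρ : ContDiff ℝ 1 ρ)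
    (hρc : HasCompactSupport ρ) {c : E → G} (hc : LocallyIntegrable c μ) (x : E)
    [CompleteSpace G] (Λ : (E →L[ℝ] G) →L[ℝ] ℝ) :
    Λ (fderiv ℝ (convolution ρ c (ContinuousLinearMap.lsmul ℝ ℝ) μ) x) =
      ∫ t, Λ ((fderiv ℝ ρ t).smulRight (c (x - t))) ∂μ := by
  rw [(hasFDerivAt_convolution_smul hρ hρc hc x).fderiv,
    Λ.integral_comp_comm (integrable_fderiv_smulRight hρ hρc hc x)]

end ConvolutionDerivative

/-! ### Weak exterior derivatives on Euclidean space -/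

section WeakDerivative

variable {n : ℕ}

/-- `w = da` in the sense of distributions on a subset of `ℝⁿ`. -/
def IsWeakDOn {k : ℕ} (B : Set (EuclideanSpace ℝ (Fin n)))
    (a : EuclideanSpace ℝ (Fin n) → EuclideanSpace ℝ (Fin n) [⋀^Fin k]→L[ℝ] ℝ)
    (w : EuclideanSpace ℝ (Fin n) → EuclideanSpace ℝ (Fin n) [⋀^Fin (k + 1)]→L[ℝ] ℝ) : Prop :=
  ∀ (l : ℕ) (h : k + 1 + l = n) (h' : k + (l + 1) = n)
    (f : EuclideanSpace ℝ (Fin n) → EuclideanSpace ℝ (Fin n) [⋀^Fin l]→L[ℝ] ℝ),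
    ContDiff ℝ ∞ f → HasCompactSupport f → tsupport f ⊆ B →
    ∫ y in B, formWedge h' (a y) (extDeriv f y) =
      (-1) ^ (k + 1) * ∫ y in B, formWedge h (w y) (f y)

lemma covWedge_neg_left {l : ℕ} (lam : EuclideanSpace ℝ (Fin n) →L[ℝ] ℝ)
    (β : EuclideanSpace ℝ (Fin n) [⋀^Fin l]→L[ℝ] ℝ) : covWedge (-lam) β = -covWedge lam β := by
  ext v
  rw [ContinuousAlternatingMap.neg_apply, covWedge_apply, covWedge_apply, ← Finset.sum_neg_distrib]
  refine Finset.sum_congr rfl fun i _ => ?_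
  rw [neg_apply]
  ring

lemma extDeriv_zero_const {l : ℕ} (α : EuclideanSpace ℝ (Fin n) [⋀^Fin l]→L[ℝ] ℝ)
    (y : EuclideanSpace ℝ (Fin n)) : extDeriv (fun _ => α) y = 0 := by
  have h1 := congrArg ContinuousAlternatingMap.alternatizeUncurryFin
    (fderiv_const_apply (𝕜 := ℝ) (x := y) α)
  exact h1.trans (map_zero (ContinuousAlternatingMap.alternatizeUncurryFinCLM ℝ _ ℝ))

section FormWedgeLinear

variable {k l : ℕ} (h : k + l = n) (α α' : EuclideanSpace ℝ (Fin n) [⋀^Fin k]→L[ℝ] ℝ)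
  (β β' : EuclideanSpace ℝ (Fin n) [⋀^Fin l]→L[ℝ] ℝ) (r : ℝ)

lemma formWedge_add_left : formWedge h (α + α') β = formWedge h α β + formWedge h α' β :=
  wedgeEval_add_left h α.toAlternatingMap α'.toAlternatingMap _ _

lemma formWedge_smul_left : formWedge h (r • α) β = r * formWedge h α β :=
  wedgeEval_smul_left h r α.toAlternatingMap _ _

lemma formWedge_add_right : formWedge h α (β + β') = formWedge h α β + formWedge h α β' :=
  wedgeEval_add_right h _ β.toAlternatingMap β'.toAlternatingMap _

lemma formWedge_smul_right : formWedge h α (r • β) = r * formWedge h α β :=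
  wedgeEval_smul_right h r _ β.toAlternatingMap _

lemma formWedge_neg_right : formWedge h α (-β) = -formWedge h α β := by
  rw [← neg_one_smul ℝ β, formWedge_smul_right, neg_one_mul]

lemma formWedge_sub_left : formWedge h (α - α') β = formWedge h α β - formWedge h α' β := by
  rw [sub_eq_add_neg, ← neg_one_smul ℝ α', formWedge_add_left, formWedge_smul_left, neg_one_mul,
    sub_eq_add_neg]

lemma formWedge_sub_right : formWedge h α (β - β') = formWedge h α β - formWedge h α β' := by
  rw [sub_eq_add_neg, formWedge_add_right, formWedge_neg_right, sub_eq_add_neg]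

end FormWedgeLinear

/-- The linear functional `T ↦ alt(T) ∧ α`. -/
def alternatizeWedge {k l : ℕ} (h : l + 1 + k = n) (α : EuclideanSpace ℝ (Fin n) [⋀^Fin k]→L[ℝ] ℝ) :=
  LinearMap.mkContinuous (E := EuclideanSpace ℝ (Fin n) →L[ℝ]
      EuclideanSpace ℝ (Fin n) [⋀^Fin l]→L[ℝ] ℝ) (σ := RingHom.id ℝ) (F := ℝ)
    { toFun := fun T => formWedge h (ContinuousAlternatingMap.alternatizeUncurryFin T) α
      map_add' := fun S T => by
        rw [← formWedge_add_left]
        exact congrArg (fun γ => formWedge h γ α)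
          (map_add (ContinuousAlternatingMap.alternatizeUncurryFinCLM ℝ _ ℝ) S T)
      map_smul' := fun r T => by
        rw [RingHom.id_apply, smul_eq_mul, ← formWedge_smul_left]
        exact congrArg (fun γ => formWedge h γ α)
          (map_smul (ContinuousAlternatingMap.alternatizeUncurryFinCLM ℝ _ ℝ) r T) }
    ((((l + 1).factorial : ℝ) * k.factorial)⁻¹ * n.factorial * (l + 1 : ℕ) * ‖α‖) (by
      intro T
      refine (norm_formWedge_le h _ α).trans ?_
      refine (mul_le_mul_of_nonneg_right (mul_le_mul_of_nonneg_left
        (ContinuousAlternatingMap.norm_alternatizeUncurryFin_le T) (by positivity))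
        (norm_nonneg α)).trans (le_of_eq ?_)
      push_cast
      ring)

/-- The exterior derivative of a mollified form. -/
lemma extDeriv_convolution {k l : ℕ} (h : l + 1 + k = n)
    {c : EuclideanSpace ℝ (Fin n) → EuclideanSpace ℝ (Fin n) [⋀^Fin l]→L[ℝ] ℝ}
    {e : EuclideanSpace ℝ (Fin n) → EuclideanSpace ℝ (Fin n) [⋀^Fin (l + 1)]→L[ℝ] ℝ}
    (hc : LocallyIntegrable c) (he : LocallyIntegrable e) (hce : IsWeakDOn univ c e)
    {ρ : EuclideanSpace ℝ (Fin n) → ℝ} (hρ : ContDiff ℝ ∞ ρ) (hρc : HasCompactSupport ρ)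
    (x : EuclideanSpace ℝ (Fin n)) :
    extDeriv (convolution ρ c (ContinuousLinearMap.lsmul ℝ ℝ) volume) x =
      convolution ρ e (ContinuousLinearMap.lsmul ℝ ℝ) volume x := by
  have h' : l + (k + 1) = n := by omega
  have hρ1 : ContDiff ℝ 1 ρ := hρ.of_le (by norm_num)
  have hint' : ConvolutionExistsAt ρ e x (ContinuousLinearMap.lsmul ℝ ℝ) volume :=
    hρc.convolutionExists_left (ContinuousLinearMap.lsmul ℝ ℝ) hρ.continuous he x
  rw [← sub_eq_zero]
  -- By nondegeneracy it suffices to wedge with constant forms `α`. The weak derivative is then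
  -- tested against `s ↦ ρ (x - s) • α`, whose exterior derivative is `-dρ(x - s) ∧ α`.
  refine eq_zero_of_formWedge_eq_zero h fun α => ?_
  have hα : ContDiff ℝ ∞ fun s => ρ (x - s) • α :=
    (hρ.comp (contDiff_const.sub contDiff_id)).smul contDiff_const
  have hαc : HasCompactSupport fun s => ρ (x - s) • α :=
    HasCompactSupport.smul_right (f := fun s => ρ (x - s)) (f' := fun _ => α)
      (hasCompactSupport_comp_sub_left hρc x)
  have hfd : ∀ s, fderiv ℝ (fun s => ρ (x - s)) s = -fderiv ℝ ρ (x - s) := by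
    intro s
    have := ((hρ1.differentiable one_ne_zero (x - s)).hasFDerivAt.comp s
      ((hasFDerivAt_id s).const_sub x)).fderiv
    refine this.trans ?_
    ext v
    simp
  have hext : ∀ s, extDeriv (fun s => ρ (x - s) • α) s = -covWedge (fderiv ℝ ρ (x - s)) α := by
    intro s
    rw [extDeriv_smul_fun (g := fun s => ρ (x - s)) (b := fun _ => α)
      ((hρ.comp (contDiff_const.sub contDiff_id)).differentiable (by norm_num) s)
      (differentiableAt_const α), extDeriv_zero_const, smul_zero, add_zero, hfd, covWedge_neg_left]
  have hw := hce k h h' _ hα hαc (subset_univ _)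
  simp only [hext, setIntegral_univ] at hw
  rw [formWedge_sub_left, sub_eq_zero]
  have h3 : formWedge h (extDeriv (convolution ρ c (ContinuousLinearMap.lsmul ℝ ℝ) volume) x) α =
      ∫ t, formWedge h (covWedge (fderiv ℝ ρ t) (c (x - t))) α := by
    exact apply_fderiv_convolution hρ1 hρc hc x (alternatizeWedge h α)
  have h4 : formWedge h (convolution ρ e (ContinuousLinearMap.lsmul ℝ ℝ) volume x) α =
      ∫ t, formWedge h (ρ t • e (x - t)) α :=
    (((formWedgeL h).flip α).integral_comp_comm hint').symm
  rw [h3, h4, ← integral_sub_left_eq_self _ volume x,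
    ← integral_sub_left_eq_self (fun t => formWedge h (ρ t • e (x - t)) α) volume x]
  simp only [sub_sub_cancel]
  have h5 : ∀ s, formWedge h' (c s) (-covWedge (fderiv ℝ ρ (x - s)) α) =
      (-1) ^ (l + 1) * formWedge h (covWedge (fderiv ℝ ρ (x - s)) (c s)) α := by
    intro s
    rw [formWedge_neg_right, formWedge_covWedge h h', pow_succ]
    ring
  have h6 : ∀ s, formWedge h (e s) (ρ (x - s) • α) = formWedge h (ρ (x - s) • e s) α := by
    intro s
    rw [formWedge_smul_right, formWedge_smul_left]
  simp only [h5, h6] at hw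
  rw [integral_const_mul] at hw
  exact mul_left_cancel₀ (pow_ne_zero _ (by norm_num)) hw

lemma norm_covWedge_le {l : ℕ} (lam : EuclideanSpace ℝ (Fin n) →L[ℝ] ℝ)
    (β : EuclideanSpace ℝ (Fin n) [⋀^Fin l]→L[ℝ] ℝ) :
    ‖covWedge lam β‖ ≤ (l + 1) * ‖lam‖ * ‖β‖ := by
  refine (ContinuousAlternatingMap.norm_alternatizeUncurryFin_le _).trans (le_of_eq ?_)
  rw [ContinuousLinearMap.norm_smulRight_apply, mul_assoc]

/-- `covWedge` as a continuous bilinear map. -/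
def covWedgeL (n l : ℕ) :=
  LinearMap.mkContinuous₂ (E := EuclideanSpace ℝ (Fin n) →L[ℝ] ℝ)
    (F := EuclideanSpace ℝ (Fin n) [⋀^Fin l]→L[ℝ] ℝ)
    (G := EuclideanSpace ℝ (Fin n) [⋀^Fin (l + 1)]→L[ℝ] ℝ)
    (LinearMap.mk₂ ℝ covWedge
      (fun _ _ _ => by
        ext v
        simp only [covWedge_apply, ContinuousAlternatingMap.add_apply, ← Finset.sum_add_distrib]
        exact Finset.sum_congr rfl fun i _ => by rw [add_apply]; ring)
      (fun _ _ _ => by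
        ext v
        simp only [covWedge_apply, ContinuousAlternatingMap.smul_apply, Finset.smul_sum]
        exact Finset.sum_congr rfl fun i _ => by rw [smul_apply, smul_eq_mul, smul_eq_mul]; ring)
      (fun _ _ _ => by
        ext v
        simp only [covWedge_apply, ContinuousAlternatingMap.add_apply, ← Finset.sum_add_distrib]
        exact Finset.sum_congr rfl fun i _ => by ring)
      (fun _ _ _ => by
        ext v
        simp only [covWedge_apply, ContinuousAlternatingMap.smul_apply, Finset.smul_sum]
        exact Finset.sum_congr rfl fun i _ => by rw [smul_eq_mul, smul_eq_mul]; ring))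
    (l + 1) norm_covWedge_le

lemma aestronglyMeasurable_covWedge {l : ℕ} {X : Type*} [MeasurableSpace X] {μ : Measure X}
    {lam : X → EuclideanSpace ℝ (Fin n) →L[ℝ] ℝ}
    {β : X → EuclideanSpace ℝ (Fin n) [⋀^Fin l]→L[ℝ] ℝ}
    (hlam : AEStronglyMeasurable lam μ) (hβ : AEStronglyMeasurable β μ) :
    AEStronglyMeasurable (fun x => covWedge (lam x) (β x)) μ :=
  (covWedgeL n l).aestronglyMeasurable_comp₂ hlam hβ

variable {X : Type*} [MeasurableSpace X] {μ : Measure X} {k l : ℕ} {p q : ℝ≥0∞}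

lemma integrable_formWedge (h : k + l = n) (hpq : p.HolderConjugate q)
    {a : X → EuclideanSpace ℝ (Fin n) [⋀^Fin k]→L[ℝ] ℝ}
    {b : X → EuclideanSpace ℝ (Fin n) [⋀^Fin l]→L[ℝ] ℝ} (ha : MemLp a p μ) (hb : MemLp b q μ) :
    Integrable (fun x => formWedge h (a x) (b x)) μ := by
  have h1 : Integrable (fun x => ‖a x‖ * ‖b x‖) μ := ha.norm.integrable_mul hb.norm
  refine (h1.const_mul (((k.factorial : ℝ) * l.factorial)⁻¹ * n.factorial)).mono'
    ((formWedgeL h).aestronglyMeasurable_comp₂ ha.1 hb.1) (Eventually.of_forall fun x => ?_)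
  rw [← mul_assoc]
  exact norm_formWedge_le h (a x) (b x)

/-- By Hölder's inequality the pairing with a fixed `L^p` form is continuous on `L^q`. -/
lemma tendsto_integral_formWedge (h : k + l = n) (hpq : p.HolderConjugate q)
    {a : X → EuclideanSpace ℝ (Fin n) [⋀^Fin k]→L[ℝ] ℝ}
    {b : ℕ → X → EuclideanSpace ℝ (Fin n) [⋀^Fin l]→L[ℝ] ℝ}
    {b' : X → EuclideanSpace ℝ (Fin n) [⋀^Fin l]→L[ℝ] ℝ} (ha : MemLp a p μ)
    (hb : ∀ j, MemLp (b j) q μ) (hb' : MemLp b' q μ)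
    (hlim : Tendsto (fun j => eLpNorm (b j - b') q μ) atTop (𝓝 0)) :
    Tendsto (fun j => ∫ x, formWedge h (a x) (b j x) ∂μ) atTop
      (𝓝 (∫ x, formWedge h (a x) (b' x) ∂μ)) := by
  rw [tendsto_iff_edist_tendsto_0]
  set C : ℝ≥0 := ⟨((k.factorial : ℝ) * l.factorial)⁻¹ * n.factorial, by positivity⟩ with hCdef
  have hC : Tendsto (fun j => C * eLpNorm a p μ * eLpNorm (b j - b') q μ) atTop
      (𝓝 0) := by
    have := ENNReal.Tendsto.const_mul hlim
      (Or.inr (ENNReal.mul_lt_top ENNReal.coe_lt_top ha.2).ne :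
        (0 : ℝ≥0∞) ≠ 0 ∨ ((C : ℝ≥0∞) * eLpNorm a p μ) ≠ ⊤)
    rwa [mul_zero] at this
  refine tendsto_of_tendsto_of_tendsto_of_le_of_le tendsto_const_nhds hC
    (fun _ => zero_le) fun j => ?_
  simp only
  rw [edist_eq_enorm_sub, ← integral_sub (integrable_formWedge h hpq ha (hb j))
    (integrable_formWedge h hpq ha hb')]
  have h1 : ∀ x, formWedge h (a x) (b j x) - formWedge h (a x) (b' x) =
      formWedge h (a x) ((b j - b') x) := by
    intro x
    rw [Pi.sub_apply, formWedge_sub_right]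
  simp only [h1]
  refine (enorm_integral_le_lintegral_enorm _).trans ?_
  rw [← eLpNorm_one_eq_lintegral_enorm]
  exact eLpNorm_le_eLpNorm_mul_eLpNorm_of_nnnorm ha.1 ((hb j).sub hb').1
    (fun α β => formWedge h α β) C
    (Eventually.of_forall fun x => norm_formWedge_le h (a x) ((b j - b') x))

end WeakDerivative

/-! ### Supports and smoothness of mollified functions -/

section Mollify

variable {E : Type*} [NormedAddCommGroup E] [NormedSpace ℝ E] [FiniteDimensional ℝ E]
  [MeasurableSpace E] [BorelSpace E] {G : Type*} [NormedAddCommGroup G] [NormedSpace ℝ G]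
  {μ : Measure E} [μ.IsAddHaarMeasure]

lemma memLp_convolution (ρ : ContDiffBump (0 : E)) {u : E → G} {q : ℝ≥0∞} (hq : 1 ≤ q)
    (hq' : q ≠ ⊤) (hu : MemLp u q μ) :
    MemLp (convolution (ρ.normed μ) u (ContinuousLinearMap.lsmul ℝ ℝ) μ) q μ :=
  ⟨(ρ.hasCompactSupport_normed.continuous_convolution_left _ ρ.continuous_normed
    (hu.locallyIntegrable hq)).aestronglyMeasurable,
    (eLpNorm_convolution_le ρ hu.1 hq hq').trans_lt hu.2⟩

lemma contDiff_convolution_normed (ρ : ContDiffBump (0 : E)) {u : E → G}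
    (hu : LocallyIntegrable u μ) :
    ContDiff ℝ ∞ (convolution (ρ.normed μ) u (ContinuousLinearMap.lsmul ℝ ℝ) μ) :=
  ρ.hasCompactSupport_normed.contDiff_convolution_left _ ρ.contDiff_normed hu

lemma tsupport_convolution_subset (ρ : ContDiffBump (0 : E)) {u : E → G} {S : Set E} {δ : ℝ}
    (hδ : ρ.rOut ≤ δ) (hu : ∀ y ∉ S, u y = 0) :
    tsupport (convolution (ρ.normed μ) u (ContinuousLinearMap.lsmul ℝ ℝ) μ) ⊆
      Metric.cthickening δ S := by
  refine closure_minimal ?_ Metric.isClosed_cthickening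
  refine (support_convolution_subset_swap _).trans ?_
  rintro _ ⟨y, hy, z, hz, rfl⟩
  refine Metric.mem_cthickening_of_dist_le _ y _ _ (by_contra fun h => hy (hu y h)) ?_
  rw [ρ.support_normed_eq, mem_ball_zero_iff] at hz
  rw [dist_eq_norm, add_sub_cancel_left]
  exact hz.le.trans hδ

lemma hasCompactSupport_smul_fun {X G : Type*} [TopologicalSpace X] [NormedAddCommGroup G]
    [NormedSpace ℝ G] (σ : X → ℝ) {f : X → G} (hf : HasCompactSupport f) : HasCompactSupport fun y => σ y • f y :=
  hf.smul_left

lemma tsupport_smul_fun_subset {X G : Type*} [TopologicalSpace X] [NormedAddCommGroup G]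
    [NormedSpace ℝ G] (σ : X → ℝ) (f : X → G) : tsupport (fun y => σ y • f y) ⊆ tsupport σ :=
  tsupport_smul_subset_left σ f

lemma contDiff_smul_fun {E G : Type*} [NormedAddCommGroup E] [NormedSpace ℝ E]
    [NormedAddCommGroup G] [NormedSpace ℝ G] {σ : E → ℝ} {f : E → G} (hσ : ContDiff ℝ ∞ σ) (hf : ContDiff ℝ ∞ f) :
    ContDiff ℝ ∞ fun y => σ y • f y :=
  hσ.smul hf

lemma hasCompactSupport_of_tsupport_subset {X G : Type*} [TopologicalSpace X]
    [NormedAddCommGroup G] {f : X → G} {K : Set X} (hK : IsCompact K) (hf : tsupport f ⊆ K) :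
    HasCompactSupport f :=
  hK.of_isClosed_subset (isClosed_tsupport _) hf

lemma memLp_add_fun {X G : Type*} [MeasurableSpace X] [NormedAddCommGroup G] {ν : Measure X}
    {q : ℝ≥0∞} {u v : X → G} (hu : MemLp u q ν) (hv : MemLp v q ν) :
    MemLp (fun y => u y + v y) q ν :=
  hu.add hv

end Mollify

/-! ### Stokes' formula for weak derivatives and a smooth cutoff -/

section LocalStokes

variable {n : ℕ} {k l : ℕ} {p q : ℝ≥0∞} {B : Set (EuclideanSpace ℝ (Fin n))}
  {σ : EuclideanSpace ℝ (Fin n) → ℝ}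
  {b : EuclideanSpace ℝ (Fin n) → EuclideanSpace ℝ (Fin n) [⋀^Fin l]→L[ℝ] ℝ}
  {v : EuclideanSpace ℝ (Fin n) → EuclideanSpace ℝ (Fin n) [⋀^Fin (l + 1)]→L[ℝ] ℝ}

lemma memLp_of_restrict {X G : Type*} [MeasurableSpace X] {μ : Measure X} [NormedAddCommGroup G]
    {u : X → G} {S : Set X} (hS : MeasurableSet S)
    (hu : MemLp u q (μ.restrict S)) (h0 : ∀ y ∉ S, u y = 0) : MemLp u q μ := by
  rw [← memLp_indicator_iff_restrict hS] at hu
  rwa [indicator_eq_self.2 fun y hy => by_contra fun hyS => hy (h0 y hyS)] at hu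

lemma memLp_smul_cutoff {G : Type*} [NormedAddCommGroup G] [NormedSpace ℝ G]
    {μ : Measure (EuclideanSpace ℝ (Fin n))} {u : EuclideanSpace ℝ (Fin n) → G}
    (hσ : Continuous σ) (hσc : HasCompactSupport σ) (hu : MemLp u q μ) :
    MemLp (fun y => σ y • u y) q μ := by
  obtain ⟨C, hC⟩ := hσc.exists_bound_of_continuous hσ
  refine hu.of_le_mul (c := C) (hσ.aestronglyMeasurable.smul hu.1) (Eventually.of_forall fun y => ?_)
  rw [norm_smul]
  exact mul_le_mul_of_nonneg_right (hC y) (norm_nonneg _)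

lemma memLp_covWedge_cutoff {μ : Measure (EuclideanSpace ℝ (Fin n))}
    (hσ : ContDiff ℝ ∞ σ) (hσc : HasCompactSupport σ) (hb : MemLp b q μ) :
    MemLp (fun y => covWedge (fderiv ℝ σ y) (b y)) q μ := by
  have hσ' : Continuous (fderiv ℝ σ) := hσ.continuous_fderiv (by norm_num)
  obtain ⟨C, hC⟩ := (hσc.fderiv ℝ).exists_bound_of_continuous hσ'
  refine hb.of_le_mul (c := (l + 1) * C)
    (aestronglyMeasurable_covWedge hσ'.aestronglyMeasurable hb.1) (Eventually.of_forall fun y => ?_)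
  refine (norm_covWedge_le _ _).trans (mul_le_mul_of_nonneg_right ?_ (norm_nonneg _))
  exact mul_le_mul_of_nonneg_left (hC y) (by positivity)

lemma fderiv_eq_zero_of_notMem_tsupport {y : EuclideanSpace ℝ (Fin n)} (hy : y ∉ tsupport σ) :
    fderiv ℝ σ y = 0 :=
  image_eq_zero_of_notMem_tsupport fun h => hy (tsupport_fderiv_subset ℝ h)

lemma covWedge_zero_left (β : EuclideanSpace ℝ (Fin n) [⋀^Fin l]→L[ℝ] ℝ) :
    covWedge (0 : EuclideanSpace ℝ (Fin n) →L[ℝ] ℝ) β = 0 := by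
  ext w
  rw [covWedge_apply]
  simp

lemma continuous_extDeriv {f : EuclideanSpace ℝ (Fin n) → EuclideanSpace ℝ (Fin n) [⋀^Fin l]→L[ℝ] ℝ}
    (hf : ContDiff ℝ ∞ f) : Continuous (extDeriv f) :=
  (ContinuousAlternatingMap.alternatizeUncurryFinCLM ℝ _ ℝ).continuous.comp
    (hf.continuous_fderiv (by norm_num))

lemma hasCompactSupport_extDeriv
    {f : EuclideanSpace ℝ (Fin n) → EuclideanSpace ℝ (Fin n) [⋀^Fin l]→L[ℝ] ℝ}
    (hfc : HasCompactSupport f) : HasCompactSupport (extDeriv f) :=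
  (hfc.fderiv ℝ).comp_left (g := ContinuousAlternatingMap.alternatizeUncurryFin)
    (map_zero (ContinuousAlternatingMap.alternatizeUncurryFinCLM ℝ _ ℝ))

/-- The product of a form which has a weak derivative with a cutoff function. -/
lemma IsWeakDOn.cutoff (hpq : p.HolderConjugate q)
    (hb : MemLp b q (volume.restrict B)) (hv : MemLp v q (volume.restrict B))
    (hbv : IsWeakDOn B b v) (hσ : ContDiff ℝ ∞ σ) (hσc : HasCompactSupport σ)
    (hσB : tsupport σ ⊆ B) :
    IsWeakDOn univ (fun y => σ y • b y)
      (fun y => covWedge (fderiv ℝ σ y) (b y) + σ y • v y) := by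
  intro m h h' f hf hfc _
  have hσ0 : ∀ y ∉ B, σ y = 0 := fun y hy => image_eq_zero_of_notMem_tsupport fun hy' => hy (hσB hy')
  have hσ0' : ∀ y ∉ B, fderiv ℝ σ y = 0 := fun y hy =>
    fderiv_eq_zero_of_notMem_tsupport fun hy' => hy (hσB hy')
  have hfp : MemLp f p (volume.restrict B) :=
    (hf.continuous.memLp_of_hasCompactSupport hfc).restrict B
  have hdfp : MemLp (extDeriv f) p (volume.restrict B) :=
    ((continuous_extDeriv hf).memLp_of_hasCompactSupport (hasCompactSupport_extDeriv hfc)).restrict B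
  have hqp : q.HolderConjugate p := hpq.symm
  -- The hypothesis on `b` is used with the test form `σ f`. In `d(σ f) = dσ ∧ f + σ df` the
  -- covector `dσ` is then moved across `b`, at the cost of `(-1)^l`.
  have hw := hbv m h h' _ (contDiff_smul_fun hσ hf) (hasCompactSupport_smul_fun σ hfc)
    ((tsupport_smul_fun_subset σ f).trans hσB)
  have hext : ∀ y, extDeriv (fun y => σ y • f y) y =
      covWedge (fderiv ℝ σ y) (f y) + σ y • extDeriv f y := fun y =>
    extDeriv_smul_fun (hσ.differentiable (by norm_num) y) (hf.differentiable (by norm_num) y)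
  have i1 := integrable_formWedge h' hqp hb (memLp_covWedge_cutoff hσ hσc hfp)
  have i2 := integrable_formWedge h' hqp hb (memLp_smul_cutoff hσ.continuous hσc hdfp)
  have i3 := integrable_formWedge h hqp (memLp_smul_cutoff hσ.continuous hσc hv) hfp
  have i4 := integrable_formWedge h hqp (memLp_covWedge_cutoff hσ hσc hb) hfp
  have e1 : ∫ y in B, formWedge h' (b y) (covWedge (fderiv ℝ σ y) (f y)) =
      (-1) ^ l * ∫ y in B, formWedge h (covWedge (fderiv ℝ σ y) (b y)) (f y) := by
    rw [← integral_const_mul]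
    exact integral_congr_ae (Eventually.of_forall fun y => formWedge_covWedge h h' _ _ _)
  have e2 : ∫ y in B, formWedge h' (b y) (extDeriv (fun y => σ y • f y) y) =
      (∫ y in B, formWedge h' (b y) (covWedge (fderiv ℝ σ y) (f y))) +
        ∫ y in B, formWedge h' (b y) (σ y • extDeriv f y) := by
    rw [← integral_add i1 i2]
    refine integral_congr_ae (Eventually.of_forall fun y => ?_)
    simp only
    rw [hext, formWedge_add_right]
  have e3 : ∫ y in B, formWedge h (v y) (σ y • f y) = ∫ y in B, formWedge h (σ y • v y) (f y) := by
    refine integral_congr_ae (Eventually.of_forall fun y => ?_)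
    simp only
    rw [formWedge_smul_left, formWedge_smul_right]
  have e4 : ∫ y in univ, formWedge h' (σ y • b y) (extDeriv f y) =
      ∫ y in B, formWedge h' (b y) (σ y • extDeriv f y) := by
    rw [setIntegral_univ, ← setIntegral_eq_integral_of_forall_compl_eq_zero (s := B)]
    · refine integral_congr_ae (Eventually.of_forall fun y => ?_)
      simp only
      rw [formWedge_smul_left, formWedge_smul_right]
    · intro y hy
      rw [formWedge_smul_left, hσ0 y hy, zero_mul]
  have e5 : ∫ y in univ, formWedge h (covWedge (fderiv ℝ σ y) (b y) + σ y • v y) (f y) =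
      (∫ y in B, formWedge h (covWedge (fderiv ℝ σ y) (b y)) (f y)) +
        ∫ y in B, formWedge h (σ y • v y) (f y) := by
    rw [← integral_add i4 i3, setIntegral_univ,
      ← setIntegral_eq_integral_of_forall_compl_eq_zero (s := B)]
    · refine integral_congr_ae (Eventually.of_forall fun y => ?_)
      simp only
      rw [formWedge_add_left]
    · intro y hy
      rw [hσ0 y hy, hσ0' y hy, covWedge_zero_left, zero_smul, add_zero,
        ← zero_smul ℝ (0 : EuclideanSpace ℝ (Fin n) [⋀^Fin (l + 1)]→L[ℝ] ℝ),
        formWedge_smul_left, zero_mul]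
  rw [e4, e5]
  rw [e2, e3, e1] at hw
  linear_combination hw

/-- Stokes' theorem for `L^p` and `L^q` forms which have weak derivatives on an open subset of `ℝⁿ`,
multiplied with a cutoff function. -/
lemma integral_cutoff_formWedge (hpq : p.HolderConjugate q) (hq : 1 ≤ q) (hq' : q ≠ ⊤)
    (hB : IsOpen B) (h : k + 1 + l = n) (h' : k + (l + 1) = n)
    {a : EuclideanSpace ℝ (Fin n) → EuclideanSpace ℝ (Fin n) [⋀^Fin k]→L[ℝ] ℝ}
    {w : EuclideanSpace ℝ (Fin n) → EuclideanSpace ℝ (Fin n) [⋀^Fin (k + 1)]→L[ℝ] ℝ}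
    (ha : MemLp a p (volume.restrict B)) (hw : MemLp w p (volume.restrict B))
    (haw : IsWeakDOn B a w)
    (hb : MemLp b q (volume.restrict B)) (hv : MemLp v q (volume.restrict B))
    (hbv : IsWeakDOn B b v) (hσ : ContDiff ℝ ∞ σ) (hσc : HasCompactSupport σ)
    (hσB : tsupport σ ⊆ B) :
    (∫ y in B, σ y * formWedge h' (a y) (v y)) - (-1) ^ (k + 1) *
      ∫ y in B, σ y * formWedge h (w y) (b y) =
    -∫ y in B, formWedge h' (a y) (covWedge (fderiv ℝ σ y) (b y)) := by
  have hσ0 : ∀ y ∉ B, σ y = 0 := fun y hy => image_eq_zero_of_notMem_tsupport fun hy' => hy (hσB hy')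
  have hσ0' : ∀ y ∉ B, fderiv ℝ σ y = 0 := fun y hy =>
    fderiv_eq_zero_of_notMem_tsupport fun hy' => hy (hσB hy')
  set c : EuclideanSpace ℝ (Fin n) → EuclideanSpace ℝ (Fin n) [⋀^Fin l]→L[ℝ] ℝ :=
    fun y => σ y • b y with hc
  set e : EuclideanSpace ℝ (Fin n) → EuclideanSpace ℝ (Fin n) [⋀^Fin (l + 1)]→L[ℝ] ℝ :=
    fun y => covWedge (fderiv ℝ σ y) (b y) + σ y • v y with he
  have hce : IsWeakDOn univ c e := hbv.cutoff hpq hb hv hσ hσc hσB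
  have hcB := memLp_smul_cutoff hσ.continuous hσc hb
  have heB1 := memLp_covWedge_cutoff hσ hσc hb
  have heB2 := memLp_smul_cutoff hσ.continuous hσc hv
  have hcq : MemLp c q volume := memLp_of_restrict hB.measurableSet hcB fun y hy => by
    rw [hc]
    simp only [hσ0 y hy, zero_smul]
  have heq : MemLp e q volume := memLp_of_restrict hB.measurableSet (memLp_add_fun heB1 heB2) fun y hy => by
    simp only [he, hσ0 y hy, hσ0' y hy, zero_smul, covWedge_zero_left, add_zero]
  -- Mollifiers of radius less than `δ₀` keep the form `σ b` compactly supported in `B`, so that its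
  -- mollifications are admissible test forms for `a`.
  obtain ⟨δ₀, hδ₀, hδ₀B⟩ := hσc.isCompact.exists_cthickening_subset_open hB hσB
  have hex : ∀ j : ℕ, ∃ ρ : ContDiffBump (0 : EuclideanSpace ℝ (Fin n)), ρ.rOut < δ₀ ∧
      eLpNorm (convolution (ρ.normed volume) c (ContinuousLinearMap.lsmul ℝ ℝ) volume - c) q volume ≤
        (j + 1 : ℝ≥0∞)⁻¹ ∧
      eLpNorm (convolution (ρ.normed volume) e (ContinuousLinearMap.lsmul ℝ ℝ) volume - e) q volume ≤
        (j + 1 : ℝ≥0∞)⁻¹ := by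
    intro j
    have hj : (j + 1 : ℝ≥0∞)⁻¹ ≠ 0 := ENNReal.inv_ne_zero.2 (by finiteness)
    obtain ⟨δ₁, hδ₁, h1⟩ := exists_eLpNorm_convolution_sub_le hq hq' hcq hj
    obtain ⟨δ₂, hδ₂, h2⟩ := exists_eLpNorm_convolution_sub_le hq hq' heq hj
    set δ := min δ₀ (min δ₁ δ₂)
    have hδ : 0 < δ := lt_min hδ₀ (lt_min hδ₁ hδ₂)
    have hlt : δ / 2 < δ := half_lt_self hδ
    exact ⟨⟨δ / 4, δ / 2, by positivity, by linarith⟩, hlt.trans_le (min_le_left _ _),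
      h1 _ (hlt.trans_le ((min_le_right _ _).trans (min_le_left _ _))),
      h2 _ (hlt.trans_le ((min_le_right _ _).trans (min_le_right _ _)))⟩
  choose ρ hρ1 hρ2 hρ3 using hex
  have hzero : Tendsto (fun j : ℕ => (j + 1 : ℝ≥0∞)⁻¹) atTop (𝓝 0) := by
    have := ENNReal.tendsto_inv_nat_nhds_zero.comp (tendsto_add_atTop_nat 1)
    refine this.congr fun j => ?_
    simp
  have hlim : ∀ {m : ℕ} {u : EuclideanSpace ℝ (Fin n) → EuclideanSpace ℝ (Fin n) [⋀^Fin m]→L[ℝ] ℝ},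
      (∀ j, eLpNorm (convolution ((ρ j).normed volume) u (ContinuousLinearMap.lsmul ℝ ℝ) volume - u) q
        volume ≤ (j + 1 : ℝ≥0∞)⁻¹) → Tendsto (fun j => eLpNorm
        (convolution ((ρ j).normed volume) u (ContinuousLinearMap.lsmul ℝ ℝ) volume - u) q
        (volume.restrict B)) atTop (𝓝 0) := fun hu =>
    tendsto_of_tendsto_of_tendsto_of_le_of_le tendsto_const_nhds hzero (fun _ => zero_le)
      fun j => (eLpNorm_mono_measure _ Measure.restrict_le_self).trans (hu j)
  -- Mollification commutes with `d`. So the weak derivative of `a`, tested on the mollified `σ b`,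
  -- produces the mollified derivative of `σ b`, and both sides converge by Hölder's inequality.
  have hid : ∀ j, ∫ y in B, formWedge h' (a y)
        (convolution ((ρ j).normed volume) e (ContinuousLinearMap.lsmul ℝ ℝ) volume y) =
      (-1) ^ (k + 1) * ∫ y in B, formWedge h (w y)
        (convolution ((ρ j).normed volume) c (ContinuousLinearMap.lsmul ℝ ℝ) volume y) := by
    intro j
    have hsupp : tsupport (convolution ((ρ j).normed volume) c (ContinuousLinearMap.lsmul ℝ ℝ) volume) ⊆
        Metric.cthickening δ₀ (tsupport σ) := by
      refine tsupport_convolution_subset (ρ j) (hρ1 j).le fun y hy => ?_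
      rw [hc]
      simp only [image_eq_zero_of_notMem_tsupport hy, zero_smul]
    have hcomp := hasCompactSupport_of_tsupport_subset hσc.isCompact.cthickening hsupp
    have hsm : ContDiff ℝ ∞
        (convolution ((ρ j).normed volume) c (ContinuousLinearMap.lsmul ℝ ℝ) volume) :=
      contDiff_convolution_normed (ρ j) (hcq.locallyIntegrable hq)
    have := haw l h h' _ hsm hcomp (hsupp.trans hδ₀B)
    rw [← this]
    refine integral_congr_ae (Eventually.of_forall fun y => ?_)
    simp only
    rw [extDeriv_convolution (by omega : l + 1 + k = n) (hcq.locallyIntegrable hq)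
      (heq.locallyIntegrable hq) hce (ρ j).contDiff_normed (ρ j).hasCompactSupport_normed]
  have hl1 := tendsto_integral_formWedge h' hpq ha (fun j => (memLp_convolution (ρ j) hq hq' heq).restrict B) (heq.restrict B)
    (hlim hρ3)
  have hl2 := (tendsto_integral_formWedge h hpq hw (fun j => (memLp_convolution (ρ j) hq hq' hcq).restrict B) (hcq.restrict B)
    (hlim hρ2)).const_mul ((-1) ^ (k + 1))
  have hfin := tendsto_nhds_unique (hl1.congr hid) hl2
  have e1 : ∫ y in B, formWedge h' (a y) (e y) =
      (∫ y in B, formWedge h' (a y) (covWedge (fderiv ℝ σ y) (b y))) +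
        ∫ y in B, σ y * formWedge h' (a y) (v y) := by
    have i1 := integrable_formWedge h' hpq ha heB1
    have i2 := integrable_formWedge h' hpq ha heB2
    simp only [formWedge_smul_right] at i2
    rw [← integral_add i1 i2]
    refine integral_congr_ae (Eventually.of_forall fun y => ?_)
    simp only [he]
    rw [formWedge_add_right, formWedge_smul_right]
  have e2 : ∫ y in B, formWedge h (w y) (c y) = ∫ y in B, σ y * formWedge h (w y) (b y) := by
    refine integral_congr_ae (Eventually.of_forall fun y => ?_)
    simp only [hc]
    rw [formWedge_smul_right]
  rw [e1, e2] at hfin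
  linear_combination hfin

end LocalStokes

/-! ### Extension and smoothing of Lipschitz functions -/

section Mollify

variable {E : Type*} [NormedAddCommGroup E] [NormedSpace ℝ E] {V : Type*}
  [NormedAddCommGroup V] [NormedSpace ℝ V]

/-- McShane's extension of a function which is Lipschitz for the seminorm `‖A ·‖`. -/
lemma exists_extension_lipschitz {A : E →L[ℝ] V} {S : V → E} (hSA : ∀ v, S (A v) = v)
    {B : Set E} {F : E → ℝ} {c : ℝ≥0} (hF : ∀ y ∈ B, ∀ z ∈ B, |F y - F z| ≤ c * ‖A (y - z)‖) :
    ∃ G : E → ℝ, (∀ y ∈ B, G y = F y) ∧ ∀ y z, |G y - G z| ≤ c * ‖A (y - z)‖ := by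
  -- Transported to `A '' B` by the left inverse `S` of `A`, the function is Lipschitz for the norm
  -- of `V`, and the extension theorem for metric spaces applies.
  have hL : LipschitzOnWith c (fun w => F (S w)) (A '' B) := by
    refine LipschitzOnWith.of_dist_le_mul ?_
    rintro _ ⟨y, hy, rfl⟩ _ ⟨z, hz, rfl⟩
    rw [hSA, hSA, Real.dist_eq, dist_eq_norm, ← map_sub]
    exact hF y hy z hz
  obtain ⟨g, hg, hgF⟩ := hL.extend_real
  refine ⟨fun y => g (A y), fun y hy => ?_, fun y z => ?_⟩
  · exact (hgF (mem_image_of_mem A hy)).symm.trans (congrArg F (hSA y))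
  · have := hg.dist_le_mul (A y) (A z)
    rwa [Real.dist_eq, dist_eq_norm, ← map_sub] at this

variable [FiniteDimensional ℝ E] [MeasurableSpace E] [BorelSpace E]

/-- Smoothing of a function which is Lipschitz for the seminorm `‖A ·‖`. -/
lemma exists_contDiff_approx_lipschitz {A : E →L[ℝ] V} {G : E → ℝ} {c : ℝ} (hc : 0 ≤ c)
    (hG : ∀ y z, |G y - G z| ≤ c * ‖A (y - z)‖) {ε : ℝ} (hε : 0 < ε) :
    ∃ g : E → ℝ, ContDiff ℝ ∞ g ∧ (∀ y, |g y - G y| ≤ ε) ∧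
      ∀ y v, |fderiv ℝ g y v| ≤ c * ‖A v‖ := by
  let μ : Measure E := Measure.addHaar
  have hGc : Continuous G := by
    rw [continuous_iff_continuousAt]
    intro y
    have h1 : Tendsto (fun z => c * ‖A (z - y)‖) (𝓝 y) (𝓝 0) := by
      have : Continuous fun z => c * ‖A (z - y)‖ := by fun_prop
      simpa using this.tendsto y
    exact tendsto_iff_norm_sub_tendsto_zero.2
      (squeeze_zero (fun _ => norm_nonneg _) (fun z => hG z y) h1)
  obtain ⟨δ, hδ, hδε⟩ : ∃ δ > 0, c * (‖A‖ * δ) ≤ ε := by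
    refine ⟨ε / (c * ‖A‖ + 1), by positivity, ?_⟩
    rw [← mul_assoc, mul_div_assoc', div_le_iff₀ (by positivity)]
    nlinarith [norm_nonneg A]
  -- Averaging over radius `δ` preserves the Lipschitz bound and changes `G` by at most `c ‖A‖ δ ≤
  -- ε`.
  let ρ : ContDiffBump (0 : E) := ⟨δ / 2, δ, by positivity, by linarith⟩
  set g := convolution (ρ.normed μ) G (ContinuousLinearMap.lsmul ℝ ℝ) μ with hg
  have hgs : ContDiff ℝ ∞ g := contDiff_convolution_normed ρ hGc.locallyIntegrable
  refine ⟨g, hgs, fun y => ?_, fun y v => ?_⟩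
  · rw [← Real.dist_eq]
    refine ContDiffBump.dist_normed_convolution_le hGc.aestronglyMeasurable fun z hz => ?_
    rw [Real.dist_eq]
    refine (hG z y).trans (le_trans (mul_le_mul_of_nonneg_left ((A.le_opNorm _).trans ?_) hc) hδε)
    refine mul_le_mul_of_nonneg_left ?_ (norm_nonneg _)
    rw [← dist_eq_norm]
    exact (Metric.mem_ball.1 hz).le
  · have hlip : ∀ z w, |g z - g w| ≤ c * ‖A (z - w)‖ := by
      intro z w
      have hint : ∀ z, Integrable (fun s => ρ.normed μ s * G (z - s)) μ := fun z =>
        (ρ.continuous_normed.mul (hGc.comp (continuous_const.sub continuous_id)))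
          |>.integrable_of_hasCompactSupport ρ.hasCompactSupport_normed.mul_right
      have : g z - g w = ∫ s, ρ.normed μ s * (G (z - s) - G (w - s)) ∂μ := by
        simp only [mul_sub]
        rw [integral_sub (hint z) (hint w)]
        rfl
      rw [this, ← Real.norm_eq_abs]
      refine (norm_integral_le_of_norm_le ((ρ.integrable_normed (μ := μ)).mul_const (c * ‖A (z - w)‖))
        (Eventually.of_forall fun s => ?_)).trans_eq ?_
      · rw [norm_mul, Real.norm_of_nonneg (ρ.nonneg_normed s)]
        refine mul_le_mul_of_nonneg_left ((hG _ _).trans_eq ?_) (ρ.nonneg_normed s)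
        congr 3
        abel
      · rw [integral_mul_const, ρ.integral_normed, one_mul]
    have hd : HasDerivAt (fun t : ℝ => g (y + t • v)) (fderiv ℝ g y v) 0 := by
      have h1 : HasDerivAt (fun t : ℝ => y + t • v) v 0 := by
        simpa using ((hasDerivAt_id (0 : ℝ)).smul_const v).const_add y
      have h2 : HasFDerivAt g (fderiv ℝ g y) (y + (0 : ℝ) • v) := by
        rw [zero_smul, add_zero]
        exact (hgs.differentiable (by norm_num) y).hasFDerivAt
      exact h2.comp_hasDerivAt _ h1
    -- The directional derivative inherits the Lipschitz bound along the line `y + t v`.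
    have := hd.hasFDerivAt.le_of_lip' (C := c * ‖A v‖) (by positivity)
      (Eventually.of_forall fun t => by
        refine (hlip _ _).trans_eq ?_
        rw [zero_smul, add_zero, add_sub_cancel_left, map_smul, norm_smul, sub_zero]
        ring)
    simpa using this

end Mollify

/-! ### The differential of a function on the manifold -/

section Differential

variable {n : ℕ} {M : Type*} [EMetricSpace M] [ChartedSpace (EuclideanSpace ℝ (Fin n)) M]
  [IsManifold (𝓡 n) ∞ M]

variable (n) in
/-- The differential of a function on `M`. -/
def dFun (ρ : M → ℝ) (x : M) : TangentSpace (𝓡 n) x →L[ℝ] ℝ :=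
  (fderiv ℝ (fun y => ρ ((extChartAt (𝓡 n) x).symm y)) (extChartAt (𝓡 n) x x)).comp
    (coordInv n x x)

lemma contDiffOn_comp_symm {ρ : M → ℝ} (hρ : ContMDiff (𝓡 n) 𝓘(ℝ, ℝ) ∞ ρ) (x₀ : M) :
    ContDiffOn ℝ ∞ (fun y => ρ ((extChartAt (𝓡 n) x₀).symm y)) (extChartAt (𝓡 n) x₀).target :=
  contMDiffOn_iff_contDiffOn.1 (hρ.comp_contMDiffOn (contMDiffOn_extChartAt_symm x₀))

/-- `dFun` is computed in the chart around the point; by the chain rule for the transition map every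
chart gives the same covector. -/
lemma dFun_comp_coordL {ρ : M → ℝ} (hρ : ContMDiff (𝓡 n) 𝓘(ℝ, ℝ) ∞ ρ) {x₀ x : M}
    (hx : x ∈ (extChartAt (𝓡 n) x₀).source) :
    (dFun n ρ x).comp (coordL n x₀ x) =
      fderiv ℝ (fun y => ρ ((extChartAt (𝓡 n) x₀).symm y)) (extChartAt (𝓡 n) x₀ x) := by
  have hxx : x ∈ (extChartAt (𝓡 n) x).source := mem_extChartAt_source x
  have h1 := hasFDerivAt_tangentCoordChange hxx hx
  have hd : DifferentiableAt ℝ (fun y => ρ ((extChartAt (𝓡 n) x).symm y)) (extChartAt (𝓡 n) x x) :=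
    ((contDiffOn_comp_symm hρ x).contDiffAt (extChartAt_target_mem_nhds x)).differentiableAt
      (by norm_num)
  have h2 : HasFDerivAt (fun y => ρ ((extChartAt (𝓡 n) x).symm y))
      (fderiv ℝ (fun y => ρ ((extChartAt (𝓡 n) x).symm y)) (extChartAt (𝓡 n) x x))
      ((extChartAt (𝓡 n) x ∘ (extChartAt (𝓡 n) x₀).symm) (extChartAt (𝓡 n) x₀ x)) := by
    rw [Function.comp_apply, (extChartAt (𝓡 n) x₀).left_inv hx]
    exact hd.hasFDerivAt
  have h3 := (h2.comp _ h1).congr_of_eventuallyEq (f₁ := fun y => ρ ((extChartAt (𝓡 n) x₀).symm y)) (by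
    filter_upwards [eventually_symm_mem_source hxx hx] with y hy
    simp only [Function.comp_apply]
    rw [(extChartAt (𝓡 n) x).left_inv hy.2])
  rw [h3.fderiv]
  ext v
  simp only [dFun, ContinuousLinearMap.comp_apply]
  rw [coordInv_coordL_eq_tangentCoordChange hxx hx]

lemma dFun_eq_of_eventuallyEq {ρ ρ' : M → ℝ} {x : M} (h : ρ =ᶠ[𝓝 x] ρ') :
    dFun n ρ x = dFun n ρ' x := by
  have : (fun y => ρ ((extChartAt (𝓡 n) x).symm y)) =ᶠ[𝓝 (extChartAt (𝓡 n) x x)]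
      fun y => ρ' ((extChartAt (𝓡 n) x).symm y) := by
    have hc := continuousAt_extChartAt_symm (I := 𝓡 n) x
    rw [ContinuousAt, extChartAt_to_inv] at hc
    exact hc.eventually h
  rw [dFun, dFun, this.fderiv_eq]

lemma dFun_const (c : ℝ) (x : M) : dFun n (fun _ : M => c) x = 0 := by
  ext v
  simp [dFun]

lemma dFun_sum {ι : Type*} (s : Finset ι) {ρ : ι → M → ℝ}
    (hρ : ∀ i ∈ s, ContMDiff (𝓡 n) 𝓘(ℝ, ℝ) ∞ (ρ i)) (x : M) :
    dFun n (fun x => ∑ i ∈ s, ρ i x) x = ∑ i ∈ s, dFun n (ρ i) x := by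
  have hd : ∀ i ∈ s, DifferentiableAt ℝ (fun y => ρ i ((extChartAt (𝓡 n) x).symm y))
      (extChartAt (𝓡 n) x x) := fun i hi =>
    ((contDiffOn_comp_symm (hρ i hi) x).contDiffAt (extChartAt_target_mem_nhds x)).differentiableAt
      (by norm_num)
  ext v
  simp only [dFun, sum_apply, ContinuousLinearMap.comp_apply]
  rw [fderiv_fun_sum hd, sum_apply]

lemma continuousOn_dFun_comp_coordL {ρ : M → ℝ} (hρ : ContMDiff (𝓡 n) 𝓘(ℝ, ℝ) ∞ ρ) (x₀ : M) :
    ContinuousOn (fun x => (dFun n ρ x).comp (coordL n x₀ x)) (extChartAt (𝓡 n) x₀).source := by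
  have h1 : ContinuousOn (fderiv ℝ (fun y => ρ ((extChartAt (𝓡 n) x₀).symm y)))
      (extChartAt (𝓡 n) x₀).target :=
    (contDiffOn_comp_symm hρ x₀).continuousOn_fderiv_of_isOpen (isOpen_extChartAt_target x₀)
      (by norm_num)
  exact (h1.comp (continuousOn_extChartAt x₀) fun x hx => (extChartAt (𝓡 n) x₀).map_source hx).congr
    fun x hx => dFun_comp_coordL hρ hx

variable [RiemannianBundle (fun x : M => TangentSpace (𝓡 n) x)]

variable (n) in
/-- The form `dρ ∧ ψ`. -/
def dWedge {l : ℕ} (ρ : M → ℝ) (ψ : DiffForm n M l) : DiffForm n M (l + 1) := fun x =>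
  covWedge (dFun n ρ x) (ψ x)

lemma localRep_dWedge {l : ℕ} (ρ : M → ℝ) (ψ : DiffForm n M l) (x₀ x : M) :
    localRep x₀ (dWedge n ρ ψ) x = covWedge ((dFun n ρ x).comp (coordL n x₀ x)) (localRep x₀ ψ x) :=
  covWedge_comp _ _ _

lemma chartRep_dWedge {l : ℕ} {ρ : M → ℝ} (hρ : ContMDiff (𝓡 n) 𝓘(ℝ, ℝ) ∞ ρ) (ψ : DiffForm n M l)
    {x₀ : M} {y : EuclideanSpace ℝ (Fin n)} (hy : y ∈ (extChartAt (𝓡 n) x₀).target) :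
    chartRep x₀ (dWedge n ρ ψ) y =
      covWedge (fderiv ℝ (fun y => ρ ((extChartAt (𝓡 n) x₀).symm y)) y) (chartRep x₀ ψ y) := by
  rw [chartRep, localRep_dWedge, dFun_comp_coordL hρ ((extChartAt (𝓡 n) x₀).map_target hy),
    (extChartAt (𝓡 n) x₀).right_inv hy]
  rfl

lemma formNorm_dWedge_le {l : ℕ} (ρ : M → ℝ) (ψ : DiffForm n M l) (x : M) :
    formNorm n (dWedge n ρ ψ x) ≤
      (n : ℝ) ^ (l + 1) * ((l + 1) * formConst n l) * (‖dFun n ρ x‖ * formNorm n (ψ x)) :=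
  formNorm_covWedge_le _ _

variable [MeasurableSpace M] [BorelSpace M]

lemma IsMeasurableForm.dWedge {l : ℕ} {ρ : M → ℝ} (hρ : ContMDiff (𝓡 n) 𝓘(ℝ, ℝ) ∞ ρ)
    {ψ : DiffForm n M l} (hψ : IsMeasurableForm ψ) : IsMeasurableForm (dWedge n ρ ψ) := by
  intro x₀
  have hs : MeasurableSet (chartAt (EuclideanSpace ℝ (Fin n)) x₀).source :=
    (chartAt (EuclideanSpace ℝ (Fin n)) x₀).open_source.measurableSet
  have h1 := continuousOn_dFun_comp_coordL hρ x₀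
  rw [extChartAt_source] at h1
  exact (aestronglyMeasurable_covWedge (h1.aestronglyMeasurable hs) (hψ x₀)).congr
    (Eventually.of_forall fun x => (localRep_dWedge ρ ψ x₀ x).symm)

end Differential

/-! ### The local estimate for a Lipschitz cutoff -/

section EuclideanEstimate

variable {n : ℕ} {k l : ℕ} {p q : ℝ≥0∞} {B : Set (EuclideanSpace ℝ (Fin n))}
  {r : EuclideanSpace ℝ (Fin n) → ℝ}

lemma covWedge_add_left (lam lam' : EuclideanSpace ℝ (Fin n) →L[ℝ] ℝ)
    (β : EuclideanSpace ℝ (Fin n) [⋀^Fin l]→L[ℝ] ℝ) :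
    covWedge (lam + lam') β = covWedge lam β + covWedge lam' β := by
  ext v
  rw [ContinuousAlternatingMap.add_apply, covWedge_apply, covWedge_apply, covWedge_apply,
    ← Finset.sum_add_distrib]
  exact Finset.sum_congr rfl fun i _ => by rw [add_apply]; ring

lemma covWedge_smul_left (c : ℝ) (lam : EuclideanSpace ℝ (Fin n) →L[ℝ] ℝ)
    (β : EuclideanSpace ℝ (Fin n) [⋀^Fin l]→L[ℝ] ℝ) :
    covWedge (c • lam) β = c • covWedge lam β := by
  ext v
  rw [ContinuousAlternatingMap.smul_apply, covWedge_apply, covWedge_apply, smul_eq_mul,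
    Finset.mul_sum]
  exact Finset.sum_congr rfl fun i _ => by rw [smul_apply, smul_eq_mul]; ring

/-- The local form of Stokes' theorem for a cutoff function which is the product of a smooth
function and of a function which is Lipschitz for the seminorm `‖A ·‖`. -/
lemma abs_integral_lipschitz_cutoff_le {V : Type*} [NormedAddCommGroup V] [NormedSpace ℝ V]
    (hpq : p.HolderConjugate q) (hq : 1 ≤ q) (hq' : q ≠ ⊤)
    (hB : IsOpen B) (h : k + 1 + l = n) (h' : k + (l + 1) = n)
    {a : EuclideanSpace ℝ (Fin n) → EuclideanSpace ℝ (Fin n) [⋀^Fin k]→L[ℝ] ℝ}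
    {w : EuclideanSpace ℝ (Fin n) → EuclideanSpace ℝ (Fin n) [⋀^Fin (k + 1)]→L[ℝ] ℝ}
    {b : EuclideanSpace ℝ (Fin n) → EuclideanSpace ℝ (Fin n) [⋀^Fin l]→L[ℝ] ℝ}
    {v : EuclideanSpace ℝ (Fin n) → EuclideanSpace ℝ (Fin n) [⋀^Fin (l + 1)]→L[ℝ] ℝ}
    (ha : MemLp a p (volume.restrict B)) (hw : MemLp w p (volume.restrict B))
    (haw : IsWeakDOn B a w)
    (hb : MemLp b q (volume.restrict B)) (hv : MemLp v q (volume.restrict B))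
    (hbv : IsWeakDOn B b v) (hr : ContDiff ℝ ∞ r) (hrc : HasCompactSupport r)
    (hrB : tsupport r ⊆ B) {A : EuclideanSpace ℝ (Fin n) →L[ℝ] V}
    {G : EuclideanSpace ℝ (Fin n) → ℝ} {c : ℝ} (hc : 0 ≤ c)
    (hG : ∀ y z, |G y - G z| ≤ c * ‖A (y - z)‖) {W : EuclideanSpace ℝ (Fin n) → ℝ}
    (hWi : IntegrableOn W B)
    (hW : ∀ y ∈ B, ∀ lam : EuclideanSpace ℝ (Fin n) →L[ℝ] ℝ, (∀ u, |lam u| ≤ c * ‖A u‖) →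
      |r y * formWedge h' (a y) (covWedge lam (b y))| ≤ W y) :
    |∫ y in B, G y * (r y * (formWedge h' (a y) (v y) - (-1) ^ (k + 1) * formWedge h (w y) (b y)) +
      formWedge h' (a y) (covWedge (fderiv ℝ r y) (b y)))| ≤ ∫ y in B, W y := by
  -- `Z` is the factor of `G` in Stokes' formula for the cutoff `G r`. The term with `dr` is kept
  -- inside it on purpose: over a partition of unity such terms add up to zero, whereas the
  -- remaining term with `dG` is estimated by `W`.
  set Z : EuclideanSpace ℝ (Fin n) → ℝ := fun y =>
    r y * (formWedge h' (a y) (v y) - (-1) ^ (k + 1) * formWedge h (w y) (b y)) +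
      formWedge h' (a y) (covWedge (fderiv ℝ r y) (b y)) with hZ
  have iav := integrable_formWedge h' hpq ha (memLp_smul_cutoff hr.continuous hrc hv)
  have iwb := integrable_formWedge h hpq hw (memLp_smul_cutoff hr.continuous hrc hb)
  have idr := integrable_formWedge h' hpq ha (memLp_covWedge_cutoff hr hrc hb)
  have hZi : IntegrableOn Z B := by
    refine ((iav.sub (iwb.const_mul ((-1) ^ (k + 1)))).add idr).congr
      (Eventually.of_forall fun y => ?_)
    simp only [hZ, Pi.add_apply, Pi.sub_apply, formWedge_smul_right]
    ring
  have key : ∀ ε > 0, |∫ y in B, G y * Z y| ≤ ε * (∫ y in B, |Z y|) + ∫ y in B, W y := by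
    intro ε hε
    -- `G` is replaced by a smooth `g` at distance at most `ε` whose differential obeys the same
    -- bound, and Stokes' formula is applied with the cutoff `g r`. Going back to `G` costs `ε ∫
    -- |Z|`.
    obtain ⟨g, hg, hgG, hg'⟩ := exists_contDiff_approx_lipschitz hc hG hε
    have hgr : ContDiff ℝ ∞ fun y => g y * r y := hg.mul hr
    have hgrc : HasCompactSupport fun y => g y * r y := hrc.mul_left
    have hgrB : tsupport (fun y => g y * r y) ⊆ B := (tsupport_mul_subset_right).trans hrB
    have hst := integral_cutoff_formWedge hpq hq hq' hB h h' ha hw haw hb hv hbv hgr hgrc hgrB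
    have hfd : ∀ y, fderiv ℝ (fun y => g y * r y) y = g y • fderiv ℝ r y + r y • fderiv ℝ g y :=
      fun y => fderiv_fun_mul (hg.differentiable (by norm_num) y) (hr.differentiable (by norm_num) y)
    have jav := integrable_formWedge h' hpq ha (memLp_smul_cutoff hgr.continuous hgrc hv)
    have jwb := integrable_formWedge h hpq hw (memLp_smul_cutoff hgr.continuous hgrc hb)
    have jdr := integrable_formWedge h' hpq ha (memLp_covWedge_cutoff hgr hgrc hb)
    simp only [formWedge_smul_right] at jav jwb
    have jsub : IntegrableOn (fun y => g y * r y * formWedge h' (a y) (v y) -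
        (-1) ^ (k + 1) * (g y * r y * formWedge h (w y) (b y))) B := jav.sub (jwb.const_mul _)
    have e : ∀ y, g y * Z y + r y * formWedge h' (a y) (covWedge (fderiv ℝ g y) (b y)) =
        (g y * r y * formWedge h' (a y) (v y) -
          (-1) ^ (k + 1) * (g y * r y * formWedge h (w y) (b y))) +
        formWedge h' (a y) (covWedge (fderiv ℝ (fun y => g y * r y) y) (b y)) := by
      intro y
      rw [hfd, covWedge_add_left, covWedge_smul_left, covWedge_smul_left, formWedge_add_right,
        formWedge_smul_right, formWedge_smul_right, hZ]
      ring
    have hzero : ∫ y in B, (g y * Z y + r y * formWedge h' (a y) (covWedge (fderiv ℝ g y) (b y))) = 0 := by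
      simp only [e]
      rw [integral_add jsub jdr, integral_sub jav (jwb.const_mul _),
        integral_const_mul, hst, neg_add_cancel]
    have hsum : IntegrableOn (fun y => g y * Z y +
        r y * formWedge h' (a y) (covWedge (fderiv ℝ g y) (b y))) B := by
      simp only [e]
      exact jsub.add jdr
    have hgGZ : IntegrableOn (fun y => (G y - g y) * Z y) B := by
      have hGc : Continuous G := by
        rw [continuous_iff_continuousAt]
        intro y
        have h1 : Tendsto (fun z => c * ‖A (z - y)‖) (𝓝 y) (𝓝 0) := by
          have : Continuous fun z => c * ‖A (z - y)‖ := by fun_prop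
          simpa using this.tendsto y
        exact tendsto_iff_norm_sub_tendsto_zero.2
          (squeeze_zero (fun _ => norm_nonneg _) (fun z => hG z y) h1)
      refine hZi.bdd_mul (c := ε) (hGc.sub hg.continuous).aestronglyMeasurable
        (Eventually.of_forall fun y => ?_)
      rw [Real.norm_eq_abs, abs_sub_comm]
      exact hgG y
    have hrg : IntegrableOn (fun y => r y * formWedge h' (a y) (covWedge (fderiv ℝ g y) (b y))) B := by
      obtain ⟨C, hC⟩ := hrc.exists_bound_of_continuous hr.continuous
      have hgc : Continuous (fderiv ℝ g) := hg.continuous_fderiv (by norm_num)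
      have hgl : ∀ y, ‖fderiv ℝ g y‖ ≤ c * ‖A‖ := fun y =>
        ContinuousLinearMap.opNorm_le_bound _ (by positivity) fun u => (hg' y u).trans (by
          rw [mul_assoc]
          exact mul_le_mul_of_nonneg_left (A.le_opNorm u) hc)
      have hm : MemLp (fun y => covWedge (fderiv ℝ g y) (b y)) q (volume.restrict B) := by
        refine hb.of_le_mul (c := (l + 1) * (c * ‖A‖))
          (aestronglyMeasurable_covWedge hgc.aestronglyMeasurable hb.1)
          (Eventually.of_forall fun y => ?_)
        refine (norm_covWedge_le _ _).trans (mul_le_mul_of_nonneg_right ?_ (norm_nonneg _))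
        exact mul_le_mul_of_nonneg_left (hgl y) (by positivity)
      exact (integrable_formWedge h' hpq ha hm).bdd_mul (c := C) hr.continuous.aestronglyMeasurable
        (Eventually.of_forall hC)
    have hsplit : ∫ y in B, G y * Z y = (∫ y in B, (G y - g y) * Z y) -
        ∫ y in B, r y * formWedge h' (a y) (covWedge (fderiv ℝ g y) (b y)) := by
      have hd : IntegrableOn (fun y => (G y - g y) * Z y -
          r y * formWedge h' (a y) (covWedge (fderiv ℝ g y) (b y))) B := hgGZ.sub hrg
      rw [← integral_sub hgGZ hrg, ← add_zero (∫ y in B, _ - _), ← hzero, ← integral_add hd hsum]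
      refine integral_congr_ae (Eventually.of_forall fun y => ?_)
      simp only
      ring
    rw [hsplit]
    refine (abs_sub _ _).trans (add_le_add ?_ ?_)
    · rw [← Real.norm_eq_abs, ← integral_const_mul]
      refine norm_integral_le_of_norm_le (hZi.abs.const_mul ε) (Eventually.of_forall fun y => ?_)
      rw [norm_mul, Real.norm_eq_abs, Real.norm_eq_abs, abs_sub_comm]
      exact mul_le_mul_of_nonneg_right (hgG y) (abs_nonneg _)
    · rw [← Real.norm_eq_abs]
      refine norm_integral_le_of_norm_le hWi ?_
      filter_upwards [ae_restrict_mem hB.measurableSet] with y hy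
      exact hW y hy _ (hg' y)
  refine le_of_forall_pos_le_add fun δ hδ => ?_
  have hN : 0 ≤ ∫ y in B, |Z y| := integral_nonneg fun _ => abs_nonneg _
  -- Makes the error `ε ∫ |Z|` at most `δ`, even if the integral is zero.
  have := key (δ / ((∫ y in B, |Z y|) + 1)) (by positivity)
  have h2 : δ / ((∫ y in B, |Z y|) + 1) * (∫ y in B, |Z y|) ≤ δ := by
    rw [div_mul_eq_mul_div, div_le_iff₀ (by positivity)]
    nlinarith
  linarith

end EuclideanEstimate

/-! ### Functions supported in a chart domain -/

section CutoffInChart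

variable {n : ℕ} {M : Type*} [EMetricSpace M] [ChartedSpace (EuclideanSpace ℝ (Fin n)) M]

variable (n) in
/-- The expression in a chart of a function supported in the domain of this chart. -/
def chartFun (x₀ : M) (ρ : M → ℝ) : EuclideanSpace ℝ (Fin n) → ℝ :=
  (extChartAt (𝓡 n) x₀).target.indicator fun y => ρ ((extChartAt (𝓡 n) x₀).symm y)

lemma chartFun_apply {x₀ : M} (ρ : M → ℝ) {y : EuclideanSpace ℝ (Fin n)}
    (hy : y ∈ (extChartAt (𝓡 n) x₀).target) :
    chartFun n x₀ ρ y = ρ ((extChartAt (𝓡 n) x₀).symm y) :=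
  indicator_of_mem hy _

lemma isCompact_extChartAt_image {x₀ : M} {S : Set M} (hS : IsCompact S)
    (hSs : S ⊆ (extChartAt (𝓡 n) x₀).source) : IsCompact (extChartAt (𝓡 n) x₀ '' S) :=
  hS.image_of_continuousOn ((continuousOn_extChartAt x₀).mono hSs)

lemma support_chartFun_subset {x₀ : M} (ρ : M → ℝ) :
    Function.support (chartFun n x₀ ρ) ⊆ extChartAt (𝓡 n) x₀ '' tsupport ρ := by
  intro y hy
  have hyt : y ∈ (extChartAt (𝓡 n) x₀).target := by
    by_contra h
    exact hy (indicator_of_notMem h _)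
  rw [Function.mem_support, chartFun_apply ρ hyt] at hy
  exact ⟨_, subset_tsupport _ hy, (extChartAt (𝓡 n) x₀).right_inv hyt⟩

lemma tsupport_chartFun_subset {x₀ : M} {ρ : M → ℝ} (hρ : HasCompactSupport ρ)
    (hρs : tsupport ρ ⊆ (extChartAt (𝓡 n) x₀).source) :
    tsupport (chartFun n x₀ ρ) ⊆ extChartAt (𝓡 n) x₀ '' tsupport ρ :=
  closure_minimal (support_chartFun_subset ρ) (isCompact_extChartAt_image hρ hρs).isClosed

lemma hasCompactSupport_chartFun {x₀ : M} {ρ : M → ℝ} (hρ : HasCompactSupport ρ)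
    (hρs : tsupport ρ ⊆ (extChartAt (𝓡 n) x₀).source) : HasCompactSupport (chartFun n x₀ ρ) :=
  (isCompact_extChartAt_image hρ hρs).of_isClosed_subset (isClosed_tsupport _)
    (tsupport_chartFun_subset hρ hρs)

lemma fderiv_chartFun {x₀ : M} (ρ : M → ℝ) {y : EuclideanSpace ℝ (Fin n)}
    (hy : y ∈ (extChartAt (𝓡 n) x₀).target) : fderiv ℝ (chartFun n x₀ ρ) y =
      fderiv ℝ (fun y => ρ ((extChartAt (𝓡 n) x₀).symm y)) y := by
  refine Filter.EventuallyEq.fderiv_eq ?_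
  filter_upwards [(isOpen_extChartAt_target (I := 𝓡 n) x₀).mem_nhds hy] with z hz
  exact chartFun_apply ρ hz

variable [IsManifold (𝓡 n) ∞ M]

/-- The support is compact in the chart domain, so its image is closed and contained in the open
target; extension by zero is therefore smooth. -/
lemma contDiff_chartFun {x₀ : M} {ρ : M → ℝ} (hρ : ContMDiff (𝓡 n) 𝓘(ℝ, ℝ) ∞ ρ)
    (hρc : HasCompactSupport ρ) (hρs : tsupport ρ ⊆ (extChartAt (𝓡 n) x₀).source) :
    ContDiff ℝ ∞ (chartFun n x₀ ρ) := by
  refine contMDiff_iff_contDiff.1 (contMDiff_of_tsupport fun y hy => ContDiffAt.contMDiffAt ?_)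
  obtain ⟨x, hx, rfl⟩ := tsupport_chartFun_subset hρc hρs hy
  have ht := (isOpen_extChartAt_target (I := 𝓡 n) x₀).mem_nhds
    ((extChartAt (𝓡 n) x₀).map_source (hρs hx))
  refine ((contDiffOn_comp_symm hρ x₀).contDiffAt ht).congr_of_eventuallyEq ?_
  filter_upwards [ht] with z hz
  exact chartFun_apply ρ hz

lemma dFun_eq_zero {ρ : M → ℝ} {x : M} (hx : x ∉ tsupport ρ) : dFun n ρ x = 0 := by
  rw [← dFun_const (n := n) 0 x]
  exact dFun_eq_of_eventuallyEq (notMem_tsupport_iff_eventuallyEq.1 hx)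

end CutoffInChart

/-! ### The local estimate on the manifold -/

section GoodBallStokes

variable {n : ℕ} {M : Type*} [EMetricSpace M] [ChartedSpace (EuclideanSpace ℝ (Fin n)) M]
  [IsManifold (𝓡 n) ∞ M] [RiemannianBundle (fun x : M => TangentSpace (𝓡 n) x)]
  {o : (x : M) → Orientation ℝ (TangentSpace (𝓡 n) x) (Fin n)} {x₀ : M} (B : GoodBall o x₀)

lemma norm_dFun_eq_zero {ρ : M → ℝ} {x : M} (hx : x ∉ tsupport ρ) : ‖dFun n ρ x‖ = 0 := by
  refine le_antisymm (ContinuousLinearMap.opNorm_le_bound _ le_rfl fun w => ?_)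
    (ContinuousLinearMap.opNorm_nonneg _)
  rw [dFun_eq_zero hx, zero_mul]
  exact (norm_zero (E := ℝ)).le

namespace GoodBall

lemma dom_subset_source : B.dom ⊆ (extChartAt (𝓡 n) x₀).source := inter_subset_left

lemma norm_coordL_center_le {x : M} (hx : x ∈ B.dom) (v : EuclideanSpace ℝ (Fin n)) :
    ‖coordL n x₀ x₀ v‖ ≤ 2 * ‖coordL n x₀ x v‖ := by
  have := (B.coordL_le_center _ hx.2 v).2
  rwa [(extChartAt (𝓡 n) x₀).left_inv hx.1] at this

lemma norm_coordInv_le {x : M} (hx : x ∈ B.dom) (w : TangentSpace (𝓡 n) x) :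
    ‖coordInv n x₀ x w‖ ≤ ‖coordInv n x₀ x₀‖ * 2 * ‖w‖ := by
  have h1 := B.norm_coordL_center_le hx (coordInv n x₀ x w)
  rw [coordL_coordInv hx.1] at h1
  have h2 := (coordInv n x₀ x₀).le_opNorm (coordL n x₀ x₀ (coordInv n x₀ x w))
  rw [coordInv_coordL (mem_extChartAt_source x₀)] at h2
  rw [mul_assoc]
  exact h2.trans (mul_le_mul_of_nonneg_left h1 (norm_nonneg _))

lemma formNorm_le_norm_localRep {k : ℕ} (θ : DiffForm n M k) {x : M} (hx : x ∈ B.dom) :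
    formNorm n (θ x) ≤ (n : ℝ) ^ k * (‖coordInv n x₀ x₀‖ * 2) ^ k * ‖localRep x₀ θ x‖ :=
  formNorm_le_norm_compContinuousLinearMap (n := n) (coordL n x₀ x) (coordInv n x₀ x)
    (coordL_coordInv hx.1) (by positivity) (B.norm_coordInv_le hx) _

/-- In the chart the differential is continuous with compact support; the metric comparison on the
good ball turns its Euclidean bound into a Riemannian one. -/
lemma exists_norm_dFun_le {ρ : M → ℝ} (hρ : ContMDiff (𝓡 n) 𝓘(ℝ, ℝ) ∞ ρ)
    (hρc : HasCompactSupport ρ) (hρB : tsupport ρ ⊆ B.dom) : ∃ C, ∀ x, ‖dFun n ρ x‖ ≤ C := by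
  have hρs := hρB.trans B.dom_subset_source
  obtain ⟨C, hC⟩ := ((hasCompactSupport_chartFun hρc hρs).fderiv ℝ).exists_bound_of_continuous
    ((contDiff_chartFun hρ hρc hρs).continuous_fderiv (by norm_num))
  have hC0 : 0 ≤ C := (norm_nonneg _).trans (hC 0)
  refine ⟨C * (‖coordInv n x₀ x₀‖ * 2), fun x => ?_⟩
  by_cases hx : x ∈ tsupport ρ
  · have hxB := hρB hx
    refine ContinuousLinearMap.opNorm_le_bound _ (by positivity) fun w => ?_
    have h1 := dFun_comp_coordL hρ hxB.1
    rw [← fderiv_chartFun ρ ((extChartAt (𝓡 n) x₀).map_source hxB.1)] at h1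
    have h2 := ContinuousLinearMap.ext_iff.1 h1 (coordInv n x₀ x w)
    rw [ContinuousLinearMap.comp_apply, coordL_coordInv hxB.1] at h2
    rw [h2, mul_assoc]
    refine (ContinuousLinearMap.le_opNorm _ _).trans ?_
    exact mul_le_mul (hC _) (B.norm_coordInv_le hxB w) (norm_nonneg _) hC0
  · rw [norm_dFun_eq_zero hx]
    positivity

variable [IsContMDiffRiemannianBundle (𝓡 n) ∞ (EuclideanSpace ℝ (Fin n))
    (fun x : M => TangentSpace (𝓡 n) x)] [MeasurableSpace M] [BorelSpace M]
    [SecondCountableTopology M]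

lemma dWedge_mem_lpForms {l : ℕ} {q : ℝ≥0∞} {ρ : M → ℝ} (hρ : ContMDiff (𝓡 n) 𝓘(ℝ, ℝ) ∞ ρ)
    (hρc : HasCompactSupport ρ) (hρB : tsupport ρ ⊆ B.dom) {ψ : DiffForm n M l}
    (hψ : ψ ∈ lpForms n M l q) : dWedge n ρ ψ ∈ lpForms n M (l + 1) q := by
  obtain ⟨C, hC⟩ := B.exists_norm_dFun_le hρ hρc hρB
  have hm := hψ.1.dWedge hρ
  refine ⟨hm, ?_⟩
  have h1 : MemLp (fun x => formNorm n (dWedge n ρ ψ x)) q (riemannianVolume n M) := by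
    refine (memLp_formNorm hψ).of_le_mul (c := (n : ℝ) ^ (l + 1) * ((l + 1) * formConst n l) * C)
      (aemeasurable_formNorm hm).aestronglyMeasurable (Eventually.of_forall fun x => ?_)
    rw [Real.norm_of_nonneg (formNorm_nonneg _), Real.norm_of_nonneg (formNorm_nonneg _), mul_assoc]
    refine (formNorm_dWedge_le ρ ψ x).trans ?_
    have := formConst_nonneg n l
    refine mul_le_mul_of_nonneg_left ?_ (by positivity)
    exact mul_le_mul_of_nonneg_right (hC x) (formNorm_nonneg _)
  exact h1.2

lemma integrableOn_density_mul {F : M → ℝ} (hF : IntegrableOn F B.dom (riemannianVolume n M)) :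
    IntegrableOn (fun y => √(gram n x₀ ((extChartAt (𝓡 n) x₀).symm y)).det *
      F ((extChartAt (𝓡 n) x₀).symm y)) B.ball := by
  have h1 := hF.1
  rw [IntegrableOn, restrict_dom] at hF
  rw [restrict_dom] at h1
  rw [integrable_map_measure h1 B.aemeasurable_symm', ballMeasure,
    integrable_withDensity_iff_integrable_smul₀' B.aemeasurable_density
      (Eventually.of_forall fun _ => ENNReal.ofReal_lt_top)] at hF
  refine hF.congr (Eventually.of_forall fun y => ?_)
  simp only [smul_eq_mul, Function.comp_apply]
  rw [ENNReal.toReal_ofReal (Real.sqrt_nonneg _)]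

end GoodBall

/-- The constant in the estimates of the error term of Stokes' theorem. -/
def stokesConst (n k l : ℕ) : ℝ :=
  wedgeConst n k (l + 1) * ((n : ℝ) ^ (l + 1) * ((l + 1) * formConst n l))

lemma stokesConst_nonneg (n k l : ℕ) : 0 ≤ stokesConst n k l := by
  have := wedgeConst_nonneg n k (l + 1)
  have := formConst_nonneg n l
  unfold stokesConst
  positivity

namespace GoodBall

variable [IsContMDiffRiemannianBundle (𝓡 n) ∞ (EuclideanSpace ℝ (Fin n))
  (fun x : M => TangentSpace (𝓡 n) x)] [MeasurableSpace M] [BorelSpace M]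

/-- The covector is controlled by the metric at the centre, hence, with an extra factor `2`, by the
metric at the point. The constant does not depend on the ball, which is what allows local estimates
to be added. -/
lemma abs_formWedge_covWedge_le {k l : ℕ} (h' : k + (l + 1) = n) (θ : DiffForm n M k)
    (ψ : DiffForm n M l) {y : EuclideanSpace ℝ (Fin n)} (hy : y ∈ B.ball)
    {lam : EuclideanSpace ℝ (Fin n) →L[ℝ] ℝ} {c : ℝ} (hc : 0 ≤ c)
    (hlam : ∀ u, |lam u| ≤ c * ‖coordL n x₀ x₀ u‖) :
    |formWedge h' (chartRep x₀ θ y) (covWedge lam (chartRep x₀ ψ y))| ≤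
      stokesConst n k l * (2 * c) * (√(gram n x₀ ((extChartAt (𝓡 n) x₀).symm y)).det *
        (formNorm n (θ ((extChartAt (𝓡 n) x₀).symm y)) *
          formNorm n (ψ ((extChartAt (𝓡 n) x₀).symm y)))) := by
  set ζ : DiffForm n M (l + 1) := fun x => covWedge (lam.comp (coordInv n x₀ x)) (ψ x) with hζ
  have hyt := B.ball_subset_target hy
  have hx := (extChartAt (𝓡 n) x₀).map_target hyt
  have h1 : chartRep x₀ ζ y = covWedge lam (chartRep x₀ ψ y) := by
    have : (lam.comp (coordInv n x₀ ((extChartAt (𝓡 n) x₀).symm y))).comp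
        (coordL n x₀ ((extChartAt (𝓡 n) x₀).symm y)) = lam := by
      ext v
      simp only [ContinuousLinearMap.comp_apply]
      rw [coordInv_coordL hx]
    have h2 := covWedge_comp (lam.comp (coordInv n x₀ ((extChartAt (𝓡 n) x₀).symm y)))
      (ψ ((extChartAt (𝓡 n) x₀).symm y)) (coordL n x₀ ((extChartAt (𝓡 n) x₀).symm y))
    rw [this] at h2
    exact h2
  have hs : |B.sign| = 1 := by
    have := B.sign_mul_sign
    rw [← abs_mul_abs_self] at this
    nlinarith [abs_nonneg B.sign]
  set x := (extChartAt (𝓡 n) x₀).symm y with hxdef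
  have hl : ‖lam.comp (coordInv n x₀ x)‖ ≤ 2 * c := by
    refine ContinuousLinearMap.opNorm_le_bound _ (by positivity) fun w => ?_
    have h2 := B.norm_coordL_center_le (B.symm_mem_dom hy) (coordInv n x₀ x w)
    rw [coordL_coordInv hx] at h2
    refine (hlam _).trans ((mul_le_mul_of_nonneg_left h2 hc).trans_eq ?_)
    ring
  have hn : formNorm n (ζ x) ≤
      (n : ℝ) ^ (l + 1) * ((l + 1) * formConst n l) * (2 * c * formNorm n (ψ x)) := by
    refine (formNorm_covWedge_le _ _).trans ?_
    have := formConst_nonneg n l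
    refine mul_le_mul_of_nonneg_left ?_ (by positivity)
    exact mul_le_mul_of_nonneg_right hl (formNorm_nonneg _)
  rw [← h1, B.formWedge_chartRep h' θ ζ hy, abs_mul, hs, one_mul, abs_mul,
    abs_of_nonneg (Real.sqrt_nonneg _)]
  have h3 := (abs_pairing_le o h' θ ζ x).trans (mul_le_mul_of_nonneg_left
    (mul_le_mul_of_nonneg_left hn (formNorm_nonneg (θ x))) (wedgeConst_nonneg n k (l + 1)))
  refine (mul_le_mul_of_nonneg_left h3 (Real.sqrt_nonneg _)).trans_eq ?_
  rw [stokesConst]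
  ring

variable [SecondCountableTopology M] [IsRiemannianManifold (𝓡 n) M]

/-- The local form of Stokes' theorem in a good ball, for the product of a smooth cutoff function
and of a Lipschitz function. -/
lemma abs_integral_le (ho : IsContinuousOrientation o) {p q : ℝ} (hpq : p.HolderConjugate q)
    {k l : ℕ} (h : k + 1 + l = n) (h' : k + (l + 1) = n)
    {θ : DiffForm n M k} {η : DiffForm n M (k + 1)} {ψ : DiffForm n M l} {ξ : DiffForm n M (l + 1)}
    (hθ : θ ∈ lpForms n M k (ENNReal.ofReal p)) (hη : η ∈ lpForms n M (k + 1) (ENNReal.ofReal p))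
    (hψ : ψ ∈ lpForms n M l (ENNReal.ofReal q)) (hξ : ξ ∈ lpForms n M (l + 1) (ENNReal.ofReal q))
    (hd : IsWeakDOn B.ball (chartRep x₀ θ) (chartRep x₀ η))
    (hd' : IsWeakDOn B.ball (chartRep x₀ ψ) (chartRep x₀ ξ))
    {ρ : M → ℝ} (hρ : ContMDiff (𝓡 n) 𝓘(ℝ, ℝ) ∞ ρ) (hρc : HasCompactSupport ρ)
    (hρB : tsupport ρ ⊆ B.dom) (hρ0 : ∀ x, 0 ≤ ρ x) (hρ1 : ∀ x, ρ x ≤ 1) {f : M → ℝ} {L : ℝ≥0}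
    (hf : LipschitzWith L f) :
    |∫ x, f x * (ρ x * (pairing o h' θ ξ x - (-1) ^ (k + 1) * pairing o h η ψ x) +
        pairing o h' θ (dWedge n ρ ψ) x) ∂(riemannianVolume n M)| ≤
      stokesConst n k l * (4 * L) *
        ∫ x, ρ x * (formNorm n (θ x) * formNorm n (ψ x)) ∂(riemannianVolume n M) := by
  have hpq' : (ENNReal.ofReal p).HolderConjugate (ENNReal.ofReal q) := hpq.ennrealOfReal
  have hq : 1 ≤ ENNReal.ofReal q := ENNReal.one_le_ofReal.2 hpq.symm.lt.le
  have hρs := hρB.trans B.dom_subset_source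
  have hnot : ∀ x ∉ B.dom, ρ x = 0 := fun x hx =>
    image_eq_zero_of_notMem_tsupport fun h => hx (hρB h)
  have hnot' : ∀ x ∉ B.dom, pairing o h' θ (dWedge n ρ ψ) x = 0 := fun x hx => by
    have h1 := abs_pairing_le o h' θ (dWedge n ρ ψ) x
    have h2 := formNorm_dWedge_le ρ ψ x
    rw [norm_dFun_eq_zero fun h => hx (hρB h), zero_mul, mul_zero] at h2
    rw [le_antisymm h2 (formNorm_nonneg _), mul_zero, mul_zero] at h1
    exact abs_nonpos_iff.1 h1
  have m1 := aestronglyMeasurable_pairing ho h' hθ.1 hξ.1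
  have m2 := aestronglyMeasurable_pairing ho h hη.1 hψ.1
  have m3 := aestronglyMeasurable_pairing ho h' hθ.1 (hψ.1.dWedge hρ)
  have m4 : AEStronglyMeasurable (fun x => f x * (ρ x *
      (pairing o h' θ ξ x - (-1) ^ (k + 1) * pairing o h η ψ x) +
        pairing o h' θ (dWedge n ρ ψ) x)) (riemannianVolume n M) :=
    hf.continuous.aestronglyMeasurable.mul
      ((hρ.continuous.aestronglyMeasurable.mul (m1.sub (m2.const_mul _))).add m3)
  have i5 : Integrable (fun x => ρ x * (formNorm n (θ x) * formNorm n (ψ x)))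
      (riemannianVolume n M) :=
    (integrable_formNorm_mul hpq hθ hψ).bdd_mul (c := 1) hρ.continuous.aestronglyMeasurable
      (Eventually.of_forall fun x => by
        rw [Real.norm_of_nonneg (hρ0 x)]
        exact hρ1 x)
  -- Read in the chart, `f` is `2 L`-Lipschitz for the norm at the centre. Comparison of that norm
  -- with the metric at each point brings another factor `2`, whence `4 L`.
  have hlip : ∀ y ∈ B.ball, ∀ z ∈ B.ball,
      |f ((extChartAt (𝓡 n) x₀).symm y) - f ((extChartAt (𝓡 n) x₀).symm z)| ≤
        (L * 2 : ℝ≥0) * ‖coordL n x₀ x₀ (y - z)‖ := by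
    intro y hy z hz
    have h1 := edist_extChartAt_symm_le (fun y hy => ⟨B.mem_target y hy, B.coordL_le_center y hy⟩)
      hz hy
    have h2 := (hf ((extChartAt (𝓡 n) x₀).symm z) ((extChartAt (𝓡 n) x₀).symm y)).trans
      (mul_le_mul_right h1 _)
    rw [edist_dist, ← ENNReal.ofReal_coe_nnreal, ← ENNReal.ofReal_mul (by positivity),
      ENNReal.ofReal_le_ofReal_iff (by positivity), dist_comm, Real.dist_eq] at h2
    refine h2.trans_eq ?_
    push_cast
    ring
  -- Smoothing by convolution requires a function on all of `ℝⁿ`, with the same Lipschitz bound.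
  obtain ⟨G, hGB, hG⟩ := exists_extension_lipschitz (A := coordL n x₀ x₀) (S := coordInv n x₀ x₀)
    (fun v => coordInv_coordL (mem_extChartAt_source x₀) v)
    (F := fun y => f ((extChartAt (𝓡 n) x₀).symm y)) hlip
  have hmain := abs_integral_lipschitz_cutoff_le hpq' hq ENNReal.ofReal_ne_top B.isOpen_ball h h'
    (B.memLp_chartRep hθ) (B.memLp_chartRep hη) hd (B.memLp_chartRep hψ) (B.memLp_chartRep hξ) hd'
    (contDiff_chartFun hρ hρc hρs) (hasCompactSupport_chartFun hρc hρs)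
    ((tsupport_chartFun_subset hρc hρs).trans (by
      rintro _ ⟨x, hx, rfl⟩
      exact (hρB hx).2))
    (A := coordL n x₀ x₀) (G := G) (c := (L * 2 : ℝ≥0)) (by positivity) hG
    (W := fun y => stokesConst n k l * (4 * L) * (√(gram n x₀ ((extChartAt (𝓡 n) x₀).symm y)).det *
      (fun x => ρ x * (formNorm n (θ x) * formNorm n (ψ x))) ((extChartAt (𝓡 n) x₀).symm y)))
    ((B.integrableOn_density_mul i5.integrableOn).const_mul _) (by
      intro y hy lam hlam
      rw [abs_mul, chartFun_apply ρ (B.ball_subset_target hy), abs_of_nonneg (hρ0 _)]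
      refine (mul_le_mul_of_nonneg_left (B.abs_formWedge_covWedge_le h' θ ψ hy (by positivity) hlam)
        (hρ0 _)).trans_eq ?_
      push_cast
      ring)
  rw [integral_const_mul, ← B.setIntegral_dom i5.1.restrict] at hmain
  rw [setIntegral_eq_integral_of_forall_compl_eq_zero
    (f := fun x => ρ x * (formNorm n (θ x) * formNorm n (ψ x)))
    fun x hx => by rw [hnot x hx, zero_mul]] at hmain
  refine le_trans (le_of_eq ?_) hmain
  rw [← setIntegral_eq_integral_of_forall_compl_eq_zero (s := B.dom)
    fun x hx => by rw [hnot x hx, hnot' x hx, zero_mul, add_zero, mul_zero],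
    B.setIntegral_dom m4.restrict]
  have hs : |B.sign| = 1 := by
    have := B.sign_mul_sign
    rw [← abs_mul_abs_self] at this
    nlinarith [abs_nonneg B.sign]
  have hsx : ∀ t, |t| = |B.sign * t| := fun t => by rw [abs_mul, hs, one_mul]
  rw [hsx (∫ y in B.ball, G y * _), ← integral_const_mul]
  congr 1
  refine setIntegral_congr_fun B.measurableSet_ball fun y hy => ?_
  have hyt := B.ball_subset_target hy
  rw [fderiv_chartFun ρ hyt, ← chartRep_dWedge hρ ψ hyt, B.formWedge_chartRep h' θ ξ hy,
    B.formWedge_chartRep h η ψ hy, B.formWedge_chartRep h' θ (dWedge n ρ ψ) hy, hGB y hy,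
    chartFun_apply ρ hyt]
  linear_combination (-(f ((extChartAt (𝓡 n) x₀).symm y) *
    √(gram n x₀ ((extChartAt (𝓡 n) x₀).symm y)).det *
    (ρ ((extChartAt (𝓡 n) x₀).symm y) * (pairing o h' θ ξ ((extChartAt (𝓡 n) x₀).symm y) -
      (-1) ^ (k + 1) * pairing o h η ψ ((extChartAt (𝓡 n) x₀).symm y)) +
      pairing o h' θ (dWedge n ρ ψ) ((extChartAt (𝓡 n) x₀).symm y)))) * B.sign_mul_sign

end GoodBall

end GoodBallStokes

/-! ### Lipschitz cutoffs on a complete manifold -/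

section Cutoff

/-- Cutoff functions with small Lipschitz constants on a complete Riemannian manifold. -/
lemma exists_seq_lipschitz_cutoff (n : ℕ) (M : Type*) [EMetricSpace M]
    [ChartedSpace (EuclideanSpace ℝ (Fin n)) M]
    [RiemannianBundle (fun x : M => TangentSpace (𝓡 n) x)] [IsRiemannianManifold (𝓡 n) M]
    [CompleteSpace M] [SecondCountableTopology M] [Nonempty M] : ∃ (f : ℕ → M → ℝ) (K : ℕ → Set M),
    (∀ j : ℕ, LipschitzWith ((j : ℝ≥0) + 1)⁻¹ (f j)) ∧ (∀ j x, |f j x| ≤ 1) ∧ (∀ j, IsCompact (K j)) ∧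
    (∀ j, ∀ x ∉ K j, f j x = 0) ∧ ∀ x, Tendsto (fun j => f j x) atTop (𝓝 1) := by
  let d := TopologicalSpace.denseSeq M
  have hd : DenseRange d := TopologicalSpace.denseRange_denseSeq M
  have hpos : ∀ j : ℕ, (0 : ℝ) < j + 1 := fun j => by positivity
  -- The cutoff is `1` at the first `j + 1` points of a dense sequence and vanishes outside their
  -- thickening by `j + 1`. A single centre would not do: `M` may be disconnected, with points at
  -- infinite distance.
  let S : ℕ → Set M := fun j => d '' Iic j
  let f : ℕ → M → ℝ := fun j x => (thickenedIndicator (hpos j) (S j) x : ℝ)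
  have hL : ∀ j : ℕ, LipschitzWith ((j : ℝ≥0) + 1)⁻¹ (f j) := by
    intro j
    have h1 := lipschitzWith_thickenedIndicator (hpos j) (S j)
    have h2 : ((j : ℝ) + 1).toNNReal = j + 1 := by
      rw [Real.toNNReal_add (by positivity) zero_le_one]
      simp
    rw [h2] at h1
    exact fun x y => h1 x y
  refine ⟨f, fun j => ⋃ i ∈ Iic j, {y | edist (d i) y ≤ (((j : ℝ≥0) + 1 : ℝ≥0) : ℝ≥0∞)}, hL,
    fun j x => ?_, fun j => ?_, fun j x hx => ?_, fun x => ?_⟩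
  · rw [abs_of_nonneg (NNReal.coe_nonneg _)]
    exact_mod_cast thickenedIndicator_le_one (hpos j) (S j) x
  -- A finite union of closed balls, compact by Hopf–Rinow.
  · exact (finite_Iic j).isCompact_biUnion fun i _ => isCompact_edist_le n (d i) _
  · have : x ∉ Metric.thickening (j + 1 : ℝ) (S j) := by
      intro h
      obtain ⟨_, ⟨i, hi, rfl⟩, hxi⟩ := Metric.mem_thickening_iff_exists_edist_lt _ _ |>.1 h
      refine hx (mem_iUnion₂.2 ⟨i, hi, ?_⟩)
      rw [mem_ofPred_eq, edist_comm]
      refine hxi.le.trans_eq ?_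
      rw [ENNReal.ofReal_add (by positivity) zero_le_one]
      simp
    exact NNReal.coe_eq_zero.2 (thickenedIndicator_zero (hpos j) _ this)
  -- Some `d i` is within distance `1` of `x`, and the cutoff is `1` at `d i` once `j ≥ i`. So `f j
  -- x` differs from `1` by at most `1 / (j + 1)`.
  · obtain ⟨_, ⟨i, rfl⟩, hi⟩ := EMetric.mem_closure_iff.1 (hd x) 1 one_pos
    rw [tendsto_iff_dist_tendsto_zero]
    have hlim : Tendsto (fun j : ℕ => (((j : ℝ≥0) + 1 : ℝ≥0)⁻¹ : ℝ)) atTop (𝓝 0) := by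
      have := tendsto_one_div_add_atTop_nhds_zero_nat (𝕜 := ℝ)
      refine this.congr fun j => ?_
      push_cast
      rw [one_div]
    refine squeeze_zero' (Eventually.of_forall fun _ => dist_nonneg) ?_ hlim
    filter_upwards [eventually_ge_atTop i] with j hj
    have h1 : f j (d i) = 1 :=
      NNReal.coe_eq_one.2 (thickenedIndicator_one (hpos j) (S j) (mem_image_of_mem d hj))
    have h2 := hL j x (d i)
    rw [h1, edist_dist] at h2
    have h3 : ENNReal.ofReal (dist (f j x) 1) ≤ ENNReal.ofReal (((j : ℝ≥0) + 1 : ℝ≥0)⁻¹ : ℝ≥0) := by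
      refine h2.trans ?_
      rw [ENNReal.ofReal_coe_nnreal]
      exact mul_le_of_le_one_right' hi.le
    exact_mod_cast (ENNReal.ofReal_le_ofReal_iff (by positivity)).1 h3

end Cutoff

/-! ### Stokes' formula on a complete manifold -/

section GlobalStokes

variable {n : ℕ} {M : Type*} [EMetricSpace M] [ChartedSpace (EuclideanSpace ℝ (Fin n)) M]
  [IsManifold (𝓡 n) ∞ M] [RiemannianBundle (fun x : M => TangentSpace (𝓡 n) x)]
  {o : (x : M) → Orientation ℝ (TangentSpace (𝓡 n) x) (Fin n)}

/-- `η = dθ` in the sense of distributions in good balls. -/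
def IsLocalWeakD (o : (x : M) → Orientation ℝ (TangentSpace (𝓡 n) x) (Fin n)) {k : ℕ}
    (θ : DiffForm n M k) (η : DiffForm n M (k + 1)) : Prop :=
  ∀ (x₀ : M) (B : GoodBall o x₀), IsWeakDOn B.ball (chartRep x₀ θ) (chartRep x₀ η)

lemma sum_formWedge_covWedge {ι : Type*} (s : Finset ι) {k l : ℕ} (h : k + (l + 1) = n)
    (a : EuclideanSpace ℝ (Fin n) [⋀^Fin k]→L[ℝ] ℝ)
    (lam : ι → EuclideanSpace ℝ (Fin n) →L[ℝ] ℝ)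
    (b : EuclideanSpace ℝ (Fin n) [⋀^Fin l]→L[ℝ] ℝ) :
    ∑ i ∈ s, formWedge h a (covWedge (lam i) b) = formWedge h a (covWedge (∑ i ∈ s, lam i) b) := by
  classical
  induction s using Finset.induction_on with
  | empty =>
    rw [Finset.sum_empty, Finset.sum_empty, ← zero_smul ℝ (0 : EuclideanSpace ℝ (Fin n) →L[ℝ] ℝ),
      covWedge_smul_left, formWedge_smul_right, zero_mul]
  | insert i s hi ih =>
    rw [Finset.sum_insert hi, Finset.sum_insert hi, covWedge_add_left, formWedge_add_right, ih]

/-- The sum of the functions is constant near `x`, so their differentials add up to zero there, and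
the wedge is linear in the covector. -/
lemma sum_pairing_dWedge_eq_zero {ι : Type*} (s : Finset ι) {k l : ℕ} (h : k + (l + 1) = n)
    (θ : DiffForm n M k) (ψ : DiffForm n M l) {ρ : ι → M → ℝ}
    (hρ : ∀ i ∈ s, ContMDiff (𝓡 n) 𝓘(ℝ, ℝ) ∞ (ρ i)) {x : M}
    (hx : ∀ᶠ y in 𝓝 x, ∑ i ∈ s, ρ i y = 1) : ∑ i ∈ s, pairing o h θ (dWedge n (ρ i) ψ) x = 0 := by
  have hxx := mem_extChartAt_source (I := 𝓡 n) x
  have h1 : ∑ i ∈ s, dFun n (ρ i) x = 0 := by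
    rw [← dFun_sum s hρ, ← dFun_const (n := n) 1 x]
    exact dFun_eq_of_eventuallyEq hx
  have h2 : ∑ i ∈ s, (dFun n (ρ i) x).comp (coordL n x x) = 0 := by
    ext v
    have := ContinuousLinearMap.ext_iff.1 h1 (coordL n x x v)
    rw [sum_apply] at this ⊢
    exact this
  refine (mul_eq_zero.1 ?_).resolve_right (volFactor_ne_zero o hxx)
  rw [Finset.sum_mul]
  simp only [pairing_mul_volFactor, localRep_dWedge]
  rw [sum_formWedge_covWedge, h2, covWedge_zero_left,
    ← zero_smul ℝ (0 : EuclideanSpace ℝ (Fin n) [⋀^Fin (l + 1)]→L[ℝ] ℝ), formWedge_smul_right,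
    zero_mul]

variable [IsContMDiffRiemannianBundle (𝓡 n) ∞ (EuclideanSpace ℝ (Fin n))
  (fun x : M => TangentSpace (𝓡 n) x)] [MeasurableSpace M] [BorelSpace M]
  [SecondCountableTopology M]

/-- A smooth partition of unity on a compact set, subordinate to good balls. -/
lemma exists_partition_goodBall (ho : IsContinuousOrientation o) {K : Set M} (hK : IsCompact K) :
    ∃ (s : Finset M) (B : ∀ x, GoodBall o x) (ρ : s → M → ℝ),
      (∀ i, ContMDiff (𝓡 n) 𝓘(ℝ, ℝ) ∞ (ρ i)) ∧ (∀ i, HasCompactSupport (ρ i)) ∧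
      (∀ i, tsupport (ρ i) ⊆ (B i).dom) ∧ (∀ i x, 0 ≤ ρ i x) ∧ (∀ x ∈ K, ∑ i, ρ i x = 1) ∧
      ∀ x, ∑ i, ρ i x ≤ 1 := by
  have hlc : LocallyCompactSpace M := ChartedSpace.locallyCompactSpace (EuclideanSpace ℝ (Fin n)) M
  have B : ∀ x, GoodBall o x := fun x => (nonempty_goodBall ho x).some
  -- Balls of half the radius have compact closure inside the good balls; this makes the supports of
  -- the partition functions compact.
  set U : M → Set M := fun x => (extChartAt (𝓡 n) x).source ∩
    extChartAt (𝓡 n) x ⁻¹' Metric.ball (extChartAt (𝓡 n) x x) ((B x).radius / 2) with hU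
  have hUo : ∀ x, IsOpen (U x) := fun x =>
    (continuousOn_extChartAt x).isOpen_inter_preimage (isOpen_extChartAt_source x) Metric.isOpen_ball
  have hUm : ∀ x, x ∈ U x := fun x => ⟨mem_extChartAt_source x, Metric.mem_ball_self
    (half_pos (B x).radius_pos)⟩
  have hsub : ∀ x, Metric.closedBall (extChartAt (𝓡 n) x x) ((B x).radius / 2) ⊆ (B x).ball :=
    fun x => Metric.closedBall_subset_ball (half_lt_self (B x).radius_pos)
  have hUc : ∀ x, U x ⊆ (extChartAt (𝓡 n) x).symm ''
      Metric.closedBall (extChartAt (𝓡 n) x x) ((B x).radius / 2) := fun x z hz =>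
    ⟨extChartAt (𝓡 n) x z, Metric.ball_subset_closedBall hz.2, (extChartAt (𝓡 n) x).left_inv hz.1⟩
  have hcc : ∀ x, IsCompact ((extChartAt (𝓡 n) x).symm ''
      Metric.closedBall (extChartAt (𝓡 n) x x) ((B x).radius / 2)) := fun x =>
    (isCompact_closedBall _ _).image_of_continuousOn ((continuousOn_extChartAt_symm x).mono
      ((hsub x).trans (B x).ball_subset_target))
  obtain ⟨s, hs⟩ := hK.elim_finite_subcover U hUo fun x _ => mem_iUnion.2 ⟨x, hUm x⟩
  obtain ⟨f, hf⟩ := SmoothPartitionOfUnity.exists_isSubordinate (𝓡 n) hK.isClosed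
    (fun i : s => U i) (fun i => hUo i) (fun x hx => by
      obtain ⟨i, hi, hxi⟩ := mem_iUnion₂.1 (hs hx)
      exact mem_iUnion.2 ⟨⟨i, hi⟩, hxi⟩)
  refine ⟨s, B, fun i => f i, fun i => (f i).contMDiff, fun i =>
    (hcc i).of_isClosed_subset (isClosed_tsupport _) ((hf i).trans (hUc i)), fun i =>
    (hf i).trans fun z hz => ⟨hz.1, Metric.ball_subset_ball (half_le_self (B i).radius_pos.le) hz.2⟩,
    fun i x => f.nonneg i x, fun x hx => ?_, fun x => ?_⟩
  · rw [← finsum_eq_sum_of_fintype]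
    exact f.sum_eq_one hx
  · rw [← finsum_eq_sum_of_fintype]
    exact f.sum_le_one x

variable [IsRiemannianManifold (𝓡 n) M]

/-- Adds the local estimates over a partition of unity on `K`. The terms with `dρ_i` cancel; since
all balls have the same constant and `∑ ρ_i ≤ 1`, the bound does not depend on the number of balls,
hence not on `K`. -/
lemma abs_integral_lipschitz_le (ho : IsContinuousOrientation o) {p q : ℝ}
    (hpq : p.HolderConjugate q) {k l : ℕ} (h : k + 1 + l = n) (h' : k + (l + 1) = n)
    {θ : DiffForm n M k} {η : DiffForm n M (k + 1)} {ψ : DiffForm n M l} {ξ : DiffForm n M (l + 1)}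
    (hθ : θ ∈ lpForms n M k (ENNReal.ofReal p)) (hη : η ∈ lpForms n M (k + 1) (ENNReal.ofReal p))
    (hψ : ψ ∈ lpForms n M l (ENNReal.ofReal q)) (hξ : ξ ∈ lpForms n M (l + 1) (ENNReal.ofReal q))
    (hd : IsLocalWeakD o θ η) (hd' : IsLocalWeakD o ψ ξ) {f : M → ℝ} {L : ℝ≥0}
    (hf : LipschitzWith L f) (hf1 : ∀ x, |f x| ≤ 1) {K : Set M} (hK : IsCompact K)
    (hfK : ∀ x ∉ K, f x = 0) :
    |∫ x, f x * (pairing o h' θ ξ x - (-1) ^ (k + 1) * pairing o h η ψ x)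
        ∂(riemannianVolume n M)| ≤
      stokesConst n k l * (4 * L) *
        ∫ x, formNorm n (θ x) * formNorm n (ψ x) ∂(riemannianVolume n M) := by
  obtain ⟨s, B, ρ, hρ, hρc, hρB, hρ0, hρK, hρ1⟩ := exists_partition_goodBall ho hK
  have hρ1' : ∀ i x, ρ i x ≤ 1 := fun i x =>
    (Finset.single_le_sum (fun j _ => hρ0 j x) (Finset.mem_univ i)).trans (hρ1 x)
  have iX : Integrable (fun x => pairing o h' θ ξ x - (-1) ^ (k + 1) * pairing o h η ψ x)
      (riemannianVolume n M) :=
    (integrable_pairing ho h' hpq hθ hξ).sub ((integrable_pairing ho h hpq hη hψ).const_mul _)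
  have iρX : ∀ i, Integrable (fun x => ρ i x *
      (pairing o h' θ ξ x - (-1) ^ (k + 1) * pairing o h η ψ x)) (riemannianVolume n M) := fun i =>
    iX.bdd_mul (c := 1) (hρ i).continuous.aestronglyMeasurable (Eventually.of_forall fun x => by
      rw [Real.norm_of_nonneg (hρ0 i x)]
      exact hρ1' i x)
  have idρ : ∀ i, Integrable (pairing o h' θ (dWedge n (ρ i) ψ)) (riemannianVolume n M) := fun i =>
    integrable_pairing ho h' hpq hθ ((B i).dWedge_mem_lpForms (hρ i) (hρc i) (hρB i) hψ)
  have iJ : ∀ i ∈ (Finset.univ : Finset s), Integrable (fun x => f x * (ρ i x *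
      (pairing o h' θ ξ x - (-1) ^ (k + 1) * pairing o h η ψ x) +
        pairing o h' θ (dWedge n (ρ i) ψ) x)) (riemannianVolume n M) := fun i _ =>
    ((iρX i).add (idρ i)).bdd_mul (c := 1) hf.continuous.aestronglyMeasurable
      (Eventually.of_forall hf1)
  have iN := integrable_formNorm_mul hpq hθ hψ
  have iρN : ∀ i ∈ (Finset.univ : Finset s), Integrable (fun x => ρ i x *
      (formNorm n (θ x) * formNorm n (ψ x))) (riemannianVolume n M) := fun i _ =>
    iN.bdd_mul (c := 1) (hρ i).continuous.aestronglyMeasurable (Eventually.of_forall fun x => by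
      rw [Real.norm_of_nonneg (hρ0 i x)]
      exact hρ1' i x)
  have hsum : ∀ x, f x * (pairing o h' θ ξ x - (-1) ^ (k + 1) * pairing o h η ψ x) =
      ∑ i, f x * (ρ i x * (pairing o h' θ ξ x - (-1) ^ (k + 1) * pairing o h η ψ x) +
        pairing o h' θ (dWedge n (ρ i) ψ) x) := by
    intro x
    by_cases hx : f x = 0
    · simp [hx]
    -- The set where `f ≠ 0` is open and contained in `K`, so the partition sums to `1` in a
    -- neighbourhood of `x` and not merely at `x`, as the cancellation requires.
    · have hxK : ∀ᶠ y in 𝓝 x, ∑ i, ρ i y = 1 := by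
        filter_upwards [hf.continuous.continuousAt.eventually_ne hx] with y hy
        exact hρK y (by_contra fun h => hy (hfK y h))
      rw [← Finset.mul_sum, Finset.sum_add_distrib, ← Finset.sum_mul, hxK.self_of_nhds, one_mul,
        sum_pairing_dWedge_eq_zero Finset.univ h' θ ψ (fun i _ => hρ i) hxK, add_zero]
  simp only [hsum]
  rw [integral_finsetSum _ iJ]
  refine (Finset.abs_sum_le_sum_abs _ _).trans ((Finset.sum_le_sum fun (i : s) _ =>
    (B i).abs_integral_le ho hpq h h' hθ hη hψ hξ (hd _ _) (hd' _ _) (hρ i) (hρc i) (hρB i)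
      (hρ0 i) (hρ1' i) hf).trans ?_)
  rw [← Finset.mul_sum, ← integral_finsetSum _ iρN]
  refine mul_le_mul_of_nonneg_left (integral_mono (integrable_finsetSum _ iρN) iN fun x => ?_)
    (mul_nonneg (stokesConst_nonneg n k l) (by positivity))
  simp only
  rw [← Finset.sum_mul]
  exact mul_le_of_le_one_left (mul_nonneg (formNorm_nonneg _) (formNorm_nonneg _)) (hρ1 x)

variable [CompleteSpace M]

/-- Stokes' theorem for `L^p` forms on a complete manifold. -/
theorem wedgeIntegral_of_isLocalWeakD (ho : IsContinuousOrientation o) {p q : ℝ}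
    (hpq : p.HolderConjugate q) {k l : ℕ} (h : k + 1 + l = n) (h' : k + (l + 1) = n)
    {θ : DiffForm n M k} {η : DiffForm n M (k + 1)} {ψ : DiffForm n M l} {ξ : DiffForm n M (l + 1)}
    (hθ : θ ∈ lpForms n M k (ENNReal.ofReal p)) (hη : η ∈ lpForms n M (k + 1) (ENNReal.ofReal p))
    (hψ : ψ ∈ lpForms n M l (ENNReal.ofReal q)) (hξ : ξ ∈ lpForms n M (l + 1) (ENNReal.ofReal q))
    (hd : IsLocalWeakD o θ η) (hd' : IsLocalWeakD o ψ ξ) :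
    wedgeIntegral o h' θ ξ = (-1) ^ (k + 1) * wedgeIntegral o h η ψ := by
  rcases isEmpty_or_nonempty M with hM | hM
  · simp [wedgeIntegral, Measure.eq_zero_of_isEmpty]
  obtain ⟨f, K, hf, hf1, hK, hfK, hlim⟩ := exists_seq_lipschitz_cutoff n M
  have i1 := integrable_pairing ho h' hpq hθ hξ
  have i2 := integrable_pairing ho h hpq hη hψ
  have iX : Integrable (fun x => pairing o h' θ ξ x - (-1) ^ (k + 1) * pairing o h η ψ x)
      (riemannianVolume n M) := i1.sub (i2.const_mul _)
  -- By dominated convergence these integrals tend to the defect in Stokes' formula. They also tend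
  -- to `0`, because the Lipschitz constants `1 / (j + 1)` do.
  have h1 : Tendsto (fun j => ∫ x, f j x *
      (pairing o h' θ ξ x - (-1) ^ (k + 1) * pairing o h η ψ x) ∂(riemannianVolume n M)) atTop
      (𝓝 (∫ x, (pairing o h' θ ξ x - (-1) ^ (k + 1) * pairing o h η ψ x) ∂(riemannianVolume n M))) := by
    refine tendsto_integral_of_dominated_convergence (fun x =>
      ‖pairing o h' θ ξ x - (-1) ^ (k + 1) * pairing o h η ψ x‖) (fun j =>
      (hf j).continuous.aestronglyMeasurable.mul iX.1) iX.norm (fun j => Eventually.of_forall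
      fun x => ?_) (Eventually.of_forall fun x => ?_)
    · rw [norm_mul]
      exact mul_le_of_le_one_left (norm_nonneg _) (hf1 j x)
    · simpa using (hlim x).mul_const _
  have h2 : Tendsto (fun j => ∫ x, f j x *
      (pairing o h' θ ξ x - (-1) ^ (k + 1) * pairing o h η ψ x) ∂(riemannianVolume n M)) atTop
      (𝓝 0) := by
    refine squeeze_zero_norm (fun j => abs_integral_lipschitz_le ho hpq h h' hθ hη hψ hξ hd hd'
      (hf j) (hf1 j) (hK j) (hfK j)) ?_
    have h3 : Tendsto (fun j : ℕ => ((j : ℝ) + 1)⁻¹) atTop (𝓝 0) := by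
      simpa only [one_div] using tendsto_one_div_add_atTop_nhds_zero_nat (𝕜 := ℝ)
    have h4 := ((h3.const_mul 4).const_mul (stokesConst n k l)).mul_const
      (∫ x, formNorm n (θ x) * formNorm n (ψ x) ∂(riemannianVolume n M))
    rw [mul_zero, mul_zero, zero_mul] at h4
    exact_mod_cast h4
  have h3 := tendsto_nhds_unique h1 h2
  rw [integral_sub i1 (i2.const_mul _), integral_const_mul, sub_eq_zero] at h3
  exact h3

end GlobalStokes

/-! ### Test forms, and weak derivatives globally and in charts -/

section SmoothForms

lemma contDiff_smul_of_tsupport_subset {E G : Type*} [NormedAddCommGroup E] [NormedSpace ℝ E]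
    [NormedAddCommGroup G] [NormedSpace ℝ G] {σ : E → ℝ} {f : E → G} {U : Set E}
    (hU : IsOpen U) (hσ : ContDiff ℝ ∞ σ) (hσU : tsupport σ ⊆ U) (hf : ContDiffOn ℝ ∞ f U) :
    ContDiff ℝ ∞ fun y => σ y • f y := by
  refine contMDiff_iff_contDiff.1 (contMDiff_of_tsupport fun y hy => ContDiffAt.contMDiffAt ?_)
  exact hσ.contDiffAt.smul
    (hf.contDiffAt (hU.mem_nhds (hσU (tsupport_smul_fun_subset σ f hy))))

variable {n : ℕ}

lemma extDeriv_eq_zero_of_eventuallyEq {k : ℕ}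
    {f : EuclideanSpace ℝ (Fin n) → EuclideanSpace ℝ (Fin n) [⋀^Fin k]→L[ℝ] ℝ}
    {y : EuclideanSpace ℝ (Fin n)} (hf : f =ᶠ[𝓝 y] fun _ => 0) : extDeriv f y = 0 := by
  rw [hf.extDeriv_eq]
  exact extDeriv_zero_const _ _

/-- A form which is smooth on a ball has a weak exterior derivative there. -/
lemma isWeakDOn_ball_of_contDiffOn {k : ℕ} {c : EuclideanSpace ℝ (Fin n)} {R : ℝ} (hR : 0 < R)
    {a : EuclideanSpace ℝ (Fin n) → EuclideanSpace ℝ (Fin n) [⋀^Fin k]→L[ℝ] ℝ}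
    (ha : ContDiffOn ℝ ∞ a (Metric.ball c R)) :
    IsWeakDOn (Metric.ball c R) a (extDeriv a) := by
  intro l h h' f hf hfc hfB
  obtain ⟨r, ⟨hr0, hr⟩, hfr⟩ := exists_pos_lt_subset_ball hR (isClosed_tsupport f) hfB
  -- `χ` is `1` near the support of `f`, so `a` may be replaced by the globally smooth form `χ a`.
  let χ : ContDiffBump c := ⟨r, (r + R) / 2, hr0, by linarith⟩
  have hχB : tsupport χ ⊆ Metric.ball c R := by
    rw [χ.tsupport_eq]
    exact Metric.closedBall_subset_ball (by change (r + R) / 2 < R; linarith)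
  have hχa := contDiff_smul_of_tsupport_subset Metric.isOpen_ball χ.contDiff hχB ha
  have hχ1 : ∀ y ∈ tsupport f, χ =ᶠ[𝓝 y] fun _ => 1 := fun y hy =>
    χ.eventuallyEq_one_of_mem_ball (hfr hy)
  have hst := integral_formWedge_extDeriv h h' (hχa.of_le (by norm_num)) (hf.of_le (by norm_num)) hfc
  have hf0 : ∀ y ∉ tsupport f, f y = 0 ∧ extDeriv f y = 0 := fun y hy =>
    ⟨image_eq_zero_of_notMem_tsupport hy,
      extDeriv_eq_zero_of_eventuallyEq (notMem_tsupport_iff_eventuallyEq.1 hy)⟩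
  have hz : ∀ {i j : ℕ} (hij : i + j = n) (α : EuclideanSpace ℝ (Fin n) [⋀^Fin i]→L[ℝ] ℝ),
      formWedge hij α 0 = 0 := fun {i j} hij α => by
    rw [← zero_smul ℝ (0 : EuclideanSpace ℝ (Fin n) [⋀^Fin j]→L[ℝ] ℝ), formWedge_smul_right, zero_mul]
  have e1 : ∫ y in Metric.ball c R, formWedge h' (a y) (extDeriv f y) =
      ∫ y, formWedge h' (χ y • a y) (extDeriv f y) := by
    rw [← setIntegral_eq_integral_of_forall_compl_eq_zero (s := Metric.ball c R)
      (f := fun y => formWedge h' (χ y • a y) (extDeriv f y))]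
    · refine integral_congr_ae (Eventually.of_forall fun y => ?_)
      by_cases hy : y ∈ tsupport f
      · simp only [(hχ1 y hy).self_of_nhds, one_smul]
      · simp only [(hf0 y hy).2, hz]
    · intro y hy
      rw [(hf0 y fun h => hy (hfB h)).2, hz]
  have e2 : ∫ y in Metric.ball c R, formWedge h (extDeriv a y) (f y) =
      ∫ y, formWedge h (extDeriv (fun y => χ y • a y) y) (f y) := by
    rw [← setIntegral_eq_integral_of_forall_compl_eq_zero (s := Metric.ball c R)
      (f := fun y => formWedge h (extDeriv (fun y => χ y • a y) y) (f y))]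
    · refine integral_congr_ae (Eventually.of_forall fun y => ?_)
      by_cases hy : y ∈ tsupport f
      · have : (fun y => χ y • a y) =ᶠ[𝓝 y] a := by
          filter_upwards [hχ1 y hy] with z hz
          rw [hz, one_smul]
        simp only [this.extDeriv_eq]
      · simp only [(hf0 y hy).1, hz]
    · intro y hy
      rw [(hf0 y fun h => hy (hfB h)).1, hz]
  rw [e1, e2, hst]

variable {M : Type*} [EMetricSpace M] [ChartedSpace (EuclideanSpace ℝ (Fin n)) M]
  [IsManifold (𝓡 n) ∞ M]

lemma extD_eq_zero {k : ℕ} {φ : DiffForm n M k} {x : M} (hx : ∀ᶠ z in 𝓝 x, φ z = 0) :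
    extD φ x = 0 := by
  have h1 : chartRep x φ =ᶠ[𝓝 (extChartAt (𝓡 n) x x)] fun _ => 0 := by
    have hc := continuousAt_extChartAt_symm (I := 𝓡 n) x
    rw [ContinuousAt, extChartAt_to_inv] at hc
    filter_upwards [hc.eventually hx] with y hy
    rw [chartRep, localRep, hy]
    rfl
  rw [extD, extDeriv_eq_zero_of_eventuallyEq h1]
  ext v
  simp

lemma chartRep_extD {k : ℕ} {φ : DiffForm n M k} (hφ : IsTestForm φ) {x₀ : M}
    {y : EuclideanSpace ℝ (Fin n)} (hy : y ∈ (extChartAt (𝓡 n) x₀).target) :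
    chartRep x₀ (extD φ) y = extDeriv (chartRep x₀ φ) y := by
  have hx := (extChartAt (𝓡 n) x₀).map_target hy
  have hr := (extChartAt (𝓡 n) x₀).right_inv hy
  rw [chartRep, localRep_extD φ hx, hr]
  rw [hr]
  exact ((hφ.1 x₀).contDiffAt ((isOpen_extChartAt_target (I := 𝓡 n) x₀).mem_nhds hy)).differentiableAt
    (by norm_num)

lemma IsTestForm.eq_zero {k : ℕ} {φ : DiffForm n M k} {x : M} (hx : x ∉ closure {x | φ x ≠ 0}) :
    φ x = 0 ∧ extD φ x = 0 := by
  have h1 : ∀ z ∉ closure {x | φ x ≠ 0}, φ z = 0 := fun z hz =>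
    by_contra fun h => hz (subset_closure h)
  refine ⟨h1 x hx, extD_eq_zero ?_⟩
  filter_upwards [isClosed_closure.isOpen_compl.mem_nhds hx] with z hz
  exact h1 z hz

lemma IsTestForm.continuousOn_localRep {k : ℕ} {φ : DiffForm n M k} (hφ : IsTestForm φ) (x₀ : M) :
    ContinuousOn (localRep x₀ φ) (extChartAt (𝓡 n) x₀).source :=
  ((hφ.1 x₀).continuousOn.comp (continuousOn_extChartAt x₀)
    fun _ hx => (extChartAt (𝓡 n) x₀).map_source hx).congr
    fun _ hx => (chartRep_extChartAt φ hx).symm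

lemma IsTestForm.continuousOn_localRep_extD {k : ℕ} {φ : DiffForm n M k} (hφ : IsTestForm φ)
    (x₀ : M) : ContinuousOn (localRep x₀ (extD φ)) (extChartAt (𝓡 n) x₀).source := by
  have h1 : ContinuousOn (extDeriv (chartRep x₀ φ)) (extChartAt (𝓡 n) x₀).target :=
    (ContinuousAlternatingMap.alternatizeUncurryFinCLM ℝ _ ℝ).continuous.comp_continuousOn
      ((hφ.1 x₀).continuousOn_fderiv_of_isOpen (isOpen_extChartAt_target x₀) (by norm_num))
  refine (h1.comp (continuousOn_extChartAt x₀)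
    fun _ hx => (extChartAt (𝓡 n) x₀).map_source hx).congr fun x hx => ?_
  rw [Function.comp_apply, ← chartRep_extD hφ ((extChartAt (𝓡 n) x₀).map_source hx),
    chartRep_extChartAt _ hx]

variable [RiemannianBundle (fun x : M => TangentSpace (𝓡 n) x)] [MeasurableSpace M] [BorelSpace M]
  {o : (x : M) → Orientation ℝ (TangentSpace (𝓡 n) x) (Fin n)}

lemma isMeasurableForm_of_continuousOn {k : ℕ} {φ : DiffForm n M k}
    (hφ : ∀ x₀ : M, ContinuousOn (localRep x₀ φ) (extChartAt (𝓡 n) x₀).source) :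
    IsMeasurableForm φ := fun x₀ => by
  have := hφ x₀
  rw [extChartAt_source] at this
  exact this.aestronglyMeasurable (chartAt (EuclideanSpace ℝ (Fin n)) x₀).open_source.measurableSet

variable [IsContMDiffRiemannianBundle (𝓡 n) ∞ (EuclideanSpace ℝ (Fin n))
  (fun x : M => TangentSpace (𝓡 n) x)]

lemma IsTestForm.isLocalWeakD {k : ℕ} {φ : DiffForm n M k} (hφ : IsTestForm φ) :
    IsLocalWeakD o φ (extD φ) := by
  intro x₀ B l h h' f hf hfc hfB
  refine (isWeakDOn_ball_of_contDiffOn B.radius_pos ((hφ.1 x₀).mono B.ball_subset_target) l h h' f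
    hf hfc hfB).trans ?_
  congr 1
  exact setIntegral_congr_fun B.measurableSet_ball fun y hy => by
    simp only [chartRep_extD hφ (B.ball_subset_target hy)]

variable [SecondCountableTopology M]

/-- Continuous forms with compact support are `L^p`. -/
lemma mem_lpForms_of_continuousOn (ho : IsContinuousOrientation o) {k : ℕ} {φ : DiffForm n M k}
    (hφ : ∀ x₀ : M, ContinuousOn (localRep x₀ φ) (extChartAt (𝓡 n) x₀).source) {K : Set M}
    (hK : IsCompact K) (hφK : ∀ x ∉ K, φ x = 0) (p : ℝ≥0∞) : φ ∈ lpForms n M k p := by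
  have hm := isMeasurableForm_of_continuousOn hφ
  refine ⟨hm, ?_⟩
  -- Local boundedness of the norm, obtained through a good ball, is enough: compactness turns it
  -- into a bound on `K`.
  have hloc : ∀ x₀ : M, ∃ C : ℝ, ∀ᶠ x in 𝓝 x₀, formNorm n (φ x) ≤ C := by
    intro x₀
    obtain ⟨B⟩ := nonempty_goodBall ho x₀
    have h1 : ContinuousAt (localRep x₀ φ) x₀ :=
      (hφ x₀).continuousAt (extChartAt_source_mem_nhds x₀)
    refine ⟨(n : ℝ) ^ k * (‖coordInv n x₀ x₀‖ * 2) ^ k * (‖localRep x₀ φ x₀‖ + 1), ?_⟩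
    filter_upwards [B.isOpen_dom.mem_nhds B.mem_dom,
      h1.norm.eventually_lt_const (lt_add_one ‖localRep x₀ φ x₀‖)] with x hx hx'
    exact (B.formNorm_le_norm_localRep φ hx).trans
      (mul_le_mul_of_nonneg_left hx'.le (by positivity))
  have hbdd : ∃ C : ℝ, ∀ x ∈ K, formNorm n (φ x) ≤ C := by
    refine hK.induction_on (p := fun S => ∃ C : ℝ, ∀ x ∈ S, formNorm n (φ x) ≤ C) ⟨0, by simp⟩
      (fun S T hST ⟨C, hC⟩ => ⟨C, fun x hx => hC x (hST hx)⟩) ?_ ?_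
    · rintro S T ⟨C, hC⟩ ⟨D, hD⟩
      exact ⟨max C D, fun x hx => hx.elim (fun h => (hC x h).trans (le_max_left _ _))
        fun h => (hD x h).trans (le_max_right _ _)⟩
    · intro x _
      obtain ⟨C, hC⟩ := hloc x
      exact ⟨_, mem_nhdsWithin_of_mem_nhds hC, C, fun y hy => hy⟩
  obtain ⟨C, hC⟩ := hbdd
  have h2 : MemLp (K.indicator fun _ => C) p (riemannianVolume n M) :=
    memLp_indicator_const p hK.measurableSet C (Or.inr hK.measure_lt_top.ne)
  refine (h2.of_le_mul (c := 1) (aemeasurable_formNorm hm).aestronglyMeasurable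
    (Eventually.of_forall fun x => ?_)).2
  rw [Real.norm_of_nonneg (formNorm_nonneg _), one_mul]
  by_cases hx : x ∈ K
  · rw [indicator_of_mem hx]
    exact (hC x hx).trans (le_abs_self C)
  · rw [hφK x hx, formNorm_zero]
    exact norm_nonneg _

lemma IsTestForm.mem_lpForms (ho : IsContinuousOrientation o) {k : ℕ} {φ : DiffForm n M k}
    (hφ : IsTestForm φ) (p : ℝ≥0∞) :
    φ ∈ lpForms n M k p ∧ extD φ ∈ lpForms n M (k + 1) p :=
  ⟨mem_lpForms_of_continuousOn ho hφ.continuousOn_localRep hφ.2 (fun _ hx => (IsTestForm.eq_zero hx).1) p,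
    mem_lpForms_of_continuousOn ho hφ.continuousOn_localRep_extD hφ.2
      (fun _ hx => (IsTestForm.eq_zero hx).2) p⟩

/-- Weak exterior derivatives can be computed in charts. -/
lemma IsWeakExtD.isLocalWeakD {k : ℕ} {θ : DiffForm n M k} {η : DiffForm n M (k + 1)}
    (hd : IsWeakExtD o θ η) : IsLocalWeakD o θ η := by
  intro x₀ B l h h' f hf hfc hfB
  have hft := hfB.trans B.ball_subset_target
  -- A test form on the ball extends by zero to a test form on `M`. Both integrals then reduce to
  -- the ball, where the same orientation sign appears on each side.
  have hφ : IsTestForm (ofChart n x₀ f) := isTestForm_ofChart hf hfc hft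
    fun y hy => image_eq_zero_of_notMem_tsupport hy
  obtain ⟨i1, i2, e⟩ := hd l h _ hφ
  have hK : IsCompact ((extChartAt (𝓡 n) x₀).symm '' tsupport f) :=
    hfc.isCompact.image_of_continuousOn ((continuousOn_extChartAt_symm x₀).mono hft)
  have hsub : closure {x | ofChart n x₀ f x ≠ 0} ⊆ B.dom := by
    refine (closure_minimal (t := (extChartAt (𝓡 n) x₀).symm '' tsupport f) (fun x hx => ?_)
      hK.isClosed).trans ?_
    · obtain ⟨h1, h2⟩ := ofChart_apply_ne_zero hx
      exact ⟨_, subset_tsupport _ h2, (extChartAt (𝓡 n) x₀).left_inv h1⟩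
    · rintro _ ⟨y, hy, rfl⟩
      exact B.symm_mem_dom (hfB hy)
  have hz : ∀ {i j : ℕ} (hij : i + j = n) (α : DiffForm n M i) (β : DiffForm n M j) (x : M),
      β x = 0 → pairing o hij α β x = 0 := fun hij α β x hx => by
    have := abs_pairing_le o hij α β x
    rw [hx, formNorm_zero, mul_zero, mul_zero] at this
    exact abs_nonpos_iff.1 this
  rw [wedgeIntegral, wedgeIntegral,
    ← setIntegral_eq_integral_of_forall_compl_eq_zero (s := B.dom) (f := pairing o _ θ _)
      fun x hx => hz _ _ _ _ (IsTestForm.eq_zero fun h => hx (hsub h)).2,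
    ← setIntegral_eq_integral_of_forall_compl_eq_zero (s := B.dom) (f := pairing o _ η _)
      fun x hx => hz _ _ _ _ (IsTestForm.eq_zero fun h => hx (hsub h)).1,
    B.setIntegral_pairing _ i1.1.restrict, B.setIntegral_pairing _ i2.1.restrict] at e
  have e1 : ∫ y in B.ball, formWedge h' (chartRep x₀ θ y) (chartRep x₀ (extD (ofChart n x₀ f)) y) =
      ∫ y in B.ball, formWedge h' (chartRep x₀ θ y) (extDeriv f y) := by
    refine setIntegral_congr_fun B.measurableSet_ball fun y hy => ?_
    have hyt := B.ball_subset_target hy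
    have : chartRep x₀ (ofChart n x₀ f) =ᶠ[𝓝 y] f := by
      filter_upwards [(isOpen_extChartAt_target (I := 𝓡 n) x₀).mem_nhds hyt] with z hz
      exact chartRep_ofChart hz f
    simp only [chartRep_extD hφ hyt, this.extDeriv_eq]
  have e2 : ∫ y in B.ball, formWedge h (chartRep x₀ η y) (chartRep x₀ (ofChart n x₀ f) y) =
      ∫ y in B.ball, formWedge h (chartRep x₀ η y) (f y) := by
    refine setIntegral_congr_fun B.measurableSet_ball fun y hy => ?_
    simp only [chartRep_ofChart (B.ball_subset_target hy)]
  rw [e1, e2] at e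
  have hs := B.sign_mul_sign
  have e' := congrArg (B.sign * ·) e
  linear_combination e' - (∫ y in B.ball, formWedge h' (chartRep x₀ θ y) (extDeriv f y)) * hs +
    (-1) ^ (k + 1) * (∫ y in B.ball, formWedge h (chartRep x₀ η y) (f y)) * hs

/-- To check that `η = dθ` it suffices to test against all smooth forms with compact support. -/
theorem isWeakExtD_of_forall_testForm (ho : IsContinuousOrientation o) {p q : ℝ}
    (hpq : p.HolderConjugate q) {k : ℕ} {θ : DiffForm n M k} {η : DiffForm n M (k + 1)}
    (hθ : θ ∈ lpForms n M k (ENNReal.ofReal p)) (hη : η ∈ lpForms n M (k + 1) (ENNReal.ofReal p))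
    (hd : ∀ (l : ℕ) (h : k + 1 + l = n) (φ : DiffForm n M l), IsTestForm φ →
      wedgeIntegral o (by omega) θ (extD φ) = (-1) ^ (k + 1) * wedgeIntegral o h η φ) :
    IsWeakExtD o θ η := by
  intro l h φ hφ
  obtain ⟨h1, h2⟩ := hφ.mem_lpForms ho (ENNReal.ofReal q)
  exact ⟨integrable_pairing ho _ hpq hθ h2, integrable_pairing ho h hpq hη h1, hd l h φ hφ⟩

variable [IsRiemannianManifold (𝓡 n) M] [CompleteSpace M]

/-- Stokes' theorem for `L^p` forms on a complete manifold. -/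
theorem IsWeakExtD.wedgeIntegral_eq (ho : IsContinuousOrientation o) {p q : ℝ}
    (hpq : p.HolderConjugate q) {k l : ℕ} (h : k + 1 + l = n) (h' : k + (l + 1) = n)
    {θ : DiffForm n M k} {η : DiffForm n M (k + 1)} {ψ : DiffForm n M l} {ξ : DiffForm n M (l + 1)}
    (hθ : θ ∈ lpForms n M k (ENNReal.ofReal p)) (hη : η ∈ lpForms n M (k + 1) (ENNReal.ofReal p))
    (hψ : ψ ∈ lpForms n M l (ENNReal.ofReal q)) (hξ : ξ ∈ lpForms n M (l + 1) (ENNReal.ofReal q))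
    (hd : IsWeakExtD o θ η) (hd' : IsWeakExtD o ψ ξ) :
    wedgeIntegral o h' θ ξ = (-1) ^ (k + 1) * wedgeIntegral o h η ψ :=
  wedgeIntegral_of_isLocalWeakD ho hpq h h' hθ hη hψ hξ hd.isLocalWeakD hd'.isLocalWeakD

/-- The exterior derivative of a test form is its weak exterior derivative. -/
theorem IsTestForm.isWeakExtD (ho : IsContinuousOrientation o) {k : ℕ} {φ : DiffForm n M k}
    (hφ : IsTestForm φ) : IsWeakExtD o φ (extD φ) := by
  -- Test forms and their derivatives lie in every `L^p`, so any conjugate pair would do.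
  have hpq : (2 : ℝ).HolderConjugate 2 := Real.HolderConjugate.two_two
  obtain ⟨h1, h2⟩ := hφ.mem_lpForms ho (ENNReal.ofReal 2)
  refine isWeakExtD_of_forall_testForm ho hpq h1 h2 fun l h φ' hφ' => ?_
  obtain ⟨h1', h2'⟩ := hφ'.mem_lpForms ho (ENNReal.ofReal 2)
  exact wedgeIntegral_of_isLocalWeakD ho hpq h _ h1 h2 h1' h2' hφ.isLocalWeakD hφ'.isLocalWeakD

end SmoothForms

/-! ### Convexity of powers of the norm -/

section UniformConvexity

variable {E : Type*} [NormedAddCommGroup E] [InnerProductSpace ℝ E]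

/-- For vectors of equal length the strict convexity of the norm is responsible, for different
lengths that of `t ↦ t ^ p`. -/
lemma norm_midpoint_rpow_lt {p : ℝ} (hp : 1 < p) {u v : E} (huv : u ≠ v) :
    ‖(1 / 2 : ℝ) • (u + v)‖ ^ p < (‖u‖ ^ p + ‖v‖ ^ p) / 2 := by
  have hp0 : 0 < p := by linarith
  by_cases h : ‖u‖ = ‖v‖
  · have h1 := (norm_midpoint_lt_iff h).2 huv
    rw [← h, add_self_div_two]
    exact Real.rpow_lt_rpow (norm_nonneg _) h1 hp0
  · have h1 : ‖(1 / 2 : ℝ) • (u + v)‖ ≤ (1 / 2) * ‖u‖ + (1 / 2) * ‖v‖ := by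
      rw [norm_smul, Real.norm_of_nonneg (by norm_num), ← mul_add]
      exact mul_le_mul_of_nonneg_left (norm_add_le _ _) (by norm_num)
    have h2 := (strictConvexOn_rpow hp).2 (norm_nonneg u) (norm_nonneg v) h
      (by norm_num : (0 : ℝ) < 1 / 2) (by norm_num : (0 : ℝ) < 1 / 2) (by norm_num)
    simp only [smul_eq_mul] at h2
    refine (Real.rpow_le_rpow (norm_nonneg _) h1 hp0.le).trans_lt (h2.trans_eq ?_)
    ring

variable [FiniteDimensional ℝ E]

variable (E) in
/-- The uniform convexity of the `p`-th power of the norm. -/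
lemma exists_norm_sub_rpow_le {p : ℝ} (hp : 1 < p) {ε : ℝ} (hε : 0 < ε) : ∃ K : ℝ, 0 ≤ K ∧
    ∀ u v : E, ‖u - v‖ ^ p ≤ ε * (‖u‖ ^ p + ‖v‖ ^ p) +
      K * ((‖u‖ ^ p + ‖v‖ ^ p) / 2 - ‖(1 / 2 : ℝ) • (u + v)‖ ^ p) := by
  have hp0 : 0 < p := by linarith
  -- On this compact set the convexity defect has a positive minimum `m`, and the distance to the
  -- power `p` is at most `2 ^ p`; so `K = 2 ^ p / m` works there. The term with `ε` covers the
  -- other normalized pairs, and homogeneity removes the normalization.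
  set S : Set (E × E) := {w | ‖w.1‖ ^ p + ‖w.2‖ ^ p = 1 ∧ ε ≤ ‖w.1 - w.2‖ ^ p} with hS
  have hc : ∀ {f : E × E → E}, Continuous f → Continuous fun w => ‖f w‖ ^ p := fun hf =>
    hf.norm.rpow_const fun _ => Or.inr hp0.le
  have hle1 : ∀ {s t : ℝ}, 0 ≤ s → 0 ≤ t → s ^ p + t ^ p = 1 → s ≤ 1 := fun {s t} hs ht hst => by
    refine (Real.rpow_le_rpow_iff hs zero_le_one hp0).1 ?_
    rw [Real.one_rpow]
    linarith [Real.rpow_nonneg ht p]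
  have hSc : IsCompact S := by
    refine Metric.isCompact_of_isClosed_isBounded ?_ ?_
    · exact (isClosed_eq ((hc continuous_fst).add (hc continuous_snd)) continuous_const).inter
        (isClosed_le continuous_const (hc (continuous_fst.sub continuous_snd)))
    · refine isBounded_iff_forall_norm_le.2 ⟨1, fun w hw => ?_⟩
      rw [Prod.norm_def]
      exact max_le (hle1 (norm_nonneg _) (norm_nonneg _) hw.1)
        (hle1 (norm_nonneg w.2) (norm_nonneg w.1) (by rw [add_comm]; exact hw.1))
  have hDc : Continuous fun w : E × E =>
      (‖w.1‖ ^ p + ‖w.2‖ ^ p) / 2 - ‖(1 / 2 : ℝ) • (w.1 + w.2)‖ ^ p :=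
    (((hc continuous_fst).add (hc continuous_snd)).div_const 2).sub
      (hc ((continuous_fst.add continuous_snd).const_smul _))
  have hD0 : ∀ u v : E, 0 ≤ (‖u‖ ^ p + ‖v‖ ^ p) / 2 - ‖(1 / 2 : ℝ) • (u + v)‖ ^ p := by
    intro u v
    by_cases h : u = v
    · rw [h, ← two_smul ℝ v, smul_smul]
      norm_num
    · linarith [norm_midpoint_rpow_lt hp h]
  obtain ⟨m, hm, hmS⟩ : ∃ m > 0, ∀ w ∈ S,
      m ≤ (‖w.1‖ ^ p + ‖w.2‖ ^ p) / 2 - ‖(1 / 2 : ℝ) • (w.1 + w.2)‖ ^ p := by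
    rcases S.eq_empty_or_nonempty with h | h
    · exact ⟨1, one_pos, fun w hw => by rw [h] at hw; exact hw.elim⟩
    · obtain ⟨w, hw, hmin⟩ := hSc.exists_isMinOn h hDc.continuousOn
      refine ⟨_, ?_, fun w' hw' => hmin hw'⟩
      have : w.1 ≠ w.2 := by
        intro h
        have := hw.2
        rw [h, sub_self, norm_zero, Real.zero_rpow hp0.ne'] at this
        linarith
      linarith [norm_midpoint_rpow_lt hp this]
  have hunit : ∀ u v : E, ‖u‖ ^ p + ‖v‖ ^ p = 1 → ‖u - v‖ ^ p ≤ ε +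
      2 ^ p / m * ((‖u‖ ^ p + ‖v‖ ^ p) / 2 - ‖(1 / 2 : ℝ) • (u + v)‖ ^ p) := by
    intro u v huv
    by_cases h : ε ≤ ‖u - v‖ ^ p
    · have h1 := hmS (u, v) ⟨huv, h⟩
      have h2 : ‖u - v‖ ^ p ≤ 2 ^ p := by
        refine Real.rpow_le_rpow (norm_nonneg _) ((norm_sub_le _ _).trans ?_) hp0.le
        linarith [hle1 (norm_nonneg _) (norm_nonneg _) huv,
          hle1 (norm_nonneg v) (norm_nonneg u) (by rw [add_comm]; exact huv)]
      have h3 : 2 ^ p ≤ 2 ^ p / m * ((‖u‖ ^ p + ‖v‖ ^ p) / 2 - ‖(1 / 2 : ℝ) • (u + v)‖ ^ p) := by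
        rw [div_mul_eq_mul_div, le_div_iff₀ hm]
        exact mul_le_mul_of_nonneg_left h1 (by positivity)
      linarith
    · have := mul_nonneg (show 0 ≤ 2 ^ p / m by positivity) (hD0 u v)
      linarith [not_le.1 h]
  refine ⟨2 ^ p / m, by positivity, fun u v => ?_⟩
  set s := ‖u‖ ^ p + ‖v‖ ^ p with hs
  have hs0 : 0 ≤ s := by positivity
  rcases hs0.eq_or_lt with h0 | hspos
  · have hu : ‖u‖ ^ p = 0 := by linarith [Real.rpow_nonneg (norm_nonneg u) p, Real.rpow_nonneg (norm_nonneg v) p]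
    have hv : ‖v‖ ^ p = 0 := by linarith [Real.rpow_nonneg (norm_nonneg u) p, Real.rpow_nonneg (norm_nonneg v) p]
    rw [Real.rpow_eq_zero (norm_nonneg _) hp0.ne', norm_eq_zero] at hu hv
    simp [hu, hv, ← h0, Real.zero_rpow hp0.ne']
  · have hr : (0 : ℝ) < s ^ (-p⁻¹) := Real.rpow_pos_of_pos hspos _
    have hrp : (s ^ (-p⁻¹)) ^ p = s⁻¹ := by
      rw [← Real.rpow_mul hs0, neg_mul, inv_mul_cancel₀ hp0.ne', Real.rpow_neg_one]
    have hsc : ∀ w : E, ‖s ^ (-p⁻¹) • w‖ ^ p = s⁻¹ * ‖w‖ ^ p := fun w => by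
      rw [norm_smul, Real.norm_of_nonneg hr.le, Real.mul_rpow hr.le (norm_nonneg _), hrp]
    have h1 := hunit (s ^ (-p⁻¹) • u) (s ^ (-p⁻¹) • v) (by
      rw [hsc, hsc, ← mul_add, ← hs, inv_mul_cancel₀ hspos.ne'])
    rw [← smul_sub, ← smul_add, smul_comm (1 / 2 : ℝ), hsc, hsc, hsc, hsc, ← mul_add, ← hs] at h1
    have h2 := mul_le_mul_of_nonneg_left h1 hs0
    have h3 : s * s⁻¹ = 1 := mul_inv_cancel₀ hspos.ne'
    calc ‖u - v‖ ^ p = s * (s⁻¹ * ‖u - v‖ ^ p) := by rw [← mul_assoc, h3, one_mul]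
      _ ≤ _ := h2
      _ = ε * s + 2 ^ p / m * ((s * s⁻¹) * s / 2 - (s * s⁻¹) * ‖(1 / 2 : ℝ) • (u + v)‖ ^ p) := by ring
      _ = _ := by rw [h3, one_mul, one_mul]

end UniformConvexity

/-! ### Uniform convexity of Lebesgue spaces -/

section Duality

variable {X : Type*} [MeasurableSpace X] {μ : Measure X} {E : Type*} [NormedAddCommGroup E]
  {p q : ℝ}

lemma norm_rpow_eq_integral (hp : 0 < p) (u : Lp E (ENNReal.ofReal p) μ) :
    ‖u‖ ^ p = ∫ x, ‖u x‖ ^ p ∂μ := by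
  have h0 : 0 ≤ ∫ x, ‖u x‖ ^ p ∂μ := integral_nonneg fun x => by positivity
  rw [Lp.norm_def, (Lp.memLp u).eLpNorm_eq_integral_rpow_norm (by simpa using hp)
    ENNReal.ofReal_ne_top, ENNReal.toReal_ofReal hp.le, ENNReal.toReal_ofReal (by positivity),
    ← Real.rpow_mul h0, inv_mul_cancel₀ hp.ne', Real.rpow_one]

lemma integrable_norm_rpow_Lp (hp : 0 < p) (u : Lp E (ENNReal.ofReal p) μ) :
    Integrable (fun x => ‖u x‖ ^ p) μ := by
  have := (Lp.memLp u).integrable_norm_rpow (by simpa using hp) ENNReal.ofReal_ne_top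
  rwa [ENNReal.toReal_ofReal hp.le] at this

variable [InnerProductSpace ℝ E]

/-- Uniform convexity of `L^p`. -/
lemma norm_sub_rpow_le_Lp (hp : 0 < p) {ε K : ℝ}
    (hK : ∀ u v : E, ‖u - v‖ ^ p ≤ ε * (‖u‖ ^ p + ‖v‖ ^ p) +
      K * ((‖u‖ ^ p + ‖v‖ ^ p) / 2 - ‖(1 / 2 : ℝ) • (u + v)‖ ^ p))
    (u v : Lp E (ENNReal.ofReal p) μ) : ‖u - v‖ ^ p ≤ ε * (‖u‖ ^ p + ‖v‖ ^ p) +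
      K * ((‖u‖ ^ p + ‖v‖ ^ p) / 2 - ‖(1 / 2 : ℝ) • (u + v)‖ ^ p) := by
  simp only [norm_rpow_eq_integral hp]
  have iu := integrable_norm_rpow_Lp hp u
  have iv := integrable_norm_rpow_Lp hp v
  have im := integrable_norm_rpow_Lp hp ((1 / 2 : ℝ) • (u + v))
  have iuv : Integrable (fun x => ‖u x‖ ^ p + ‖v x‖ ^ p) μ := iu.add iv
  have i1 : Integrable (fun x => ε * (‖u x‖ ^ p + ‖v x‖ ^ p)) μ := iuv.const_mul _
  have i2 : Integrable (fun x => (‖u x‖ ^ p + ‖v x‖ ^ p) / 2) μ := iuv.div_const _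
  have i3 : Integrable (fun x => (‖u x‖ ^ p + ‖v x‖ ^ p) / 2 -
      ‖((1 / 2 : ℝ) • (u + v) : Lp E (ENNReal.ofReal p) μ) x‖ ^ p) μ := i2.sub im
  rw [← integral_add iu iv, ← integral_const_mul, ← integral_div, ← integral_sub i2 im,
    ← integral_const_mul, ← integral_add i1 (i3.const_mul K)]
  refine integral_mono_ae (integrable_norm_rpow_Lp hp (u - v)) (i1.add (i3.const_mul K)) ?_
  filter_upwards [Lp.coeFn_sub u v, Lp.coeFn_smul (1 / 2 : ℝ) (u + v), Lp.coeFn_add u v]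
    with x h1 h2 h3
  rw [h1, h2, Pi.smul_apply, h3]
  exact hK (u x) (v x)

variable [Fact (1 ≤ ENNReal.ofReal p)]

/-- In `L^p`, minimizing sequences in convex sets are Cauchy sequences. -/
lemma cauchySeq_of_tendsto_norm [FiniteDimensional ℝ E] (hp : 1 < p)
    {a : ℕ → Lp E (ENNReal.ofReal p) μ} {d : ℝ} (hd : 0 ≤ d)
    (ha : Tendsto (fun j => ‖a j‖) atTop (𝓝 d))
    (had : ∀ i j, d ≤ ‖(1 / 2 : ℝ) • (a i + a j)‖) : CauchySeq a := by
  have hp0 : 0 < p := by linarith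
  have hap : Tendsto (fun j => ‖a j‖ ^ p) atTop (𝓝 (d ^ p)) :=
    ha.rpow_const (Or.inr hp0.le)
  have hdp : 0 ≤ d ^ p := Real.rpow_nonneg hd p
  rw [Metric.cauchySeq_iff]
  intro r hr
  have hrp : 0 < r ^ p := Real.rpow_pos_of_pos hr p
  -- The constants are chosen to make both terms of the estimate at most `r ^ p / 2`: for large
  -- indices the `p`-th powers of the norms are below `d ^ p + 1`, and their mean exceeds that of
  -- the midpoint by at most `r ^ p / (4 (K + 1))`.
  obtain ⟨K, hK0, hK⟩ := exists_norm_sub_rpow_le E hp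
    (ε := r ^ p / (4 * (d ^ p + 1))) (by positivity)
  have hlt : d ^ p < d ^ p + min 1 (r ^ p / (4 * (K + 1))) := by
    have : 0 < min 1 (r ^ p / (4 * (K + 1))) := lt_min one_pos (by positivity)
    linarith
  obtain ⟨N, hN⟩ := eventually_atTop.1 (hap.eventually_lt_const hlt)
  refine ⟨N, fun i hi j hj => ?_⟩
  have h1 := norm_sub_rpow_le_Lp (μ := μ) hp0 hK (a i) (a j)
  have hi1 := hN i hi
  have hj1 := hN j hj
  have hmid : d ^ p ≤ ‖(1 / 2 : ℝ) • (a i + a j)‖ ^ p := Real.rpow_le_rpow hd (had i j) hp0.le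
  have e1 : r ^ p / (4 * (d ^ p + 1)) * (‖a i‖ ^ p + ‖a j‖ ^ p) ≤ r ^ p / 2 := by
    rw [div_mul_eq_mul_div, div_le_div_iff₀ (by positivity) two_pos]
    have := min_le_left 1 (r ^ p / (4 * (K + 1)))
    nlinarith
  have e2 : K * ((‖a i‖ ^ p + ‖a j‖ ^ p) / 2 - ‖(1 / 2 : ℝ) • (a i + a j)‖ ^ p) < r ^ p / 2 := by
    have h3 : (‖a i‖ ^ p + ‖a j‖ ^ p) / 2 - ‖(1 / 2 : ℝ) • (a i + a j)‖ ^ p ≤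
        r ^ p / (4 * (K + 1)) := by
      linarith [min_le_right 1 (r ^ p / (4 * (K + 1)))]
    refine (mul_le_mul_of_nonneg_left h3 hK0).trans_lt ?_
    rw [mul_div_assoc', div_lt_div_iff₀ (by positivity) two_pos]
    nlinarith
  rw [dist_eq_norm]
  refine (Real.rpow_lt_rpow_iff (norm_nonneg _) hr.le hp0).1 ?_
  linarith


end Duality

/-! ### Representation of bounded functionals -/

section Representation

variable {X : Type*} [MeasurableSpace X] {μ : Measure X} {E : Type*} [NormedAddCommGroup E]
  [InnerProductSpace ℝ E] {p q : ℝ}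

/-- This vector has length `‖u‖ ^ (p - 1)`, and `p / (p - 1) = q`. For the minimizer `u` below it
represents the functional up to a factor. -/
lemma memLp_norm_rpow_smul (hpq : p.HolderConjugate q) {u : X → E}
    (hu : MemLp u (ENNReal.ofReal p) μ) :
    MemLp (fun x => ‖u x‖ ^ (p - 2) • u x) (ENNReal.ofReal q) μ := by
  have hp1 : 0 < p - 1 := by linarith [hpq.lt]
  have h1 := hu.norm_rpow_div (ENNReal.ofReal (p - 1))
  rw [← ENNReal.ofReal_div_of_pos hp1, ENNReal.toReal_ofReal hp1.le,
    ← hpq.conjugate_eq] at h1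
  have hm : AEStronglyMeasurable (fun x => ‖u x‖ ^ (p - 2) • u x) μ :=
    (hu.1.norm.aemeasurable.pow_const (p - 2)).aestronglyMeasurable.smul hu.1
  refine h1.of_le hm (Eventually.of_forall fun x => ?_)
  rw [norm_smul, Real.norm_of_nonneg (by positivity), Real.norm_of_nonneg (by positivity)]
  rcases eq_or_ne (u x) 0 with h | h
  · rw [h, norm_zero, mul_zero]
    positivity
  · rw [← Real.rpow_add_one (norm_ne_zero_iff.2 h)]
    exact le_of_eq (by congr 1; ring)

lemma hasDerivAt_norm_add_smul_rpow (hp : 1 < p) (u v : E) (t : ℝ) :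
    HasDerivAt (fun t : ℝ => ‖u + t • v‖ ^ p)
      (p * ‖u + t • v‖ ^ (p - 2) * inner ℝ (u + t • v) v) t := by
  have h1 : HasDerivAt (fun t : ℝ => u + t • v) v t := by
    simpa using ((hasDerivAt_id t).smul_const v).const_add u
  have h2 := (hasFDerivAt_norm_rpow (u + t • v) hp).comp_hasDerivAt t h1
  simp only [smul_apply, innerSL_apply_apply, smul_eq_mul] at h2
  exact h2

lemma abs_norm_rpow_mul_inner_le (hp : 1 < p) (u v : E) :
    |p * ‖u‖ ^ (p - 2) * inner ℝ u v| ≤ p * (‖u‖ ^ (p - 1) * ‖v‖) := by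
  have hp0 : 0 < p := by linarith
  rw [abs_mul, abs_of_nonneg (by positivity), mul_assoc]
  refine mul_le_mul_of_nonneg_left ?_ hp0.le
  rcases eq_or_ne u 0 with h | h
  · rw [h, inner_zero_left, abs_zero, mul_zero]
    positivity
  · have h1 : ‖u‖ ^ (p - 1) = ‖u‖ ^ (p - 2) * ‖u‖ := by
      rw [← Real.rpow_add_one (norm_ne_zero_iff.2 h)]
      congr 1
      ring
    rw [h1, mul_assoc]
    exact mul_le_mul_of_nonneg_left (abs_real_inner_le_norm u v) (by positivity)

/-- The Euler–Lagrange equation of the `L^p` norm. -/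
lemma integral_inner_eq_zero_of_norm_le (hpq : p.HolderConjugate q) {u v : X → E}
    (hu : MemLp u (ENNReal.ofReal p) μ) (hv : MemLp v (ENNReal.ofReal p) μ)
    (huv : ∀ t : ℝ, ∫ x, ‖u x‖ ^ p ∂μ ≤ ∫ x, ‖u x + t • v x‖ ^ p ∂μ) :
    ∫ x, inner ℝ (‖u x‖ ^ (p - 2) • u x) (v x) ∂μ = 0 := by
  have hp : 1 < p := hpq.lt
  have hp0 : 0 < p := by linarith
  have hint : ∀ {w : X → E}, MemLp w (ENNReal.ofReal p) μ → Integrable (fun x => ‖w x‖ ^ p) μ := by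
    intro w hw
    have := hw.integrable_norm_rpow (by simpa using hp0) ENNReal.ofReal_ne_top
    rwa [ENNReal.toReal_ofReal hp0.le] at this
  have hs : MemLp (fun x => ‖u x‖ + ‖v x‖) (ENNReal.ofReal p) μ := hu.norm.add hv.norm
  have hsi : Integrable (fun x => p * (‖u x‖ + ‖v x‖) ^ p) μ := by
    have := hs.integrable_norm_rpow (by simpa using hp0) ENNReal.ofReal_ne_top
    rw [ENNReal.toReal_ofReal hp0.le] at this
    refine (this.const_mul p).congr (Eventually.of_forall fun x => ?_)
    simp only
    rw [Real.norm_of_nonneg (by positivity)]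
  have hm : ∀ t : ℝ, MemLp (fun x => u x + t • v x) (ENNReal.ofReal p) μ := fun t =>
    hu.add (hv.const_smul t)
  -- Differentiation under the integral sign; for `|t| < 1` the derivative is dominated by `p (‖u‖ +
  -- ‖v‖) ^ p`.
  have hder := hasDerivAt_integral_of_dominated_loc_of_deriv_le (μ := μ) (x₀ := (0 : ℝ))
    (s := Metric.ball 0 1) (F := fun t x => ‖u x + t • v x‖ ^ p)
    (F' := fun t x => p * ‖u x + t • v x‖ ^ (p - 2) * inner ℝ (u x + t • v x) (v x))
    (bound := fun x => p * (‖u x‖ + ‖v x‖) ^ p) (Metric.ball_mem_nhds 0 one_pos)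
    (Eventually.of_forall fun t => (hint (hm t)).1) (hint (hm 0))
    ((((hm 0).1.norm.aemeasurable.pow_const (p - 2)).const_mul p).aestronglyMeasurable.mul
      ((hm 0).1.inner hv.1))
    (Eventually.of_forall fun x t ht => by
      refine (abs_norm_rpow_mul_inner_le hp _ _).trans (mul_le_mul_of_nonneg_left ?_ hp0.le)
      have ht1 : |t| ≤ 1 := by
        have := Metric.mem_ball.1 ht
        rw [dist_zero_right, Real.norm_eq_abs] at this
        exact this.le
      have h1 : ‖u x + t • v x‖ ≤ ‖u x‖ + ‖v x‖ := by
        refine (norm_add_le _ _).trans (add_le_add_right ?_ _)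
        rw [norm_smul]
        exact mul_le_of_le_one_left (norm_nonneg _) ht1
      have h2 : ‖v x‖ ≤ ‖u x‖ + ‖v x‖ := le_add_of_nonneg_left (norm_nonneg _)
      have h3 : (‖u x‖ + ‖v x‖) ^ p = (‖u x‖ + ‖v x‖) ^ (p - 1) * (‖u x‖ + ‖v x‖) := by
        rw [← Real.rpow_add_one' (by positivity) (by linarith)]
        congr 1
        ring
      rw [h3]
      exact mul_le_mul (Real.rpow_le_rpow (norm_nonneg _) h1 (by linarith)) h2 (norm_nonneg _)
        (by positivity))
    hsi (Eventually.of_forall fun x t _ => hasDerivAt_norm_add_smul_rpow hp (u x) (v x) t)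
  have hmin : IsLocalMin (fun t : ℝ => ∫ x, ‖u x + t • v x‖ ^ p ∂μ) 0 :=
    Eventually.of_forall fun t => by simpa using huv t
  have h0 := hmin.hasDerivAt_eq_zero hder.2
  have h1 : p * ∫ x, inner ℝ (‖u x‖ ^ (p - 2) • u x) (v x) ∂μ = 0 := by
    rw [← integral_const_mul, ← h0]
    refine integral_congr_ae (Eventually.of_forall fun x => ?_)
    simp only [zero_smul, add_zero, real_inner_smul_left, mul_assoc]
  exact (mul_eq_zero.1 h1).resolve_left hp0.ne'

lemma eLpNorm_inner_le (hpq : p.HolderConjugate q) {g f : X → E}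
    (hg : MemLp g (ENNReal.ofReal q) μ) (hf : MemLp f (ENNReal.ofReal p) μ) :
    eLpNorm (fun x => (inner ℝ (g x) (f x) : ℝ)) 1 μ ≤
      eLpNorm g (ENNReal.ofReal q) μ * eLpNorm f (ENNReal.ofReal p) μ := by
  have : (ENNReal.ofReal q).HolderTriple (ENNReal.ofReal p) 1 := hpq.symm.ennrealOfReal
  have h1 := eLpNorm_smul_le_mul_eLpNorm (r := 1) hf.1.norm hg.1.norm
    (p := ENNReal.ofReal q) (q := ENNReal.ofReal p)
  rw [eLpNorm_norm, eLpNorm_norm] at h1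
  refine (eLpNorm_mono fun x => ?_).trans h1
  rw [Pi.smul_apply', smul_eq_mul, norm_mul, norm_norm, norm_norm]
  exact norm_inner_le_norm _ _

lemma integrable_inner_of_memLp (hpq : p.HolderConjugate q) {g f : X → E}
    (hg : MemLp g (ENNReal.ofReal q) μ) (hf : MemLp f (ENNReal.ofReal p) μ) :
    Integrable (fun x => (inner ℝ (g x) (f x) : ℝ)) μ :=
  memLp_one_iff_integrable.1 ⟨hg.1.inner hf.1,
    (eLpNorm_inner_le hpq hg hf).trans_lt (ENNReal.mul_lt_top hg.2 hf.2)⟩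

lemma abs_integral_inner_le (hpq : p.HolderConjugate q) {g f : X → E}
    (hg : MemLp g (ENNReal.ofReal q) μ) (hf : MemLp f (ENNReal.ofReal p) μ) :
    |∫ x, inner ℝ (g x) (f x) ∂μ| ≤
      (eLpNorm g (ENNReal.ofReal q) μ).toReal * (eLpNorm f (ENNReal.ofReal p) μ).toReal := by
  rw [← ENNReal.toReal_mul, ← Real.norm_eq_abs]
  refine (norm_integral_le_lintegral_norm _).trans (ENNReal.toReal_mono
    (ENNReal.mul_lt_top hg.2 hf.2).ne ?_)
  refine le_trans (le_of_eq ?_) (eLpNorm_inner_le hpq hg hf)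
  rw [eLpNorm_one_eq_lintegral_enorm]
  exact lintegral_congr fun x => ofReal_norm _

/-- The pairing with an `L^q` function, as a linear functional on `L^p`. -/
def integralInner [Fact (1 ≤ ENNReal.ofReal p)] (hpq : p.HolderConjugate q) {g : X → E}
    (hg : MemLp g (ENNReal.ofReal q) μ) : Lp E (ENNReal.ofReal p) μ →L[ℝ] ℝ :=
  LinearMap.mkContinuous
    { toFun := fun u => ∫ x, inner ℝ (g x) (u x) ∂μ
      map_add' := fun u v => by
        rw [← integral_add (integrable_inner_of_memLp hpq hg (Lp.memLp u))
          (integrable_inner_of_memLp hpq hg (Lp.memLp v))]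
        refine integral_congr_ae ?_
        filter_upwards [Lp.coeFn_add u v] with x hx
        rw [hx, Pi.add_apply, inner_add_right]
      map_smul' := fun c u => by
        rw [RingHom.id_apply, smul_eq_mul, ← integral_const_mul]
        refine integral_congr_ae ?_
        filter_upwards [Lp.coeFn_smul c u] with x hx
        rw [hx, Pi.smul_apply, real_inner_smul_right] }
    (eLpNorm g (ENNReal.ofReal q) μ).toReal
    (fun u => abs_integral_inner_le hpq hg (Lp.memLp u))

lemma integralInner_apply [Fact (1 ≤ ENNReal.ofReal p)] (hpq : p.HolderConjugate q) {g : X → E}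
    (hg : MemLp g (ENNReal.ofReal q) μ) (u : Lp E (ENNReal.ofReal p) μ) :
    integralInner hpq hg u = ∫ x, inner ℝ (g x) (u x) ∂μ := rfl

/-- A bounded functional on a subspace of `L^p` is the pairing with an `L^q` function. -/
theorem exists_memLp_integral_inner_eq [FiniteDimensional ℝ E] [Fact (1 ≤ ENNReal.ofReal p)]
    (hpq : p.HolderConjugate q) {V : Type*} [AddCommGroup V] [Module ℝ V]
    (ι : V →ₗ[ℝ] Lp E (ENNReal.ofReal p) μ) (Λ : V →ₗ[ℝ] ℝ) (C : ℝ)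
    (hΛ : ∀ v, |Λ v| ≤ C * ‖ι v‖) :
    ∃ g : X → E, MemLp g (ENNReal.ofReal q) μ ∧ ∀ v, Λ v = ∫ x, inner ℝ (g x) (ι v x) ∂μ := by
  have hp : 1 < p := hpq.lt
  have hp0 : 0 < p := by linarith
  by_cases h0 : Λ = 0
  · exact ⟨0, MemLp.zero, fun v => by simp [h0]⟩
  obtain ⟨v₀, hv₀⟩ : ∃ v, Λ v ≠ 0 := by
    by_contra! h
    exact h0 (LinearMap.ext h)
  -- The norm of `ι v` is minimized on this affine hyperplane. As midpoints stay in it, a minimizing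
  -- sequence is Cauchy by uniform convexity. Its limit `u` need not be of the form `ι v`, and this
  -- is never needed.
  let A : Set V := {v | Λ v = 1}
  have hA : ((Λ v₀)⁻¹ • v₀) ∈ A := by
    change Λ _ = 1
    rw [map_smul, smul_eq_mul, inv_mul_cancel₀ hv₀]
  have hAne : ((fun v => ‖ι v‖) '' A).Nonempty := ⟨_, _, hA, rfl⟩
  have hbdd : BddBelow ((fun v => ‖ι v‖) '' A) := ⟨0, by
    rintro _ ⟨v, -, rfl⟩
    exact norm_nonneg _⟩
  set d := sInf ((fun v => ‖ι v‖) '' A) with hd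
  have hdle : ∀ v, Λ v = 1 → d ≤ ‖ι v‖ := fun v hv => csInf_le hbdd ⟨v, hv, rfl⟩
  have hCpos : 0 < C := by
    have h1 := hΛ v₀
    by_contra! h
    have h2 : |Λ v₀| ≤ 0 := h1.trans (mul_nonpos_of_nonpos_of_nonneg h (norm_nonneg _))
    exact hv₀ (abs_nonpos_iff.1 h2)
  -- On the hyperplane `1 ≤ C ‖ι v‖`, so `d ≥ 1 / C`.
  have hdpos : 0 < d := by
    refine lt_of_lt_of_le (inv_pos.2 hCpos) (le_csInf hAne ?_)
    rintro _ ⟨v, hv, rfl⟩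
    have h1 := hΛ v
    rw [show Λ v = 1 from hv, abs_one] at h1
    exact (inv_le_iff_one_le_mul₀' hCpos).2 h1
  have hseq : ∀ j : ℕ, ∃ v, Λ v = 1 ∧ ‖ι v‖ < d + 1 / ((j : ℝ) + 1) := by
    intro j
    obtain ⟨_, ⟨v, hv, rfl⟩, h⟩ := exists_lt_of_csInf_lt hAne
      (lt_add_of_pos_right d (Nat.one_div_pos_of_nat (α := ℝ) (n := j)))
    exact ⟨v, hv, h⟩
  choose a ha1 ha2 using hseq
  have hnorm : Tendsto (fun j => ‖ι (a j)‖) atTop (𝓝 d) := by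
    have h1 : Tendsto (fun j : ℕ => d + 1 / ((j : ℝ) + 1)) atTop (𝓝 (d + 0)) :=
      tendsto_const_nhds.add tendsto_one_div_add_atTop_nhds_zero_nat
    rw [add_zero] at h1
    exact tendsto_of_tendsto_of_tendsto_of_le_of_le tendsto_const_nhds h1
      (fun j => hdle _ (ha1 j)) fun j => (ha2 j).le
  have hcau : CauchySeq fun j => ι (a j) := by
    refine cauchySeq_of_tendsto_norm hp hdpos.le hnorm fun i j => ?_
    rw [← map_add, ← map_smul]
    refine hdle _ ?_
    rw [map_smul, map_add, ha1, ha1]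
    norm_num
  obtain ⟨u, hu⟩ := cauchySeq_tendsto_of_complete hcau
  have hud : ‖u‖ = d := tendsto_nhds_unique hu.norm hnorm
  have hg := memLp_norm_rpow_smul hpq (Lp.memLp u)
  set g : X → E := fun x => ‖u x‖ ^ (p - 2) • u x with hgdef
  -- Adding `t ζ` to the minimizing sequence keeps it in the hyperplane, so `u` minimizes the norm
  -- along these directions, and the Euler–Lagrange equation says that `g` annihilates them.
  have hker : ∀ ζ, Λ ζ = 0 → integralInner hpq hg (ι ζ) = 0 := by
    intro ζ hζ
    refine integral_inner_eq_zero_of_norm_le hpq (Lp.memLp u) (Lp.memLp (ι ζ)) fun t => ?_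
    have h1 : d ≤ ‖u + t • ι ζ‖ := by
      refine ge_of_tendsto ((hu.add_const (t • ι ζ)).norm) (Eventually.of_forall fun j => ?_)
      rw [← map_smul, ← map_add]
      refine hdle _ ?_
      rw [map_add, map_smul, hζ, ha1, smul_zero, add_zero]
    have h2 : ∫ x, ‖u x + t • ι ζ x‖ ^ p ∂μ = ‖u + t • ι ζ‖ ^ p := by
      rw [norm_rpow_eq_integral hp0]
      refine integral_congr_ae ?_
      filter_upwards [Lp.coeFn_add u (t • ι ζ), Lp.coeFn_smul t (ι ζ)] with x hx hx'
      rw [hx, Pi.add_apply, hx', Pi.smul_apply]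
    rw [h2, ← norm_rpow_eq_integral hp0, hud]
    exact Real.rpow_le_rpow hdpos.le h1 hp0.le
  have hgu : integralInner hpq hg u = d ^ p := by
    rw [integralInner_apply, ← hud, norm_rpow_eq_integral hp0]
    refine integral_congr_ae (Eventually.of_forall fun x => ?_)
    simp only [hgdef, real_inner_smul_left, real_inner_self_eq_norm_sq]
    rcases eq_or_ne (‖u x‖) 0 with h | h
    · rw [h, Real.zero_rpow hp0.ne']
      simp
    · rw [← Real.rpow_natCast, ← Real.rpow_add ((norm_nonneg _).lt_of_ne' h)]
      congr 1
      push_cast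
      ring
  -- Two elements of the hyperplane differ by an element of the kernel, so the pairing with `g` is
  -- constant on it; passing to the limit `u`, the constant is `d ^ p`.
  have hconst : ∀ v, Λ v = 1 → integralInner hpq hg (ι v) = d ^ p := by
    intro v hv
    refine tendsto_nhds_unique (tendsto_const_nhds.congr fun j => ?_)
      (hgu ▸ ((integralInner hpq hg).continuous.tendsto u).comp hu)
    have h1 := hker (v - a j) (by rw [map_sub, hv, ha1, sub_self])
    rw [map_sub, map_sub, sub_eq_zero] at h1
    exact h1
  have hdp : 0 < d ^ p := Real.rpow_pos_of_pos hdpos p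
  refine ⟨(d ^ p)⁻¹ • g, hg.const_smul _, fun v => ?_⟩
  have h1 : integralInner hpq hg (ι v) = Λ v * d ^ p := by
    set w := (Λ v₀)⁻¹ • v₀
    have h2 := hker (v - Λ v • w) (by
      rw [map_sub, map_smul, show Λ w = 1 from hA, smul_eq_mul, mul_one, sub_self])
    rw [map_sub, map_sub, map_smul, map_smul, hconst w hA, sub_eq_zero, smul_eq_mul] at h2
    exact h2
  have h3 : ∫ x, inner ℝ (((d ^ p)⁻¹ • g) x) (ι v x) ∂μ =
      (d ^ p)⁻¹ * integralInner hpq hg (ι v) := by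
    rw [integralInner_apply, ← integral_const_mul]
    refine integral_congr_ae (Eventually.of_forall fun x => ?_)
    simp only [Pi.smul_apply, real_inner_smul_left]
  rw [h3, h1, mul_comm (Λ v), inv_mul_cancel_left₀ hdp.ne']

end Representation

/-! ### Measurable frames of the tangent bundle -/

section Frames

lemma aestronglyMeasurable_of_iUnion_fiber {X : Type*} [MeasurableSpace X] {E : Type*} [TopologicalSpace E]
    [TopologicalSpace.PseudoMetrizableSpace E] {μ : Measure X} {F : X → E}
    {m : X → ℕ}
    (h : ∀ i, AEStronglyMeasurable F (μ.restrict (m ⁻¹' {i}))) : AEStronglyMeasurable F μ := by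
  have hU : ⋃ i, m ⁻¹' {i} = univ := by
    rw [← preimage_iUnion, iUnion_singleton_eq_range]
    simp
  rw [← Measure.restrict_univ (μ := μ), ← hU]
  exact aestronglyMeasurable_iUnion_iff.2 h

variable {n : ℕ} {M : Type*} [EMetricSpace M] [ChartedSpace (EuclideanSpace ℝ (Fin n)) M]
  [IsManifold (𝓡 n) ∞ M] [RiemannianBundle (fun x : M => TangentSpace (𝓡 n) x)]

lemma continuous_compContinuousLinearMap (n k : ℕ) :
    Continuous fun z : (EuclideanSpace ℝ (Fin n) [⋀^Fin k]→L[ℝ] ℝ) ×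
      (EuclideanSpace ℝ (Fin n) →L[ℝ] EuclideanSpace ℝ (Fin n)) =>
        z.1.compContinuousLinearMap z.2 :=
  continuous_iff_continuousAt.2 fun _ =>
    (contDiffAt_compContinuousLinearMap contDiffAt_fst contDiffAt_snd).continuousAt

lemma volumeForm_comp_coordL (o : (x : M) → Orientation ℝ (TangentSpace (𝓡 n) x) (Fin n))
    (x₀ x : M) (T : EuclideanSpace ℝ (Fin n) →L[ℝ] EuclideanSpace ℝ (Fin n)) :
    (o x).volumeForm (fun i => coordL n x₀ x (T (EuclideanSpace.single i 1))) =
      T.det * volFactor o x₀ x := by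
  have h1 := AlternatingMap.eq_smul_basis_det (EuclideanSpace.basisFun (Fin n) ℝ).toBasis
    ((o x).volumeForm.compLinearMap (coordL n x₀ x).toLinearMap)
  have h2 := congrArg (fun γ => γ (T.toLinearMap ∘
    (EuclideanSpace.basisFun (Fin n) ℝ).toBasis)) h1
  simp only [AlternatingMap.smul_apply, Basis.det_comp, Basis.det_self, mul_one, smul_eq_mul] at h2
  rw [mul_comm]
  convert h2 using 1
  · simp only [AlternatingMap.compLinearMap_apply]
    congr 1
    funext i
    simp
  · congr 1
    simp only [AlternatingMap.compLinearMap_apply, volFactor]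
    congr 1
    funext i
    simp [coordFrame]

variable [MeasurableSpace M]

/-- A measurable, uniformly almost orthonormal frame of the tangent bundle. -/
structure MeasurableFrame (o : (x : M) → Orientation ℝ (TangentSpace (𝓡 n) x) (Fin n)) where
  /-- the frame, as a linear map -/
  toFun : ∀ x : M, EuclideanSpace ℝ (Fin n) →L[ℝ] TangentSpace (𝓡 n) x
  /-- the dual frame -/
  inv : ∀ x : M, TangentSpace (𝓡 n) x →L[ℝ] EuclideanSpace ℝ (Fin n)
  apply_inv : ∀ x w, toFun x (inv x w) = w
  inv_apply : ∀ x v, inv x (toFun x v) = v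
  norm_apply_le : ∀ x v, ‖toFun x v‖ ≤ 2 * ‖v‖
  norm_inv_le : ∀ x w, ‖inv x w‖ ≤ 2 * ‖w‖
  aestronglyMeasurable_pullback : ∀ {k : ℕ} {θ : DiffForm n M k}, IsMeasurableForm θ →
    AEStronglyMeasurable (fun x => (θ x).compContinuousLinearMap (toFun x)) (riemannianVolume n M)
  isMeasurableForm : ∀ {k : ℕ} {G : M → EuclideanSpace ℝ (Fin n) [⋀^Fin k]→L[ℝ] ℝ},
    AEStronglyMeasurable G (riemannianVolume n M) →
    IsMeasurableForm (fun x => (G x).compContinuousLinearMap (inv x) : DiffForm n M k)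
  aestronglyMeasurable_volume : AEStronglyMeasurable
    (fun x => (o x).volumeForm fun i => toFun x (EuclideanSpace.single i 1)) (riemannianVolume n M)

variable {o : (x : M) → Orientation ℝ (TangentSpace (𝓡 n) x) (Fin n)}

namespace MeasurableFrame

variable (Fr : MeasurableFrame o) {k l : ℕ}

/-- The components of a form in the frame. -/
def pullback (θ : DiffForm n M k) (x : M) : EuclideanSpace ℝ (Fin n) [⋀^Fin k]→L[ℝ] ℝ :=
  (θ x).compContinuousLinearMap (Fr.toFun x)

/-- The volume of the frame. -/
def volume (x : M) : ℝ := (o x).volumeForm fun i => Fr.toFun x (EuclideanSpace.single i 1)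

lemma norm_pullback_le (θ : DiffForm n M k) (x : M) :
    ‖Fr.pullback θ x‖ ≤ formConst n k * 2 ^ k * formNorm n (θ x) :=
  norm_compContinuousLinearMap_le _ zero_le_two (Fr.norm_apply_le x) _

lemma formNorm_le_norm_pullback (θ : DiffForm n M k) (x : M) :
    formNorm n (θ x) ≤ (n : ℝ) ^ k * 2 ^ k * ‖Fr.pullback θ x‖ :=
  formNorm_le_norm_compContinuousLinearMap _ (Fr.inv x) (Fr.apply_inv x) zero_le_two
    (Fr.norm_inv_le x) _

lemma pairing_mul_volume (h : k + l = n) (θ : DiffForm n M k) (ψ : DiffForm n M l) (x : M) :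
    pairing o h θ ψ x * Fr.volume x = formWedge h (Fr.pullback θ x) (Fr.pullback ψ x) := by
  have h1 := volCoeff_smul_volumeForm (o x)
    ((wedge (θ x).toAlternatingMap (ψ x).toAlternatingMap).domDomCongr (finCongr h))
  have h2 := congrArg (fun γ => γ fun i => Fr.toFun x (EuclideanSpace.single i 1)) h1
  refine h2.symm.trans ?_
  exact (wedgeEval_comp h (θ x).toAlternatingMap (ψ x).toAlternatingMap
    (Fr.toFun x).toLinearMap _).symm

lemma abs_volume_le (x : M) : |Fr.volume x| ≤ 2 ^ n := by
  refine ((o x).abs_volumeForm_apply_le _).trans ?_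
  refine (Finset.prod_le_prod (fun _ _ => norm_nonneg _) fun i _ =>
    (Fr.norm_apply_le x _)).trans ?_
  simp

lemma volume_ne_zero (x : M) : Fr.volume x ≠ 0 := by
  intro h0
  let e : EuclideanSpace ℝ (Fin n) ≃ₗ[ℝ] TangentSpace (𝓡 n) x :=
    { (Fr.toFun x).toLinearMap with
      invFun := Fr.inv x
      left_inv := Fr.inv_apply x
      right_inv := Fr.apply_inv x }
  set b := (EuclideanSpace.basisFun (Fin n) ℝ).toBasis.map e
  have hb : ⇑b = fun i => Fr.toFun x (EuclideanSpace.single i 1) := by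
    funext i
    simp [b, e]
  have h1 : (o x).volumeForm = 0 := by
    have := AlternatingMap.eq_smul_basis_det b (o x).volumeForm
    rw [this, hb]
    change Fr.volume x • _ = 0
    rw [h0, zero_smul]
  have h2 := (o x).abs_volumeForm_apply_of_orthonormal (onb n _)
  rw [h1] at h2
  simp at h2

/-- The form with given components in the frame. -/
def pushforward (G : M → EuclideanSpace ℝ (Fin n) [⋀^Fin k]→L[ℝ] ℝ) : DiffForm n M k :=
  fun x => (G x).compContinuousLinearMap (Fr.inv x)

lemma pullback_pushforward (G : M → EuclideanSpace ℝ (Fin n) [⋀^Fin k]→L[ℝ] ℝ) (x : M) :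
    Fr.pullback (Fr.pushforward G) x = G x := by
  ext v
  exact congrArg (G x) (funext fun j => Fr.inv_apply x (v j))

end MeasurableFrame

variable [IsContMDiffRiemannianBundle (𝓡 n) ∞ (EuclideanSpace ℝ (Fin n))
    (fun x : M => TangentSpace (𝓡 n) x)]
    [BorelSpace M] [SecondCountableTopology M]

/-- On each piece of a countable measurable partition subordinate to good balls, take the
combination of coordinate fields, with constant coefficients, that is orthonormal at the centre of
the ball. On the ball lengths change by a factor at most `2`, and no continuity across the pieces is
required. -/
lemma nonempty_measurableFrame (ho : IsContinuousOrientation o) :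
    Nonempty (MeasurableFrame o) := by
  rcases isEmpty_or_nonempty M with hM | hM
  · exact ⟨{
      toFun := fun x => hM.elim x
      inv := fun x => hM.elim x
      apply_inv := fun x => hM.elim x
      inv_apply := fun x => hM.elim x
      norm_apply_le := fun x => hM.elim x
      norm_inv_le := fun x => hM.elim x
      aestronglyMeasurable_pullback := fun _ =>
        StronglyMeasurable.of_subsingleton_dom.aestronglyMeasurable
      isMeasurableForm := fun _ x => hM.elim x
      aestronglyMeasurable_volume :=
        StronglyMeasurable.of_subsingleton_dom.aestronglyMeasurable }⟩
  obtain ⟨c, B, hB⟩ := exists_seq_goodBall ho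
  have hex : ∀ x, ∃ i, x ∈ (B i).dom := fun x => by
    have : x ∈ ⋃ i, (B i).dom := hB ▸ mem_univ x
    exact mem_iUnion.1 this
  classical
  -- The index of the first good ball that contains `x`; its fibres are the pieces.
  let m : M → ℕ := fun x => Nat.find (hex x)
  have hm : ∀ x, x ∈ (B (m x)).dom := fun x => Nat.find_spec (hex x)
  have hmeas : ∀ i, MeasurableSet (m ⁻¹' {i}) := by
    intro i
    have : m ⁻¹' {i} = (B i).dom \ ⋃ j ∈ Finset.range i, (B j).dom := by
      ext x
      simp only [mem_preimage, mem_singleton_iff, m, Nat.find_eq_iff, Set.mem_sdiff, mem_iUnion,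
        Finset.mem_range, not_exists]
    rw [this]
    exact (B i).isOpen_dom.measurableSet.diff (Finset.measurableSet_biUnion _ fun j _ =>
      (B j).isOpen_dom.measurableSet)
  have hsub : ∀ i, m ⁻¹' {i} ⊆ (B i).dom := by
    rintro i x rfl
    exact hm x
  let R : ∀ i, EuclideanSpace ℝ (Fin n) ≃ₗᵢ[ℝ] TangentSpace (𝓡 n) (c i) := fun i =>
    (onb n (TangentSpace (𝓡 n) (c i))).repr.symm
  -- Normalizes the coordinates: at the centre, `coordL` composed with `T i` is the isometry `R i`.
  let T : ∀ i, EuclideanSpace ℝ (Fin n) →L[ℝ] EuclideanSpace ℝ (Fin n) := fun i =>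
    (coordInv n (c i) (c i)).comp ((R i).toContinuousLinearEquiv :
      EuclideanSpace ℝ (Fin n) →L[ℝ] TangentSpace (𝓡 n) (c i))
  let T' : ∀ i, EuclideanSpace ℝ (Fin n) →L[ℝ] EuclideanSpace ℝ (Fin n) := fun i =>
    ((R i).symm.toContinuousLinearEquiv :
      TangentSpace (𝓡 n) (c i) →L[ℝ] EuclideanSpace ℝ (Fin n)).comp (coordL n (c i) (c i))
  have hTT' : ∀ i v, T i (T' i v) = v := fun i v => by
    refine (congrArg (coordInv n (c i) (c i)) ((R i).apply_symm_apply _)).trans ?_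
    exact coordInv_coordL (mem_extChartAt_source (c i)) v
  have hT'T : ∀ i v, T' i (T i v) = v := fun i v => by
    refine (congrArg (R i).symm (coordL_coordInv (mem_extChartAt_source (c i)) _)).trans ?_
    exact (R i).symm_apply_apply v
  have hTn : ∀ i v, ‖coordL n (c i) (c i) (T i v)‖ = ‖v‖ := fun i v => by
    refine (congrArg norm (coordL_coordInv (mem_extChartAt_source (c i)) (R i v))).trans ?_
    exact (R i).norm_map v
  let F : ∀ x : M, EuclideanSpace ℝ (Fin n) →L[ℝ] TangentSpace (𝓡 n) x := fun x =>
    (coordL n (c (m x)) x).comp (T (m x))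
  let F' : ∀ x : M, TangentSpace (𝓡 n) x →L[ℝ] EuclideanSpace ℝ (Fin n) := fun x =>
    (T' (m x)).comp (coordInv n (c (m x)) x)
  have hFF' : ∀ x w, F x (F' x w) = w := fun x w => by
    refine (congrArg (coordL n (c (m x)) x) (hTT' _ _)).trans ?_
    exact coordL_coordInv (hm x).1 w
  have hF'F : ∀ x v, F' x (F x v) = v := fun x v => by
    refine (congrArg (T' (m x)) (coordInv_coordL (hm x).1 _)).trans ?_
    exact hT'T _ v
  have hFn : ∀ x v, ‖F x v‖ ≤ 2 * ‖v‖ ∧ ‖v‖ ≤ 2 * ‖F x v‖ := fun x v => by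
    have h1 := (B (m x)).coordL_le_center _ (hm x).2 (T (m x) v)
    rw [(extChartAt (𝓡 n) (c (m x))).left_inv (hm x).1, hTn] at h1
    exact h1
  refine ⟨⟨F, F', hFF', hF'F, fun x v => (hFn x v).1, fun x w => ?_, fun {k θ} hθ => ?_,
    fun {k G} hG x₀ => ?_, ?_⟩⟩
  · have h1 := (hFn x (F' x w)).2
    rwa [hFF'] at h1
  · refine aestronglyMeasurable_of_iUnion_fiber (m := m) fun i => ?_
    have h1 := ((B i).aestronglyMeasurable_localRep hθ).mono_measure
      (Measure.restrict_mono (hsub i) le_rfl)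
    have h2 := (ContinuousAlternatingMap.compContinuousLinearMapCLM (ι := Fin k) (F := ℝ)
      (T i)).continuous.comp_aestronglyMeasurable h1
    refine h2.congr ?_
    filter_upwards [ae_restrict_mem (hmeas i)] with x hx
    obtain rfl : m x = i := hx
    rfl
  · refine aestronglyMeasurable_of_iUnion_fiber (m := m) fun i => ?_
    rw [Measure.restrict_restrict (hmeas i), ← extChartAt_source (𝓡 n)]
    set S := m ⁻¹' {i} ∩ (extChartAt (𝓡 n) x₀).source with hS
    have hSm : MeasurableSet S := (hmeas i).inter (isOpen_extChartAt_source x₀).measurableSet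
    have h1 : AEStronglyMeasurable (tangentCoordChange (𝓡 n) x₀ (c i))
        ((riemannianVolume n M).restrict S) :=
      ((continuousOn_tangentCoordChange x₀ (c i)).mono fun x hx =>
        ⟨hx.2, (hsub i hx.1).1⟩).aestronglyMeasurable hSm
    have h2 := (ContinuousAlternatingMap.compContinuousLinearMapCLM (ι := Fin k) (F := ℝ)
      (T' i)).continuous.comp_aestronglyMeasurable (hG.restrict (s := S))
    have h3 := (continuous_compContinuousLinearMap n k).comp_aestronglyMeasurable (h2.prodMk h1)
    refine h3.congr ?_
    filter_upwards [ae_restrict_mem hSm] with x hx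
    have hmx : m x = i := hx.1
    refine Eq.trans ?_ (localRep_change (fun x => (G x).compContinuousLinearMap (F' x))
      (hsub i hx.1).1 hx.2).symm
    refine congrArg (fun α => ContinuousAlternatingMap.compContinuousLinearMap α _) ?_
    subst hmx
    ext v
    refine congrArg (G x) (funext fun j => ?_)
    exact congrArg (T' (m x)) (coordInv_coordL (hm x).1 (v j)).symm
  · refine aestronglyMeasurable_of_iUnion_fiber (m := m) fun i => ?_
    have h1 : AEStronglyMeasurable (fun x => (T i).det * ((B i).sign * √(gram n (c i) x).det))
        ((riemannianVolume n M).restrict (m ⁻¹' {i})) :=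
      ((((continuousOn_sqrt_det_gram (c i)).mono fun x hx =>
        (hsub i hx).1).aestronglyMeasurable (hmeas i)).const_mul _).const_mul _
    refine h1.congr ?_
    filter_upwards [ae_restrict_mem (hmeas i)] with x hx
    obtain rfl : m x = i := hx
    have h2 := (B (m x)).volFactor_eq _ (hm x).2
    rw [(extChartAt (𝓡 n) (c (m x))).left_inv (hm x).1] at h2
    rw [← h2]
    exact (volumeForm_comp_coordL o (c (m x)) x (T (m x))).symm

namespace MeasurableFrame

variable (Fr : MeasurableFrame o) {k l : ℕ} {p : ℝ≥0∞}

lemma memLp_pullback {θ : DiffForm n M k} (hθ : θ ∈ lpForms n M k p) :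
    MemLp (Fr.pullback θ) p (riemannianVolume n M) :=
  (memLp_formNorm hθ).of_le_mul (Fr.aestronglyMeasurable_pullback hθ.1)
    (Eventually.of_forall fun x => by
      rw [Real.norm_of_nonneg (formNorm_nonneg _)]
      exact Fr.norm_pullback_le θ x)

lemma pushforward_mem_lpForms {G : M → EuclideanSpace ℝ (Fin n) [⋀^Fin k]→L[ℝ] ℝ}
    (hG : MemLp G p (riemannianVolume n M)) : Fr.pushforward G ∈ lpForms n M k p := by
  have h1 := Fr.isMeasurableForm hG.1
  refine ⟨h1, ?_⟩
  have h2 : MemLp (fun x => formNorm n (Fr.pushforward G x)) p (riemannianVolume n M) :=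
    hG.of_le_mul (c := (n : ℝ) ^ k * 2 ^ k) (aemeasurable_formNorm h1).aestronglyMeasurable
      (Eventually.of_forall fun x => by
        rw [Real.norm_of_nonneg (formNorm_nonneg _)]
        refine (Fr.formNorm_le_norm_pullback _ x).trans_eq ?_
        rw [Fr.pullback_pushforward])
  exact h2.2

end MeasurableFrame

end Frames

/-! ### Pointwise duality of forms -/

section FormDuality

variable {n k l : ℕ}

/-- In finite dimension, nondegeneracy in one factor makes the pairing surjective onto the dual of
that factor. The choice of preimages is made linearly, so that composing with it preserves
measurability and `L^q` bounds. -/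
lemma exists_linearMap_formWedge_eq (h : k + l = n) {W : Type*} [AddCommGroup W] [Module ℝ W]
    (b : W →ₗ[ℝ] Dual ℝ (EuclideanSpace ℝ (Fin n) [⋀^Fin k]→L[ℝ] ℝ)) :
    ∃ D : W →ₗ[ℝ] EuclideanSpace ℝ (Fin n) [⋀^Fin l]→L[ℝ] ℝ,
      ∀ w α, formWedge h α (D w) = b w α := by
  let B : (EuclideanSpace ℝ (Fin n) [⋀^Fin k]→L[ℝ] ℝ) →ₗ[ℝ]
      (EuclideanSpace ℝ (Fin n) [⋀^Fin l]→L[ℝ] ℝ) →ₗ[ℝ] ℝ :=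
    LinearMap.mk₂ ℝ (formWedge h) (fun _ _ _ => formWedge_add_left h _ _ _)
      (fun _ _ _ => formWedge_smul_left h _ _ _) (fun _ _ _ => formWedge_add_right h _ _ _)
      (fun _ _ _ => formWedge_smul_right h _ _ _)
  have hB : Function.Injective B := by
    rw [injective_iff_map_eq_zero]
    exact fun α hα => eq_zero_of_formWedge_eq_zero h fun β => LinearMap.congr_fun hα β
  obtain ⟨g, hg⟩ := B.flip.exists_rightInverse_of_surjective
    (LinearMap.range_eq_top.2 (LinearMap.flip_surjective_iff₁.2 hB))
  exact ⟨g.comp b, fun w α => LinearMap.congr_fun (LinearMap.congr_fun hg (b w)) α⟩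

end FormDuality

/-! ### Duality of Lebesgue spaces of forms -/

section LpDuality

variable {n : ℕ} {M : Type*} [EMetricSpace M] [ChartedSpace (EuclideanSpace ℝ (Fin n)) M]
  [IsManifold (𝓡 n) ∞ M] [RiemannianBundle (fun x : M => TangentSpace (𝓡 n) x)]
  [IsContMDiffRiemannianBundle (𝓡 n) ∞ (EuclideanSpace ℝ (Fin n))
    (fun x : M => TangentSpace (𝓡 n) x)] [MeasurableSpace M] [BorelSpace M]
  [SecondCountableTopology M] {o : (x : M) → Orientation ℝ (TangentSpace (𝓡 n) x) (Fin n)}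

variable (n) in
/-- A Euclidean model of the space of forms of degree `k` on `ℝⁿ`. -/
abbrev FormModel (k : ℕ) : Type :=
  EuclideanSpace ℝ (Fin (finrank ℝ (EuclideanSpace ℝ (Fin n) [⋀^Fin k]→L[ℝ] ℝ)))

variable (n) in
/-- Linear coordinates on the space of forms of degree `k` on `ℝⁿ`. -/
def formModel (k : ℕ) : (EuclideanSpace ℝ (Fin n) [⋀^Fin k]→L[ℝ] ℝ) ≃L[ℝ] FormModel n k :=
  toEuclidean

namespace MeasurableFrame

variable (Fr : MeasurableFrame o) {k l : ℕ} {p : ℝ≥0∞}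

lemma memLp_formModel_pullback {θ : DiffForm n M k} (hθ : θ ∈ lpForms n M k p) :
    MemLp (fun x => formModel n k (Fr.pullback θ x)) p (riemannianVolume n M) :=
  (formModel n k).toContinuousLinearMap.comp_memLp' (Fr.memLp_pullback hθ)

/-- The components of an `L^p` form, as a vector valued `L^p` function. -/
def toLp (k : ℕ) (p : ℝ≥0∞) :
    lpForms n M k p →ₗ[ℝ] Lp (FormModel n k) p (riemannianVolume n M) where
  toFun θ := (Fr.memLp_formModel_pullback θ.2).toLp _
  map_add' θ θ' := by
    rw [← MemLp.toLp_add]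
    refine MemLp.toLp_congr _ _ (Eventually.of_forall fun x => ?_)
    exact (formModel n k).map_add (Fr.pullback θ x) (Fr.pullback θ' x)
  map_smul' c θ := by
    rw [RingHom.id_apply, ← MemLp.toLp_const_smul]
    refine MemLp.toLp_congr _ _ (Eventually.of_forall fun x => ?_)
    exact (formModel n k).map_smul c (Fr.pullback θ x)

lemma coeFn_toLp (θ : lpForms n M k p) :
    Fr.toLp k p θ =ᵐ[riemannianVolume n M] fun x => formModel n k (Fr.pullback θ x) :=
  MemLp.coeFn_toLp (Fr.memLp_formModel_pullback θ.2)

lemma norm_toLp (θ : lpForms n M k p) : ‖Fr.toLp k p θ‖ =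
    (eLpNorm (fun x => formModel n k (Fr.pullback θ x)) p (riemannianVolume n M)).toReal :=
  Lp.norm_toLp _ (Fr.memLp_formModel_pullback θ.2)

lemma exists_norm_toLp_le (k : ℕ) (p : ℝ≥0∞) : ∃ C : ℝ, 0 ≤ C ∧ ∀ θ : lpForms n M k p,
    ‖Fr.toLp k p θ‖ ≤ C * (lpNorm (θ : DiffForm n M k) p).toReal := by
  obtain ⟨K, hK, hle⟩ := (formModel n k).toContinuousLinearMap.bound
  have hC : 0 ≤ K * (formConst n k * 2 ^ k) :=
    mul_nonneg hK.le (mul_nonneg (formConst_nonneg n k) (by positivity))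
  refine ⟨_, hC, fun θ => ?_⟩
  rw [norm_toLp, ← ENNReal.toReal_ofReal_mul _ _ hC]
  refine ENNReal.toReal_mono (ENNReal.mul_lt_top ENNReal.ofReal_lt_top θ.2.2).ne ?_
  refine eLpNorm_le_mul_eLpNorm_of_ae_le_mul (Eventually.of_forall fun x => ?_) p
  rw [Real.norm_of_nonneg (formNorm_nonneg _), mul_assoc]
  exact (hle _).trans (mul_le_mul_of_nonneg_left (Fr.norm_pullback_le _ x) hK.le)

/-- With `exists_norm_toLp_le` and `surjective_toLp`, this identifies the `L^p` forms, up to forms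
of norm zero, with a Banach space of vector valued functions. -/
lemma exists_lpNorm_le (k : ℕ) (p : ℝ≥0∞) : ∃ C : ℝ, 0 ≤ C ∧ ∀ θ : lpForms n M k p,
    (lpNorm (θ : DiffForm n M k) p).toReal ≤ C * ‖Fr.toLp k p θ‖ := by
  obtain ⟨K, hK, hle⟩ := (formModel n k).symm.toContinuousLinearMap.bound
  have hC : 0 ≤ (n : ℝ) ^ k * 2 ^ k * K := mul_nonneg (by positivity) hK.le
  refine ⟨_, hC, fun θ => ?_⟩
  rw [norm_toLp, ← ENNReal.toReal_ofReal_mul _ _ hC]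
  refine ENNReal.toReal_mono (ENNReal.mul_lt_top ENNReal.ofReal_lt_top
    (Fr.memLp_formModel_pullback θ.2).2).ne ?_
  refine eLpNorm_le_mul_eLpNorm_of_ae_le_mul (Eventually.of_forall fun x => ?_) p
  rw [Real.norm_of_nonneg (formNorm_nonneg _), mul_assoc]
  refine (Fr.formNorm_le_norm_pullback _ x).trans (mul_le_mul_of_nonneg_left ?_ (by positivity))
  exact (congrArg norm ((formModel n k).symm_apply_apply _)).symm.trans_le
    (hle (formModel n k (Fr.pullback θ x)))

lemma surjective_toLp (k : ℕ) (p : ℝ≥0∞) : Function.Surjective (Fr.toLp k p) := by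
  intro u
  have h1 : MemLp (fun x => (formModel n k).symm (u x)) p (riemannianVolume n M) :=
    (formModel n k).symm.toContinuousLinearMap.comp_memLp' (Lp.memLp u)
  refine ⟨⟨_, Fr.pushforward_mem_lpForms h1⟩, ?_⟩
  refine Lp.ext ((Fr.coeFn_toLp _).trans (Eventually.of_forall fun x => ?_))
  exact (congrArg (formModel n k) (Fr.pullback_pushforward _ x)).trans
    ((formModel n k).apply_symm_apply _)

end MeasurableFrame

/-- Every bounded functional of `L^p` forms is the pairing with an `L^q` form. -/
theorem exists_wedgeIntegral_eq (ho : IsContinuousOrientation o) {p q : ℝ}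
    (hpq : p.HolderConjugate q) {k l : ℕ} (h : k + l = n) {V : Type*} [AddCommGroup V] [Module ℝ V]
    (ι : V →ₗ[ℝ] lpForms n M k (ENNReal.ofReal p)) (Λ : V →ₗ[ℝ] ℝ) (C : ℝ)
    (hΛ : ∀ v, |Λ v| ≤ C * (lpNorm (ι v : DiffForm n M k) (ENNReal.ofReal p)).toReal) :
    ∃ ψ ∈ lpForms n M l (ENNReal.ofReal q), ∀ v, wedgeIntegral o h (ι v) ψ = Λ v := by
  obtain ⟨Fr⟩ := nonempty_measurableFrame ho
  have : Fact (1 ≤ ENNReal.ofReal p) := ⟨by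
    rw [← ENNReal.ofReal_one]
    exact ENNReal.ofReal_le_ofReal hpq.lt.le⟩
  obtain ⟨C', hC', hle⟩ := Fr.exists_lpNorm_le k (ENNReal.ofReal p)
  obtain ⟨g, hg, hgΛ⟩ := exists_memLp_integral_inner_eq hpq
    ((Fr.toLp k (ENNReal.ofReal p)).comp ι) Λ (|C| * C') fun v =>
      (hΛ v).trans ((mul_le_mul_of_nonneg_right (le_abs_self C) ENNReal.toReal_nonneg).trans (by
        rw [mul_assoc]
        exact mul_le_mul_of_nonneg_left (hle (ι v)) (abs_nonneg C)))
  -- `D` turns the inner product with `g` into a wedge product. The wedge of components in the frame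
  -- is the pairing times the volume of the frame, and the factor `Fr.volume` in the form below
  -- compensates for this.
  obtain ⟨D, hD⟩ := exists_linearMap_formWedge_eq h
    (((innerₗ (FormModel n k)).compl₂ ((formModel n k).toLinearEquiv : _ →ₗ[ℝ] FormModel n k)))
  have h1 : MemLp (fun x => D (g x)) (ENNReal.ofReal q) (riemannianVolume n M) :=
    D.toContinuousLinearMap.comp_memLp' hg
  have h2 : MemLp (fun x => Fr.volume x • D (g x)) (ENNReal.ofReal q) (riemannianVolume n M) :=
    h1.of_le_mul (c := 2 ^ n) (Fr.aestronglyMeasurable_volume.smul h1.1)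
      (Eventually.of_forall fun x => by
        rw [norm_smul, Real.norm_eq_abs]
        exact mul_le_mul_of_nonneg_right (Fr.abs_volume_le x) (norm_nonneg _))
  refine ⟨_, Fr.pushforward_mem_lpForms h2, fun v => ?_⟩
  rw [hgΛ v, wedgeIntegral]
  refine integral_congr_ae ?_
  filter_upwards [Fr.coeFn_toLp (ι v)] with x hx
  refine mul_right_cancel₀ (Fr.volume_ne_zero x) ?_
  rw [Fr.pairing_mul_volume, Fr.pullback_pushforward, formWedge_smul_right, hD, mul_comm]
  congr 1
  rw [LinearMap.comp_apply, hx]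
  rfl

/-- Hölder's inequality. -/
lemma abs_wedgeIntegral_le (o : (x : M) → Orientation ℝ (TangentSpace (𝓡 n) x) (Fin n)) {p q : ℝ}
    (hpq : p.HolderConjugate q) {k l : ℕ} (h : k + l = n) {θ : DiffForm n M k}
    {ψ : DiffForm n M l} (hθ : θ ∈ lpForms n M k (ENNReal.ofReal p))
    (hψ : ψ ∈ lpForms n M l (ENNReal.ofReal q)) :
    |wedgeIntegral o h θ ψ| ≤ wedgeConst n k l * ((lpNorm θ (ENNReal.ofReal p)).toReal *
      (lpNorm ψ (ENNReal.ofReal q)).toReal) := by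
  have h1 := abs_integral_inner_le hpq (memLp_formNorm hψ) (memLp_formNorm hθ)
  have h2 : ∫ x, inner ℝ (formNorm n (ψ x)) (formNorm n (θ x)) ∂(riemannianVolume n M) =
      ∫ x, formNorm n (θ x) * formNorm n (ψ x) ∂(riemannianVolume n M) :=
    integral_congr_ae (Eventually.of_forall fun x => by simp)
  rw [h2] at h1
  refine (norm_integral_le_of_norm_le (f := pairing o h θ ψ) ((integrable_formNorm_mul hpq hθ hψ).const_mul
    (wedgeConst n k l)) (Eventually.of_forall fun x => abs_pairing_le o h θ ψ x)).trans ?_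
  rw [integral_const_mul]
  refine mul_le_mul_of_nonneg_left ?_ (wedgeConst_nonneg n k l)
  rw [mul_comm (lpNorm θ _).toReal]
  exact (le_abs_self _).trans h1

end LpDuality

/-! ### Closed and exact forms described by duality -/

section Duality

variable {n : ℕ} {M : Type*} [EMetricSpace M] [ChartedSpace (EuclideanSpace ℝ (Fin n)) M]
  [RiemannianBundle (fun x : M => TangentSpace (𝓡 n) x)]

lemma eq_zero_of_formNorm_eq_zero {k : ℕ} {x : M} {α : TangentSpace (𝓡 n) x [⋀^Fin k]→L[ℝ] ℝ}
    (h : formNorm n α = 0) : α = 0 := by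
  ext v
  have h1 := abs_form_apply_le (n := n) α v
  rw [h, mul_zero, zero_mul] at h1
  exact abs_nonpos_iff.1 h1

/-- Among more than `n` vectors of a basis one is repeated. -/
lemma eq_zero_of_lt_degree {k : ℕ} (hk : n < k) (θ : DiffForm n M k) : θ = 0 := by
  funext x
  refine eq_zero_of_formNorm_eq_zero ?_
  rw [formNorm, Finset.sum_eq_zero, mul_zero, Real.sqrt_zero]
  intro f _
  have hf : ¬Function.Injective f := fun hf => by
    have := Fintype.card_le_of_injective f hf
    simp only [Fintype.card_fin] at this
    omega
  obtain ⟨i, j, hij, hne⟩ : ∃ i j, f i = f j ∧ i ≠ j := by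
    simpa [Function.Injective] using hf
  rw [(θ x).map_eq_zero_of_eq _ (congrArg (onb n (TangentSpace (𝓡 n) x)) hij) hne]
  norm_num

variable [IsManifold (𝓡 n) ∞ M]
variable [MeasurableSpace M] {o : (x : M) → Orientation ℝ (TangentSpace (𝓡 n) x) (Fin n)}

variable (o) in
lemma exists_wedgeIntegral_comm {k l : ℕ} (h : k + l = n) (h' : l + k = n) :
    ∃ ε : ℝ, ε * ε = 1 ∧ ∀ (θ : DiffForm n M k) (ψ : DiffForm n M l),
      wedgeIntegral o h' ψ θ = ε * wedgeIntegral o h θ ψ := by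
  obtain ⟨ε, hε, hc⟩ := exists_wedgeEval_comm h h'
  refine ⟨ε, hε, fun θ ψ => ?_⟩
  rw [wedgeIntegral, wedgeIntegral, ← integral_const_mul]
  refine integral_congr_ae (Eventually.of_forall fun x => ?_)
  have := hc (TangentSpace (𝓡 n) x) (θ x).toAlternatingMap (ψ x).toAlternatingMap
    (onb n (TangentSpace (𝓡 n) x))
  change (o x).volumeForm (onb n _) * wedgeEval h' _ _ _ =
    ε * ((o x).volumeForm (onb n _) * wedgeEval h _ _ _)
  rw [this]
  ring

/-- The condition is vacuous: no degree is left for the test forms. -/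
lemma isWeakExtD_zero_of_le {l : ℕ} (hl : n ≤ l) (ψ : DiffForm n M l) : IsWeakExtD o ψ 0 :=
  fun m h => by omega

lemma lpNorm_neg {k : ℕ} (θ : DiffForm n M k) (p : ℝ≥0∞) : lpNorm (-θ) p = lpNorm θ p := by
  have := lpNorm_smul (-1) θ p
  rwa [neg_one_smul, enorm_neg, enorm_one, one_mul] at this

lemma lpNorm_eq_zero_of_ae {k : ℕ} {p : ℝ≥0∞} {θ : DiffForm n M k}
    (h : ∀ᵐ x ∂(riemannianVolume n M), θ x = 0) : lpNorm θ p = 0 := by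
  rw [lpNorm, eLpNorm_congr_ae (g := 0) (h.mono fun x hx => by rw [hx, formNorm_zero]; rfl),
    eLpNorm_zero]

lemma toReal_lpNorm_smul {k : ℕ} (c : ℝ) (θ : DiffForm n M k) (p : ℝ≥0∞) :
    (lpNorm (c • θ) p).toReal = |c| * (lpNorm θ p).toReal := by
  rw [lpNorm_smul, ENNReal.toReal_mul, toReal_enorm, Real.norm_eq_abs]

variable [IsContMDiffRiemannianBundle (𝓡 n) ∞ (EuclideanSpace ℝ (Fin n))
    (fun x : M => TangentSpace (𝓡 n) x)] [BorelSpace M] [SecondCountableTopology M]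

lemma ae_eq_zero_of_lpNorm_eq_zero {k : ℕ} {p : ℝ≥0∞} (hp : p ≠ 0) {θ : DiffForm n M k}
    (hθ : θ ∈ lpForms n M k p) (h : lpNorm θ p = 0) :
    ∀ᵐ x ∂(riemannianVolume n M), θ x = 0 := by
  have := (eLpNorm_eq_zero_iff (memLp_formNorm hθ).1 hp).1 h
  filter_upwards [this] with x hx
  exact eq_zero_of_formNorm_eq_zero hx

/-- The pairing of `L^p` forms and `L^q` forms. -/
def wedgeIntegralL (ho : IsContinuousOrientation o) {p q : ℝ} (hpq : p.HolderConjugate q)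
    {k l : ℕ} (h : k + l = n) :
    lpForms n M k (ENNReal.ofReal p) →ₗ[ℝ] lpForms n M l (ENNReal.ofReal q) →ₗ[ℝ] ℝ :=
  LinearMap.mk₂ ℝ (fun θ ψ => wedgeIntegral o h (θ : DiffForm n M k) (ψ : DiffForm n M l))
    (fun θ θ' ψ => by
      rw [wedgeIntegral, wedgeIntegral, wedgeIntegral, Submodule.coe_add, pairing_add_left]
      exact integral_add (integrable_pairing ho h hpq θ.2 ψ.2)
        (integrable_pairing ho h hpq θ'.2 ψ.2))
    (fun c θ ψ => by
      rw [wedgeIntegral, wedgeIntegral, Submodule.coe_smul, pairing_smul_left]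
      exact integral_smul c _)
    (fun θ ψ ψ' => by
      -- Exchanging the factors reduces linearity in the second one to linearity in the first.
      obtain ⟨ε, -, hε⟩ := exists_wedgeIntegral_comm o (k := l) (l := k) (by omega) h
      rw [hε, hε, hε, ← mul_add]
      congr 1
      rw [wedgeIntegral, wedgeIntegral, wedgeIntegral, Submodule.coe_add, pairing_add_left]
      exact integral_add (integrable_pairing ho _ hpq.symm ψ.2 θ.2)
        (integrable_pairing ho _ hpq.symm ψ'.2 θ.2))
    (fun c θ ψ => by
      obtain ⟨ε, -, hε⟩ := exists_wedgeIntegral_comm o (k := l) (l := k) (by omega) h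
      rw [hε, hε, smul_eq_mul, mul_left_comm]
      congr 1
      rw [wedgeIntegral, wedgeIntegral, Submodule.coe_smul, pairing_smul_left]
      exact integral_smul c _)

lemma wedgeIntegral_eq_zero_of_lpNorm {p q : ℝ} (hpq : p.HolderConjugate q)
    {k l : ℕ} (h : k + l = n) {θ : DiffForm n M k} {ψ : DiffForm n M l}
    (hθ : θ ∈ lpForms n M k (ENNReal.ofReal p)) (hψ : ψ ∈ lpForms n M l (ENNReal.ofReal q))
    (h0 : lpNorm θ (ENNReal.ofReal p) = 0) : wedgeIntegral o h θ ψ = 0 := by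
  have := abs_wedgeIntegral_le o hpq h hθ hψ
  rw [h0, ENNReal.toReal_zero, zero_mul, mul_zero] at this
  exact abs_nonpos_iff.1 this

/-- An `L^p` form at positive distance from a space of `L^p` forms is separated from it by an
`L^q` form. -/
lemma exists_wedgeIntegral_eq_one (ho : IsContinuousOrientation o) {p q : ℝ}
    (hpq : p.HolderConjugate q) {k l : ℕ} (h : k + l = n) {S : Submodule ℝ (DiffForm n M k)}
    (hS : S ≤ lpForms n M k (ENNReal.ofReal p)) {θ : DiffForm n M k}
    (hθ : θ ∈ lpForms n M k (ENNReal.ofReal p))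
    (hθS : ¬∃ η : ℕ → DiffForm n M k, (∀ j, η j ∈ S) ∧
      Tendsto (fun j => lpNorm (η j - θ) (ENNReal.ofReal p)) atTop (𝓝 0)) :
    ∃ ψ ∈ lpForms n M l (ENNReal.ofReal q), wedgeIntegral o h θ ψ = 1 ∧
      ∀ η ∈ S, wedgeIntegral o h η ψ = 0 := by
  -- If no sequence in `S` converges to `θ`, then `θ` has positive distance `δ` from `S`.
  obtain ⟨δ, hδ, hle⟩ : ∃ δ : ℝ, 0 < δ ∧
      ∀ η ∈ S, δ ≤ (lpNorm (η - θ) (ENNReal.ofReal p)).toReal := by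
    by_contra! hcon
    refine hθS ?_
    choose η hη hlt using fun j : ℕ => hcon (1 / ((j : ℝ) + 1)) Nat.one_div_pos_of_nat
    refine ⟨η, hη, ?_⟩
    rw [← ENNReal.tendsto_toReal_iff
      (fun j => (sub_mem (hS (hη j)) hθ).2.ne) ENNReal.zero_ne_top, ENNReal.toReal_zero]
    exact squeeze_zero (fun _ => ENNReal.toReal_nonneg) (fun j => (hlt j).le)
      tendsto_one_div_add_atTop_nhds_zero_nat
  -- The functional `η + t θ ↦ t` is bounded by `1 / δ` times the norm. Defined on `S × ℝ`, it
  -- raises no question of well-definedness on the span.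
  let ι : (S × ℝ) →ₗ[ℝ] lpForms n M k (ENNReal.ofReal p) :=
    LinearMap.coprod (Submodule.inclusion hS) (LinearMap.toSpanSingleton ℝ _ ⟨θ, hθ⟩)
  have hι : ∀ z : S × ℝ, (ι z : DiffForm n M k) = z.1 + z.2 • θ := fun z => rfl
  obtain ⟨ψ, hψ, hΛ⟩ := exists_wedgeIntegral_eq ho hpq h ι (LinearMap.snd ℝ S ℝ) δ⁻¹ (by
    rintro ⟨η, t⟩
    rw [hι, LinearMap.snd_apply]
    rcases eq_or_ne t 0 with rfl | ht
    · rw [abs_zero]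
      exact mul_nonneg (inv_nonneg.2 hδ.le) ENNReal.toReal_nonneg
    · have h1 : (η : DiffForm n M k) + t • θ = (-t) • ((-t⁻¹) • (η : DiffForm n M k) - θ) := by
        rw [smul_sub, smul_smul, neg_mul_neg, mul_inv_cancel₀ ht, one_smul, neg_smul, sub_neg_eq_add]
      simp only
      rw [h1, toReal_lpNorm_smul, abs_neg, mul_left_comm]
      refine le_mul_of_one_le_right (abs_nonneg t) ?_
      rw [← inv_mul_cancel₀ hδ.ne']
      exact mul_le_mul_of_nonneg_left (hle _ (S.smul_mem _ η.2)) (inv_nonneg.2 hδ.le))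
  refine ⟨ψ, hψ, ?_, fun η hη => ?_⟩
  · have h1 := hΛ (0, 1)
    rw [hι, LinearMap.snd_apply, Submodule.coe_zero, zero_add, one_smul] at h1
    exact h1
  · have h1 := hΛ (⟨η, hη⟩, 0)
    rw [hι, LinearMap.snd_apply, zero_smul, add_zero] at h1
    exact h1

variable (o) in
/-- The graph of `d`. -/
def extDGraph (k : ℕ) (p : ℝ≥0∞) : Submodule ℝ (lpForms n M k p × lpForms n M (k + 1) p) where
  carrier := {z | IsWeakExtD o (z.1 : DiffForm n M k) (z.2 : DiffForm n M (k + 1))}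
  add_mem' h h' := h.add h'
  zero_mem' := .zero o
  smul_mem' c _ h := h.smul c

variable [IsRiemannianManifold (𝓡 n) M] [CompleteSpace M]

/-- A form which is orthogonal to the exact forms is closed. -/
lemma isWeakExtD_zero_of_orthogonal (ho : IsContinuousOrientation o) {p q : ℝ}
    (hpq : p.HolderConjugate q) {k l : ℕ} (h : k + l = n) {ψ : DiffForm n M l}
    (hψ : ψ ∈ lpForms n M l (ENNReal.ofReal q))
    (horth : ∀ η ∈ exactForms o k (ENNReal.ofReal p), wedgeIntegral o h η ψ = 0) :
    IsWeakExtD o ψ 0 := by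
  -- Differentials of test forms are exact, and orthogonality to them is the condition `dψ = 0`.
  refine isWeakExtD_of_forall_testForm ho hpq.symm hψ (zero_mem _) fun m hm φ hφ => ?_
  obtain rfl : k = m + 1 := by omega
  obtain ⟨ε, -, hε⟩ := exists_wedgeIntegral_comm o h (by omega)
  have h1 := hφ.mem_lpForms ho (ENNReal.ofReal p)
  rw [hε, horth _ ⟨h1.2, φ, h1.1, hφ.isWeakExtD ho⟩, mul_zero,
    wedgeIntegral_eq_zero_of_lpNorm hpq.symm _ (zero_mem _) h1.1 (lpNorm_zero _), mul_zero]

/-- If the pairing with `ξ` is bounded by the norm of the exterior derivative, then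
`ξ` is exact. -/
lemma mem_exactForms_of_abs_wedgeIntegral_le (ho : IsContinuousOrientation o) {p q : ℝ}
    (hpq : p.HolderConjugate q) {k l : ℕ} (h : k + (l + 1) = n) {ξ : DiffForm n M (l + 1)}
    (hξ : ξ ∈ lpForms n M (l + 1) (ENNReal.ofReal q)) (C : ℝ)
    (hC : ∀ β ∈ lpForms n M k (ENNReal.ofReal p), ∀ η ∈ lpForms n M (k + 1) (ENNReal.ofReal p),
      IsWeakExtD o β η →
      |wedgeIntegral o h β ξ| ≤ C * (lpNorm η (ENNReal.ofReal p)).toReal) :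
    ξ ∈ exactForms o (l + 1) (ENNReal.ofReal q) := by
  -- The bound makes `dβ ↦ ∫ β ∧ ξ` a bounded functional of `dβ`; on the graph of `d` it is defined
  -- without choosing `β`. The form that represents it satisfies `∫ dβ ∧ ψ = ∫ β ∧ ξ`, and taking
  -- test forms for `β` gives `dψ = ± ξ`.
  let Γ := extDGraph o k (ENNReal.ofReal p)
  obtain ⟨ψ, hψ, hΛ⟩ := exists_wedgeIntegral_eq ho hpq (k := k + 1) (l := l) (by omega)
    ((LinearMap.snd ℝ _ _).comp Γ.subtype)
    (((wedgeIntegralL ho hpq h).flip ⟨ξ, hξ⟩).comp ((LinearMap.fst ℝ _ _).comp Γ.subtype)) C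
    fun z => hC _ z.1.1.2 _ z.1.2.2 z.2
  obtain ⟨ε, hε, hc⟩ := exists_wedgeIntegral_comm o (k := k + 1) (l := l) (n := n) (M := M)
    (by omega) (by omega)
  obtain ⟨ε', hε', hc'⟩ := exists_wedgeIntegral_comm o (k := l + 1) (l := k) (M := M)
    (by omega) h
  -- The sign in the definition of the weak derivative, times those of the two exchanges of factors.
  set c : ℝ := (-1) ^ (l + 1) * (ε * ε') with hcdef
  have hsign : ((-1 : ℝ) ^ (l + 1)) * (-1) ^ (l + 1) = 1 := by
    rw [← mul_pow]
    norm_num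
  have hcc : c * c = 1 := by
    rw [hcdef]
    linear_combination (ε * ε') ^ 2 * hsign + ε' ^ 2 * hε + hε'
  have hd : IsWeakExtD o ψ (c • ξ) := by
    refine isWeakExtD_of_forall_testForm ho hpq.symm hψ (Submodule.smul_mem _ c hξ)
      fun m hm φ hφ => ?_
    obtain rfl : k = m := by omega
    have h1 := hφ.mem_lpForms ho (ENNReal.ofReal p)
    have h2 := hΛ ⟨(⟨φ, h1.1⟩, ⟨extD φ, h1.2⟩), hφ.isWeakExtD ho⟩
    change wedgeIntegral o _ (extD φ) ψ = wedgeIntegral o h φ ξ at h2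
    have h3 : wedgeIntegral o hm (c • ξ) φ = c * wedgeIntegral o hm ξ φ := by
      rw [wedgeIntegral, pairing_smul_left]
      exact integral_smul c _
    rw [hc, h2, hc', h3, hcdef]
    linear_combination (-(ε * ε' * wedgeIntegral o hm ξ φ)) * hsign
  refine ⟨hξ, c • ψ, Submodule.smul_mem _ c hψ, ?_⟩
  have h1 := hd.smul c
  rwa [smul_smul, hcc, one_smul] at h1

/-- Stokes' formula with `dψ = 0`; in degree `0` the exact forms vanish almost everywhere. -/
lemma wedgeIntegral_eq_zero_of_exact (ho : IsContinuousOrientation o) {p q : ℝ}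
    (hpq : p.HolderConjugate q) {k l : ℕ} (h : k + l = n) {η : DiffForm n M k} {ψ : DiffForm n M l}
    (hη : η ∈ exactForms o k (ENNReal.ofReal p)) (hψ : ψ ∈ closedForms o l (ENNReal.ofReal q)) :
    wedgeIntegral o h η ψ = 0 := by
  cases k with
  | zero => exact wedgeIntegral_eq_zero_of_lpNorm hpq h hη.1 hψ.1 (lpNorm_eq_zero_of_ae hη.2)
  | succ k =>
    obtain ⟨hη, β, hβ, hd⟩ := hη
    obtain ⟨ε, -, hε⟩ := exists_wedgeIntegral_comm o (k := l + 1) (l := k) (M := M) (n := n)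
      (by omega) (by omega)
    have h1 := hd.wedgeIntegral_eq ho hpq h (by omega) hβ hη hψ.1 (zero_mem _) hψ.2
    rw [hε, wedgeIntegral_eq_zero_of_lpNorm hpq.symm _ (zero_mem _) hβ (lpNorm_zero _),
      mul_zero] at h1
    exact (mul_eq_zero.1 h1.symm).resolve_left (pow_ne_zero _ (by norm_num))

/-- Hölder's inequality carries the orthogonality of exact and closed forms over to limits. -/
lemma wedgeIntegral_eq_zero_of_mem_exactClosure (ho : IsContinuousOrientation o) {p q : ℝ}
    (hpq : p.HolderConjugate q) {k l : ℕ} (h : k + l = n) {θ : DiffForm n M k} {ψ : DiffForm n M l}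
    (hθ : θ ∈ exactClosure o k (ENNReal.ofReal p)) (hψ : ψ ∈ closedForms o l (ENNReal.ofReal q)) :
    wedgeIntegral o h θ ψ = 0 := by
  obtain ⟨hθ, η, hη, hlim⟩ := hθ
  have hηp := fun j => exactForms_le_lpForms o k _ (hη j)
  have h1 : ∀ j, |wedgeIntegral o h θ ψ| ≤ wedgeConst n k l *
      ((lpNorm (η j - θ) (ENNReal.ofReal p)).toReal * (lpNorm ψ (ENNReal.ofReal q)).toReal) := by
    intro j
    have h2 := abs_wedgeIntegral_le o hpq h (sub_mem (hηp j) hθ) hψ.1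
    have h3 := LinearMap.congr_fun ((wedgeIntegralL ho hpq h).map_sub ⟨η j, hηp j⟩ ⟨θ, hθ⟩)
      ⟨ψ, hψ.1⟩
    change wedgeIntegral o h (η j - θ) ψ = wedgeIntegral o h (η j) ψ - wedgeIntegral o h θ ψ at h3
    rw [wedgeIntegral_eq_zero_of_exact ho hpq h (hη j) hψ, zero_sub] at h3
    rwa [h3, abs_neg] at h2
  have h4 := (ENNReal.tendsto_toReal_iff (fun j => (sub_mem (hηp j) hθ).2.ne)
    ENNReal.zero_ne_top).2 hlim
  rw [ENNReal.toReal_zero] at h4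
  have h5 := (h4.mul_const (lpNorm ψ (ENNReal.ofReal q)).toReal).const_mul (wedgeConst n k l)
  rw [zero_mul, mul_zero] at h5
  exact abs_nonpos_iff.1 (ge_of_tendsto h5 (Eventually.of_forall h1))

/-- The description of the closure of the space of exact forms by duality. -/
theorem not_mem_exactClosure_iff (ho : IsContinuousOrientation o) {p q : ℝ}
    (hpq : p.HolderConjugate q) {k l : ℕ} (h : k + l = n) {θ : DiffForm n M k}
    (hθ : θ ∈ lpForms n M k (ENNReal.ofReal p)) :
    θ ∉ exactClosure o k (ENNReal.ofReal p) ↔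
      ∃ ψ ∈ closedForms o l (ENNReal.ofReal q), wedgeIntegral o h θ ψ ≠ 0 := by
  constructor
  · intro hθc
    obtain ⟨ψ, hψ, h1, h0⟩ := exists_wedgeIntegral_eq_one ho hpq h (exactForms_le_lpForms o k _)
      hθ fun hex => hθc ⟨hθ, hex⟩
    exact ⟨ψ, ⟨hψ, isWeakExtD_zero_of_orthogonal ho hpq h hψ h0⟩, h1 ▸ one_ne_zero⟩
  · rintro ⟨ψ, hψ, hne⟩ hθc
    exact hne (wedgeIntegral_eq_zero_of_mem_exactClosure ho hpq h hθc hψ)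

/-- The description of the space of exact forms by duality. -/
theorem not_mem_exactForms_iff (ho : IsContinuousOrientation o) {p q : ℝ}
    (hpq : p.HolderConjugate q) {k l : ℕ} (h : k + l = n) {θ : DiffForm n M k}
    (hθ : θ ∈ lpForms n M k (ENNReal.ofReal p)) :
    θ ∉ exactForms o k (ENNReal.ofReal p) ↔
      ∃ (ψ : ℕ → DiffForm n M l) (η : ℕ → DiffForm n M (l + 1)),
        (∀ j, ψ j ∈ lpForms n M l (ENNReal.ofReal q)) ∧
        (∀ j, η j ∈ lpForms n M (l + 1) (ENNReal.ofReal q)) ∧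
        (∀ j, IsWeakExtD o (ψ j) (η j)) ∧ (∀ j, 1 ≤ wedgeIntegral o h θ (ψ j)) ∧
        Tendsto (fun j => lpNorm (η j) (ENNReal.ofReal q)) atTop (𝓝 0) := by
  have hp0 : ENNReal.ofReal p ≠ 0 := by
    rw [Ne, ENNReal.ofReal_eq_zero, not_le]
    exact hpq.pos
  constructor
  · intro hθe
    cases k with
    | zero =>
      -- In degree `0` exact forms are those that vanish almost everywhere, so `θ` is separated from
      -- `0` by some `ψ`. As `ψ` has degree `n`, its derivative is `0` and a constant sequence does.
      have hne : lpNorm θ (ENNReal.ofReal p) ≠ 0 := fun h0 =>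
        hθe ⟨hθ, ae_eq_zero_of_lpNorm_eq_zero hp0 hθ h0⟩
      obtain ⟨ψ, hψ, h1, -⟩ := exists_wedgeIntegral_eq_one ho hpq h
        (bot_le : (⊥ : Submodule ℝ (DiffForm n M 0)) ≤ _) hθ (by
          rintro ⟨η, hη, hlim⟩
          have h2 : ∀ j, lpNorm (η j - θ) (ENNReal.ofReal p) = lpNorm θ (ENNReal.ofReal p) :=
            fun j => by rw [(Submodule.mem_bot ℝ).1 (hη j), zero_sub, lpNorm_neg]
          simp only [h2] at hlim
          exact hne (tendsto_nhds_unique tendsto_const_nhds hlim))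
      exact ⟨fun _ => ψ, fun _ => 0, fun _ => hψ, fun _ => zero_mem _,
        fun _ => isWeakExtD_zero_of_le (by omega) ψ, fun _ => h1.ge,
        by simp only [lpNorm_zero]; exact tendsto_const_nhds⟩
    | succ k =>
      have hseq : ∀ j : ℕ, ∃ ψ ∈ lpForms n M l (ENNReal.ofReal q),
          ∃ η ∈ lpForms n M (l + 1) (ENNReal.ofReal q), IsWeakExtD o ψ η ∧
          wedgeIntegral o h θ ψ = 1 ∧
          (lpNorm η (ENNReal.ofReal q)).toReal ≤ 1 / ((j : ℝ) + 1) := by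
        intro j
        -- If there is no such `ψ` for some `j`, rescaling to `∫ θ ∧ ψ = 1` gives `|∫ θ ∧ ψ| ≤ (j +
        -- 1) ‖dψ‖` for every `ψ`, and then `θ` is exact.
        by_contra! hcon
        obtain ⟨ε, hε, hc⟩ := exists_wedgeIntegral_comm o (M := M) h (by omega)
        have hε1 : |ε| = 1 := by
          rcases mul_self_eq_one_iff.1 hε with rfl | rfl <;> simp
        refine hθe (mem_exactForms_of_abs_wedgeIntegral_le ho hpq.symm (k := l) (l := k)
          (by omega) hθ ((j : ℝ) + 1) fun ψ hψ η hη hd => ?_)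
        rw [hc, abs_mul, hε1, one_mul]
        set a := wedgeIntegral o h θ ψ with ha
        rcases eq_or_ne a 0 with h0 | h0
        · rw [h0, abs_zero]
          exact mul_nonneg (by positivity) ENNReal.toReal_nonneg
        · have h1 := hcon (a⁻¹ • ψ) (Submodule.smul_mem _ _ hψ) (a⁻¹ • η)
            (Submodule.smul_mem _ _ hη) (hd.smul _) (by
              have h2 := ((wedgeIntegralL ho hpq h) ⟨θ, hθ⟩).map_smul a⁻¹ ⟨ψ, hψ⟩
              change wedgeIntegral o h θ (a⁻¹ • ψ) = a⁻¹ * a at h2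
              rw [h2, inv_mul_cancel₀ h0])
          rw [toReal_lpNorm_smul, abs_inv, div_lt_iff₀ (by positivity), mul_assoc,
            lt_inv_mul_iff₀ (abs_pos.2 h0), mul_one] at h1
          linarith
      choose ψ hψ η hη hd h1 hle using hseq
      refine ⟨ψ, η, hψ, hη, hd, fun j => (h1 j).ge, ?_⟩
      rw [← ENNReal.tendsto_toReal_iff (fun j => (hη j).2.ne) ENNReal.zero_ne_top,
        ENNReal.toReal_zero]
      exact squeeze_zero (fun _ => ENNReal.toReal_nonneg) hle
        tendsto_one_div_add_atTop_nhds_zero_nat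
  · rintro ⟨ψ, η, hψ, hη, hd, h1, hlim⟩ hθe
    cases k with
    | zero =>
      have h2 := h1 0
      rw [wedgeIntegral_eq_zero_of_lpNorm hpq h hθ (hψ 0) (lpNorm_eq_zero_of_ae hθe.2)] at h2
      linarith
    | succ k =>
      obtain ⟨-, β, hβ, hdβ⟩ := hθe
      -- If `θ = dβ`, Stokes' formula turns the pairing with `ψ j` into `± ∫ β ∧ η j`, which tends
      -- to `0`.
      have h3 : ∀ j, 1 ≤ wedgeConst n k (l + 1) * ((lpNorm β (ENNReal.ofReal p)).toReal *
          (lpNorm (η j) (ENNReal.ofReal q)).toReal) := by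
        intro j
        have h4 := hdβ.wedgeIntegral_eq ho hpq h (by omega) hβ hθ (hψ j) (hη j) (hd j)
        have h5 := congrArg abs h4
        rw [abs_mul, abs_pow, abs_neg, abs_one, one_pow, one_mul] at h5
        refine ((h1 j).trans (le_abs_self _)).trans (h5.symm.trans_le ?_)
        exact abs_wedgeIntegral_le o hpq _ hβ (hη j)
      have h4 := (ENNReal.tendsto_toReal_iff (fun j => (hη j).2.ne) ENNReal.zero_ne_top).2 hlim
      rw [ENNReal.toReal_zero] at h4
      have h5 := (h4.const_mul (lpNorm β (ENNReal.ofReal p)).toReal).const_mul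
        (wedgeConst n k (l + 1))
      rw [mul_zero, mul_zero] at h5
      have := ge_of_tendsto h5 (Eventually.of_forall h3)
      linarith

end Duality

/-! ### Vanishing of reduced cohomology and of torsion -/

section Torsion

lemma subsingleton_quotient_submoduleOf_iff {V : Type*} [AddCommGroup V] [Module ℝ V]
    (S T : Submodule ℝ V) : Subsingleton (T ⧸ S.submoduleOf T) ↔ T ≤ S := by
  rw [Submodule.Quotient.subsingleton_iff, Submodule.submoduleOf_eq_top]

variable {n : ℕ} {M : Type*} [EMetricSpace M] [ChartedSpace (EuclideanSpace ℝ (Fin n)) M]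
  [IsManifold (𝓡 n) ∞ M] [RiemannianBundle (fun x : M => TangentSpace (𝓡 n) x)]
  [IsContMDiffRiemannianBundle (𝓡 n) ∞ (EuclideanSpace ℝ (Fin n))
    (fun x : M => TangentSpace (𝓡 n) x)] [MeasurableSpace M] [BorelSpace M]
  [SecondCountableTopology M]
  {o : (x : M) → Orientation ℝ (TangentSpace (𝓡 n) x) (Fin n)}

/-- The criterion treats the two degrees and exponents alike, which yields the duality of reduced
cohomology. -/
lemma subsingleton_reducedLpCohomology_iff [IsRiemannianManifold (𝓡 n) M] [CompleteSpace M]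
    (ho : IsContinuousOrientation o) {p q : ℝ} (hpq : p.HolderConjugate q) {k l : ℕ}
    (h : k + l = n) :
    Subsingleton (ReducedLpCohomology o k (ENNReal.ofReal p)) ↔
      ∀ θ ∈ closedForms o k (ENNReal.ofReal p), ∀ ψ ∈ closedForms o l (ENNReal.ofReal q),
        wedgeIntegral o h θ ψ = 0 := by
  rw [ReducedLpCohomology, subsingleton_quotient_submoduleOf_iff]
  refine forall₂_congr fun θ hθ => ?_
  have h1 := not_mem_exactClosure_iff ho hpq h hθ.1
  rw [← not_iff_not, h1]
  push Not
  rfl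

/-- The pairing kills forms of norm zero, so it descends to the Banach space `Lp`, where the uniform
boundedness principle is available. -/
lemma MeasurableFrame.exists_continuousLinearMap_toLp (Fr : MeasurableFrame o) {p q : ℝ}
    (ho : IsContinuousOrientation o) (hpq : p.HolderConjugate q) [Fact (1 ≤ ENNReal.ofReal p)]
    {k l : ℕ} (h : k + l = n)
    {ψ : DiffForm n M l} (hψ : ψ ∈ lpForms n M l (ENNReal.ofReal q)) :
    ∃ f : Lp (FormModel n k) (ENNReal.ofReal p) (riemannianVolume n M) →L[ℝ] ℝ,
      ∀ θ : lpForms n M k (ENNReal.ofReal p),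
        f (Fr.toLp k _ θ) = wedgeIntegral o h (θ : DiffForm n M k) ψ := by
  obtain ⟨C, hC, hle⟩ := Fr.exists_lpNorm_le k (ENNReal.ofReal p)
  obtain ⟨s, hs⟩ := (Fr.toLp k (ENNReal.ofReal p)).exists_rightInverse_of_surjective
    (LinearMap.range_eq_top.2 (Fr.surjective_toLp k _))
  have hs' : ∀ u, Fr.toLp k _ (s u) = u := fun u => LinearMap.congr_fun hs u
  let f₀ := ((wedgeIntegralL ho hpq h).flip ⟨ψ, hψ⟩).comp s
  have hf₀ : ∀ u, f₀ u = wedgeIntegral o h (s u : DiffForm n M k) ψ := fun u => rfl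
  refine ⟨f₀.mkContinuous (wedgeConst n k l * (C * (lpNorm ψ (ENNReal.ofReal q)).toReal))
    fun u => ?_, fun θ => ?_⟩
  · rw [hf₀, Real.norm_eq_abs]
    refine (abs_wedgeIntegral_le o hpq h (s u).2 hψ).trans ?_
    rw [mul_assoc]
    refine mul_le_mul_of_nonneg_left ?_ (wedgeConst_nonneg n k l)
    have h1 := hle (s u)
    rw [hs'] at h1
    refine (mul_le_mul_of_nonneg_right h1 ENNReal.toReal_nonneg).trans_eq ?_
    ring
  · rw [LinearMap.mkContinuous_apply]
    have h1 : Fr.toLp k _ (s (Fr.toLp k _ θ) - θ) = 0 := by rw [map_sub, hs', sub_self]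
    have h2 := hle (s (Fr.toLp k _ θ) - θ)
    rw [h1, norm_zero, mul_zero] at h2
    have h3 := (ENNReal.toReal_eq_zero_iff _).1 (le_antisymm h2 ENNReal.toReal_nonneg)
    have h4 := wedgeIntegral_eq_zero_of_lpNorm (o := o) hpq h (s (Fr.toLp k _ θ) - θ).2 hψ
      (h3.resolve_right (s (Fr.toLp k _ θ) - θ).2.2.ne)
    have h5 := LinearMap.congr_fun ((wedgeIntegralL ho hpq h).map_sub (s (Fr.toLp k _ θ)) θ)
      ⟨ψ, hψ⟩
    exact sub_eq_zero.1 (h5.symm.trans h4)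

variable [IsRiemannianManifold (𝓡 n) M] [CompleteSpace M]

/-- If the space of exact `L^p` forms is closed, then the pairing of `L^p` forms with a limit of
exact `L^q` forms is controlled by the exterior derivative. -/
lemma exists_abs_wedgeIntegral_le (ho : IsContinuousOrientation o) {p q : ℝ}
    (hpq : p.HolderConjugate q) {k l : ℕ} (h : k + (l + 1) = n)
    (hcl : exactClosure o (k + 1) (ENNReal.ofReal p) ≤ exactForms o (k + 1) (ENNReal.ofReal p))
    {ξ : DiffForm n M (l + 1)} (hξ : ξ ∈ exactClosure o (l + 1) (ENNReal.ofReal q)) :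
    ∃ C : ℝ, ∀ β ∈ lpForms n M k (ENNReal.ofReal p),
      ∀ η ∈ lpForms n M (k + 1) (ENNReal.ofReal p), IsWeakExtD o β η →
      |wedgeIntegral o h β ξ| ≤ C * (lpNorm η (ENNReal.ofReal p)).toReal := by
  obtain ⟨Fr⟩ := nonempty_measurableFrame ho
  have hfact : Fact (1 ≤ ENNReal.ofReal p) := ⟨by
    rw [← ENNReal.ofReal_one]
    exact ENNReal.ofReal_le_ofReal hpq.lt.le⟩
  obtain ⟨hξ, ζ, hζ, hlim⟩ := hξ
  choose hζp ψ hψ hd using hζ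
  have h' : k + 1 + l = n := by omega
  -- The exact forms inside a Banach space. By hypothesis this subspace is closed, hence itself a
  -- Banach space.
  let Y : Submodule ℝ (Lp (FormModel n (k + 1)) (ENNReal.ofReal p) (riemannianVolume n M)) :=
    ((exactForms o (k + 1) (ENNReal.ofReal p)).submoduleOf
      (lpForms n M (k + 1) (ENNReal.ofReal p))).map (Fr.toLp (k + 1) _)
  obtain ⟨K, hK, hle⟩ := Fr.exists_norm_toLp_le (k + 1) (ENNReal.ofReal p)
  obtain ⟨K', hK', hle'⟩ := Fr.exists_lpNorm_le (k + 1) (ENNReal.ofReal p)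
  have hY : IsClosed (Y : Set (Lp (FormModel n (k + 1)) (ENNReal.ofReal p)
      (riemannianVolume n M))) := by
    refine isClosed_of_closure_subset fun u hu => ?_
    obtain ⟨y, hy, hyu⟩ := mem_closure_iff_seq_limit.1 hu
    choose η hη hηy using hy
    obtain ⟨θ, rfl⟩ := Fr.surjective_toLp _ _ u
    refine ⟨θ, hcl ⟨θ.2, fun j => η j, hη, ?_⟩, rfl⟩
    refine (ENNReal.tendsto_toReal_iff (fun j => (η j - θ).2.2.ne) ENNReal.zero_ne_top).1 ?_
    rw [ENNReal.toReal_zero]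
    have h1 := (tendsto_iff_norm_sub_tendsto_zero.1 hyu).const_mul K'
    rw [mul_zero] at h1
    refine squeeze_zero (fun _ => ENNReal.toReal_nonneg) (fun j => ?_) h1
    rw [← hηy, ← map_sub]
    exact hle' (η j - θ)
  have hYc : CompleteSpace Y := hY.completeSpace_coe
  choose f hf using fun j => Fr.exists_continuousLinearMap_toLp ho hpq h' (hψ j)
  have hstokes : ∀ β ∈ lpForms n M k (ENNReal.ofReal p),
      ∀ η ∈ lpForms n M (k + 1) (ENNReal.ofReal p), IsWeakExtD o β η → ∀ j,
      |wedgeIntegral o h' η (ψ j)| = |wedgeIntegral o h β (ζ j)| := by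
    intro β hβ η hη hdβ j
    rw [hdβ.wedgeIntegral_eq ho hpq h' h hβ hη (hψ j) (hζp j) (hd j), abs_mul, abs_pow, abs_neg,
      abs_one, one_pow, one_mul]
  have hconv : ∀ β ∈ lpForms n M k (ENNReal.ofReal p),
      Tendsto (fun j => wedgeIntegral o h β (ζ j)) atTop (𝓝 (wedgeIntegral o h β ξ)) := by
    intro β hβ
    rw [tendsto_iff_norm_sub_tendsto_zero]
    have h1 := (ENNReal.tendsto_toReal_iff (fun j => (sub_mem (hζp j) hξ).2.ne)
      ENNReal.zero_ne_top).2 hlim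
    rw [ENNReal.toReal_zero] at h1
    have h2 := (h1.const_mul (lpNorm β (ENNReal.ofReal p)).toReal).const_mul
      (wedgeConst n k (l + 1))
    rw [mul_zero, mul_zero] at h2
    refine squeeze_zero (fun _ => norm_nonneg _) (fun j => ?_) h2
    have h3 := ((wedgeIntegralL ho hpq h) ⟨β, hβ⟩).map_sub ⟨ζ j, hζp j⟩ ⟨ξ, hξ⟩
    refine (congrArg norm h3).symm.trans_le ?_
    exact abs_wedgeIntegral_le o hpq h hβ (sub_mem (hζp j) hξ)
  -- With `ζ j = dψ j → ξ`, the functionals `dβ ↦ ∫ dβ ∧ ψ j` equal `± ∫ β ∧ ζ j`, which converges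
  -- for each `β`. Being pointwise bounded on `Y`, they are uniformly bounded, even if the norms of
  -- the `ψ j` are not.
  obtain ⟨C, hC⟩ := banach_steinhaus (g := fun j => (f j).comp Y.subtypeL) (by
    rintro ⟨_, η, ⟨hη, β, hβ, hdβ⟩, rfl⟩
    obtain ⟨C, hC⟩ := (hconv β hβ).norm.bddAbove_range
    refine ⟨C, fun j => ?_⟩
    refine le_of_eq_of_le ?_ (hC ⟨j, rfl⟩)
    refine (congrArg norm (hf j η)).trans ?_
    exact hstokes β hβ η η.2 hdβ j)
  refine ⟨C * K, fun β hβ η hη hdβ => ?_⟩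
  refine le_of_tendsto (hconv β hβ).abs (Eventually.of_forall fun j => ?_)
  rw [← hstokes β hβ η hη hdβ j]
  have hC0 : 0 ≤ C := (ContinuousLinearMap.opNorm_nonneg _).trans (hC j)
  have h1 := ((f j).comp Y.subtypeL).le_of_opNorm_le (hC j)
    ⟨Fr.toLp _ _ ⟨η, hη⟩, ⟨η, hη⟩, ⟨hη, β, hβ, hdβ⟩, rfl⟩
  refine ((congrArg norm (hf j ⟨η, hη⟩)).symm.trans_le h1).trans ?_
  rw [mul_assoc]
  exact mul_le_mul_of_nonneg_left (hle ⟨η, hη⟩) hC0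

/-- In positive degrees a limit of exact `L^q` forms satisfies the uniform bound, hence the duality
criterion of exactness. For `l = 0` the exact forms are the null forms, which is a closed condition;
for `k = 0` the degree `l` is `n + 1`, where all forms vanish. -/
lemma exactClosure_le_exactForms_of_conjugate (ho : IsContinuousOrientation o) {p q : ℝ}
    (hpq : p.HolderConjugate q) {k l : ℕ} (h : k + l = n + 1)
    (hcl : exactClosure o k (ENNReal.ofReal p) ≤ exactForms o k (ENNReal.ofReal p)) :
    exactClosure o l (ENNReal.ofReal q) ≤ exactForms o l (ENNReal.ofReal q) := by
  have hq0 : ENNReal.ofReal q ≠ 0 := by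
    rw [Ne, ENNReal.ofReal_eq_zero, not_le]
    exact hpq.symm.pos
  intro ξ hξ
  cases l with
  | zero =>
    obtain ⟨hξ, η, hη, hlim⟩ := hξ
    have h1 : ∀ j, lpNorm (η j - ξ) (ENNReal.ofReal q) = lpNorm ξ (ENNReal.ofReal q) := by
      intro j
      refine eLpNorm_congr_ae ((hη j).2.mono fun x hx => ?_)
      have h2 : (η j - ξ) x = (-1 : ℝ) • ξ x := by
        change η j x - ξ x = _
        rw [hx]
        exact (zero_sub _).trans (neg_one_smul ℝ (ξ x)).symm
      simp only [h2]
      rw [formNorm_smul, abs_neg, abs_one, one_mul]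
    simp only [h1] at hlim
    exact ⟨hξ, ae_eq_zero_of_lpNorm_eq_zero hq0 hξ
      (tendsto_nhds_unique tendsto_const_nhds hlim)⟩
  | succ l =>
    cases k with
    | zero =>
      rw [eq_zero_of_lt_degree (by omega) ξ]
      exact zero_mem _
    | succ k =>
      have h' : k + (l + 1) = n := by omega
      obtain ⟨C, hC⟩ := exists_abs_wedgeIntegral_le ho hpq h' hcl hξ
      exact mem_exactForms_of_abs_wedgeIntegral_le ho hpq h' hξ.1 C hC

end Torsion

end LpDeRham

end

/-! ### Conclusion -/

theorem mainTheorem7 {n : ℕ} {M : Type*} [EMetricSpace M]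
    [ChartedSpace (EuclideanSpace ℝ (Fin n)) M] [IsManifold (𝓡 n) ∞ M]
    [RiemannianBundle (fun x : M => TangentSpace (𝓡 n) x)]
    [IsContMDiffRiemannianBundle (𝓡 n) ∞ (EuclideanSpace ℝ (Fin n))
      (fun x : M => TangentSpace (𝓡 n) x)]
    [IsRiemannianManifold (𝓡 n) M] [CompleteSpace M] [SecondCountableTopology M]
    [MeasurableSpace M] [BorelSpace M]
    (o : (x : M) → Orientation ℝ (TangentSpace (𝓡 n) x) (Fin n))
    (ho : LpDeRham.IsContinuousOrientation o)
    (p q : ℝ) (hpq : p.HolderConjugate q) :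
    (∀ (k l : ℕ) (h : k + l = n) (θ : LpDeRham.closedForms o k (ENNReal.ofReal p)),
      (LpDeRham.reducedClass o θ ≠ 0 ↔
        ∃ ψ ∈ LpDeRham.closedForms o l (ENNReal.ofReal q),
          LpDeRham.wedgeIntegral o h θ.1 ψ ≠ 0) ∧
      (LpDeRham.cohomologyClass o θ ≠ 0 ↔
        ∃ (ψ : ℕ → LpDeRham.DiffForm n M l) (η : ℕ → LpDeRham.DiffForm n M (l + 1)),
          (∀ j, ψ j ∈ LpDeRham.lpForms n M l (ENNReal.ofReal q)) ∧
          (∀ j, η j ∈ LpDeRham.lpForms n M (l + 1) (ENNReal.ofReal q)) ∧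
          (∀ j, LpDeRham.IsWeakExtD o (ψ j) (η j)) ∧
          (∀ j, 1 ≤ LpDeRham.wedgeIntegral o h θ.1 (ψ j)) ∧
          Tendsto (fun j => LpDeRham.lpNorm (η j) (ENNReal.ofReal q)) atTop (𝓝 0))) ∧
    (∀ k l : ℕ, k + l = n →
      (Subsingleton (LpDeRham.ReducedLpCohomology o k (ENNReal.ofReal p)) ↔
        Subsingleton (LpDeRham.ReducedLpCohomology o l (ENNReal.ofReal q)))) ∧
    (∀ k l : ℕ, k + l = n + 1 →
      (Subsingleton (LpDeRham.LpTorsion o k (ENNReal.ofReal p)) ↔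
        Subsingleton (LpDeRham.LpTorsion o l (ENNReal.ofReal q)))) := by
  refine ⟨fun k l h θ => ⟨?_, ?_⟩, fun k l h => ?_, fun k l h => ?_⟩
  · rw [← LpDeRham.not_mem_exactClosure_iff ho hpq h θ.2.1, not_iff_not]
    exact Submodule.Quotient.mk_eq_zero _
  · rw [← LpDeRham.not_mem_exactForms_iff ho hpq h θ.2.1, not_iff_not]
    exact Submodule.Quotient.mk_eq_zero _
  -- Both sides say that closed forms of complementary degrees pair to zero, and exchanging the
  -- factors only changes a sign.
  · obtain ⟨ε, hε, hc⟩ := LpDeRham.exists_wedgeIntegral_comm o h (by omega)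
    have hε0 : ε ≠ 0 := left_ne_zero_of_mul_eq_one hε
    rw [LpDeRham.subsingleton_reducedLpCohomology_iff ho hpq h,
      LpDeRham.subsingleton_reducedLpCohomology_iff ho hpq.symm (k := l) (l := k) (by omega)]
    simp only [hc, mul_eq_zero, hε0, false_or]
    exact ⟨fun H ψ hψ θ hθ => H θ hθ ψ hψ, fun H θ hθ ψ hψ => H ψ hψ θ hθ⟩
  · rw [LpDeRham.LpTorsion, LpDeRham.LpTorsion, LpDeRham.subsingleton_quotient_submoduleOf_iff,
      LpDeRham.subsingleton_quotient_submoduleOf_iff]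
    exact ⟨LpDeRham.exactClosure_le_exactForms_of_conjugate ho hpq h,
      LpDeRham.exactClosure_le_exactForms_of_conjugate ho hpq.symm (by omega)⟩
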